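/- Let $d\in\{1,2\}$, $N\in\mathbb N$, and let $\phi_1,\dots,\phi_N\in C_b^\infty(\mathbb R^d,\mathbb R)$ satisfy, for every $1\le k\le N$, * (A0) $\lim_{|x|\to\infty}(1+|x|^2)\,|\partial_x^\nu\phi_k(x)|=0$ for every multi-index $\nu\neq0$; * (A1) $\partial_x^\nu\phi_k(0)=0$ for every multi-index $0\le|\nu|\le5$. Let $B_1,\dots,B_N$ be independent standard real Brownian motions on a probability space, $W(t,x)=\sum_{k=1}^N i\,\phi_k(x)B_k(t)$, $b=2\nabla W$ and $c=\sum_{j=1}^d(\partial_jW)^2+\Delta W$. Let $Q$ be the ground state, i.e. the positive radial solution of $\Delta Q-Q+Q^{1+4/d}=0$ vanishing at infinity, and let $\rho$ be the radial $H^1$ solution of $-\Delta\rho+\rho-(1+\tfrac4d)Q^{4/d}\rho=-|x|^2Q$. For $t<T$ put $$S_T(t,x)=(T-t)^{-d/2}\,Q\Big(\frac{x}{T-t}\Big)\,e^{\frac{i}{T-t}-\frac{i|x|^2}{4(T-t)}},\qquad E(u)=\frac12\int_{\mathbb R^d}|\nabla u|^2dx-\frac d{2d+4}\int_{\mathbb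 R^d}|u|^{2+4/d}dx .$$ For $g:\mathbb R^d\to\mathbb R$ and $\mathcal P=(\lambda,\alpha,\beta,\gamma,\theta)\in(0,\infty)\times\mathbb R^d\times\mathbb R^d\times\mathbb R\times\mathbb R$ put $$g[\mathcal P](x)=\lambda^{-d/2}g(y)\,e^{i\beta\cdot y-i\frac\gamma4|y|^2}e^{i\theta},\qquad y=\frac{x-\alpha}\lambda .$$ Write $\Lambda=\tfrac d2+x\cdot\nabla$. Let $0<\delta<\frac1{12}$. Then for almost every $\omega$ there are $\tau>0$ and $C>0$ such that the following holds for every $T\in(0,\tau]$ and every nondecreasing sequence $t_n<T$ with $t_n\to T$. Let $n\in\mathbb N$, $0\le t_*\le t_n$ (where $t_*$ may depend on $n$), and let $u_n\in C([t_*,t_n];H^1(\mathbb R^d))$ be a solution, in $H^{-1}$ and in integrated form, of $$i\partial_tu_n+\Delta u_n+|u_n|^{4/d}u_n+b\cdot\nabla u_n+c\,u_n=0\ \text{ on }[t_*,t_n],\qquad u_n(t_n)=S_T(t_n),$$ for the sample path $B(\omega)$. Suppose that $u_n$ admits a geometrical decomposition $u_n(t)=w_n(t)+R_n(t)$ on $[t_*,t_n]$,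 with $w_n(t)=Q[\mathcal P_n(t)]$, $R_n(t)\in H^1$, parameters $\mathcal P_n=(\lambda_n,\alpha_n,\beta_n,\gamma_n,\theta_n)$ of class $C^1$ on $(t_*,t_n)$ with $\lambda_n>0$, and, for every $t\in[t_*,t_n]$, the orthogonality conditions $$\mathrm{Re}\int(x-\alpha_n)w_n\overline{R_n}\,dx=0,\quad\mathrm{Re}\int|x-\alpha_n|^2w_n\overline{R_n}\,dx=0,$$ $$\mathrm{Im}\int\Lambda w_n\overline{R_n}\,dx=0,\quad\mathrm{Im}\int\nabla w_n\overline{R_n}\,dx=0,\quad\mathrm{Im}\int\rho[\mathcal P_n]\,\overline{R_n}\,dx=0 .$$ Suppose moreover that the bootstrap estimates hold for every $t\in[t_*,t_n]$: $$\|\nabla R_n(t)\|_{L^2}\le2(T-t)^2,\qquad\|R_n(t)\|_{L^2}\le2(T-t)^3,$$ $$|\lambda_n(t)-(T-t)|+|\gamma_n(t)-(T-t)|\le2(T-t)^{3+\delta},\qquad|\alpha_n(t)|+|\beta_n(t)|\le2(T-t)^{2+\delta},$$ $$\Big|\theta_n(t)-\frac1{T-t}\Big|\le2(T-t)^{1+\delta}.$$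 Then $$|E(u_n(t))-E(u_n(t_n))|\le C\,(T-t)^3\qquad\text{for all }t\in[t_*,t_n].$$ In particular $C$ does not depend on $n$. -/

import Mathlib

open MeasureTheory ProbabilityTheory Filter Topology
open scoped NNReal ENNReal SchwartzMap LineDeriv Laplacian

noncomputable section

namespace RoughNLS

/-- The space `ℝ^d` with its Euclidean norm. -/
abbrev Sp (d : ℕ) : Type := EuclideanSpace ℝ (Fin d)

/-- The complex space `L²(ℝ^d)`. -/
abbrev L2 (d : ℕ) : Type := Lp ℂ 2 (volume : Measure (Sp d))

/-- The `j`-th coordinate vector of `ℝ^d`. -/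
abbrev ei {d : ℕ} (j : Fin d) : Sp d := EuclideanSpace.single j (1 : ℝ)

/-- The classical partial derivative `∂_j f`. -/
def pderiv {d : ℕ} {F : Type*} [NormedAddCommGroup F] [NormedSpace ℝ F]
    (j : Fin d) (f : Sp d → F) (x : Sp d) : F :=
  fderiv ℝ f x (ei j)

/-! ### The Sobolev space `H¹` -/

/-- The Sobolev space `H¹(ℝ^d)`, realised as the space of pairs `(u, ∇u)` of square integrable
functions such that `∂_j u` (as a derivative of tempered distributions) is the `j`-th component
of `∇u`. The second component is determined by the first one, and the topology inherited from
`L² × (L²)^d` is that of the `H¹` norm. -/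
def H1 (d : ℕ) : Submodule ℂ (L2 d × (Fin d → L2 d)) where
  carrier := {p | ∀ j, ∂_{ei j} (p.1 : 𝓢'(Sp d, ℂ)) = (p.2 j : 𝓢'(Sp d, ℂ))}
  add_mem' := by
    intro p q hp hq j
    have hp := hp j
    have hq := hq j
    simp only [← Lp.toTemperedDistributionCLM_apply] at hp hq ⊢
    simp only [Prod.fst_add, Prod.snd_add, Pi.add_apply, map_add,
      LineDeriv.lineDerivOp_add, hp, hq]
  zero_mem' := by
    intro j
    simp only [← Lp.toTemperedDistributionCLM_apply]
    simp only [Prod.fst_zero, Prod.snd_zero, Pi.zero_apply, map_zero,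
      LineDeriv.lineDerivOp_zero]
  smul_mem' := by
    intro c p hp j
    have hp := hp j
    simp only [← Lp.toTemperedDistributionCLM_apply] at hp ⊢
    simp only [Prod.smul_fst, Prod.smul_snd, Pi.smul_apply, map_smul,
      LineDeriv.lineDerivOp_smul, hp]

/-- The underlying `L²` function of an element of `H¹`. -/
def toL2 {d : ℕ} (u : H1 d) : L2 d := (u : L2 d × (Fin d → L2 d)).1

/-- The weak derivative `∂_j u ∈ L²` of `u ∈ H¹`. -/
def grad {d : ℕ} (u : H1 d) (j : Fin d) : L2 d := (u : L2 d × (Fin d → L2 d)).2 j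

/-- `‖∇u‖_{L²}`. -/
def gradNorm {d : ℕ} (u : H1 d) : ℝ := Real.sqrt (∑ j, ‖grad u j‖ ^ 2)

/-- The energy `E(u) = ½ ∫ |∇u|² - d/(2d+4) ∫ |u|^{2+4/d}`. -/
def energy {d : ℕ} (u : H1 d) : ℝ :=
  1 / 2 * (∑ j, ∫ x, ‖grad u j x‖ ^ 2)
    - (d : ℝ) / (2 * d + 4) * ∫ x, ‖toL2 u x‖ ^ (2 + 4 / (d : ℝ))

/-! ### The spatial functions of the noise -/

open scoped ContDiff in
/-- `f ∈ C_b^∞(ℝ^d, ℝ)`: smooth, with bounded derivatives of every order. -/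
def IsCbInfty {d : ℕ} (f : Sp d → ℝ) : Prop :=
  ContDiff ℝ ∞ f ∧ ∀ m : ℕ, ∃ K : ℝ, ∀ x, ‖iteratedFDeriv ℝ m f x‖ ≤ K

/-- Asymptotical flatness: `⟨x⟩² |∂^ν f(x)| → 0` as `|x| → ∞` for every `ν ≠ 0`. -/
def AsymptoticallyFlat {d : ℕ} (f : Sp d → ℝ) : Prop :=
  ∀ m : ℕ, 1 ≤ m →
    Tendsto (fun x => (1 + ‖x‖ ^ 2) * ‖iteratedFDeriv ℝ m f x‖) (cocompact (Sp d)) (𝓝 0)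

/-- Flatness at the origin: `∂^ν f(0) = 0` for every `0 ≤ |ν| ≤ 5`. -/
def FlatAtOrigin {d : ℕ} (f : Sp d → ℝ) : Prop :=
  ∀ m : ℕ, m ≤ 5 → iteratedFDeriv ℝ m f 0 = 0

/-! ### The random equation

Here `h : Fin N → ℝ → ℝ` stands for a sample path `t ↦ (B_1(t), …, B_N(t))`. -/

/-- `W(t,x) = ∑_k i φ_k(x) B_k(t)`. -/
def noiseW {d N : ℕ} (φ : Fin N → Sp d → ℝ) (h : Fin N → ℝ → ℝ) (t : ℝ) (x : Sp d) : ℂ :=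
  ∑ k, Complex.I * (φ k x : ℂ) * (h k t : ℂ)

/-- The `j`-th component of `b = 2 ∇W`. -/
def coeffB {d N : ℕ} (φ : Fin N → Sp d → ℝ) (h : Fin N → ℝ → ℝ) (j : Fin d) (t : ℝ)
    (x : Sp d) : ℂ :=
  2 * pderiv j (noiseW φ h t) x

/-- `c = ∑_j (∂_j W)² + Δ W`. -/
def coeffC {d N : ℕ} (φ : Fin N → Sp d → ℝ) (h : Fin N → ℝ → ℝ) (t : ℝ) (x : Sp d) : ℂ :=
  (∑ j, pderiv j (noiseW φ h t) x ^ 2) + Δ (noiseW φ h t) x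

/-- The nonlinearity `|z|^{4/d} z`. -/
def nonlin (d : ℕ) (z : ℂ) : ℂ := ((‖z‖ ^ (4 / (d : ℝ)) : ℝ) : ℂ) * z

/-- The tempered distribution `Δu + |u|^{4/d} u + b(t)·∇u + c(t) u`, evaluated at a test
function `ψ`. -/
def rhsPairing {d N : ℕ} (φ : Fin N → Sp d → ℝ) (h : Fin N → ℝ → ℝ) (t : ℝ) (u : H1 d)
    (ψ : 𝓢(Sp d, ℂ)) : ℂ :=
  -(∑ j, ∫ x, grad u j x * pderiv j ψ x)
    + (∫ x, nonlin d (toL2 u x) * ψ x)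
    + (∑ j, ∫ x, coeffB φ h j t x * grad u j x * ψ x)
    + ∫ x, coeffC φ h t x * toL2 u x * ψ x

/-- `u ∈ C([a,b]; H¹)` solves `i ∂_t u + Δu + |u|^{4/d} u + b·∇u + c u = 0` on `[a,b]`, in the
integrated form
`u(t) = u(b) + ∫_b^t i (Δu + |u|^{4/d} u + b·∇u + c u) ds`
as an equation in `H^{-1}`, i.e. when tested with Schwartz functions. In dimensions one and two
`|u|^{4/d} u ∈ C([a,b]; L²)` holds automatically. -/
structure IsSolutionOn {d N : ℕ} (φ : Fin N → Sp d → ℝ) (h : Fin N → ℝ → ℝ) (a b : ℝ)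
    (u : ℝ → H1 d) : Prop where
  continuousOn : ContinuousOn u (Set.Icc a b)
  equation : ∀ t ∈ Set.Icc a b, ∀ ψ : 𝓢(Sp d, ℂ),
    ∫ x, toL2 (u t) x * ψ x
      = (∫ x, toL2 (u b) x * ψ x) + ∫ s in b..t, Complex.I * rhsPairing φ h s (u s) ψ

/-! ### The ground state and the profiles -/

/-- A function that depends on `|x|` only. -/
def IsRadial {d : ℕ} (f : Sp d → ℝ) : Prop := ∀ x y, ‖x‖ = ‖y‖ → f x = f y

/-- The ground state: the positive radial solution, vanishing at infinity, of
`ΔQ - Q + Q^{1+4/d} = 0`. -/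
structure IsGroundState {d : ℕ} (Q : Sp d → ℝ) : Prop where
  contDiff : ContDiff ℝ 2 Q
  pos : ∀ x, 0 < Q x
  radial : IsRadial Q
  vanishing : Tendsto Q (cocompact (Sp d)) (𝓝 0)
  equation : ∀ x, Δ Q x - Q x + Q x ^ (1 + 4 / (d : ℝ)) = 0

/-- The radial `H¹` solution `ρ` of `L₊ ρ = -|x|² Q`, where
`L₊ = -Δ + 1 - (1 + 4/d) Q^{4/d}`. -/
structure IsRho {d : ℕ} (Q ρ : Sp d → ℝ) : Prop where
  contDiff : ContDiff ℝ 2 ρ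
  radial : IsRadial ρ
  memLp : MemLp ρ 2
  memLp_grad : MemLp (fderiv ℝ ρ) 2
  equation : ∀ x, -Δ ρ x + ρ x - (1 + 4 / (d : ℝ)) * Q x ^ (4 / (d : ℝ)) * ρ x = -‖x‖ ^ 2 * Q x

/-- The pseudo-conformal blow-up solution
`S_T(t,x) = (T-t)^{-d/2} Q(x/(T-t)) exp(i/(T-t) - i|x|²/(4(T-t)))`, `t < T`. -/
def pseudoConformal {d : ℕ} (Q : Sp d → ℝ) (T t : ℝ) (x : Sp d) : ℂ :=
  (((T - t) ^ (-(d : ℝ) / 2) * Q ((T - t)⁻¹ • x) : ℝ) : ℂ)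
    * Complex.exp (Complex.I * ((1 / (T - t) - ‖x‖ ^ 2 / (4 * (T - t)) : ℝ) : ℂ))

/-- The values `(λ, α, β, γ, θ) ∈ ℝ^{2d+3}` of the modulation parameters at one time. -/
structure Modulation (d : ℕ) where
  lam : ℝ
  α : Sp d
  β : Sp d
  γ : ℝ
  θ : ℝ

/-- The modulated profile `λ^{-d/2} g(y) e^{i β·y - i γ|y|²/4} e^{iθ}` with `y = (x-α)/λ`. -/
def modulated {d : ℕ} (g : Sp d → ℝ) (p : Modulation d) (x : Sp d) : ℂ :=
  let y : Sp d := p.lam⁻¹ • (x - p.α)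
  ((p.lam ^ (-(d : ℝ) / 2) * g y : ℝ) : ℂ)
    * Complex.exp (Complex.I * ((inner ℝ p.β y - p.γ / 4 * ‖y‖ ^ 2 : ℝ) : ℂ))
    * Complex.exp (Complex.I * (p.θ : ℂ))

/-- The generator of scaling, `Λf = (d/2) f + x·∇f`. -/
def scalingGen {d : ℕ} (f : Sp d → ℂ) (x : Sp d) : ℂ :=
  ((d : ℂ) / 2) * f x + ∑ j, (x j : ℂ) * pderiv j f x

/-- The orthogonality conditions between the remainder `R` and the main profile `w` (the
modulated ground state); `ρ` enters through its modulated version. -/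
structure Orthogonal {d : ℕ} (Q ρ : Sp d → ℝ) (p : Modulation d) (R : L2 d) : Prop where
  position : ∀ j : Fin d,
    (∫ x, ((x j - p.α j : ℝ) : ℂ) * modulated Q p x * starRingEnd ℂ (R x)).re = 0
  variance : (∫ x, ((‖x - p.α‖ ^ 2 : ℝ) : ℂ) * modulated Q p x * starRingEnd ℂ (R x)).re = 0
  scaling : (∫ x, scalingGen (modulated Q p) x * starRingEnd ℂ (R x)).im = 0
  gradient : ∀ j : Fin d, (∫ x, pderiv j (modulated Q p) x * starRingEnd ℂ (R x)).im = 0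
  rho : (∫ x, modulated ρ p x * starRingEnd ℂ (R x)).im = 0

/-- The geometrical decomposition `u = w + R` on `[a,b]`, where `w` is the ground state modulated
by the parameters `p`, which are of class `C¹` on `(a,b)`, and the orthogonality conditions hold
on `[a,b]`. -/
structure IsGeometricDecomposition {d : ℕ} (Q ρ : Sp d → ℝ) (a b : ℝ) (u : ℝ → H1 d)
    (p : ℝ → Modulation d) (R : ℝ → H1 d) : Prop where
  lam_pos : ∀ t ∈ Set.Icc a b, 0 < (p t).lam
  contDiffOn_lam : ContDiffOn ℝ 1 (fun t => (p t).lam) (Set.Ioo a b)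
  contDiffOn_α : ContDiffOn ℝ 1 (fun t => (p t).α) (Set.Ioo a b)
  contDiffOn_β : ContDiffOn ℝ 1 (fun t => (p t).β) (Set.Ioo a b)
  contDiffOn_γ : ContDiffOn ℝ 1 (fun t => (p t).γ) (Set.Ioo a b)
  contDiffOn_θ : ContDiffOn ℝ 1 (fun t => (p t).θ) (Set.Ioo a b)
  decomposition : ∀ t ∈ Set.Icc a b,
    ∀ᵐ x, toL2 (u t) x = modulated Q (p t) x + toL2 (R t) x
  orthogonal : ∀ t ∈ Set.Icc a b, Orthogonal Q ρ (p t) (toL2 (R t))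

/-- The bootstrap estimates on the remainder and on the modulation parameters at time `t`. -/
structure BootstrapBounds {d : ℕ} (δ T t : ℝ) (p : Modulation d) (R : H1 d) : Prop where
  grad_remainder : gradNorm R ≤ 2 * (T - t) ^ 2
  remainder : ‖toL2 R‖ ≤ 2 * (T - t) ^ 3
  lam_γ : |p.lam - (T - t)| + |p.γ - (T - t)| ≤ 2 * (T - t) ^ (3 + δ)
  α_β : ‖p.α‖ + ‖p.β‖ ≤ 2 * (T - t) ^ (2 + δ)
  θ : |p.θ - 1 / (T - t)| ≤ 2 * (T - t) ^ (1 + δ)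

end RoughNLS

end

noncomputable section

namespace RoughNLS

open FourierTransform
open scoped BoundedContinuousFunction ComplexInnerProductSpace

variable {d : ℕ}

/-! ### Multiplication and Fourier multiplication by bounded continuous functions -/

/-! Without noise the energy is conserved. The noise acts as a forcing X = i(b·∇u + cu), and
formally dE/dt = Re⟨X, -Δu - |u|^{4/d}u⟩. Since W is imaginary, X combines the skew-adjoint
operators 2∇φ·∇ + Δφ (`transport`) with multiplications by i∇φ·∇φ (`potential`). Skewness removes
second derivatives of u from the pairing with -Δu. What remains pairs ∇u, u and |u|^{4/d}u with one
another, with coefficients built from derivatives of the φ_k.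

Condition (A1) makes a derivative of φ_k of order m ≤ 6 of size min(1, |x|^(6-m))
(`FlatAtOrigin.flatOfOrder`). Sharing these weights between the two factors bounds |dE/dt| by
`noiseWeight`: the integrals of |∇u|², |u|² and |u|^{2+8/d} against min(1, |x|^n) with n = 4, 2, 6
(`exists_noise_le`). The profile w lives at scale λ ~ T-t near the origin, so these three integrals
are of size λ^4·λ^(-2), λ^2 and λ^6·λ^(-4), all comparable to (T-t)². The remainder contributes at
most a multiple of its squared H¹ norm, which is smaller. Hence |dE/dt| ≤ C(T-t)²
(`exists_noiseWeight_bootstrap_le`), and integrating over [t, t_n] gives the third power. The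
moments of Q and ∇Q used here come from a barrier argument (`IsGroundState.exists_le_barrier`) and
from Caccioppoli's inequality (`IsGroundState.caccioppoli`).

The analytic difficulty is the energy identity for a solution that is only in H¹
(`energy_sub_energy_eq`). The equation is smoothed by the heat semigroup at times s = 2^(-j), and
the energy of the smoothed function is differentiated. The forcing terms converge: on Schwartz
functions by direct computation, and on H¹ by density and a bound uniform in s that rests on
Friedrichs' commutator estimate. The one delicate term pairs the commutator of the heat semigroup
and the nonlinearity with the smoothed Laplacian. The squared L² norm of the commutator is O((j+1)
2^(-j)) (`exists_norm_commutator_le`), the factor j+1 being the logarithmic failure of H¹ ⊂ L^∞ in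
the plane. The sum over j of 2^(-j)‖Δ heat u‖² is finite (`sum_norm_sq_lap_le`). Because the
harmonic series diverges, the loss j+1 is harmless for infinitely many j
(`frequently_mul_lt_of_sum_le`), and this identifies the limit. -/

theorem memLp_bcf_mul (g : Sp d →ᵇ ℂ) (v : L2 d) : MemLp (fun x => g x * v x) 2 := by
  refine MemLp.of_le_mul (c := ‖g‖) (Lp.memLp v)
    (g.continuous.aestronglyMeasurable.mul (Lp.aestronglyMeasurable v)) ?_
  filter_upwards with x
  rw [norm_mul]
  gcongr
  exact g.norm_coe_le_norm x

/-- Multiplication by a bounded continuous function on `L²`. -/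
def bmul (g : Sp d →ᵇ ℂ) : L2 d →L[ℂ] L2 d :=
  LinearMap.mkContinuous
    { toFun := fun v => (memLp_bcf_mul g v).toLp
      map_add' := by
        intro v w
        rw [← MemLp.toLp_add]
        apply MemLp.toLp_congr
        filter_upwards [Lp.coeFn_add v w] with x hx
        simp only [hx, Pi.add_apply, mul_add]
      map_smul' := by
        intro c v
        rw [RingHom.id_apply, ← MemLp.toLp_const_smul]
        apply MemLp.toLp_congr
        filter_upwards [Lp.coeFn_smul c v] with x hx
        simp only [hx, Pi.smul_apply, smul_eq_mul]
        ring }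
    ‖g‖ (by
      intro v
      apply Lp.norm_le_mul_norm_of_ae_le_mul
      filter_upwards [(memLp_bcf_mul g v).coeFn_toLp] with x hx
      simp only [LinearMap.coe_mk, AddHom.coe_mk, hx, norm_mul]
      gcongr
      exact g.norm_coe_le_norm x)

theorem bmul_ae (g : Sp d →ᵇ ℂ) (v : L2 d) : bmul g v =ᵐ[volume] fun x => g x * v x :=
  (memLp_bcf_mul g v).coeFn_toLp

theorem norm_bmul_le_of_bound {g : Sp d →ᵇ ℂ} {K : ℝ} (hK : ∀ x, ‖g x‖ ≤ K) (v : L2 d) :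
    ‖bmul g v‖ ≤ K * ‖v‖ := by
  apply Lp.norm_le_mul_norm_of_ae_le_mul
  filter_upwards [bmul_ae g v] with x hx
  rw [hx, norm_mul]
  gcongr
  exact hK x

theorem bmul_mul (g h : Sp d →ᵇ ℂ) (v : L2 d) : bmul (g * h) v = bmul g (bmul h v) := by
  apply Lp.ext
  filter_upwards [bmul_ae (g * h) v, bmul_ae g (bmul h v), bmul_ae h v] with x h1 h2 h3
  rw [h1, h2, h3, BoundedContinuousFunction.mul_apply, mul_assoc]

theorem inner_eq_integral (v w : L2 d) :
    ⟪v, w⟫ = ∫ x, w x * starRingEnd ℂ (v x) := by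
  rw [L2.inner_def]
  rfl

theorem inner_bmul_left (g : Sp d →ᵇ ℂ) (v w : L2 d) : ⟪bmul g v, w⟫ = ⟪v, bmul (star g) w⟫ := by
  rw [inner_eq_integral, inner_eq_integral]
  apply integral_congr_ae
  filter_upwards [bmul_ae g v, bmul_ae (star g) w] with x h1 h2
  rw [h1, h2, map_mul, BoundedContinuousFunction.star_apply, RCLike.star_def]
  ring

/-- The Fourier multiplier with a bounded continuous symbol. -/
def fmul (m : Sp d →ᵇ ℂ) : L2 d →L[ℂ] L2 d :=
  ((Lp.fourierTransformₗᵢ (Sp d) ℂ).symm.toContinuousLinearEquiv : L2 d →L[ℂ] L2 d) ∘L bmul m ∘L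
    ((Lp.fourierTransformₗᵢ (Sp d) ℂ).toContinuousLinearEquiv : L2 d →L[ℂ] L2 d)

theorem fmul_apply (m : Sp d →ᵇ ℂ) (v : L2 d) : fmul m v = 𝓕⁻ (bmul m (𝓕 v)) := rfl

theorem fourier_fmul (m : Sp d →ᵇ ℂ) (v : L2 d) : 𝓕 (fmul m v) = bmul m (𝓕 v) := by
  rw [fmul_apply, fourier_fourierInv_eq]

theorem fourier_fmul_ae (m : Sp d →ᵇ ℂ) (v : L2 d) :
    (𝓕 (fmul m v) : L2 d) =ᵐ[volume] fun ξ => m ξ * (𝓕 v : L2 d) ξ := by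
  rw [fourier_fmul]
  exact bmul_ae m _

theorem norm_fmul_le_of_bound {m : Sp d →ᵇ ℂ} {K : ℝ} (hK : ∀ x, ‖m x‖ ≤ K) (v : L2 d) :
    ‖fmul m v‖ ≤ K * ‖v‖ := by
  rw [← Lp.norm_fourier_eq (fmul m v), ← Lp.norm_fourier_eq v, fourier_fmul]
  exact norm_bmul_le_of_bound hK _

theorem fmul_mul (m n : Sp d →ᵇ ℂ) (v : L2 d) : fmul (m * n) v = fmul m (fmul n v) := by
  rw [fmul_apply, fmul_apply m, fourier_fmul, bmul_mul]

theorem inner_fmul_left (m : Sp d →ᵇ ℂ) (v w : L2 d) : ⟪fmul m v, w⟫ = ⟪v, fmul (star m) w⟫ := by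
  rw [← Lp.inner_fourier_eq, ← Lp.inner_fourier_eq v, fourier_fmul, fourier_fmul, inner_bmul_left]

theorem fourier_ext {v w : L2 d} (h : (𝓕 v : L2 d) =ᵐ[volume] (𝓕 w : L2 d)) : v = w :=
  (Lp.fourierTransformₗᵢ (Sp d) ℂ).injective (Lp.ext h)

/-! ### `H¹` through the Fourier transform -/

theorem inner_ei (ξ : Sp d) (j : Fin d) : inner ℝ ξ (ei j) = ξ j := by
  rw [EuclideanSpace.inner_single_right]
  simp

/-- The bridge between the distributional definition of `H1` and multiplication by 2πiξ_j on the
Fourier side, where all later H¹ computations take place. -/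
theorem temperedDistribution_fourier_lineDeriv (v : L2 d) (j : Fin d) (ψ : 𝓢(Sp d, ℂ)) :
    (𝓕 (∂_{ei j} (v : 𝓢'(Sp d, ℂ))) : 𝓢'(Sp d, ℂ)) ψ
      = ∫ ξ, ψ ξ * (2 * Real.pi * Complex.I * ξ j * (𝓕 v : L2 d) ξ) := by
  rw [TemperedDistribution.fourier_lineDerivOp_eq, Lp.fourier_toTemperedDistribution_eq]
  have ht : (fun ξ : Sp d => ((inner ℝ ξ (ei j) : ℝ) : ℂ)).HasTemperateGrowth := by fun_prop
  change (2 * Real.pi * Complex.I) • (TemperedDistribution.smulLeftCLM ℂ _ _ ψ) = _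
  rw [TemperedDistribution.smulLeftCLM_apply_apply, Lp.toTemperedDistribution_apply,
    ← integral_smul]
  apply integral_congr_ae
  filter_upwards with ξ
  rw [SchwartzMap.smulLeftCLM_apply_apply ht, inner_ei]
  simp only [smul_eq_mul]
  ring

/-- The right side is only known to be locally integrable, because ξ_j is unbounded. Equality of the
two distributions is therefore tested on smooth compactly supported functions. -/
theorem fourier_grad (u : H1 d) (j : Fin d) :
    (𝓕 (grad u j) : L2 d) =ᵐ[volume]
      fun ξ => 2 * Real.pi * Complex.I * ξ j * (𝓕 (toL2 u) : L2 d) ξ := by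
  have hu := u.2 j
  have hF : (𝓕 (∂_{ei j} ((toL2 u : L2 d) : 𝓢'(Sp d, ℂ))) : 𝓢'(Sp d, ℂ))
      = ((𝓕 (grad u j) : L2 d) : 𝓢'(Sp d, ℂ)) := by
    rw [← Lp.fourier_toTemperedDistribution_eq]
    exact congrArg _ hu
  have hl := (Lp.memLp (𝓕 (toL2 u) : L2 d)).locallyIntegrable (by norm_num)
  apply ae_eq_of_integral_contDiff_smul_eq
  · exact (Lp.memLp _).locallyIntegrable (by norm_num)
  · intro x
    obtain ⟨K, hK⟩ := (isCompact_closedBall x 1).exists_bound_of_continuousOn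
      (f := fun ξ : Sp d => (2 * Real.pi * Complex.I * ξ j : ℂ)) (by fun_prop)
    refine ⟨Metric.closedBall x 1, Metric.closedBall_mem_nhds x one_pos, ?_⟩
    exact (hl.integrableOn_isCompact (isCompact_closedBall x 1)).bdd_mul (c := K)
      (by fun_prop : Continuous fun ξ : Sp d => (2 * Real.pi * Complex.I * ξ j : ℂ)).aestronglyMeasurable
      (by
        filter_upwards [ae_restrict_mem measurableSet_closedBall] with ξ hξ
        exact hK ξ hξ)
  · intro g hg hgc
    have hg₁ : HasCompactSupport (Complex.ofRealCLM ∘ g) := hgc.comp_left rfl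
    have hg₂ : ContDiff ℝ (⊤ : ℕ∞) (Complex.ofRealCLM ∘ g) := by fun_prop
    have := congrArg (fun T : 𝓢'(Sp d, ℂ) => T (hg₁.toSchwartzMap hg₂)) hF
    simp only [temperedDistribution_fourier_lineDeriv, Lp.toTemperedDistribution_apply] at this
    simpa using this.symm

/-- Two `L²` functions related on the Fourier side by `2πiξ_j` define an element of `H¹`. -/
def H1.ofFourier (v : L2 d) (w : Fin d → L2 d)
    (h : ∀ j, (𝓕 (w j) : L2 d) =ᵐ[volume]
      fun ξ => 2 * Real.pi * Complex.I * ξ j * (𝓕 v : L2 d) ξ) : H1 d :=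
  ⟨(v, w), by
    intro j
    have : (𝓕 (∂_{ei j} (v : 𝓢'(Sp d, ℂ))) : 𝓢'(Sp d, ℂ)) = 𝓕 ((w j : L2 d) : 𝓢'(Sp d, ℂ)) := by
      rw [Lp.fourier_toTemperedDistribution_eq]
      ext ψ
      rw [temperedDistribution_fourier_lineDeriv, Lp.toTemperedDistribution_apply]
      apply integral_congr_ae
      filter_upwards [h j] with ξ hξ
      rw [hξ, smul_eq_mul]
    have h2 := congrArg (fun T : 𝓢'(Sp d, ℂ) => 𝓕⁻ T) this
    simpa using h2⟩

theorem H1.ext_toL2 {u v : H1 d} (h : toL2 u = toL2 v) : u = v := by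
  apply Subtype.ext
  apply Prod.ext h
  funext j
  apply fourier_ext
  have h1 := fourier_grad u j
  have h2 := fourier_grad v j
  rw [h] at h1
  exact h1.trans h2.symm

/-! ### Schwartz functions inside H¹ and their density. -/

/-- The class in `L²` of a Schwartz function. -/
def schL2 (ψ : 𝓢(Sp d, ℂ)) : L2 d := ψ.toLp 2 volume

theorem schL2_ae (ψ : 𝓢(Sp d, ℂ)) : schL2 ψ =ᵐ[volume] ψ := SchwartzMap.coeFn_toLp ψ 2 volume

theorem fourier_schL2 (ψ : 𝓢(Sp d, ℂ)) : (𝓕 (schL2 ψ) : L2 d) = schL2 (𝓕 ψ) :=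
  SchwartzMap.toLp_fourier_eq ψ

theorem lineDeriv_schL2 (ψ : 𝓢(Sp d, ℂ)) (m : Sp d) :
    ∂_{m} ((schL2 ψ : L2 d) : 𝓢'(Sp d, ℂ)) = ((schL2 (∂_{m} ψ) : L2 d) : 𝓢'(Sp d, ℂ)) := by
  unfold schL2
  rw [Lp.toTemperedDistribution_toLp_eq ψ, Lp.toTemperedDistribution_toLp_eq (∂_{m} ψ)]
  exact TemperedDistribution.lineDerivOp_toTemperedDistributionCLM_eq ψ m

/-- A Schwartz function as an element of `H¹`. -/
def ofSchwartz (ψ : 𝓢(Sp d, ℂ)) : H1 d :=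
  ⟨(schL2 ψ, fun j => schL2 (∂_{ei j} ψ)), fun j => lineDeriv_schL2 ψ (ei j)⟩

theorem toL2_ofSchwartz (ψ : 𝓢(Sp d, ℂ)) : toL2 (ofSchwartz ψ) = schL2 ψ := rfl

theorem grad_ofSchwartz (ψ : 𝓢(Sp d, ℂ)) (j : Fin d) :
    grad (ofSchwartz ψ) j = schL2 (∂_{ei j} ψ) := rfl

theorem fourier_sub_L2 (v w : L2 d) : (𝓕 (v - w) : L2 d) = 𝓕 v - 𝓕 w :=
  map_sub (Lp.fourierTransformₗᵢ (Sp d) ℂ) v w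

/-- `toL2` as a continuous linear map. -/
def toL2L : H1 d →L[ℂ] L2 d := (ContinuousLinearMap.fst ℂ _ _) ∘L (H1 d).subtypeL

/-- `grad · j` as a continuous linear map. -/
def gradL (j : Fin d) : H1 d →L[ℂ] L2 d :=
  (ContinuousLinearMap.proj j) ∘L (ContinuousLinearMap.snd ℂ _ _) ∘L (H1 d).subtypeL

@[simp] theorem toL2L_apply (u : H1 d) : toL2L u = toL2 u := rfl

@[simp] theorem gradL_apply (j : Fin d) (u : H1 d) : gradL j u = grad u j := rfl

theorem norm_toL2_le (u : H1 d) : ‖toL2 u‖ ≤ ‖u‖ := norm_fst_le (u : L2 d × (Fin d → L2 d))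

theorem norm_grad_le (u : H1 d) (j : Fin d) : ‖grad u j‖ ≤ ‖u‖ :=
  (norm_le_pi_norm (u : L2 d × (Fin d → L2 d)).2 j).trans
    (norm_snd_le (u : L2 d × (Fin d → L2 d)))

theorem norm_H1_le {u : H1 d} {K : ℝ} (hK : 0 ≤ K) (h0 : ‖toL2 u‖ ≤ K) (h1 : ∀ j, ‖grad u j‖ ≤ K) :
    ‖u‖ ≤ K := by
  change ‖(u : L2 d × (Fin d → L2 d))‖ ≤ K
  rw [Prod.norm_def, max_le_iff]
  exact ⟨h0, (pi_norm_le_iff_of_nonneg hK).2 h1⟩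

/-- With c = (1+|ξ|²)^(-1/2), the H¹ norm of u is comparable to the L² norm of the weighted
transform û/c. That function is approximated in L² by a Schwartz function g, and c·g is again
Schwartz because c has temperate growth; its inverse transform approximates u. -/
theorem denseRange_ofSchwartz : DenseRange (ofSchwartz : 𝓢(Sp d, ℂ) → H1 d) := by
  intro u
  rw [Metric.mem_closure_range_iff]
  intro ε hε
  set c : Sp d → ℂ := fun ξ => (((1 + ‖ξ‖ ^ 2) ^ (-1 / 2 : ℝ) : ℝ) : ℂ) with hc
  have hcg : c.HasTemperateGrowth := by fun_prop
  have hcpos : ∀ ξ : Sp d, (0 : ℝ) < 1 + ‖ξ‖ ^ 2 := fun ξ => by positivity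
  have hcsq : ∀ ξ : Sp d, ‖c ξ‖ ^ 2 * (1 + ‖ξ‖ ^ 2) = 1 := by
    intro ξ
    rw [hc]
    simp only [Complex.norm_real, Real.norm_eq_abs, sq_abs]
    rw [← Real.rpow_natCast, ← Real.rpow_mul (hcpos ξ).le]
    norm_num
    rw [Real.rpow_neg_one, inv_mul_cancel₀ (hcpos ξ).ne']
  have hc1 : ∀ ξ, ‖c ξ‖ ≤ 1 := by
    intro ξ
    have := hcsq ξ
    nlinarith [norm_nonneg (c ξ), sq_nonneg ‖ξ‖, mul_nonneg (sq_nonneg ‖c ξ‖) (sq_nonneg ‖ξ‖)]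
  have hc2 : ∀ ξ (j : Fin d), ‖(ξ j : ℂ) * c ξ‖ ≤ 1 := by
    intro ξ j
    have := hcsq ξ
    have hj : ‖ξ j‖ ≤ ‖ξ‖ := PiLp.norm_apply_le ξ j
    rw [norm_mul, Complex.norm_real]
    have h3 : (‖ξ j‖ * ‖c ξ‖) ^ 2 ≤ 1 := by
      have : ‖ξ j‖ ^ 2 ≤ ‖ξ‖ ^ 2 := by gcongr
      nlinarith [sq_nonneg ‖c ξ‖, mul_le_mul_of_nonneg_right this (sq_nonneg ‖c ξ‖)]
    nlinarith [mul_nonneg (norm_nonneg (ξ j)) (norm_nonneg (c ξ))]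
  have hne : ∀ ξ, c ξ ≠ 0 := by
    intro ξ h
    have := hcsq ξ
    simp [h] at this
  -- the weighted Fourier transform
  set U : L2 d := 𝓕 (toL2 u) with hU
  have hmem : MemLp (fun ξ => (c ξ)⁻¹ * U ξ) 2 := by
    have hgr : ∀ j, MemLp (fun ξ : Sp d => (ξ j : ℂ) * U ξ) 2 := by
      intro j
      have h1 := (Lp.memLp (𝓕 (grad u j) : L2 d)).const_mul ((2 * Real.pi * Complex.I : ℂ)⁻¹)
      refine h1.ae_eq ?_
      filter_upwards [fourier_grad u j] with ξ hξ
      rw [hξ]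
      have : (2 * Real.pi * Complex.I : ℂ) ≠ 0 := Complex.two_pi_I_ne_zero
      field_simp
      rfl
    have hcm : Continuous fun ξ => (c ξ)⁻¹ := hcg.1.continuous.inv₀ hne
    have hs : MemLp (fun ξ : Sp d => ‖U ξ‖ + ∑ j, ‖(ξ j : ℂ) * U ξ‖) 2 :=
      (Lp.memLp U).norm.add (memLp_finsetSum _ fun j _ => (hgr j).norm)
    refine hs.of_le (hcm.aestronglyMeasurable.mul (Lp.aestronglyMeasurable U)) ?_
    filter_upwards with ξ
    have hle : ‖(c ξ)⁻¹‖ ≤ 1 + ∑ j, ‖ξ j‖ := by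
      have h1 : ‖(c ξ)⁻¹‖ ^ 2 = 1 + ‖ξ‖ ^ 2 := by
        rw [norm_inv, inv_pow]
        exact inv_eq_of_mul_eq_one_right (hcsq ξ)
      have h2 : ‖ξ‖ ≤ ∑ j, ‖ξ j‖ := by
        have : ξ = ∑ j, ξ j • (ei j : Sp d) := by
          ext i
          simp [Finset.sum_apply, Pi.single_apply]
        calc ‖ξ‖ = ‖∑ j, ξ j • (ei j : Sp d)‖ := by rw [← this]
          _ ≤ ∑ j, ‖ξ j • (ei j : Sp d)‖ := norm_sum_le _ _
          _ = ∑ j, ‖ξ j‖ := by simp [norm_smul]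
      have h3 : 0 ≤ ∑ j, ‖ξ j‖ := Finset.sum_nonneg fun j _ => norm_nonneg _
      nlinarith [norm_nonneg (c ξ)⁻¹, norm_nonneg ξ]
    have hs0 : 0 ≤ ‖U ξ‖ + ∑ j, ‖(ξ j : ℂ) * U ξ‖ := by positivity
    rw [norm_mul, Real.norm_of_nonneg hs0]
    calc ‖(c ξ)⁻¹‖ * ‖U ξ‖ ≤ (1 + ∑ j, ‖ξ j‖) * ‖U ξ‖ := by gcongr
      _ = _ := by
        rw [add_mul, one_mul, Finset.sum_mul]
        simp
  set G : L2 d := hmem.toLp with hG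
  -- The radius ε/7 absorbs the factor 2π < 7 lost when the gradient is read off from the weighted
  -- transform.
  obtain ⟨g, hg⟩ := Metric.mem_closure_range_iff.1
    (SchwartzMap.denseRange_toLpCLM (F := ℂ) (E := Sp d) (μ := volume) (p := 2)
      ENNReal.ofNat_ne_top G) (ε / 7) (by positivity)
  set ψ : 𝓢(Sp d, ℂ) := 𝓕⁻ (SchwartzMap.smulLeftCLM ℂ c g) with hψ
  have hFψ : (𝓕 (schL2 ψ) : L2 d) =ᵐ[volume] fun ξ => c ξ * g ξ := by
    rw [fourier_schL2, hψ, fourier_fourierInv_eq]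
    filter_upwards [schL2_ae (SchwartzMap.smulLeftCLM ℂ c g)] with ξ hξ
    rw [hξ, SchwartzMap.smulLeftCLM_apply_apply hcg, smul_eq_mul]
  refine ⟨ψ, ?_⟩
  rw [dist_eq_norm] at hg ⊢
  have hFd : (𝓕 (toL2 (u - ofSchwartz ψ)) : L2 d)
      =ᵐ[volume] fun ξ => c ξ * ((G - schL2 g : L2 d) ξ) := by
    have : (𝓕 (toL2 (u - ofSchwartz ψ)) : L2 d) = U - 𝓕 (schL2 ψ) := by
      rw [hU, ← fourier_sub_L2]
      rfl
    rw [this]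
    filter_upwards [Lp.coeFn_sub U (𝓕 (schL2 ψ)), hFψ, Lp.coeFn_sub G (schL2 g),
      hmem.coeFn_toLp, schL2_ae g] with ξ h1 h2 h3 h4 h5
    rw [h1, h3, Pi.sub_apply, Pi.sub_apply, h2, hG, h4, h5, mul_sub, mul_inv_cancel_left₀ (hne ξ)]
  have hpi : 2 * Real.pi < 7 := by linarith [Real.pi_lt_d2]
  have hgn : ‖G - schL2 g‖ < ε / 7 := hg
  refine lt_of_le_of_lt (norm_H1_le (K := 2 * Real.pi * ‖G - schL2 g‖) (by positivity) ?_ ?_) ?_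
  · rw [← Lp.norm_fourier_eq]
    apply Lp.norm_le_mul_norm_of_ae_le_mul
    filter_upwards [hFd] with ξ hξ
    rw [hξ, norm_mul]
    gcongr
    linarith [hc1 ξ, Real.pi_gt_three]
  · intro j
    rw [← Lp.norm_fourier_eq]
    apply Lp.norm_le_mul_norm_of_ae_le_mul
    filter_upwards [hFd, fourier_grad (u - ofSchwartz ψ) j] with ξ hξ h2
    rw [h2, hξ]
    have : (2 * Real.pi * Complex.I * ξ j * (c ξ * ((G - schL2 g : L2 d) ξ)) : ℂ)
      = 2 * Real.pi * Complex.I * (ξ j * c ξ) * ((G - schL2 g : L2 d) ξ) := by ring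
    rw [this, norm_mul, norm_mul]
    have h3 : ‖(2 * Real.pi * Complex.I : ℂ)‖ = 2 * Real.pi := by
      simp [abs_of_pos Real.pi_pos]
    rw [h3]
    have h4 : 2 * Real.pi * ‖(ξ j : ℂ) * c ξ‖ ≤ 2 * Real.pi * 1 :=
      mul_le_mul_of_nonneg_left (hc2 ξ j) (by positivity)
    rw [mul_one] at h4
    gcongr
  · nlinarith [norm_nonneg (G - schL2 g)]

/-! ### The heat semigroup -/

theorem mul_exp_neg_le (y : ℝ) : y * Real.exp (-y) ≤ 1 := by
  have h := Real.add_one_le_exp y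
  have : y * Real.exp (-y) ≤ Real.exp y * Real.exp (-y) := by gcongr; linarith
  rwa [← Real.exp_add, add_neg_cancel, Real.exp_zero] at this

/-- The symbol `exp (-s |ξ|²)` of the heat semigroup (and `0` for `s ≤ 0`). -/
def heatSym (s : ℝ) : Sp d →ᵇ ℂ :=
  if hs : 0 < s then
    BoundedContinuousFunction.ofNormedAddCommGroup
      (fun ξ : Sp d => ((Real.exp (-s * ‖ξ‖ ^ 2) : ℝ) : ℂ)) (by fun_prop) 1 (by
        intro ξ
        rw [Complex.norm_real, Real.norm_of_nonneg (Real.exp_pos _).le]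
        exact Real.exp_le_one_iff.2 (by nlinarith [sq_nonneg ‖ξ‖]))
  else 0

/-- The symbol `4π²|ξ|² exp (-s |ξ|²)` (and `0` for `s ≤ 0`). -/
def lapSym (s : ℝ) : Sp d →ᵇ ℂ :=
  if hs : 0 < s then
    BoundedContinuousFunction.ofNormedAddCommGroup
      (fun ξ : Sp d => ((4 * Real.pi ^ 2 * ‖ξ‖ ^ 2 * Real.exp (-s * ‖ξ‖ ^ 2) : ℝ) : ℂ))
      (by fun_prop) (4 * Real.pi ^ 2 / s) (by
        intro ξ
        rw [Complex.norm_real, Real.norm_of_nonneg (by positivity), le_div_iff₀ hs]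
        have := mul_exp_neg_le (s * ‖ξ‖ ^ 2)
        rw [← neg_mul] at this
        nlinarith [sq_nonneg Real.pi])
  else 0

/-- The symbol `2πiξ_j exp (-s |ξ|²)` (and `0` for `s ≤ 0`). -/
def gradSym (s : ℝ) (j : Fin d) : Sp d →ᵇ ℂ :=
  if hs : 0 < s then
    BoundedContinuousFunction.ofNormedAddCommGroup
      (fun ξ : Sp d => 2 * Real.pi * Complex.I * ξ j * ((Real.exp (-s * ‖ξ‖ ^ 2) : ℝ) : ℂ))
      (by fun_prop) (2 * Real.pi * (1 + 1 / s)) (by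
        intro ξ
        rw [norm_mul, norm_mul, Complex.norm_real, Complex.norm_real,
          Real.norm_of_nonneg (Real.exp_pos _).le]
        have h3 : ‖(2 * Real.pi * Complex.I : ℂ)‖ = 2 * Real.pi := by
          simp [abs_of_pos Real.pi_pos]
        rw [h3, mul_assoc]
        have h1 : ‖ξ j‖ ≤ ‖ξ‖ := PiLp.norm_apply_le ξ j
        have h2 : ‖ξ‖ ≤ 1 + ‖ξ‖ ^ 2 := by nlinarith [sq_nonneg (‖ξ‖ - 1), norm_nonneg ξ]
        have h4 := mul_exp_neg_le (s * ‖ξ‖ ^ 2)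
        rw [← neg_mul] at h4
        have h5 : Real.exp (-s * ‖ξ‖ ^ 2) ≤ 1 :=
          Real.exp_le_one_iff.2 (by nlinarith [sq_nonneg ‖ξ‖])
        have h6 : ‖ξ‖ ^ 2 * Real.exp (-s * ‖ξ‖ ^ 2) ≤ 1 / s := by
          rw [le_div_iff₀ hs]; linarith
        gcongr
        calc ‖ξ j‖ * Real.exp (-s * ‖ξ‖ ^ 2) ≤ (1 + ‖ξ‖ ^ 2) * Real.exp (-s * ‖ξ‖ ^ 2) := by
              gcongr; linarith
          _ ≤ 1 + 1 / s := by linarith)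
  else 0

theorem heatSym_apply {s : ℝ} (hs : 0 < s) (ξ : Sp d) :
    heatSym s ξ = ((Real.exp (-s * ‖ξ‖ ^ 2) : ℝ) : ℂ) := by
  simp only [heatSym, dif_pos hs]; rfl

theorem lapSym_apply {s : ℝ} (hs : 0 < s) (ξ : Sp d) :
    lapSym s ξ = ((4 * Real.pi ^ 2 * ‖ξ‖ ^ 2 * Real.exp (-s * ‖ξ‖ ^ 2) : ℝ) : ℂ) := by
  simp only [lapSym, dif_pos hs]; rfl

theorem gradSym_apply {s : ℝ} (hs : 0 < s) (j : Fin d) (ξ : Sp d) :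
    gradSym s j ξ = 2 * Real.pi * Complex.I * ξ j * ((Real.exp (-s * ‖ξ‖ ^ 2) : ℝ) : ℂ) := by
  simp only [gradSym, dif_pos hs]; rfl

/-- The heat semigroup, `heat s = exp (s (4π²)⁻¹ Δ)`. -/
def heat (s : ℝ) : L2 d →L[ℂ] L2 d := fmul (heatSym s)

/-- The operator `-Δ heat s`. -/
def lap (s : ℝ) : L2 d →L[ℂ] L2 d := fmul (lapSym s)

theorem star_heatSym (s : ℝ) : star (heatSym s : Sp d →ᵇ ℂ) = heatSym s := by
  ext ξ
  by_cases hs : 0 < s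
  · rw [BoundedContinuousFunction.star_apply, heatSym_apply hs, RCLike.star_def, Complex.conj_ofReal]
  · simp [heatSym, dif_neg hs]

theorem star_lapSym (s : ℝ) : star (lapSym s : Sp d →ᵇ ℂ) = lapSym s := by
  ext ξ
  by_cases hs : 0 < s
  · rw [BoundedContinuousFunction.star_apply, lapSym_apply hs, RCLike.star_def, Complex.conj_ofReal]
  · simp [lapSym, dif_neg hs]

theorem inner_heat_left (s : ℝ) (v w : L2 d) : ⟪heat s v, w⟫ = ⟪v, heat s w⟫ := by
  rw [heat, inner_fmul_left, star_heatSym]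

theorem inner_lap_left (s : ℝ) (v w : L2 d) : ⟪lap s v, w⟫ = ⟪v, lap s w⟫ := by
  rw [lap, inner_fmul_left, star_lapSym]

theorem heat_lap {s t : ℝ} (hs : 0 < s) (ht : 0 < t) (v : L2 d) :
    heat s (lap t v) = lap (s + t) v := by
  rw [heat, lap, ← fmul_mul, lap]
  congr 1
  congr 1
  ext ξ
  rw [BoundedContinuousFunction.mul_apply, heatSym_apply hs, lapSym_apply ht,
    lapSym_apply (add_pos hs ht), ← Complex.ofReal_mul]
  congr 1
  rw [show -(s + t) * ‖ξ‖ ^ 2 = -s * ‖ξ‖ ^ 2 + -t * ‖ξ‖ ^ 2 by ring, Real.exp_add]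
  ring

theorem lap_heat {s t : ℝ} (hs : 0 < s) (ht : 0 < t) (v : L2 d) :
    lap s (heat t v) = lap (s + t) v := by
  rw [add_comm, ← heat_lap ht hs, heat, lap, ← fmul_mul, ← fmul_mul, mul_comm]

theorem norm_heat_le (s : ℝ) (v : L2 d) : ‖heat s v‖ ≤ ‖v‖ := by
  have := norm_fmul_le_of_bound (m := heatSym s) (K := 1) (fun ξ => by
    by_cases hs : 0 < s
    · rw [heatSym_apply hs, Complex.norm_real, Real.norm_of_nonneg (Real.exp_pos _).le]
      exact Real.exp_le_one_iff.2 (by nlinarith [sq_nonneg ‖ξ‖])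
    · simp [heatSym, dif_neg hs]) v
  rwa [one_mul] at this

theorem norm_sq_eq_integral (v : L2 d) : ‖v‖ ^ 2 = ∫ x, ‖v x‖ ^ 2 := by
  have h : ⟪v, v⟫ = ((‖v‖ ^ 2 : ℝ) : ℂ) := by
    rw [inner_self_eq_norm_sq_to_K]; simp
  rw [inner_eq_integral] at h
  have h2 : (fun x => v x * starRingEnd ℂ (v x)) = fun x => ((‖v x‖ ^ 2 : ℝ) : ℂ) := by
    funext x
    rw [Complex.mul_conj, Complex.normSq_eq_norm_sq]
  rw [h2, integral_complex_ofReal] at h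
  exact_mod_cast h.symm

theorem integrable_norm_sq (v : L2 d) : Integrable fun x => ‖v x‖ ^ 2 :=
  (memLp_two_iff_integrable_sq_norm (Lp.aestronglyMeasurable v)).1 (Lp.memLp v)

theorem norm_sq_heat_sub {s : ℝ} (hs : 0 < s) (v : L2 d) :
    ‖heat s v - v‖ ^ 2
      = ∫ ξ, (Real.exp (-s * ‖ξ‖ ^ 2) - 1) ^ 2 * ‖(𝓕 v : L2 d) ξ‖ ^ 2 := by
  rw [← Lp.norm_fourier_eq, fourier_sub_L2, norm_sq_eq_integral]
  apply integral_congr_ae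
  filter_upwards [fourier_fmul_ae (heatSym s) v, Lp.coeFn_sub (𝓕 (heat s v)) (𝓕 v)] with ξ h1 h2
  rw [h2, Pi.sub_apply, heat, h1, heatSym_apply hs, ← sub_one_mul, norm_mul, mul_pow,
    ← Complex.ofReal_one, ← Complex.ofReal_sub, Complex.norm_real, Real.norm_eq_abs, sq_abs]

/-- Dominated convergence on the Fourier side, with dominating function |v̂|². -/
theorem tendsto_heat (v : L2 d) : Tendsto (fun s => heat s v) (𝓝[>] 0) (𝓝 v) := by
  rw [tendsto_iff_norm_sub_tendsto_zero]
  have hsq : Tendsto (fun s => ‖heat s v - v‖ ^ 2) (𝓝[>] 0) (𝓝 0) := by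
    have : Tendsto (fun s : ℝ => ∫ ξ, (Real.exp (-s * ‖ξ‖ ^ 2) - 1) ^ 2 * ‖(𝓕 v : L2 d) ξ‖ ^ 2)
        (𝓝[>] 0) (𝓝 (∫ ξ : Sp d, (0 : ℝ))) := by
      apply tendsto_integral_filter_of_dominated_convergence
        (fun ξ => ‖(𝓕 v : L2 d) ξ‖ ^ 2)
      · filter_upwards with s
        exact (by fun_prop : Continuous fun ξ : Sp d =>
          (Real.exp (-s * ‖ξ‖ ^ 2) - 1) ^ 2).aestronglyMeasurable.mul
            (integrable_norm_sq _).aestronglyMeasurable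
      · filter_upwards [self_mem_nhdsWithin] with s hs
        filter_upwards with ξ
        rw [Real.norm_of_nonneg (by positivity)]
        have h1 : Real.exp (-s * ‖ξ‖ ^ 2) ≤ 1 :=
          Real.exp_le_one_iff.2 (by nlinarith [sq_nonneg ‖ξ‖, Set.mem_Ioi.1 hs])
        have h2 := Real.exp_pos (-s * ‖ξ‖ ^ 2)
        have h3 : (Real.exp (-s * ‖ξ‖ ^ 2) - 1) ^ 2 ≤ 1 := by nlinarith
        nlinarith [sq_nonneg ‖(𝓕 v : L2 d) ξ‖]
      · exact integrable_norm_sq _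
      · filter_upwards with ξ
        have : Continuous fun s : ℝ => (Real.exp (-s * ‖ξ‖ ^ 2) - 1) ^ 2 * ‖(𝓕 v : L2 d) ξ‖ ^ 2 := by
          fun_prop
        have h := this.tendsto 0
        simp only [neg_zero, zero_mul, Real.exp_zero, sub_self, ne_eq, OfNat.ofNat_ne_zero,
          not_false_eq_true, zero_pow] at h
        exact h.mono_left nhdsWithin_le_nhds
    rw [integral_zero] at this
    refine this.congr' ?_
    filter_upwards [self_mem_nhdsWithin] with s hs
    rw [norm_sq_heat_sub hs]
  have h := hsq.sqrt
  simpa using h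

/-- Smoothing of an `L²` function to an element of `H¹`. -/
def heatH1 {s : ℝ} (hs : 0 < s) (v : L2 d) : H1 d :=
  H1.ofFourier (heat s v) (fun j => fmul (gradSym s j) v) (by
    intro j
    filter_upwards [fourier_fmul_ae (heatSym s) v, fourier_fmul_ae (gradSym s j) v] with ξ h1 h2
    rw [h2, heat, h1, heatSym_apply hs, gradSym_apply hs]
    ring)

theorem toL2_heatH1 {s : ℝ} (hs : 0 < s) (v : L2 d) : toL2 (heatH1 hs v) = heat s v := rfl

theorem grad_heatH1 {s : ℝ} (hs : 0 < s) (u : H1 d) (j : Fin d) :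
    grad (heatH1 hs (toL2 u)) j = heat s (grad u j) := by
  apply fourier_ext
  filter_upwards [fourier_grad (heatH1 hs (toL2 u)) j, fourier_fmul_ae (heatSym s) (toL2 u),
    fourier_fmul_ae (heatSym s) (grad u j), fourier_grad u j] with ξ h1 h2 h3 h4
  rw [h1, toL2_heatH1, heat, h2, h3, h4]
  ring

theorem norm_heatH1_le {s : ℝ} (hs : 0 < s) (u : H1 d) : ‖heatH1 hs (toL2 u)‖ ≤ ‖u‖ := by
  apply norm_H1_le (norm_nonneg _)
  · exact (norm_heat_le _ _).trans (norm_toL2_le u)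
  · intro j
    rw [grad_heatH1]
    exact (norm_heat_le _ _).trans (norm_grad_le u j)

/-- Integration by parts through Plancherel. The whole Laplacian falls on `u`, so `v` may be an
arbitrary L² function. -/
theorem sum_inner_grad_heatH1 {s : ℝ} (hs : 0 < s) (v : L2 d) (u : H1 d) :
    ∑ j, ⟪grad (heatH1 hs v) j, grad u j⟫ = ⟪v, lap s (toL2 u)⟫ := by
  have h0 : ∀ j, ⟪grad (heatH1 hs v) j, grad u j⟫ = ∫ ξ, (𝓕 (grad u j) : L2 d) ξ
      * starRingEnd ℂ ((𝓕 (grad (heatH1 hs v) j) : L2 d) ξ) := by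
    intro j
    rw [← Lp.inner_fourier_eq, inner_eq_integral]
  rw [Finset.sum_congr rfl fun j _ => h0 j, ← Lp.inner_fourier_eq v, inner_eq_integral]
  have hint : ∀ j, Integrable fun ξ => (𝓕 (grad u j) : L2 d) ξ
      * starRingEnd ℂ ((𝓕 (grad (heatH1 hs v) j) : L2 d) ξ) := by
    intro j
    have := L2.integrable_inner (𝕜 := ℂ) (𝓕 (grad (heatH1 hs v) j) : L2 d) (𝓕 (grad u j))
    exact this
  rw [← integral_finsetSum _ fun j _ => hint j]
  apply integral_congr_ae
  have hall := ae_all_iff.2 fun j => fourier_grad u j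
  have hall2 := ae_all_iff.2 fun j => fourier_grad (heatH1 hs v) j
  filter_upwards [hall, hall2, fourier_fmul_ae (heatSym s) v,
    fourier_fmul_ae (lapSym s) (toL2 u)] with ξ h1 h2 h3 h4
  simp_rw [h1, h2, toL2_heatH1, heat, h3, lap, h4, heatSym_apply hs, lapSym_apply hs]
  have hn : (‖ξ‖ : ℝ) ^ 2 = ∑ j, ξ j ^ 2 := by
    rw [EuclideanSpace.norm_sq_eq]; simp
  generalize Real.exp (-s * ‖ξ‖ ^ 2) = e
  rw [hn]
  push_cast
  simp only [map_mul, Complex.conj_ofReal, Complex.conj_I, map_ofNat, Finset.mul_sum, Finset.sum_mul]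
  apply Finset.sum_congr rfl
  intro j _
  have := Complex.I_sq
  linear_combination (-4 * (Real.pi : ℂ) ^ 2 * (ξ j : ℂ) ^ 2 * (𝓕 (toL2 u) : L2 d) ξ
    * (e : ℂ) * starRingEnd ℂ ((𝓕 v : L2 d) ξ)) * this

theorem sum_norm_sq_grad (u : H1 d) :
    ∑ j, ‖grad u j‖ ^ 2 = ∫ ξ, 4 * Real.pi ^ 2 * ‖ξ‖ ^ 2 * ‖(𝓕 (toL2 u) : L2 d) ξ‖ ^ 2 := by
  have h1 : ∀ j, ‖grad u j‖ ^ 2 = ∫ ξ, ‖(𝓕 (grad u j) : L2 d) ξ‖ ^ 2 := by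
    intro j
    rw [← norm_sq_eq_integral, Lp.norm_fourier_eq]
  simp_rw [h1]
  rw [← integral_finsetSum _ fun j _ => integrable_norm_sq _]
  apply integral_congr_ae
  have hall := ae_all_iff.2 fun j => fourier_grad u j
  filter_upwards [hall] with ξ h1
  simp_rw [h1]
  have hn : (‖ξ‖ : ℝ) ^ 2 = ∑ j, ‖ξ j‖ ^ 2 := EuclideanSpace.norm_sq_eq _
  rw [hn, Finset.mul_sum, Finset.sum_mul]
  apply Finset.sum_congr rfl
  intro j _
  simp only [norm_mul, Complex.norm_ofNat, Complex.norm_real, Complex.norm_I, Real.norm_eq_abs,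
    abs_of_pos Real.pi_pos]
  ring

theorem integrable_sq_fourier (u : H1 d) :
    Integrable fun ξ : Sp d => 4 * Real.pi ^ 2 * ‖ξ‖ ^ 2 * ‖(𝓕 (toL2 u) : L2 d) ξ‖ ^ 2 := by
  have := integrable_finsetSum Finset.univ fun (j : Fin d) _ =>
    integrable_norm_sq (𝓕 (grad u j) : L2 d)
  refine this.congr ?_
  have hall := ae_all_iff.2 fun j => fourier_grad u j
  filter_upwards [hall] with ξ h1
  simp_rw [h1]
  have hn : (‖ξ‖ : ℝ) ^ 2 = ∑ j, ‖ξ j‖ ^ 2 := EuclideanSpace.norm_sq_eq _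
  rw [hn, Finset.mul_sum, Finset.sum_mul]
  apply Finset.sum_congr rfl
  intro j _
  simp only [norm_mul, Complex.norm_ofNat, Complex.norm_real, Complex.norm_I, Real.norm_eq_abs,
    abs_of_pos Real.pi_pos]
  ring

/-- With x_j = 2^(-j)y, the sharper bound e^(-2x_n) for the sum over j < n propagates by induction,
because (1+x)e^(-2x) ≤ e^(-x) and 2x_{n+1} = x_n. Uniformity in y, the squared frequency, is what
the square function estimate uses. -/
theorem sum_geometric_mul_exp_le (y : ℝ) (hy : 0 ≤ y) (n : ℕ) :
    ∑ j ∈ Finset.range n, (2 : ℝ)⁻¹ ^ j * y * Real.exp (-2 * ((2 : ℝ)⁻¹ ^ j * y)) ≤ 1 := by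
  have h : ∀ n : ℕ, ∑ j ∈ Finset.range n, (2 : ℝ)⁻¹ ^ j * y * Real.exp (-2 * ((2 : ℝ)⁻¹ ^ j * y))
      ≤ Real.exp (-((2 : ℝ)⁻¹ ^ n * y * 2)) := by
    intro n
    induction n with
    | zero => simp; positivity
    | succ n ih =>
      rw [Finset.sum_range_succ]
      set x := (2 : ℝ)⁻¹ ^ n * y with hx
      have hx0 : 0 ≤ x := by positivity
      have h1 : (2 : ℝ)⁻¹ ^ (n + 1) * y * 2 = x := by rw [hx, pow_succ]; ring
      rw [h1]
      have h2 : Real.exp (-x) = Real.exp x * Real.exp (-2 * x) := by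
        rw [← Real.exp_add]; congr 1; ring
      have h3 := Real.add_one_le_exp x
      have h4 : (x + 1) * Real.exp (-2 * x) ≤ Real.exp x * Real.exp (-2 * x) := by gcongr
      have h5 : Real.exp (-(x * 2)) = Real.exp (-2 * x) := by congr 1; ring
      rw [h5] at ih
      linarith
  refine (h n).trans (Real.exp_le_one_iff.2 ?_)
  have : 0 ≤ (2 : ℝ)⁻¹ ^ n * y := by positivity
  linarith

/-- The square function estimate for the heat semigroup along dyadic times. -/
theorem sum_norm_sq_lap_le (u : H1 d) (n : ℕ) :
    ∑ j ∈ Finset.range n, (2 : ℝ)⁻¹ ^ j * ‖lap ((2 : ℝ)⁻¹ ^ j) (toL2 u)‖ ^ 2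
      ≤ 4 * Real.pi ^ 2 * ∑ k, ‖grad u k‖ ^ 2 := by
  have h1 : ∀ j : ℕ, (2 : ℝ)⁻¹ ^ j * ‖lap ((2 : ℝ)⁻¹ ^ j) (toL2 u)‖ ^ 2
      = ∫ ξ, (2 : ℝ)⁻¹ ^ j * ‖(𝓕 (lap ((2 : ℝ)⁻¹ ^ j) (toL2 u)) : L2 d) ξ‖ ^ 2 := by
    intro j
    rw [integral_const_mul, ← norm_sq_eq_integral, Lp.norm_fourier_eq]
  simp_rw [h1]
  rw [← integral_finsetSum _ fun j _ => (integrable_norm_sq _).const_mul _, sum_norm_sq_grad,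
    ← integral_const_mul]
  apply integral_mono_ae
  · exact integrable_finsetSum _ fun j _ => (integrable_norm_sq _).const_mul _
  · exact (integrable_sq_fourier u).const_mul _
  have hall := ae_all_iff.2 fun j : ℕ => fourier_fmul_ae (lapSym ((2 : ℝ)⁻¹ ^ j)) (toL2 u)
  filter_upwards [hall] with ξ h
  have hp : ∀ j : ℕ, (0 : ℝ) < (2 : ℝ)⁻¹ ^ j := fun j => by positivity
  have h2 : ∀ j : ℕ, (2 : ℝ)⁻¹ ^ j * ‖(𝓕 (lap ((2 : ℝ)⁻¹ ^ j) (toL2 u)) : L2 d) ξ‖ ^ 2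
      = (4 * Real.pi ^ 2) ^ 2 * ‖ξ‖ ^ 2 * ‖(𝓕 (toL2 u) : L2 d) ξ‖ ^ 2 *
        ((2 : ℝ)⁻¹ ^ j * ‖ξ‖ ^ 2 * Real.exp (-2 * ((2 : ℝ)⁻¹ ^ j * ‖ξ‖ ^ 2))) := by
    intro j
    rw [lap, h j, lapSym_apply (hp j), norm_mul, Complex.norm_real,
      Real.norm_of_nonneg (by positivity)]
    have : Real.exp (-2 * ((2 : ℝ)⁻¹ ^ j * ‖ξ‖ ^ 2)) = Real.exp (-(2 : ℝ)⁻¹ ^ j * ‖ξ‖ ^ 2) ^ 2 := by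
      rw [← Real.exp_nat_mul]; congr 1; push_cast; ring
    rw [this]
    ring
  simp_rw [h2]
  rw [← Finset.mul_sum]
  have h3 := sum_geometric_mul_exp_le (‖ξ‖ ^ 2) (by positivity) n
  have h4 : 0 ≤ (4 * Real.pi ^ 2) ^ 2 * ‖ξ‖ ^ 2 * ‖(𝓕 (toL2 u) : L2 d) ξ‖ ^ 2 := by positivity
  nlinarith

/-! ### The heat kernel -/

/-- The kernel of `heat s`. -/
def pk (s : ℝ) (z : Sp d) : ℝ :=
  (Real.pi / s) ^ ((d : ℝ) / 2) * Real.exp (-(Real.pi ^ 2 / s) * ‖z‖ ^ 2)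

theorem pk_nonneg {s : ℝ} (hs : 0 < s) (z : Sp d) : 0 ≤ pk s z := by
  have := Real.pi_pos
  unfold pk
  positivity

@[fun_prop]
theorem continuous_pk (s : ℝ) : Continuous (pk s : Sp d → ℝ) := by
  unfold pk
  fun_prop

/-- The integral of a non-integrable function is 0 by convention, so the known positive value of the
Gaussian integral forces integrability. -/
theorem integrable_gaussian {b : ℝ} (hb : 0 < b) :
    Integrable fun z : Sp d => Real.exp (-b * ‖z‖ ^ 2) := by
  by_contra h
  have h1 := GaussianFourier.integral_rexp_neg_mul_sq_norm (V := Sp d) hb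
  rw [integral_undef h] at h1
  have : 0 < (Real.pi / b) ^ ((Module.finrank ℝ (Sp d) : ℝ) / 2) :=
    Real.rpow_pos_of_pos (div_pos Real.pi_pos hb) _
  linarith

theorem integrable_pk {s : ℝ} (hs : 0 < s) : Integrable (pk s : Sp d → ℝ) :=
  (integrable_gaussian (div_pos (pow_pos Real.pi_pos 2) hs)).const_mul _

theorem integral_pk {s : ℝ} (hs : 0 < s) : ∫ z : Sp d, pk s z = 1 := by
  unfold pk
  have hp := Real.pi_pos
  rw [integral_const_mul, GaussianFourier.integral_rexp_neg_mul_sq_norm (by positivity),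
    finrank_euclideanSpace, Fintype.card_fin, ← Real.mul_rpow (by positivity) (by positivity)]
  have : Real.pi / s * (Real.pi / (Real.pi ^ 2 / s)) = 1 := by field_simp
  rw [this, Real.one_rpow]

theorem pk_le {s : ℝ} (hs : 0 < s) (z : Sp d) : pk s z ≤ (Real.pi / s) ^ ((d : ℝ) / 2) := by
  have hp := Real.pi_pos
  unfold pk
  have h1 : Real.exp (-(Real.pi ^ 2 / s) * ‖z‖ ^ 2) ≤ 1 := by
    apply Real.exp_le_one_iff.2
    have : 0 ≤ Real.pi ^ 2 / s * ‖z‖ ^ 2 := by positivity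
    linarith
  have h2 : 0 ≤ (Real.pi / s) ^ ((d : ℝ) / 2) := by positivity
  nlinarith

theorem memLp_pk {s : ℝ} (hs : 0 < s) : MemLp (fun z : Sp d => (pk s z : ℂ)) 2 := by
  rw [memLp_two_iff_integrable_sq_norm (by fun_prop : Continuous fun z : Sp d =>
    (pk s z : ℂ)).aestronglyMeasurable]
  refine ((integrable_pk (d := d) hs).const_mul ((Real.pi / s) ^ ((d : ℝ) / 2))).mono'
    (by fun_prop : Continuous fun z : Sp d => ‖(pk s z : ℂ)‖ ^ 2).aestronglyMeasurable ?_
  filter_upwards with z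
  rw [Complex.norm_real, norm_pow, norm_norm, Real.norm_of_nonneg (pk_nonneg hs z), sq]
  exact mul_le_mul_of_nonneg_right (pk_le hs z) (pk_nonneg hs z)

/-- Half of the Gaussian exponent pays for replacing s by 2s. The other half remains available to
absorb powers of |z|. -/
theorem pk_eq_two_mul {s : ℝ} (hs : 0 < s) (z : Sp d) :
    pk s z = 2 ^ ((d : ℝ) / 2) * pk (2 * s) z * Real.exp (-(Real.pi ^ 2 * ‖z‖ ^ 2 / (2 * s))) := by
  have hp := Real.pi_pos
  unfold pk
  have h1 : (Real.pi / s) ^ ((d : ℝ) / 2) = 2 ^ ((d : ℝ) / 2) * (Real.pi / (2 * s)) ^ ((d : ℝ) / 2) := by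
    rw [← Real.mul_rpow (by positivity) (by positivity)]
    congr 1
    field_simp
  rw [h1, mul_assoc, mul_assoc, mul_assoc, ← Real.exp_add]
  congr 4
  field_simp
  ring

/-- Second moments of the heat kernel. -/
theorem sq_norm_mul_pk_le {s : ℝ} (hs : 0 < s) (z : Sp d) :
    ‖z‖ ^ 2 * pk s z ≤ 2 ^ ((d : ℝ) / 2) * s * pk (2 * s) z := by
  have hp := Real.pi_pos
  rw [pk_eq_two_mul hs]
  have h1 := mul_exp_neg_le (Real.pi ^ 2 * ‖z‖ ^ 2 / (2 * s))
  have h2 := pk_nonneg (by positivity : 0 < 2 * s) z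
  have h3 : ‖z‖ ^ 2 * Real.exp (-(Real.pi ^ 2 * ‖z‖ ^ 2 / (2 * s))) ≤ s := by
    have h4 : ‖z‖ ^ 2 * Real.exp (-(Real.pi ^ 2 * ‖z‖ ^ 2 / (2 * s)))
      = 2 * s / Real.pi ^ 2 * (Real.pi ^ 2 * ‖z‖ ^ 2 / (2 * s)
        * Real.exp (-(Real.pi ^ 2 * ‖z‖ ^ 2 / (2 * s)))) := by field_simp
    have h5 : 2 * s / Real.pi ^ 2 ≤ s := by
      have : 2 ≤ Real.pi ^ 2 := by nlinarith [Real.pi_gt_three]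
      rw [div_le_iff₀ (by positivity)]
      nlinarith
    rw [h4]
    calc _ ≤ 2 * s / Real.pi ^ 2 * 1 := by gcongr
      _ ≤ s := by linarith
  have h6 : (0 : ℝ) ≤ 2 ^ ((d : ℝ) / 2) := by positivity
  calc _ = 2 ^ ((d : ℝ) / 2) * pk (2 * s) z * (‖z‖ ^ 2 * Real.exp (-(Real.pi ^ 2 * ‖z‖ ^ 2 / (2 * s)))) := by
        ring
    _ ≤ 2 ^ ((d : ℝ) / 2) * pk (2 * s) z * s := by gcongr
    _ = _ := by ring

/-! ### The heat semigroup as a convolution -/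

/-- The L² transform is defined by extension, the other one by an integral. They are compared by
duality: the transform is moved onto a test function on both sides. -/
theorem fourierInv_ae_of_integrable {w : L2 d} (hw : Integrable w) :
    (𝓕⁻ w : L2 d) =ᵐ[volume] fun x => 𝓕⁻ (w : Sp d → ℂ) x := by
  have hL : Continuous fun p : Sp d × Sp d => (-innerₗ (Sp d)) p.1 p.2 := by
    simp only [LinearMap.neg_apply, innerₗ_apply_apply]
    fun_prop
  have hcont : Continuous (𝓕⁻ (w : Sp d → ℂ)) :=
    VectorFourier.fourierIntegral_continuous (L := -innerₗ (Sp d)) Real.continuous_fourierChar hL hw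
  apply ae_eq_of_integral_contDiff_smul_eq
  · exact (Lp.memLp _).locallyIntegrable (by norm_num)
  · exact hcont.locallyIntegrable
  · intro g hg hgc
    have hg₁ : HasCompactSupport (Complex.ofRealCLM ∘ g) := hgc.comp_left rfl
    have hg₂ : ContDiff ℝ (⊤ : ℕ∞) (Complex.ofRealCLM ∘ g) := by fun_prop
    set χ : 𝓢(Sp d, ℂ) := hg₁.toSchwartzMap hg₂ with hχ
    have hχa : ∀ x, χ x = (g x : ℂ) := fun x => rfl
    have h1 : (((𝓕⁻ w : L2 d) : 𝓢'(Sp d, ℂ))) χ = (w : 𝓢'(Sp d, ℂ)) (𝓕⁻ χ) := by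
      rw [← Lp.fourierInv_toTemperedDistribution_eq, TemperedDistribution.fourierInv_apply]
    rw [Lp.toTemperedDistribution_apply, Lp.toTemperedDistribution_apply] at h1
    have h2 := VectorFourier.integral_fourierIntegral_smul_eq_flip (μ := volume) (ν := volume)
      (L := -innerₗ (Sp d)) (f := χ) (g := w) Real.continuous_fourierChar hL χ.integrable hw
    have hflip : (-innerₗ (Sp d)).flip = -innerₗ (Sp d) := by
      ext x y
      simp [real_inner_comm]
    rw [hflip] at h2
    calc ∫ x, g x • (𝓕⁻ w : L2 d) x = ∫ x, χ x • (𝓕⁻ w : L2 d) x := by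
          simp only [hχa, smul_eq_mul, Complex.real_smul]
      _ = ∫ ξ, (𝓕⁻ χ) ξ • w ξ := h1
      _ = ∫ ξ, (𝓕⁻ (χ : Sp d → ℂ)) ξ • w ξ := by rw [SchwartzMap.fourierInv_coe]
      _ = ∫ x, χ x • 𝓕⁻ (w : Sp d → ℂ) x := h2
      _ = _ := by simp only [hχa, smul_eq_mul, Complex.real_smul]

theorem heat_schwartz_ae_fourier (s : ℝ) (ψ : 𝓢(Sp d, ℂ)) :
    heat s (schL2 ψ) =ᵐ[volume] fun x => 𝓕⁻ (fun ξ : Sp d => heatSym s ξ * 𝓕 (ψ : Sp d → ℂ) ξ) x := by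
  have h1 : bmul (heatSym s) (𝓕 (schL2 ψ)) =ᵐ[volume]
      fun ξ : Sp d => heatSym s ξ * 𝓕 (ψ : Sp d → ℂ) ξ := by
    rw [fourier_schL2]
    filter_upwards [bmul_ae (heatSym s) (schL2 (𝓕 ψ)), schL2_ae (𝓕 ψ)] with ξ h1 h2
    rw [h1, h2, SchwartzMap.fourier_coe]
  have hint : Integrable fun ξ : Sp d => heatSym s ξ * 𝓕 (ψ : Sp d → ℂ) ξ := by
    have := (𝓕 ψ : 𝓢(Sp d, ℂ)).integrable (μ := volume)
    rw [SchwartzMap.fourier_coe] at this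
    exact this.bdd_mul (c := ‖(heatSym s : Sp d →ᵇ ℂ)‖) (heatSym s).continuous.aestronglyMeasurable
      (by filter_upwards with ξ using (heatSym s).norm_coe_le_norm ξ)
  have h2 := fourierInv_ae_of_integrable (hint.congr h1.symm)
  rw [heat, fmul_apply]
  filter_upwards [h2] with x hx
  rw [hx]
  exact Real.fourierInv_congr_ae h1 x

/-- The multiplication formula ∫ ψ̂ h = ∫ ψ ĥ, applied to the Gaussian times the character of x,
whose transform is the heat kernel centred at x. -/
theorem heat_schwartz_ae {s : ℝ} (hs : 0 < s) (ψ : 𝓢(Sp d, ℂ)) :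
    heat s (schL2 ψ) =ᵐ[volume] fun x => ∫ y, (pk s (x - y) : ℂ) * ψ y := by
  filter_upwards [heat_schwartz_ae_fourier s ψ] with x hx
  rw [hx, Real.fourierInv_eq']
  set h : Sp d → ℂ := fun v => Complex.exp (-(s : ℂ) * ‖v‖ ^ 2
    + 2 * Real.pi * Complex.I * (inner ℝ x v : ℝ)) with hh
  have hb : 0 < (s : ℂ).re := by simpa using hs
  have hint : Integrable h := by
    have := GaussianFourier.integrable_cexp_neg_mul_sq_norm_add (V := Sp d) hb
      (2 * Real.pi * Complex.I) x
    exact this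
  have h2 := VectorFourier.integral_fourierIntegral_smul_eq_flip (μ := volume) (ν := volume)
    (L := innerₗ (Sp d)) (f := ψ) (g := h) Real.continuous_fourierChar continuous_inner
    ψ.integrable hint
  have hflip : (innerₗ (Sp d)).flip = innerₗ (Sp d) := by
    ext x y
    simp
  rw [hflip] at h2
  have h3 : ∀ y, VectorFourier.fourierIntegral Real.fourierChar volume (innerₗ (Sp d)) h y
      = (pk s (x - y) : ℂ) := by
    intro y
    have := fourier_gaussian_innerProductSpace' hb x y
    change 𝓕 h y = _
    rw [this, finrank_euclideanSpace, Fintype.card_fin, pk]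
    push_cast
    rw [Complex.ofReal_cpow (by positivity)]
    push_cast
    congr 2
    ring
  calc _ = ∫ ξ, 𝓕 (ψ : Sp d → ℂ) ξ • h ξ := by
        apply integral_congr_ae
        filter_upwards with ξ
        rw [heatSym_apply hs, hh]
        simp only [smul_eq_mul]
        rw [Complex.exp_add, Complex.ofReal_exp, real_inner_comm]
        push_cast
        ring_nf
    _ = ∫ y, ψ y • VectorFourier.fourierIntegral Real.fourierChar volume (innerₗ (Sp d)) h y := h2
    _ = _ := by
        apply integral_congr_ae
        filter_upwards with y
        rw [h3, smul_eq_mul, mul_comm]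

theorem memLp_pk_sub {s : ℝ} (hs : 0 < s) (x : Sp d) :
    MemLp (fun y : Sp d => (pk s (x - y) : ℂ)) 2 :=
  (memLp_pk hs).comp_measurePreserving (Measure.measurePreserving_sub_left volume x)

theorem integral_pk_mul_eq_inner {s : ℝ} (hs : 0 < s) (g : L2 d) (x : Sp d) :
    ∫ y, (pk s (x - y) : ℂ) * g y = ⟪(memLp_pk_sub hs x).toLp, g⟫ := by
  rw [inner_eq_integral]
  apply integral_congr_ae
  filter_upwards [(memLp_pk_sub hs x).coeFn_toLp] with y hy
  rw [hy, Complex.conj_ofReal, mul_comm]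

/-- The heat semigroup is convolution with the heat kernel. -/
theorem heat_ae {s : ℝ} (hs : 0 < s) (g : L2 d) :
    heat s g =ᵐ[volume] fun x => ∫ y, (pk s (x - y) : ℂ) * g y := by
  have hd := (SchwartzMap.denseRange_toLpCLM (F := ℂ) (E := Sp d) (μ := volume) (p := 2)
      ENNReal.ofNat_ne_top)
  obtain ⟨f, hf, hlim⟩ := mem_closure_iff_seq_limit.1 (hd g)
  choose ψ hψ using hf
  have hψ' : ∀ n, schL2 (ψ n) = f n := hψ
  have h1 : Tendsto (fun n => heat s (f n)) atTop (𝓝 (heat s g)) :=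
    ((heat s).continuous.tendsto g).comp hlim
  -- On the left L² convergence gives pointwise convergence only along a subsequence. On the right,
  -- for fixed x, the convolution is an inner product with a fixed L² function and converges along
  -- any subsequence.
  obtain ⟨ns, hmono, hns⟩ := (tendstoInMeasure_of_tendsto_Lp h1).exists_seq_tendsto_ae
  have hall := ae_all_iff.2 fun n => heat_schwartz_ae hs (ψ (ns n))
  filter_upwards [hns, hall] with x hx hx2
  refine tendsto_nhds_unique hx ?_
  have h2 : ∀ n, heat s (f (ns n)) x = ⟪(memLp_pk_sub hs x).toLp, f (ns n)⟫ := by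
    intro n
    rw [← integral_pk_mul_eq_inner hs, ← hψ', hx2]
    apply integral_congr_ae
    filter_upwards [schL2_ae (ψ (ns n))] with y hy
    rw [hy]
  simp_rw [h2]
  rw [integral_pk_mul_eq_inner hs]
  exact Filter.Tendsto.inner tendsto_const_nhds (hlim.comp hmono.tendsto_atTop)

theorem norm_toLp_pk_sub {s : ℝ} (hs : 0 < s) (x : Sp d) :
    ‖(memLp_pk_sub hs x).toLp (fun y : Sp d => (pk s (x - y) : ℂ))‖
      = (eLpNorm (fun z : Sp d => (pk s z : ℂ)) 2 volume).toReal := by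
  have h := eLpNorm_comp_measurePreserving (p := 2) (memLp_pk (d := d) hs).aestronglyMeasurable
    (Measure.measurePreserving_sub_left volume x)
  rw [Lp.norm_toLp, ← h]
  rfl

/-- Smoothing from `L²` to `L^∞`. -/
theorem exists_norm_heat_le {s : ℝ} (hs : 0 < s) :
    ∃ K : ℝ, 0 ≤ K ∧ ∀ g : L2 d, ∀ᵐ x, ‖heat s g x‖ ≤ K * ‖g‖ := by
  refine ⟨(eLpNorm (fun z : Sp d => (pk s z : ℂ)) 2 volume).toReal, ENNReal.toReal_nonneg, ?_⟩
  intro g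
  filter_upwards [heat_ae hs g] with x hx
  rw [hx, integral_pk_mul_eq_inner hs, ← norm_toLp_pk_sub hs x]
  exact norm_inner_le_norm _ _

/-! ### Sobolev inequalities -/

theorem sq_integral_mul_le {α : Type*} [MeasurableSpace α] {μ : Measure α} {f g : α → ℝ}
    (hf0 : ∀ x, 0 ≤ f x) (hg0 : ∀ x, 0 ≤ g x) (hf : MemLp f 2 μ) (hg : MemLp g 2 μ) :
    (∫ x, f x * g x ∂μ) ^ 2 ≤ (∫ x, f x ^ 2 ∂μ) * ∫ x, g x ^ 2 ∂μ := by
  have h := integral_mul_le_Lp_mul_Lq_of_nonneg (μ := μ) (f := f) (g := g)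
    (Real.HolderConjugate.two_two) (Eventually.of_forall hf0) (Eventually.of_forall hg0)
    (by simpa using hf) (by simpa using hg)
  simp only [Real.rpow_two, ← Real.sqrt_eq_rpow] at h
  have h0 : 0 ≤ ∫ x, f x * g x ∂μ := integral_nonneg fun x => mul_nonneg (hf0 x) (hg0 x)
  have hF : 0 ≤ ∫ x, f x ^ 2 ∂μ := integral_nonneg fun x => sq_nonneg _
  have hG : 0 ≤ ∫ x, g x ^ 2 ∂μ := integral_nonneg fun x => sq_nonneg _
  calc _ ≤ (√(∫ x, f x ^ 2 ∂μ) * √(∫ x, g x ^ 2 ∂μ)) ^ 2 := by gcongr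
    _ = _ := by rw [mul_pow, Real.sq_sqrt hF, Real.sq_sqrt hG]

theorem integrable_norm_pow (ψ : 𝓢(Sp d, ℂ)) {k : ℕ} (hk : k ≠ 0) :
    Integrable fun x => ‖ψ x‖ ^ k :=
  (ψ.memLp (k : ℝ≥0∞) volume).integrable_norm_pow hk

theorem norm_sq_schL2 (ψ : 𝓢(Sp d, ℂ)) : ‖schL2 ψ‖ ^ 2 = ∫ x, ‖ψ x‖ ^ 2 := by
  rw [norm_sq_eq_integral]
  apply integral_congr_ae
  filter_upwards [schL2_ae ψ] with x hx
  rw [hx]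

theorem sum_norm_sq_grad_le (u : H1 d) : ∑ j, ‖grad u j‖ ^ 2 ≤ d * ‖u‖ ^ 2 := by
  calc _ ≤ ∑ _j : Fin d, ‖u‖ ^ 2 := by
        gcongr with j
        exact norm_grad_le u j
    _ = _ := by simp

/-- The absolute value of a Fourier integral is controlled by the `H¹` norm. -/
theorem integral_mul_fourier_le (ψ : 𝓢(Sp d, ℂ)) {m : Sp d → ℝ} (hm : Continuous m)
    (hm0 : ∀ ξ, 0 ≤ m ξ) (hint : Integrable fun ξ => m ξ ^ 2 / (1 + ‖ξ‖ ^ 2)) :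
    ∫ ξ, m ξ * ‖𝓕 ψ ξ‖ ≤ √(∫ ξ, m ξ ^ 2 / (1 + ‖ξ‖ ^ 2)) * (√(d + 1) * ‖ofSchwartz ψ‖) := by
  set F : Sp d → ℝ := fun ξ => m ξ / √(1 + ‖ξ‖ ^ 2) with hF
  set G : Sp d → ℝ := fun ξ => √(1 + ‖ξ‖ ^ 2) * ‖𝓕 ψ ξ‖ with hG
  have hpos : ∀ ξ : Sp d, 0 < √(1 + ‖ξ‖ ^ 2) := fun ξ => by positivity
  have hsq : ∀ ξ : Sp d, √(1 + ‖ξ‖ ^ 2) ^ 2 = 1 + ‖ξ‖ ^ 2 := fun ξ => Real.sq_sqrt (by positivity)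
  have hF2 : ∀ ξ, F ξ ^ 2 = m ξ ^ 2 / (1 + ‖ξ‖ ^ 2) := fun ξ => by rw [hF, div_pow, hsq]
  have hG2 : ∀ ξ, G ξ ^ 2 = ‖𝓕 ψ ξ‖ ^ 2 + ‖ξ‖ ^ 2 * ‖𝓕 ψ ξ‖ ^ 2 := fun ξ => by
    rw [hG, mul_pow, hsq]; ring
  have hFc : Continuous F := by
    apply hm.div (by fun_prop) fun ξ => (hpos ξ).ne'
  have hGc : Continuous G := by
    have := (𝓕 ψ : 𝓢(Sp d, ℂ)).continuous
    fun_prop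
  have hae := schL2_ae (𝓕 ψ : 𝓢(Sp d, ℂ))
  have e1 : ∫ ξ, ‖𝓕 ψ ξ‖ ^ 2 = ‖toL2 (ofSchwartz ψ)‖ ^ 2 := by
    rw [← norm_sq_schL2, ← fourier_schL2, Lp.norm_fourier_eq, toL2_ofSchwartz]
  have h4 : ∀ᵐ ξ : Sp d, 4 * Real.pi ^ 2 * ‖ξ‖ ^ 2 * ‖(𝓕 (toL2 (ofSchwartz ψ)) : L2 d) ξ‖ ^ 2
      = 4 * Real.pi ^ 2 * (‖ξ‖ ^ 2 * ‖𝓕 ψ ξ‖ ^ 2) := by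
    rw [toL2_ofSchwartz, fourier_schL2]
    filter_upwards [hae] with ξ hξ
    rw [hξ]
    ring
  have hi1 : Integrable fun ξ : Sp d => ‖ξ‖ ^ 2 * ‖𝓕 ψ ξ‖ ^ 2 := by
    have := ((integrable_sq_fourier (ofSchwartz ψ)).congr h4).const_mul (4 * Real.pi ^ 2)⁻¹
    refine this.congr ?_
    filter_upwards with ξ
    have := Real.pi_pos
    field_simp
  have hi0 : Integrable fun ξ : Sp d => ‖𝓕 ψ ξ‖ ^ 2 := integrable_norm_pow (𝓕 ψ) two_ne_zero
  have e2 : ∫ ξ, ‖ξ‖ ^ 2 * ‖𝓕 ψ ξ‖ ^ 2 ≤ ∑ j, ‖grad (ofSchwartz ψ) j‖ ^ 2 := by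
    rw [sum_norm_sq_grad, integral_congr_ae h4, integral_const_mul]
    have : 0 ≤ ∫ ξ : Sp d, ‖ξ‖ ^ 2 * ‖𝓕 ψ ξ‖ ^ 2 := integral_nonneg fun ξ => by positivity
    have : 1 ≤ 4 * Real.pi ^ 2 := by nlinarith [Real.pi_gt_three]
    nlinarith
  have e3 : ∫ ξ, G ξ ^ 2 ≤ (d + 1) * ‖ofSchwartz ψ‖ ^ 2 := by
    simp only [hG2]
    rw [integral_add hi0 hi1, e1]
    have := sum_norm_sq_grad_le (ofSchwartz ψ)
    have h5 : ‖toL2 (ofSchwartz ψ)‖ ^ 2 ≤ ‖ofSchwartz ψ‖ ^ 2 := by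
      gcongr; exact norm_toL2_le _
    linarith
  have key := sq_integral_mul_le (μ := volume) (f := F) (g := G)
    (fun ξ => div_nonneg (hm0 ξ) (hpos ξ).le) (fun ξ => by positivity)
    ((memLp_two_iff_integrable_sq hFc.aestronglyMeasurable).2 (by simpa only [hF2] using hint))
    ((memLp_two_iff_integrable_sq hGc.aestronglyMeasurable).2
      ((hi0.add hi1).congr (Eventually.of_forall fun ξ => (hG2 ξ).symm)))
  have hFG : ∀ ξ, F ξ * G ξ = m ξ * ‖𝓕 ψ ξ‖ := fun ξ => by
    rw [hF, hG]
    have := (hpos ξ).ne'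
    simp only
    field_simp
  simp only [hFG, hF2] at key
  apply le_of_sq_le_sq _ (by positivity)
  calc _ ≤ _ := key
    _ ≤ (∫ ξ, m ξ ^ 2 / (1 + ‖ξ‖ ^ 2)) * ((d + 1) * ‖ofSchwartz ψ‖ ^ 2) := by
        gcongr
    _ = _ := by
        rw [mul_pow, mul_pow, Real.sq_sqrt (integral_nonneg fun ξ => by positivity),
          Real.sq_sqrt (by positivity)]

theorem norm_fourierInv_integral_le (g : Sp d → ℂ) (x : Sp d) : ‖𝓕⁻ g x‖ ≤ ∫ ξ, ‖g ξ‖ := by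
  rw [Real.fourierInv_eq']
  refine (norm_integral_le_integral_norm _).trans_eq ?_
  congr 1
  funext ξ
  rw [norm_smul]
  have : (2 * Real.pi * (inner ℝ ξ x : ℝ) * Complex.I : ℂ)
    = ((2 * Real.pi * (inner ℝ ξ x : ℝ) : ℝ) : ℂ) * Complex.I := by push_cast; ring
  have h2 := Complex.norm_exp_ofReal_mul_I (2 * Real.pi * (inner ℝ ξ x : ℝ))
  push_cast at h2 ⊢
  rw [h2, one_mul]

/-- `H¹ ⊆ L^∞` in dimension one. -/
theorem exists_norm_le_one :
    ∃ C : ℝ, 0 ≤ C ∧ ∀ (ψ : 𝓢(Sp 1, ℂ)) (x : Sp 1), ‖ψ x‖ ≤ C * ‖ofSchwartz ψ‖ := by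
  refine ⟨√(∫ ξ : Sp 1, 1 ^ 2 / (1 + ‖ξ‖ ^ 2)) * √((1 : ℕ) + 1), by positivity, fun ψ x => ?_⟩
  have hint : Integrable fun ξ : Sp 1 => (1 : ℝ) ^ 2 / (1 + ‖ξ‖ ^ 2) := by
    have := integrable_rpow_neg_one_add_norm_sq (E := Sp 1) (μ := volume) (r := 2) (by simp)
    refine this.congr ?_
    filter_upwards with ξ
    rw [show (-2 / 2 : ℝ) = -1 by norm_num, Real.rpow_neg_one]
    simp
  have h := integral_mul_fourier_le ψ (m := fun _ => 1) continuous_const (by simp) hint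
  have h1 : ψ x = 𝓕⁻ ((𝓕 ψ : 𝓢(Sp 1, ℂ)) : Sp 1 → ℂ) x := by
    rw [← SchwartzMap.fourierInv_coe, FourierTransform.fourierInv_fourier_eq]
  rw [h1, mul_assoc]
  refine (norm_fourierInv_integral_le _ x).trans ?_
  simpa using h

theorem integrable_exp_div {s : ℝ} (hs : 0 < s) :
    Integrable fun ξ : Sp d => Real.exp (-s * ‖ξ‖ ^ 2) ^ 2 / (1 + ‖ξ‖ ^ 2) := by
  have h := integrable_gaussian (d := d) (by positivity : 0 < 2 * s)
  refine h.mono' ?_ ?_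
  · apply Continuous.aestronglyMeasurable
    apply Continuous.div (by fun_prop) (by fun_prop)
    intro x; positivity
  · filter_upwards with ξ
    rw [Real.norm_of_nonneg (by positivity), ← Real.exp_nat_mul]
    refine (div_le_self (Real.exp_pos _).le (by nlinarith [sq_nonneg ‖ξ‖])).trans_eq ?_
    congr 1; push_cast; ring

/-- In the plane the integral of 1/(1+|ξ|²) diverges logarithmically, so each dyadic step may cost a
constant. With E = exp(-s|ξ|²), passing from s to s/2 replaces E² by E, and E(1-E) ≤ s|ξ|²E, so the
step costs at most s∫E = π. -/
theorem integral_exp_div_le (j : ℕ) :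
    ∫ ξ : Sp 2, Real.exp (-(2⁻¹ ^ j) * ‖ξ‖ ^ 2) ^ 2 / (1 + ‖ξ‖ ^ 2) ≤ Real.pi * (j + 1) := by
  have hp := Real.pi_pos
  have hgi : ∀ s : ℝ, 0 < s → ∫ ξ : Sp 2, Real.exp (-s * ‖ξ‖ ^ 2) = Real.pi / s := by
    intro s hs
    rw [GaussianFourier.integral_rexp_neg_mul_sq_norm hs]
    simp
  induction j with
  | zero =>
    calc _ ≤ ∫ ξ : Sp 2, Real.exp (-2 * ‖ξ‖ ^ 2) := by
          apply integral_mono (integrable_exp_div (by norm_num)) (integrable_gaussian (by norm_num))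
          intro ξ
          simp only
          rw [← Real.exp_nat_mul]
          refine (div_le_self (Real.exp_pos _).le (by nlinarith [sq_nonneg ‖ξ‖])).trans_eq ?_
          congr 1; push_cast; ring
      _ = Real.pi / 2 := hgi 2 (by norm_num)
      _ ≤ _ := by push_cast; linarith
  | succ j ih =>
    have hs : (0 : ℝ) < 2⁻¹ ^ j := by positivity
    have hs' : (0 : ℝ) < 2⁻¹ ^ (j + 1) := by positivity
    set s : ℝ := 2⁻¹ ^ j with hsd
    have hss : (2⁻¹ : ℝ) ^ (j + 1) = s / 2 := by rw [pow_succ, hsd]; ring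
    rw [hss] at hs' ⊢
    have hstep : ∫ ξ : Sp 2, Real.exp (-(s / 2) * ‖ξ‖ ^ 2) ^ 2 / (1 + ‖ξ‖ ^ 2)
        ≤ ∫ ξ : Sp 2, (Real.exp (-s * ‖ξ‖ ^ 2) ^ 2 / (1 + ‖ξ‖ ^ 2) + s * Real.exp (-s * ‖ξ‖ ^ 2)) := by
      apply integral_mono (integrable_exp_div hs')
        ((integrable_exp_div hs).add ((integrable_gaussian hs).const_mul s))
      intro ξ
      change _ ≤ Real.exp (-s * ‖ξ‖ ^ 2) ^ 2 / (1 + ‖ξ‖ ^ 2) + s * Real.exp (-s * ‖ξ‖ ^ 2)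
      simp only
      have e1 : Real.exp (-(s / 2) * ‖ξ‖ ^ 2) ^ 2 = Real.exp (-s * ‖ξ‖ ^ 2) := by
        rw [← Real.exp_nat_mul]; congr 1; push_cast; ring
      rw [e1]
      set E := Real.exp (-s * ‖ξ‖ ^ 2) with hE
      have hE0 : 0 < E := Real.exp_pos _
      have hE1 : 1 - E ≤ s * ‖ξ‖ ^ 2 := by
        have := Real.add_one_le_exp (-s * ‖ξ‖ ^ 2)
        linarith
      have hq : 0 ≤ s * E := by positivity
      rw [div_add' _ _ _ (by positivity), div_le_div_iff_of_pos_right (by positivity)]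
      nlinarith [mul_le_mul_of_nonneg_left hE1 hE0.le]
    rw [integral_add (integrable_exp_div hs) ((integrable_gaussian hs).const_mul s),
      integral_const_mul, hgi s hs] at hstep
    have : s * (Real.pi / s) = Real.pi := by field_simp
    push_cast
    linarith

/-- The heat semigroup at time `2⁻ʲ` maps `H¹` to `L^∞` in dimension two, with a logarithmic
loss. -/
theorem exists_norm_heat_le_two :
    ∃ C : ℝ, 0 ≤ C ∧ ∀ (ψ : 𝓢(Sp 2, ℂ)) (j : ℕ), ∀ᵐ x,
      ‖heat (2⁻¹ ^ j) (schL2 ψ) x‖ ≤ C * √(j + 1) * ‖ofSchwartz ψ‖ := by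
  refine ⟨√Real.pi * √((2 : ℕ) + 1), by positivity, fun ψ j => ?_⟩
  have hs : (0 : ℝ) < 2⁻¹ ^ j := by positivity
  filter_upwards [heat_schwartz_ae_fourier _ ψ] with x hx
  rw [hx]
  refine (norm_fourierInv_integral_le _ x).trans ?_
  have h := integral_mul_fourier_le ψ (m := fun ξ => Real.exp (-(2⁻¹ ^ j) * ‖ξ‖ ^ 2)) (by fun_prop)
    (fun ξ => (Real.exp_pos _).le) (integrable_exp_div hs)
  calc _ = ∫ ξ, Real.exp (-(2⁻¹ ^ j) * ‖ξ‖ ^ 2) * ‖𝓕 ψ ξ‖ := by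
        congr 1; funext ξ
        rw [norm_mul, heatSym_apply hs, Complex.norm_real, Real.norm_of_nonneg (Real.exp_pos _).le,
          SchwartzMap.fourier_coe]
    _ ≤ _ := h
    _ ≤ √(Real.pi * (j + 1)) * (√((2 : ℕ) + 1) * ‖ofSchwartz ψ‖) := by
        gcongr
        exact integral_exp_div_le j
    _ = _ := by rw [Real.sqrt_mul Real.pi_pos.le]; ring

/-- The Gagliardo-Nirenberg-Sobolev inequality in the plane, without compact support. -/
theorem eLpNorm_two_le_eLpNorm_fderiv_one {g : Sp 2 → ℂ} (hg : ContDiff ℝ 1 g)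
    (hgi : Integrable g) :
    eLpNorm g 2 volume
      ≤ eLpNormLESNormFDerivOneConst (volume : Measure (Sp 2)) 2 * eLpNorm (fderiv ℝ g) 1 volume := by
  set C : ℝ≥0 := eLpNormLESNormFDerivOneConst (volume : Measure (Sp 2)) 2 with hC
  -- The inequality is available for compact support. The cut-offs χ(r_n x) with r_n → 0 add an
  -- error K r_n ‖g‖₁ to the gradient norm, which vanishes in the limit, and Fatou's lemma treats
  -- the left side.
  let χ : ContDiffBump (0 : Sp 2) := ⟨1, 2, one_pos, one_lt_two⟩
  have hχ1 : ContDiff ℝ 1 χ := χ.contDiff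
  obtain ⟨K, hK⟩ : ∃ K : ℝ, ∀ x, ‖fderiv ℝ χ x‖ ≤ K :=
    (χ.hasCompactSupport.fderiv (𝕜 := ℝ)).exists_bound_of_continuous (hχ1.continuous_fderiv one_ne_zero)
  have hK0 : 0 ≤ K := (norm_nonneg _).trans (hK 0)
  let r : ℕ → ℝ := fun n => ((n : ℝ) + 1)⁻¹
  have hr : ∀ n, 0 < r n := fun n => by positivity
  let χn : ℕ → Sp 2 → ℝ := fun n x => χ (r n • x)
  let G : ℕ → Sp 2 → ℂ := fun n x => χn n x • g x
  have hχn : ∀ n, ContDiff ℝ 1 (χn n) := fun n => hχ1.comp (contDiff_const_smul (r n))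
  have hχnd : ∀ n x, ‖fderiv ℝ (χn n) x‖ ≤ K * r n := by
    intro n x
    have h1 : HasFDerivAt (fun x : Sp 2 => r n • x) (r n • ContinuousLinearMap.id ℝ (Sp 2)) x :=
      (hasFDerivAt_id x).const_smul (r n)
    have h2 := ((hχ1.differentiable one_ne_zero (r n • x)).hasFDerivAt).comp x h1
    have h3 : fderiv ℝ (χn n) x = _ := h2.fderiv
    rw [h3]
    refine (ContinuousLinearMap.opNorm_comp_le _ _).trans ?_
    gcongr
    · exact hK _
    · rw [norm_smul, Real.norm_of_nonneg (hr n).le]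
      exact mul_le_of_le_one_right (hr n).le ContinuousLinearMap.norm_id_le
  have hGc : ∀ n, ContDiff ℝ 1 (G n) := fun n => (hχn n).smul hg
  have hGs : ∀ n, HasCompactSupport (G n) := by
    intro n
    have h1 : HasCompactSupport (χn n) :=
      χ.hasCompactSupport.comp_homeomorph (Homeomorph.smulOfNeZero (r n) (hr n).ne')
    exact h1.smul_right (f' := g)
  have hbound : ∀ n, eLpNorm (G n) 2 volume
      ≤ C * (eLpNorm (fderiv ℝ g) 1 volume + ENNReal.ofReal (K * r n) * eLpNorm g 1 volume) := by
    intro n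
    have hconj : NNReal.HolderConjugate (Module.finrank ℝ (Sp 2)) 2 := by
      have : ((Module.finrank ℝ (Sp 2) : ℕ) : ℝ≥0) = 2 := by simp
      rw [this, NNReal.holderConjugate_iff]
      refine ⟨one_lt_two, ?_⟩
      rw [← two_mul, mul_inv_cancel₀ two_ne_zero]
    have h1 := eLpNorm_le_eLpNorm_fderiv_one volume (hGc n) (hGs n) hconj
    rw [NNReal.coe_ofNat, ENNReal.coe_ofNat, ← hC] at h1
    refine h1.trans ?_
    gcongr
    simp only [eLpNorm_one_eq_lintegral_enorm]
    rw [← lintegral_const_mul' _ _ ENNReal.ofReal_ne_top,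
      ← lintegral_add_left (by
        have := hg.continuous_fderiv one_ne_zero
        fun_prop)]
    apply lintegral_mono
    intro x
    have h2 : fderiv ℝ (G n) x = χn n x • fderiv ℝ g x + (fderiv ℝ (χn n) x).smulRight (g x) :=
      fderiv_fun_smul ((hχn n).differentiable one_ne_zero x) (hg.differentiable one_ne_zero x)
    simp only
    rw [h2]
    refine (enorm_add_le (χn n x • fderiv ℝ g x) ((fderiv ℝ (χn n) x).smulRight (g x))).trans ?_
    gcongr
    · rw [enorm_smul]
      refine mul_le_of_le_one_left zero_le ?_
      rw [Real.enorm_of_nonneg χ.nonneg]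
      exact ENNReal.ofReal_le_one.2 χ.le_one
    · rw [← ofReal_norm, ← ofReal_norm, ← ENNReal.ofReal_mul (by
        have := hr n
        positivity)]
      apply ENNReal.ofReal_le_ofReal
      rw [ContinuousLinearMap.norm_smulRight_apply]
      gcongr
      exact hχnd n x
  have hlim : Tendsto (fun n => C * (eLpNorm (fderiv ℝ g) 1 volume
      + ENNReal.ofReal (K * r n) * eLpNorm g 1 volume)) atTop
      (𝓝 (C * (eLpNorm (fderiv ℝ g) 1 volume + ENNReal.ofReal (K * 0) * eLpNorm g 1 volume))) := by
    have hr0 : Tendsto r atTop (𝓝 0) := tendsto_inv_atTop_zero.comp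
      (tendsto_atTop_add_const_right _ _ tendsto_natCast_atTop_atTop)
    apply ENNReal.Tendsto.const_mul _ (Or.inr ENNReal.coe_ne_top)
    apply tendsto_const_nhds.add
    apply ENNReal.Tendsto.mul_const _ (Or.inr (memLp_one_iff_integrable.2 hgi).2.ne)
    exact ENNReal.tendsto_ofReal (hr0.const_mul K)
  have hae : ∀ x, Tendsto (fun n => G n x) atTop (𝓝 (g x)) := by
    intro x
    apply tendsto_const_nhds.congr'
    filter_upwards [eventually_ge_atTop ⌈‖x‖⌉₊] with n hn
    have : χn n x = 1 := by
      apply χ.one_of_mem_closedBall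
      rw [mem_closedBall_zero_iff, norm_smul, Real.norm_of_nonneg (hr n).le]
      change ((n : ℝ) + 1)⁻¹ * ‖x‖ ≤ 1
      rw [inv_mul_le_one₀ (by positivity)]
      have := (Nat.le_ceil ‖x‖).trans (Nat.cast_le.2 hn)
      linarith
    simp only [G, this, one_smul]
  have hfat := Lp.eLpNorm_lim_le_liminf_eLpNorm (p := 2) (μ := volume)
    (fun n => (hGc n).continuous.aestronglyMeasurable) g (Eventually.of_forall hae)
  refine hfat.trans ((liminf_le_liminf (Eventually.of_forall hbound)).trans ?_)
  rw [hlim.liminf_eq]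
  simp

theorem sq_norm_le_sum_sq_apply_ei {F : Type*} [NormedAddCommGroup F] [NormedSpace ℝ F]
    (L : Sp d →L[ℝ] F) : ‖L‖ ^ 2 ≤ ∑ j : Fin d, ‖L (ei j)‖ ^ 2 := by
  have h : ‖L‖ ≤ √(∑ j : Fin d, ‖L (ei j)‖ ^ 2) := by
    apply ContinuousLinearMap.opNorm_le_bound _ (by positivity)
    intro v
    have hv : v = ∑ j, v j • ei j := by
      ext i
      simp [Finset.sum_apply, Pi.single_apply]
    calc ‖L v‖ = ‖∑ j, v j • L (ei j)‖ := by
          conv_lhs => rw [hv, map_sum]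
          simp only [map_smul]
      _ ≤ ∑ j, ‖v j‖ * ‖L (ei j)‖ := by
          refine (norm_sum_le _ _).trans_eq ?_
          simp only [norm_smul]
      _ ≤ √(∑ j, ‖v j‖ ^ 2) * √(∑ j, ‖L (ei j)‖ ^ 2) :=
          Real.sum_mul_le_sqrt_mul_sqrt _ _ _
      _ = _ := by rw [EuclideanSpace.norm_eq, mul_comm]
  calc _ ≤ _ := pow_le_pow_left₀ (norm_nonneg _) h 2
    _ = _ := Real.sq_sqrt (by positivity)

theorem sq_norm_fderiv_le (ψ : 𝓢(Sp d, ℂ)) (x : Sp d) :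
    ‖fderiv ℝ ψ x‖ ^ 2 ≤ ∑ j : Fin d, ‖(∂_{ei j} ψ : 𝓢(Sp d, ℂ)) x‖ ^ 2 := by
  simpa only [SchwartzMap.lineDerivOp_apply_eq_fderiv] using
    sq_norm_le_sum_sq_apply_ei (fderiv ℝ ψ x)

theorem integral_sum_sq_lineDeriv (ψ : 𝓢(Sp d, ℂ)) :
    ∫ x, ∑ j : Fin d, ‖(∂_{ei j} ψ : 𝓢(Sp d, ℂ)) x‖ ^ 2 = ∑ j, ‖grad (ofSchwartz ψ) j‖ ^ 2 := by
  rw [integral_finsetSum _ fun j _ => integrable_norm_pow _ two_ne_zero]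
  simp only [grad_ofSchwartz, norm_sq_schL2]

theorem integrable_sq_norm_fderiv (ψ : 𝓢(Sp d, ℂ)) : Integrable fun x => ‖fderiv ℝ ψ x‖ ^ 2 := by
  have h := integrable_finsetSum Finset.univ fun (j : Fin d) _ =>
    integrable_norm_pow (∂_{ei j} ψ : 𝓢(Sp d, ℂ)) two_ne_zero
  refine h.mono' ?_ ?_
  · have := (ψ.smooth 1).continuous_fderiv one_ne_zero
    exact Continuous.aestronglyMeasurable (by fun_prop)
  · filter_upwards with x
    rw [Real.norm_of_nonneg (by positivity)]
    exact sq_norm_fderiv_le ψ x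

/-- The planar inequality ‖g‖₂ ≤ C‖∇g‖₁ for g = ψ^(m+1), followed by Cauchy–Schwarz on |ψ|^m |∇ψ|.
Induction on m then reaches every even power. -/
theorem integral_pow_succ_le_two :
    ∃ C : ℝ, 0 ≤ C ∧ ∀ (ψ : 𝓢(Sp 2, ℂ)) (m : ℕ), m ≠ 0 → ∫ x, ‖ψ x‖ ^ (2 * (m + 1))
      ≤ C * (m + 1) ^ 2 * ((∫ x, ‖ψ x‖ ^ (2 * m)) * ‖ofSchwartz ψ‖ ^ 2) := by
  set C : ℝ≥0 := eLpNormLESNormFDerivOneConst (volume : Measure (Sp 2)) 2 with hC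
  refine ⟨C ^ 2 * 2, by positivity, fun ψ m hm => ?_⟩
  set g : Sp 2 → ℂ := fun x => ψ x ^ (m + 1) with hgdef
  have hψ := ψ.smooth 1
  have hg : ContDiff ℝ 1 g := hψ.pow _
  have hgi : Integrable g := by
    rw [← integrable_norm_iff hg.continuous.aestronglyMeasurable]
    simp only [hgdef, norm_pow]
    exact integrable_norm_pow ψ (Nat.succ_ne_zero m)
  have hfd : ∀ x, ‖fderiv ℝ g x‖ = (m + 1) * (‖ψ x‖ ^ m * ‖fderiv ℝ ψ x‖) := by
    intro x
    have := (hψ.differentiable one_ne_zero x).hasFDerivAt.pow (m + 1)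
    rw [hgdef, HasFDerivAt.fderiv (f := fun x => ψ x ^ (m + 1)) this, norm_smul]
    simp only [Nat.add_sub_cancel, norm_mul, norm_pow, nsmul_eq_mul]
    rw [← mul_assoc]
    congr 2
    simpa using Complex.norm_natCast (m + 1)
  have hL2 : MemLp g 2 := by
    rw [memLp_two_iff_integrable_sq_norm hg.continuous.aestronglyMeasurable]
    simp only [hgdef, norm_pow, ← pow_mul]
    exact integrable_norm_pow ψ (by omega)
  have hm1 : MemLp (fun x => ‖ψ x‖ ^ m) 2 := by
    rw [memLp_two_iff_integrable_sq (by have := ψ.continuous; exact Continuous.aestronglyMeasurable (by fun_prop))]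
    simp only [← pow_mul]
    exact integrable_norm_pow ψ (by omega)
  have hm2 : MemLp (fun x => ‖fderiv ℝ ψ x‖) 2 := by
    rw [memLp_two_iff_integrable_sq (by
      have := hψ.continuous_fderiv one_ne_zero
      exact Continuous.aestronglyMeasurable (by fun_prop))]
    exact integrable_sq_norm_fderiv ψ
  have hcs := sq_integral_mul_le (fun x => by positivity) (fun x => norm_nonneg _) hm1 hm2
  have hfdi : Integrable (fderiv ℝ g) := by
    rw [← integrable_norm_iff (hg.continuous_fderiv one_ne_zero).aestronglyMeasurable]
    simp only [hfd]
    exact (hm1.integrable_mul hm2).const_mul _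
  have h1 := eLpNorm_two_le_eLpNorm_fderiv_one hg hgi
  have h2 : ‖hL2.toLp g‖ ≤ C * ∫ x, ‖fderiv ℝ g x‖ := by
    rw [Lp.norm_toLp]
    refine (ENNReal.toReal_mono (ENNReal.mul_ne_top ENNReal.coe_ne_top
      (memLp_one_iff_integrable.2 hfdi).2.ne) h1).trans_eq ?_
    rw [ENNReal.toReal_mul, ENNReal.coe_toReal, eLpNorm_one_eq_lintegral_enorm,
      integral_norm_eq_lintegral_enorm (hg.continuous_fderiv one_ne_zero).aestronglyMeasurable]
  have h3 : ∫ x, ‖ψ x‖ ^ (2 * (m + 1)) = ‖hL2.toLp g‖ ^ 2 := by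
    rw [norm_sq_eq_integral]
    apply integral_congr_ae
    filter_upwards [hL2.coeFn_toLp] with x hx
    rw [hx, hgdef, norm_pow, ← pow_mul, mul_comm]
  have h4 : ∫ x, ‖fderiv ℝ ψ x‖ ^ 2 ≤ 2 * ‖ofSchwartz ψ‖ ^ 2 := by
    calc _ ≤ ∫ x, ∑ j : Fin 2, ‖(∂_{ei j} ψ : 𝓢(Sp 2, ℂ)) x‖ ^ 2 :=
          integral_mono (integrable_sq_norm_fderiv ψ)
            (integrable_finsetSum _ fun j _ => integrable_norm_pow _ two_ne_zero)
            (sq_norm_fderiv_le ψ)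
      _ ≤ _ := by
          rw [integral_sum_sq_lineDeriv]
          exact_mod_cast sum_norm_sq_grad_le (ofSchwartz ψ)
  have h5 : 0 ≤ ∫ x, ‖ψ x‖ ^ (2 * m) := integral_nonneg fun x => by positivity
  rw [h3]
  calc _ ≤ (C * ∫ x, ‖fderiv ℝ g x‖) ^ 2 := by gcongr
    _ = C ^ 2 * (m + 1) ^ 2 * (∫ x, ‖ψ x‖ ^ m * ‖fderiv ℝ ψ x‖) ^ 2 := by
        simp only [hfd]
        rw [integral_const_mul]; ring
    _ ≤ C ^ 2 * (m + 1) ^ 2 * ((∫ x, ‖ψ x‖ ^ (2 * m)) * (2 * ‖ofSchwartz ψ‖ ^ 2)) := by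
        gcongr
        refine hcs.trans ?_
        simp only [← pow_mul, mul_comm m 2]
        gcongr
    _ = _ := by ring

/-- The Gagliardo-Nirenberg inequality for Schwartz functions. -/
theorem exists_integral_pow_le_schwartz (hd : d = 1 ∨ d = 2) (k : ℕ) :
    ∃ C : ℝ, 0 ≤ C ∧ ∀ ψ : 𝓢(Sp d, ℂ),
      ∫ x, ‖ψ x‖ ^ (2 * k + 2) ≤ C * ‖schL2 ψ‖ ^ 2 * ‖ofSchwartz ψ‖ ^ (2 * k) := by
  rcases hd with rfl | rfl
  · obtain ⟨C, hC, h⟩ := exists_norm_le_one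
    refine ⟨C ^ (2 * k), by positivity, fun ψ => ?_⟩
    calc ∫ x, ‖ψ x‖ ^ (2 * k + 2) ≤ ∫ x, (C * ‖ofSchwartz ψ‖) ^ (2 * k) * ‖ψ x‖ ^ 2 := by
          apply integral_mono (integrable_norm_pow ψ (by omega))
            ((integrable_norm_pow ψ two_ne_zero).const_mul _)
          intro x
          simp only
          rw [pow_add]
          gcongr
          exact h ψ x
      _ = _ := by
          rw [integral_const_mul, ← norm_sq_schL2]; ring
  · obtain ⟨C, hC, h⟩ := integral_pow_succ_le_two
    induction k with
    | zero =>
      refine ⟨1, zero_le_one, fun ψ => ?_⟩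
      simp [norm_sq_schL2]
    | succ k ih =>
      obtain ⟨D, hD, hk⟩ := ih
      refine ⟨C * ((k + 1 : ℕ) + 1) ^ 2 * D, by positivity, fun ψ => ?_⟩
      refine (h ψ (k + 1) (Nat.succ_ne_zero k)).trans ?_
      calc _ ≤ C * ((k + 1 : ℕ) + 1) ^ 2 *
            ((D * ‖schL2 ψ‖ ^ 2 * ‖ofSchwartz ψ‖ ^ (2 * k)) * ‖ofSchwartz ψ‖ ^ 2) := by
            gcongr
            exact hk ψ
        _ = _ := by ring

theorem exists_seq_schwartz (u : H1 d) :
    ∃ ψ : ℕ → 𝓢(Sp d, ℂ), Tendsto (fun n => ofSchwartz (ψ n)) atTop (𝓝 u) ∧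
      ∀ᵐ x, Tendsto (fun n => ψ n x) atTop (𝓝 (toL2 u x)) := by
  obtain ⟨f, hf, hlim⟩ := mem_closure_iff_seq_limit.1 (denseRange_ofSchwartz u)
  choose ψ hψ using hf
  have h1 : Tendsto (fun n => schL2 (ψ n)) atTop (𝓝 (toL2 u)) := by
    have := (toL2L.continuous.tendsto u).comp hlim
    refine this.congr fun n => ?_
    rw [Function.comp_apply, ← hψ]
    rfl
  obtain ⟨ns, hmono, hns⟩ := (tendstoInMeasure_of_tendsto_Lp h1).exists_seq_tendsto_ae
  refine ⟨fun n => ψ (ns n), ?_, ?_⟩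
  · simp only [hψ]
    exact hlim.comp hmono.tendsto_atTop
  · filter_upwards [hns, ae_all_iff.2 fun n => schL2_ae (ψ n)] with x hx h2
    simpa only [h2] using hx

/-- The Gagliardo-Nirenberg inequality. -/
theorem exists_integral_pow_le (hd : d = 1 ∨ d = 2) (k : ℕ) :
    ∃ C : ℝ, 0 ≤ C ∧ ∀ u : H1 d, Integrable (fun x => ‖toL2 u x‖ ^ (2 * k + 2)) ∧
      ∫ x, ‖toL2 u x‖ ^ (2 * k + 2) ≤ C * ‖toL2 u‖ ^ 2 * ‖u‖ ^ (2 * k) := by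
  obtain ⟨C, hC, h⟩ := exists_integral_pow_le_schwartz hd k
  refine ⟨C, hC, fun u => ?_⟩
  obtain ⟨ψ, hψ, hae⟩ := exists_seq_schwartz u
  have hmeas : AEStronglyMeasurable (fun x => ‖toL2 u x‖ ^ (2 * k + 2)) volume :=
    ((Lp.aestronglyMeasurable (toL2 u)).norm.pow _)
  have hpos : ∀ x, 0 ≤ ‖toL2 u x‖ ^ (2 * k + 2) := fun x => by positivity
  have hlim : Tendsto (fun n => ENNReal.ofReal
      (C * ‖toL2 (ofSchwartz (ψ n))‖ ^ 2 * ‖ofSchwartz (ψ n)‖ ^ (2 * k))) atTop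
      (𝓝 (ENNReal.ofReal (C * ‖toL2 u‖ ^ 2 * ‖u‖ ^ (2 * k)))) := by
    apply ENNReal.tendsto_ofReal
    have h2 := ((toL2L.continuous.tendsto u).comp hψ).norm
    exact ((h2.pow 2).const_mul C).mul (hψ.norm.pow _)
  -- Fatou along Schwartz approximations converging both in H¹ and almost everywhere. It yields
  -- integrability and the bound together.
  have hfat : ∫⁻ x, ENNReal.ofReal (‖toL2 u x‖ ^ (2 * k + 2))
      ≤ ENNReal.ofReal (C * ‖toL2 u‖ ^ 2 * ‖u‖ ^ (2 * k)) := by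
    calc _ = ∫⁻ x, liminf (fun n => ENNReal.ofReal (‖ψ n x‖ ^ (2 * k + 2))) atTop := by
          apply lintegral_congr_ae
          filter_upwards [hae] with x hx
          exact (ENNReal.tendsto_ofReal (hx.norm.pow _)).liminf_eq.symm
      _ ≤ liminf (fun n => ∫⁻ x, ENNReal.ofReal (‖ψ n x‖ ^ (2 * k + 2))) atTop := by
          apply lintegral_liminf_le
          intro n
          have := (ψ n).continuous
          exact (ENNReal.continuous_ofReal.comp (by fun_prop)).measurable
      _ ≤ liminf (fun n => ENNReal.ofReal
            (C * ‖toL2 (ofSchwartz (ψ n))‖ ^ 2 * ‖ofSchwartz (ψ n)‖ ^ (2 * k))) atTop := by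
          apply liminf_le_liminf (Eventually.of_forall fun n => ?_)
          rw [← ofReal_integral_eq_lintegral_ofReal (integrable_norm_pow _ (by omega))
            (Eventually.of_forall fun x => by positivity)]
          exact ENNReal.ofReal_le_ofReal (h (ψ n))
      _ = _ := hlim.liminf_eq
  have hint : Integrable (fun x => ‖toL2 u x‖ ^ (2 * k + 2)) := by
    refine ⟨hmeas, ?_⟩
    rw [hasFiniteIntegral_iff_ofReal (Eventually.of_forall hpos)]
    exact hfat.trans_lt ENNReal.ofReal_lt_top
  refine ⟨hint, ?_⟩
  rw [← ofReal_integral_eq_lintegral_ofReal hint (Eventually.of_forall hpos)] at hfat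
  exact (ENNReal.ofReal_le_ofReal_iff (by positivity)).1 hfat

/-! ### The nonlinearity -/

/-- For d = 1, 2 the natural-number quotient 4/d is exact, equal to 4 or 2. All exponents are
natural numbers from here on. -/
theorem rpow_four_div (hd : d = 1 ∨ d = 2) (x : ℝ) : x ^ (4 / (d : ℝ)) = x ^ (4 / d) := by
  rcases hd with rfl | rfl
  · rw [← Real.rpow_natCast]; norm_num
  · rw [← Real.rpow_natCast]; norm_num

theorem nonlin_eq (hd : d = 1 ∨ d = 2) (z : ℂ) :
    nonlin d z = ((‖z‖ ^ (4 / d) : ℝ) : ℂ) * z := by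
  rw [nonlin, rpow_four_div hd]

theorem norm_nonlin (hd : d = 1 ∨ d = 2) (z : ℂ) : ‖nonlin d z‖ = ‖z‖ ^ (4 / d + 1) := by
  rw [nonlin_eq hd, norm_mul, Complex.norm_real, norm_pow, norm_norm, pow_succ]

theorem continuous_nonlin (hd : d = 1 ∨ d = 2) : Continuous (nonlin d) := by
  rw [show nonlin d = fun z => ((‖z‖ ^ (4 / d) : ℝ) : ℂ) * z from funext (nonlin_eq hd)]
  fun_prop

/-- With e = 4/d the difference is |a|^e(a-b) + (|a|^e-|b|^e)b. The second term carries a factor e ≤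
4, whence 5 = 1 + 4. -/
theorem norm_nonlin_sub_le (hd : d = 1 ∨ d = 2) (a b : ℂ) :
    ‖nonlin d a - nonlin d b‖ ≤ 5 * ((‖a‖ + ‖b‖) ^ (4 / d) * ‖a - b‖) := by
  rw [nonlin_eq hd, nonlin_eq hd]
  set e := 4 / d with he
  obtain ⟨k, hk, hk4⟩ : ∃ k, e = k + 1 ∧ k + 1 ≤ 4 := by
    rcases hd with rfl | rfl
    · exact ⟨3, by rw [he], by norm_num⟩
    · exact ⟨1, by rw [he], by norm_num⟩
  have h1 : ((‖a‖ ^ e : ℝ) : ℂ) * a - ((‖b‖ ^ e : ℝ) : ℂ) * b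
      = ((‖a‖ ^ e : ℝ) : ℂ) * (a - b) + ((‖a‖ ^ e - ‖b‖ ^ e : ℝ) : ℂ) * b := by
    push_cast; ring
  have ha := norm_nonneg a
  have hb := norm_nonneg b
  have h2 := abs_pow_sub_pow_le ‖a‖ ‖b‖ e
  have h3 : max |‖a‖| |‖b‖| ≤ ‖a‖ + ‖b‖ := by
    rw [abs_of_nonneg ha, abs_of_nonneg hb]
    exact max_le (by linarith) (by linarith)
  have h4 : |‖a‖ ^ e - ‖b‖ ^ e| ≤ ‖a - b‖ * 4 * (‖a‖ + ‖b‖) ^ k := by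
    refine h2.trans ?_
    rw [hk, Nat.add_sub_cancel]
    gcongr
    · exact abs_norm_sub_norm_le a b
    · exact_mod_cast hk4
  rw [h1]
  calc _ ≤ ‖a‖ ^ e * ‖a - b‖ + |‖a‖ ^ e - ‖b‖ ^ e| * ‖b‖ := by
        refine (norm_add_le _ _).trans_eq ?_
        rw [norm_mul, norm_mul, Complex.norm_real, Complex.norm_real, norm_pow, norm_norm,
          Real.norm_eq_abs]
    _ ≤ (‖a‖ + ‖b‖) ^ e * ‖a - b‖ + (‖a - b‖ * 4 * (‖a‖ + ‖b‖) ^ k) * (‖a‖ + ‖b‖) := by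
        gcongr
        · linarith
        · linarith
    _ = _ := by rw [hk]; ring

theorem norm_sq_add (a δ : ℂ) :
    ‖a + δ‖ ^ 2 = ‖a‖ ^ 2 + (2 * (starRingEnd ℂ a * δ).re + ‖δ‖ ^ 2) := by
  rw [Complex.sq_norm, Complex.sq_norm, Complex.sq_norm, Complex.normSq_add]
  simp only [Complex.mul_re, Complex.conj_re, Complex.conj_im]
  ring

theorem abs_two_mul_re_add_le (a δ : ℂ) :
    |2 * (starRingEnd ℂ a * δ).re + ‖δ‖ ^ 2| ≤ 2 * ‖δ‖ * (‖a‖ + ‖δ‖) := by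
  have h := Complex.abs_re_le_norm (starRingEnd ℂ a * δ)
  rw [norm_mul, RCLike.norm_conj] at h
  have := abs_le.1 h
  have h2 := norm_nonneg δ
  rw [abs_le]
  constructor <;> nlinarith [norm_nonneg a]

/-- Second order Taylor expansion of the nonlinearity. -/
theorem exists_norm_nonlin_taylor_le (hd : d = 1 ∨ d = 2) (a : ℂ) :
    ∃ L : ℂ →L[ℝ] ℂ, ∀ δ : ℂ, ‖nonlin d (a + δ) - nonlin d a - L δ‖
      ≤ 14 * (‖δ‖ ^ 2 * (‖a‖ + ‖δ‖) ^ (4 / d - 1)) := by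
  let T : ℂ →L[ℝ] ℝ := 2 • (Complex.reCLM ∘L (ContinuousLinearMap.mul ℝ ℂ (starRingEnd ℂ a)))
  have hT : ∀ δ, T δ = 2 * (starRingEnd ℂ a * δ).re := fun δ => by simp [T]; ring
  have hA := norm_nonneg a
  rcases hd with rfl | rfl
  · refine ⟨(‖a‖ ^ 4) • ContinuousLinearMap.id ℝ ℂ + (2 * ‖a‖ ^ 2) • (T.smulRight a), fun δ => ?_⟩
    rw [nonlin_eq (Or.inl rfl), nonlin_eq (Or.inl rfl)]
    have hr := abs_two_mul_re_add_le a δ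
    have hN := norm_sq_add a δ
    have hD := norm_nonneg δ
    set r := 2 * (starRingEnd ℂ a * δ).re + ‖δ‖ ^ 2 with hrd
    have hTr : T δ = r - ‖δ‖ ^ 2 := by rw [hT, hrd]; ring
    have e1 : ‖a + δ‖ ^ (4 / 1) = (‖a‖ ^ 2 + r) ^ 2 := by rw [← hN]; ring
    have e2 : ‖a‖ ^ (4 / 1) = ‖a‖ ^ 4 := by norm_num
    rw [e1, e2]
    have key : ((((‖a‖ ^ 2 + r) ^ 2 : ℝ) : ℂ) * (a + δ) - ((‖a‖ ^ 4 : ℝ) : ℂ) * a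
        - ((‖a‖ ^ 4) • ContinuousLinearMap.id ℝ ℂ + (2 * ‖a‖ ^ 2) • (T.smulRight a)) δ)
        = ((2 * ‖a‖ ^ 2 * r + r ^ 2 : ℝ) : ℂ) * δ
          + ((2 * ‖a‖ ^ 2 * ‖δ‖ ^ 2 + r ^ 2 : ℝ) : ℂ) * a := by
      simp only [add_apply, smul_apply,
        ContinuousLinearMap.id_apply, ContinuousLinearMap.smulRight_apply, hTr, Complex.real_smul]
      push_cast
      ring
    rw [key]
    set S := ‖a‖ + ‖δ‖ with hS
    have hS0 : 0 ≤ S := by positivity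
    have hAS : ‖a‖ ≤ S := by linarith
    have hDS : ‖δ‖ ≤ S := by linarith
    have hr2 : r ^ 2 ≤ (2 * ‖δ‖ * S) ^ 2 := sq_le_sq' (by linarith [(abs_le.1 hr).1]) (abs_le.1 hr).2
    calc _ ≤ (2 * ‖a‖ ^ 2 * |r| + r ^ 2) * ‖δ‖ + (2 * ‖a‖ ^ 2 * ‖δ‖ ^ 2 + r ^ 2) * ‖a‖ := by
          refine (norm_add_le _ _).trans ?_
          rw [norm_mul, norm_mul, Complex.norm_real, Complex.norm_real, Real.norm_eq_abs,
            Real.norm_eq_abs]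
          gcongr
          · refine (abs_add_le _ _).trans_eq ?_
            rw [abs_mul, abs_of_nonneg (sq_nonneg r), abs_of_nonneg (by positivity : 0 ≤ 2 * ‖a‖ ^ 2)]
          · rw [abs_of_nonneg (by positivity)]
      _ ≤ (2 * S ^ 2 * (2 * ‖δ‖ * S) + 2 * ‖δ‖ * S * (2 * S * S)) * ‖δ‖
          + (2 * S ^ 2 * ‖δ‖ ^ 2 + (2 * ‖δ‖ * S) ^ 2) * S := by
          gcongr
          calc r ^ 2 ≤ 2 * ‖δ‖ * S * (2 * ‖δ‖ * S) := by rw [← sq]; exact hr2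
            _ ≤ _ := by gcongr
      _ = _ := by norm_num; ring
  · refine ⟨(‖a‖ ^ 2) • ContinuousLinearMap.id ℝ ℂ + T.smulRight a, fun δ => ?_⟩
    rw [nonlin_eq (Or.inr rfl), nonlin_eq (Or.inr rfl)]
    have hr := abs_two_mul_re_add_le a δ
    have hN := norm_sq_add a δ
    have hD := norm_nonneg δ
    set r := 2 * (starRingEnd ℂ a * δ).re + ‖δ‖ ^ 2 with hrd
    have hTr : T δ = r - ‖δ‖ ^ 2 := by rw [hT, hrd]; ring
    have e1 : ‖a + δ‖ ^ (4 / 2) = ‖a‖ ^ 2 + r := by rw [← hN]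
    have e2 : ‖a‖ ^ (4 / 2) = ‖a‖ ^ 2 := by norm_num
    rw [e1, e2]
    have key : (((‖a‖ ^ 2 + r : ℝ) : ℂ) * (a + δ) - ((‖a‖ ^ 2 : ℝ) : ℂ) * a
        - ((‖a‖ ^ 2) • ContinuousLinearMap.id ℝ ℂ + T.smulRight a) δ)
        = (r : ℂ) * δ + ((‖δ‖ ^ 2 : ℝ) : ℂ) * a := by
      simp only [add_apply, smul_apply,
        ContinuousLinearMap.id_apply, ContinuousLinearMap.smulRight_apply, hTr, Complex.real_smul]
      push_cast
      ring
    rw [key]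
    calc _ ≤ |r| * ‖δ‖ + ‖δ‖ ^ 2 * ‖a‖ := by
          refine (norm_add_le _ _).trans_eq ?_
          rw [norm_mul, norm_mul, Complex.norm_real, Complex.norm_real, Real.norm_eq_abs,
            Real.norm_of_nonneg (by positivity)]
      _ ≤ 2 * ‖δ‖ * (‖a‖ + ‖δ‖) * ‖δ‖ + ‖δ‖ ^ 2 * (‖a‖ + ‖δ‖) := by
          gcongr
          linarith
      _ = 3 * (‖δ‖ ^ 2 * (‖a‖ + ‖δ‖) ^ 1) := by ring
      _ ≤ 14 * (‖δ‖ ^ 2 * (‖a‖ + ‖δ‖) ^ 1) := by gcongr; norm_num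
      _ = _ := by norm_num

/-- Second order Taylor expansion of the potential. -/
theorem abs_potential_taylor_le (hd : d = 1 ∨ d = 2) (a b : ℂ) :
    |‖b‖ ^ (4 / d + 2) - ‖a‖ ^ (4 / d + 2)
      - ((4 / d : ℕ) + 2) * (starRingEnd ℂ (nonlin d a) * (b - a)).re|
      ≤ 23 * (‖b - a‖ ^ 2 * (‖a‖ + ‖b - a‖) ^ (4 / d)) := by
  obtain ⟨δ, rfl⟩ : ∃ δ, b = a + δ := ⟨b - a, by ring⟩
  rw [add_sub_cancel_left, nonlin_eq hd]
  have hr := abs_two_mul_re_add_le a δ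
  have hN := norm_sq_add a δ
  have hD := norm_nonneg δ
  have hA := norm_nonneg a
  have hre : ∀ c : ℝ, (starRingEnd ℂ ((c : ℂ) * a) * δ).re = c * (starRingEnd ℂ a * δ).re := by
    intro c
    rw [map_mul, Complex.conj_ofReal, mul_assoc, Complex.re_ofReal_mul]
  rw [hre]
  set q := (starRingEnd ℂ a * δ).re with hq
  set r := 2 * q + ‖δ‖ ^ 2 with hrd
  set S := ‖a‖ + ‖δ‖ with hS
  have hS0 : 0 ≤ S := by positivity
  have hAS : ‖a‖ ≤ S := by linarith
  have hDS : ‖δ‖ ≤ S := by linarith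
  have hr2 : r ^ 2 ≤ (2 * ‖δ‖ * S) ^ 2 := sq_le_sq' (by linarith [(abs_le.1 hr).1]) (abs_le.1 hr).2
  have hqr : 2 * q = r - ‖δ‖ ^ 2 := by rw [hrd]; ring
  -- The case d = 1 gives 12 + 8 + 3 = 23, the case d = 2 only 4 + 2 = 6.
  rcases hd with rfl | rfl
  · have e1 : ‖a + δ‖ ^ (4 / 1 + 2) = (‖a‖ ^ 2 + r) ^ 3 := by rw [← hN]; ring
    have key : ‖a + δ‖ ^ (4 / 1 + 2) - ‖a‖ ^ (4 / 1 + 2) - ((4 / 1 : ℕ) + 2) * (‖a‖ ^ (4 / 1) * q)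
        = 3 * ‖a‖ ^ 2 * r ^ 2 + r ^ 2 * r + 3 * ‖a‖ ^ 4 * ‖δ‖ ^ 2 := by
      rw [e1]
      norm_num
      linear_combination (-3 * ‖a‖ ^ 4) * hqr
    rw [key]
    calc _ ≤ 3 * ‖a‖ ^ 2 * r ^ 2 + r ^ 2 * |r| + 3 * ‖a‖ ^ 4 * ‖δ‖ ^ 2 := by
          refine (abs_add_le _ _).trans ?_
          gcongr
          · refine (abs_add_le _ _).trans_eq ?_
            rw [abs_mul (r ^ 2), abs_of_nonneg (sq_nonneg r),
              abs_of_nonneg (by positivity : 0 ≤ 3 * ‖a‖ ^ 2 * r ^ 2)]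
          · rw [abs_of_nonneg (by positivity)]
      _ ≤ 3 * S ^ 2 * (2 * ‖δ‖ * S) ^ 2 + (2 * ‖δ‖ * S) ^ 2 * (2 * S * S) + 3 * S ^ 4 * ‖δ‖ ^ 2 := by
          gcongr
          exact hr.trans (by gcongr)
      _ = _ := by norm_num; ring
  · have e1 : ‖a + δ‖ ^ (4 / 2 + 2) = (‖a‖ ^ 2 + r) ^ 2 := by rw [← hN]; ring
    have key : ‖a + δ‖ ^ (4 / 2 + 2) - ‖a‖ ^ (4 / 2 + 2) - ((4 / 2 : ℕ) + 2) * (‖a‖ ^ (4 / 2) * q)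
        = r ^ 2 + 2 * ‖a‖ ^ 2 * ‖δ‖ ^ 2 := by
      rw [e1]
      norm_num
      linear_combination (-2 * ‖a‖ ^ 2) * hqr
    rw [key, abs_of_nonneg (by positivity)]
    calc _ ≤ (2 * ‖δ‖ * S) ^ 2 + 2 * S ^ 2 * ‖δ‖ ^ 2 := by gcongr
      _ = 6 * (‖δ‖ ^ 2 * S ^ 2) := by ring
      _ ≤ 23 * (‖δ‖ ^ 2 * S ^ 2) := by gcongr; norm_num
      _ = _ := by norm_num

theorem exists_integral_add_pow_le (hd : d = 1 ∨ d = 2) (k : ℕ) :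
    ∃ C : ℝ, 0 ≤ C ∧ ∀ u v : H1 d, Integrable (fun x => (‖toL2 u x‖ + ‖toL2 v x‖) ^ (2 * k + 2)) ∧
      ∫ x, (‖toL2 u x‖ + ‖toL2 v x‖) ^ (2 * k + 2) ≤ C * (‖u‖ + ‖v‖) ^ (2 * k + 2) := by
  obtain ⟨C, hC, h⟩ := exists_integral_pow_le hd k
  refine ⟨2 ^ (2 * k + 1) * (C + C), by positivity, fun u v => ?_⟩
  obtain ⟨hu1, hu2⟩ := h u
  obtain ⟨hv1, hv2⟩ := h v
  have hle : ∀ x, (‖toL2 u x‖ + ‖toL2 v x‖) ^ (2 * k + 2)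
      ≤ 2 ^ (2 * k + 1) * (‖toL2 u x‖ ^ (2 * k + 2) + ‖toL2 v x‖ ^ (2 * k + 2)) := fun x =>
    add_pow_le (norm_nonneg _) (norm_nonneg _) _
  have hint := (hu1.add hv1).const_mul (2 ^ (2 * k + 1))
  have hint2 : Integrable (fun x => (‖toL2 u x‖ + ‖toL2 v x‖) ^ (2 * k + 2)) := by
    refine hint.mono' (((Lp.aestronglyMeasurable (toL2 u)).norm.add
      (Lp.aestronglyMeasurable (toL2 v)).norm).pow _) ?_
    filter_upwards with x
    rw [Real.norm_of_nonneg (by positivity)]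
    exact hle x
  refine ⟨hint2, ?_⟩
  have hb : ∀ w : H1 d, ‖w‖ ≤ ‖u‖ + ‖v‖ →
      C * ‖toL2 w‖ ^ 2 * ‖w‖ ^ (2 * k) ≤ C * (‖u‖ + ‖v‖) ^ (2 * k + 2) := by
    intro w hw
    calc _ ≤ C * (‖u‖ + ‖v‖) ^ 2 * (‖u‖ + ‖v‖) ^ (2 * k) := by
          gcongr
          exact (norm_toL2_le w).trans hw
      _ = _ := by ring
  calc _ ≤ ∫ x, 2 ^ (2 * k + 1) * (‖toL2 u x‖ ^ (2 * k + 2) + ‖toL2 v x‖ ^ (2 * k + 2)) :=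
        integral_mono hint2 hint hle
    _ = 2 ^ (2 * k + 1) * ((∫ x, ‖toL2 u x‖ ^ (2 * k + 2)) + ∫ x, ‖toL2 v x‖ ^ (2 * k + 2)) := by
        rw [integral_const_mul, integral_add hu1 hv1]
    _ ≤ 2 ^ (2 * k + 1) * (C * (‖u‖ + ‖v‖) ^ (2 * k + 2) + C * (‖u‖ + ‖v‖) ^ (2 * k + 2)) := by
        gcongr
        · exact hu2.trans (hb u (by linarith [norm_nonneg v]))
        · exact hv2.trans (hb v (by linarith [norm_nonneg u]))
    _ = _ := by ring

theorem memLp_nonlin (hd : d = 1 ∨ d = 2) (u : H1 d) : MemLp (fun x => nonlin d (toL2 u x)) 2 := by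
  rw [memLp_two_iff_integrable_sq_norm
    ((continuous_nonlin hd).comp_aestronglyMeasurable (Lp.aestronglyMeasurable _))]
  obtain ⟨_, _, h⟩ := exists_integral_pow_le hd (4 / d)
  refine (h u).1.congr ?_
  filter_upwards with x
  rw [norm_nonlin hd, ← pow_mul]
  congr 1
  ring

/-- The nonlinearity as a map from `H¹` to `L²`. -/
def nl (hd : d = 1 ∨ d = 2) (u : H1 d) : L2 d := (memLp_nonlin hd u).toLp

theorem nl_ae (hd : d = 1 ∨ d = 2) (u : H1 d) : nl hd u =ᵐ[volume] fun x => nonlin d (toL2 u x) :=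
  (memLp_nonlin hd u).coeFn_toLp

/-- One factor |u-v| is kept and the other is bounded by |u|+|v|, then Cauchy–Schwarz. The modulus
of continuity is only a square root, but u-v enters through its L² norm alone, which is what
`tendsto_nl` relies on. -/
theorem exists_norm_nl_sub_le (hd : d = 1 ∨ d = 2) :
    ∃ C : ℝ, 0 ≤ C ∧ ∀ u v : H1 d,
      ‖nl hd u - nl hd v‖ ^ 2 ≤ C * (‖u‖ + ‖v‖) ^ (2 * (4 / d) + 1) * ‖toL2 u - toL2 v‖ := by
  obtain ⟨C, hC, h⟩ := exists_integral_add_pow_le hd (2 * (4 / d))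
  set e := 4 / d with he
  refine ⟨25 * √C, by positivity, fun u v => ?_⟩
  obtain ⟨hi, hle⟩ := h u v
  set U : Sp d → ℝ := fun x => (‖toL2 u x‖ + ‖toL2 v x‖) ^ (2 * e + 1) with hU
  set V : Sp d → ℝ := fun x => ‖(toL2 u - toL2 v) x‖ with hV
  have hU2 : MemLp U 2 := by
    have hUm : AEStronglyMeasurable U volume := ((Lp.aestronglyMeasurable (toL2 u)).norm.add
      (Lp.aestronglyMeasurable (toL2 v)).norm).pow _
    rw [memLp_two_iff_integrable_sq hUm]
    refine hi.congr ?_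
    filter_upwards with x
    rw [hU, ← pow_mul]
    congr 1
    ring
  have hV2 : MemLp V 2 := (Lp.memLp (toL2 u - toL2 v)).norm
  have hcs := sq_integral_mul_le (μ := volume) (fun x => by positivity) (fun x => norm_nonneg _) hU2 hV2
  rw [← norm_sq_eq_integral] at hcs
  have hUU : ∫ x, U x ^ 2 ≤ C * (‖u‖ + ‖v‖) ^ (2 * (2 * e) + 2) := by
    refine le_trans (le_of_eq ?_) hle
    congr 1
    funext x
    rw [hU, ← pow_mul]
    congr 1
    ring
  have h1 : ∫ x, U x * V x ≤ √C * (‖u‖ + ‖v‖) ^ (2 * e + 1) * ‖toL2 u - toL2 v‖ := by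
    apply le_of_sq_le_sq _ (by positivity)
    refine hcs.trans ?_
    rw [mul_pow, mul_pow, Real.sq_sqrt hC]
    gcongr
    refine hUU.trans_eq ?_
    ring
  calc _ = ∫ x, ‖(nl hd u - nl hd v) x‖ ^ 2 := norm_sq_eq_integral _
    _ ≤ ∫ x, 25 * (U x * V x) := by
        apply integral_mono_ae (integrable_norm_sq _) ((hU2.integrable_mul hV2).const_mul _)
        filter_upwards [nl_ae hd u, nl_ae hd v, Lp.coeFn_sub (nl hd u) (nl hd v),
          Lp.coeFn_sub (toL2 u) (toL2 v)] with x h1 h2 h3 h4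
        simp only [hU, hV, Pi.mul_apply]
        rw [h3, h4, Pi.sub_apply, Pi.sub_apply, h1, h2]
        have h5 := norm_nonlin_sub_le hd (toL2 u x) (toL2 v x)
        have h6 := norm_sub_le (toL2 u x) (toL2 v x)
        rw [← he] at h5
        calc _ ≤ (5 * ((‖toL2 u x‖ + ‖toL2 v x‖) ^ e * ‖toL2 u x - toL2 v x‖)) ^ 2 := by gcongr
          _ = 25 * ((‖toL2 u x‖ + ‖toL2 v x‖) ^ (2 * e) * ‖toL2 u x - toL2 v x‖
              * ‖toL2 u x - toL2 v x‖) := by ring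
          _ ≤ 25 * ((‖toL2 u x‖ + ‖toL2 v x‖) ^ (2 * e) * (‖toL2 u x‖ + ‖toL2 v x‖)
              * ‖toL2 u x - toL2 v x‖) := by gcongr
          _ = _ := by ring
    _ ≤ _ := by
        rw [integral_const_mul]
        calc _ ≤ 25 * (√C * (‖u‖ + ‖v‖) ^ (2 * e + 1) * ‖toL2 u - toL2 v‖) := by gcongr
          _ = _ := by ring

theorem exists_norm_nl_le (hd : d = 1 ∨ d = 2) :
    ∃ C : ℝ, 0 ≤ C ∧ ∀ u : H1 d, ‖nl hd u‖ ≤ C * ‖u‖ ^ (4 / d + 1) := by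
  obtain ⟨C, hC, h⟩ := exists_integral_pow_le hd (4 / d)
  refine ⟨√C, by positivity, fun u => ?_⟩
  apply le_of_sq_le_sq _ (by positivity)
  rw [mul_pow, Real.sq_sqrt hC, norm_sq_eq_integral]
  calc _ = ∫ x, ‖toL2 u x‖ ^ (2 * (4 / d) + 2) := by
        apply integral_congr_ae
        filter_upwards [nl_ae hd u] with x hx
        rw [hx, norm_nonlin hd]
        ring
    _ ≤ C * ‖toL2 u‖ ^ 2 * ‖u‖ ^ (2 * (4 / d)) := (h u).2
    _ ≤ C * ‖u‖ ^ 2 * ‖u‖ ^ (2 * (4 / d)) := by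
        gcongr
        exact norm_toL2_le u
    _ = _ := by ring

/-- Continuity of the nonlinearity on bounded sets of `H¹`, for the topology of `L²`. -/
theorem tendsto_nl {ι : Type*} {l : Filter ι} (hd : d = 1 ∨ d = 2) {u : ι → H1 d} {v : H1 d} {M : ℝ}
    (hM : ∀ i, ‖u i‖ ≤ M) (h : Tendsto (fun i => toL2 (u i)) l (𝓝 (toL2 v))) :
    Tendsto (fun i => nl hd (u i)) l (𝓝 (nl hd v)) := by
  obtain ⟨C, hC, hle⟩ := exists_norm_nl_sub_le hd
  rw [tendsto_iff_norm_sub_tendsto_zero] at h ⊢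
  have h1 : Tendsto (fun i => C * (M + ‖v‖) ^ (2 * (4 / d) + 1) * ‖toL2 (u i) - toL2 v‖) l (𝓝 0) := by
    simpa using h.const_mul (C * (M + ‖v‖) ^ (2 * (4 / d) + 1))
  have h2 : Tendsto (fun i => ‖nl hd (u i) - nl hd v‖ ^ 2) l (𝓝 0) := by
    refine squeeze_zero (fun i => by positivity) (fun i => ?_) h1
    refine (hle (u i) v).trans ?_
    gcongr
    exact hM i
  have h3 := (Real.continuous_sqrt.tendsto 0).comp h2
  rw [Real.sqrt_zero] at h3
  refine h3.congr fun i => ?_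
  simp [Real.sqrt_sq (norm_nonneg _)]

theorem continuous_nl (hd : d = 1 ∨ d = 2) : Continuous (nl (d := d) hd) := by
  rw [continuous_iff_continuousAt]
  intro v
  obtain ⟨C, hC, hle⟩ := exists_norm_nl_sub_le hd
  have hc : Continuous fun u : H1 d =>
      √(C * (‖u‖ + ‖v‖) ^ (2 * (4 / d) + 1) * ‖toL2L u - toL2L v‖) := by fun_prop
  have h0 := hc.tendsto v
  simp only [sub_self, norm_zero, mul_zero, Real.sqrt_zero] at h0
  rw [ContinuousAt, tendsto_iff_norm_sub_tendsto_zero]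
  refine squeeze_zero (fun i => norm_nonneg _) (fun u => ?_) h0
  exact Real.le_sqrt_of_sq_le (hle u v)

/-! ### Translations -/

theorem norm_ofSchwartz_translate (ψ : 𝓢(Sp d, ℂ)) (z : Sp d) :
    ‖ofSchwartz (ψ.compSubConstCLM ℂ z)‖ ≤ ‖ofSchwartz ψ‖ := by
  have h0 : ∀ χ : 𝓢(Sp d, ℂ), ‖schL2 (χ.compSubConstCLM ℂ z)‖ = ‖schL2 χ‖ := by
    intro χ
    rw [← sq_eq_sq₀ (norm_nonneg _) (norm_nonneg _), norm_sq_schL2, norm_sq_schL2]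
    exact integral_sub_right_eq_self (fun x => ‖χ x‖ ^ 2) z
  apply norm_H1_le (norm_nonneg _)
  · rw [toL2_ofSchwartz, h0]
    exact norm_toL2_le (ofSchwartz ψ)
  · intro j
    have h1 : (∂_{ei j} (ψ.compSubConstCLM ℂ z) : 𝓢(Sp d, ℂ))
        = (∂_{ei j} ψ : 𝓢(Sp d, ℂ)).compSubConstCLM ℂ z := by
      ext x
      rw [SchwartzMap.lineDerivOp_apply_eq_fderiv, SchwartzMap.compSubConstCLM_apply,
        SchwartzMap.lineDerivOp_apply_eq_fderiv]
      have : (ψ.compSubConstCLM ℂ z : Sp d → ℂ) = fun x => ψ (x - z) := rfl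
      rw [this, fderiv_comp_sub]
    rw [grad_ofSchwartz, h1, h0]
    exact norm_grad_le (ofSchwartz ψ) j

theorem schL2_sub (φ ψ : 𝓢(Sp d, ℂ)) : schL2 (φ - ψ) = schL2 φ - schL2 ψ := by
  apply Lp.ext
  filter_upwards [schL2_ae (φ - ψ), schL2_ae φ, schL2_ae ψ, Lp.coeFn_sub (schL2 φ) (schL2 ψ)]
    with x h1 h2 h3 h4
  rw [h1, h4, Pi.sub_apply, h2, h3, sub_apply]

theorem ofSchwartz_sub (φ ψ : 𝓢(Sp d, ℂ)) : ofSchwartz (φ - ψ) = ofSchwartz φ - ofSchwartz ψ :=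
  H1.ext_toL2 (schL2_sub φ ψ)

theorem norm_ofSchwartz_translate_sub_le (ψ : 𝓢(Sp d, ℂ)) (z : Sp d) :
    ‖ofSchwartz (ψ.compSubConstCLM ℂ z - ψ)‖ ≤ 2 * ‖ofSchwartz ψ‖ := by
  rw [ofSchwartz_sub, two_mul]
  exact (norm_sub_le _ _).trans (add_le_add_left (norm_ofSchwartz_translate ψ z) _)

theorem fourier_sub_schwartz (φ ψ : 𝓢(Sp d, ℂ)) : 𝓕 (φ - ψ) = 𝓕 φ - 𝓕 ψ :=
  map_sub (FourierTransform.fourierCLM ℂ 𝓢(Sp d, ℂ)) φ ψ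

/-- A translation is multiplication by a character on the Fourier side, and |e^(iθ)-1| ≤ |θ| with θ
= -2π z·ξ. -/
theorem norm_sq_translate_sub_le (ψ : 𝓢(Sp d, ℂ)) (z : Sp d) :
    ‖schL2 (ψ.compSubConstCLM ℂ z - ψ)‖ ^ 2 ≤ ‖z‖ ^ 2 * ∑ j, ‖grad (ofSchwartz ψ) j‖ ^ 2 := by
  have h1 : ∀ ξ, 𝓕 (ψ.compSubConstCLM ℂ z) ξ
      = Complex.exp (Complex.I * ((-(2 * Real.pi * inner ℝ z ξ) : ℝ) : ℂ)) * 𝓕 ψ ξ := by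
    intro ξ
    have := congrFun (VectorFourier.fourierIntegral_comp_add_right Real.fourierChar volume
      (innerₗ (Sp d)) ψ (-z)) ξ
    have h2 : (ψ ∘ fun v => v + -z) = (ψ.compSubConstCLM ℂ z : Sp d → ℂ) := by
      funext v
      simp [sub_eq_add_neg, SchwartzMap.compSubConstCLM_apply]
    rw [h2] at this
    rw [SchwartzMap.fourier_coe, SchwartzMap.fourier_coe]
    refine this.trans ?_
    rw [Circle.smul_def, Real.fourierChar_apply, smul_eq_mul]
    congr 2
    simp only [map_neg, innerₗ_apply_apply, LinearMap.neg_apply]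
    push_cast
    ring
  have h2 : ∀ ξ, ‖𝓕 (ψ.compSubConstCLM ℂ z - ψ) ξ‖ ^ 2
      ≤ ‖z‖ ^ 2 * (4 * Real.pi ^ 2 * ‖ξ‖ ^ 2 * ‖𝓕 ψ ξ‖ ^ 2) := by
    intro ξ
    have h3 : 𝓕 (ψ.compSubConstCLM ℂ z - ψ) ξ = (Complex.exp (Complex.I *
        ((-(2 * Real.pi * inner ℝ z ξ) : ℝ) : ℂ)) - 1) * 𝓕 ψ ξ := by
      rw [fourier_sub_schwartz, sub_apply, h1]
      ring
    rw [h3, norm_mul, mul_pow]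
    have h4 := Real.norm_exp_I_mul_ofReal_sub_one_le (x := -(2 * Real.pi * inner ℝ z ξ))
    have h5 : ‖-(2 * Real.pi * inner ℝ z ξ)‖ ≤ 2 * Real.pi * (‖z‖ * ‖ξ‖) := by
      rw [norm_neg, norm_mul, Real.norm_of_nonneg (by positivity)]
      gcongr
      exact norm_inner_le_norm z ξ
    calc _ ≤ (2 * Real.pi * (‖z‖ * ‖ξ‖)) ^ 2 * ‖𝓕 ψ ξ‖ ^ 2 := by
          gcongr
          exact h4.trans h5
      _ = _ := by ring
  have h6 := sum_norm_sq_grad (ofSchwartz ψ)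
  have hi := integrable_sq_fourier (ofSchwartz ψ)
  rw [h6, ← Lp.norm_fourier_eq, fourier_schL2, norm_sq_schL2, ← integral_const_mul]
  apply integral_mono_ae (integrable_norm_pow _ two_ne_zero) (hi.const_mul _)
  rw [toL2_ofSchwartz, fourier_schL2]
  filter_upwards [schL2_ae (𝓕 ψ)] with ξ hξ
  rw [hξ]
  exact h2 ξ

/-! ### The commutator of the heat semigroup and the nonlinearity -/

/-- The tangent line of t^k at m, obtained from Bernoulli's inequality for t/m. It is the pointwise
form of convexity behind Jensen's inequality below. -/
theorem pow_ge_tangent {m t : ℝ} (hm : 0 < m) (ht : 0 ≤ t) (k : ℕ) :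
    m ^ k + k * m ^ (k - 1) * (t - m) ≤ t ^ k := by
  rcases k with _ | k
  · simp
  have h := one_add_mul_sub_le_pow (a := t / m) (by have : 0 ≤ t / m := by positivity
                                                    linarith) (k + 1)
  have h2 : m ^ (k + 1) * (1 + ((k + 1 : ℕ) : ℝ) * (t / m - 1)) ≤ m ^ (k + 1) * (t / m) ^ (k + 1) := by
    gcongr
  rw [← mul_pow, mul_div_cancel₀ _ hm.ne'] at h2
  refine le_trans (le_of_eq ?_) h2
  rw [Nat.add_sub_cancel]
  field_simp
  ring

/-- Jensen's inequality for powers. -/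
theorem integral_mul_pow_le {α : Type*} [MeasurableSpace α] {μ : Measure α} {w t : α → ℝ}
    (hw : ∀ x, 0 ≤ w x) (hwi : Integrable w μ) (hw1 : ∫ x, w x ∂μ = 1) (ht : ∀ x, 0 ≤ t x) {k : ℕ}
    (hk : k ≠ 0) (h1 : Integrable (fun x => w x * t x) μ) (h2 : Integrable (fun x => w x * t x ^ k) μ) :
    (∫ x, w x * t x ∂μ) ^ k ≤ ∫ x, w x * t x ^ k ∂μ := by
  set m := ∫ x, w x * t x ∂μ with hm
  have hm0 : 0 ≤ m := integral_nonneg fun x => mul_nonneg (hw x) (ht x)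
  rcases hm0.eq_or_lt with h0 | h0
  · rw [← h0, zero_pow hk]
    exact integral_nonneg fun x => mul_nonneg (hw x) (pow_nonneg (ht x) _)
  have h3 : ∫ x, ((m ^ k - k * m ^ (k - 1) * m) * w x + k * m ^ (k - 1) * (w x * t x)) ∂μ = m ^ k := by
    rw [integral_add (hwi.const_mul _) (h1.const_mul _), integral_const_mul, integral_const_mul,
      hw1, ← hm]
    ring
  rw [← h3]
  apply integral_mono ((hwi.const_mul _).add (h1.const_mul _)) h2
  intro x
  have := mul_le_mul_of_nonneg_left (pow_ge_tangent h0 (ht x) k) (hw x)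
  simp only [Pi.add_apply]
  linarith

theorem integrable_pk_mul {E : Type*} [NormedAddCommGroup E] [NormedSpace ℝ E] {s : ℝ} (hs : 0 < s)
    {g : Sp d → E} (hg : Continuous g) {K : ℝ} (hK : ∀ z, ‖g z‖ ≤ K) :
    Integrable fun z => pk s z • g z :=
  (integrable_pk hs).smul_bdd K hg.aestronglyMeasurable (Eventually.of_forall hK)

theorem exists_norm_schwartz_le (ψ : 𝓢(Sp d, ℂ)) : ∃ K : ℝ, 0 ≤ K ∧ ∀ x, ‖ψ x‖ ≤ K := by
  obtain ⟨K, hK⟩ := ψ.decay 0 0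
  exact ⟨K, hK.1.le, fun x => by simpa using hK.2 x⟩

/-- The mean oscillation of order `k` of `ψ` at scale `√s`. -/
def osc (s : ℝ) (ψ : 𝓢(Sp d, ℂ)) (k : ℕ) (x : Sp d) : ℝ := ∫ z, pk s z * ‖ψ (x - z) - ψ x‖ ^ k

/-- Gagliardo–Nirenberg is applied to ψ(·-z)-ψ, whose L² norm is O(|z|) while its H¹ norm stays
bounded. This gives O(|z|²) for fixed z, and the second moment of the heat kernel turns it into O(s)
after Fubini. -/
theorem exists_integral_osc_le (hd : d = 1 ∨ d = 2) (k : ℕ) :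
    ∃ C : ℝ, 0 ≤ C ∧ ∀ {s : ℝ}, 0 < s → ∀ ψ : 𝓢(Sp d, ℂ), Integrable (osc s ψ (2 * k + 2)) ∧
      ∫ x, osc s ψ (2 * k + 2) x ≤ C * s * ‖ofSchwartz ψ‖ ^ (2 * k + 2) := by
  obtain ⟨C, hC, h⟩ := exists_integral_pow_le_schwartz hd k
  refine ⟨C * d * 2 ^ (2 * k) * 2 ^ ((d : ℝ) / 2), by positivity, fun {s} hs ψ => ?_⟩
  set M := ‖ofSchwartz ψ‖ with hM
  have hM0 : 0 ≤ M := norm_nonneg _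
  set F : Sp d × Sp d → ℝ := fun q => pk s q.2 * ‖ψ (q.1 - q.2) - ψ q.1‖ ^ (2 * k + 2) with hF
  have hFc : Continuous F := by
    have h1 := ψ.continuous
    have h2 := continuous_pk (d := d) s
    fun_prop
  have hF0 : ∀ q, 0 ≤ F q := fun q => mul_nonneg (pk_nonneg hs _) (by positivity)
  have hb : ∀ z, Integrable (fun x => ‖ψ (x - z) - ψ x‖ ^ (2 * k + 2)) ∧
      ∫ x, ‖ψ (x - z) - ψ x‖ ^ (2 * k + 2) ≤ (C * d * 2 ^ (2 * k) * M ^ (2 * k + 2)) * ‖z‖ ^ 2 := by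
    intro z
    have h1 := h (ψ.compSubConstCLM ℂ z - ψ)
    have h2 := integrable_norm_pow (ψ.compSubConstCLM ℂ z - ψ) (k := 2 * k + 2) (by omega)
    simp only [sub_apply, SchwartzMap.compSubConstCLM_apply] at h1 h2
    refine ⟨h2, h1.trans ?_⟩
    calc _ ≤ C * (‖z‖ ^ 2 * (d * M ^ 2)) * (2 * M) ^ (2 * k) := by
          gcongr
          · exact (norm_sq_translate_sub_le ψ z).trans (by
              gcongr
              exact sum_norm_sq_grad_le _)
          · exact norm_ofSchwartz_translate_sub_le ψ z
      _ = _ := by ring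
  have hinner : ∀ z, ∫ x, F (x, z) ≤ (C * d * 2 ^ (2 * k) * M ^ (2 * k + 2))
      * (2 ^ ((d : ℝ) / 2) * s * pk (2 * s) z) := by
    intro z
    simp only [hF]
    rw [integral_const_mul]
    calc _ ≤ pk s z * ((C * d * 2 ^ (2 * k) * M ^ (2 * k + 2)) * ‖z‖ ^ 2) := by
          exact mul_le_mul_of_nonneg_left (hb z).2 (pk_nonneg hs z)
      _ = (C * d * 2 ^ (2 * k) * M ^ (2 * k + 2)) * (‖z‖ ^ 2 * pk s z) := by ring
      _ ≤ _ := by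
          exact mul_le_mul_of_nonneg_left (sq_norm_mul_pk_le hs z) (by positivity)
  have hdom := ((integrable_pk (d := d) (by positivity : 0 < 2 * s)).const_mul
    (2 ^ ((d : ℝ) / 2) * s)).const_mul (C * d * 2 ^ (2 * k) * M ^ (2 * k + 2))
  have hFi : Integrable F (volume.prod volume) := by
    rw [integrable_prod_iff' hFc.aestronglyMeasurable]
    refine ⟨Eventually.of_forall fun z => (hb z).1.const_mul (pk s z), ?_⟩
    simp only [Real.norm_of_nonneg (hF0 _)]
    refine hdom.mono' ?_ ?_
    · exact (hFc.aestronglyMeasurable (μ := volume.prod volume)).prod_swap.integral_prod_right'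
    · filter_upwards with z
      rw [Real.norm_of_nonneg (integral_nonneg fun x => hF0 _)]
      exact hinner z
  have hosc : osc s ψ (2 * k + 2) = fun x => ∫ z, F (x, z) := rfl
  refine ⟨hFi.integral_prod_left, ?_⟩
  rw [hosc, integral_integral_swap (f := fun x z => F (x, z)) hFi]
  calc _ ≤ ∫ z, (C * d * 2 ^ (2 * k) * M ^ (2 * k + 2)) * (2 ^ ((d : ℝ) / 2) * s * pk (2 * s) z) :=
        integral_mono hFi.integral_prod_right hdom hinner
    _ = _ := by
        rw [integral_const_mul, integral_const_mul, integral_pk (by positivity)]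
        ring

theorem integral_pk_sub_eq {s : ℝ} (g : Sp d → ℂ) (x : Sp d) :
    ∫ y, (pk s (x - y) : ℂ) * g y = ∫ z, pk s z • g (x - z) := by
  have := integral_sub_left_eq_self (fun z => pk s z • g (x - z)) volume x
  rw [← this]
  congr 1
  funext y
  rw [sub_sub_cancel, Complex.real_smul]

/-- The nonlinearity is expanded around the heat average J. The first-order term averages to zero,
since ψ(x-z)-J has mean zero for the kernel, so only a quadratic remainder in the oscillation
survives. The number κ isolates |J|^(4/d-1), the one factor that the oscillation does not control
and that may grow logarithmically. -/
theorem sq_norm_commutator_le (hd : d = 1 ∨ d = 2) {s : ℝ} (hs : 0 < s) (ψ : 𝓢(Sp d, ℂ)) (x : Sp d)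
    {κ : ℝ} (hκ : ‖∫ y, (pk s (x - y) : ℂ) * ψ y‖ ^ (4 / d - 1) ≤ κ) :
    ‖(∫ y, (pk s (x - y) : ℂ) * nonlin d (ψ y)) - nonlin d (∫ y, (pk s (x - y) : ℂ) * ψ y)‖ ^ 2
      ≤ 25690112 * (κ ^ 2 * osc s ψ 4 x + osc s ψ (2 * (4 / d) + 2) x) := by
  rw [integral_pk_sub_eq] at hκ
  rw [integral_pk_sub_eq ψ, integral_pk_sub_eq (fun y => nonlin d (ψ y))]
  set J := ∫ z, pk s z • ψ (x - z) with hJ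
  set e := 4 / d with he
  obtain ⟨K, hK0, hK⟩ := exists_norm_schwartz_le ψ
  have hψc := ψ.continuous
  have hfc := continuous_nonlin (d := d) hd
  have hpk1 : ∫ z : Sp d, pk s z = 1 := integral_pk hs
  have hκ0 : 0 ≤ κ := le_trans (by positivity) hκ
  have hψi : Integrable fun z => pk s z • ψ (x - z) :=
    integrable_pk_mul hs (by fun_prop) (fun z => hK _)
  have hfi : Integrable fun z => pk s z • nonlin d (ψ (x - z)) := by
    refine integrable_pk_mul (K := K ^ (e + 1)) hs (by fun_prop) (fun z => ?_)
    rw [norm_nonlin hd]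
    gcongr
    exact hK _
  have hci : ∀ c : ℂ, Integrable (fun z : Sp d => pk s z • c) ∧ ∫ z : Sp d, pk s z • c = c := by
    intro c
    refine ⟨(integrable_pk hs).smul_const c, ?_⟩
    rw [integral_smul_const, hpk1, one_smul]
  set D : Sp d → ℝ := fun z => ‖ψ (x - z) - J‖ with hD
  set Θ : Sp d → ℝ := fun z => ‖ψ (x - z) - ψ x‖ with hΘ
  have hDK : ∀ z, D z ≤ K + ‖J‖ := fun z => (norm_sub_le _ _).trans (by gcongr; exact hK _)
  have hΘK : ∀ z, Θ z ≤ K + K := fun z => (norm_sub_le _ _).trans (add_le_add (hK _) (hK _))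
  have hDc : Continuous D := by fun_prop
  have hΘc : Continuous Θ := by fun_prop
  have hD0 : ∀ z, 0 ≤ D z := fun z => norm_nonneg _
  have hΘ0 : ∀ z, 0 ≤ Θ z := fun z => norm_nonneg _
  have hDi : ∀ k : ℕ, Integrable fun z => pk s z * D z ^ k := by
    intro k
    refine integrable_pk_mul (K := (K + ‖J‖) ^ k) hs (g := fun z => D z ^ k) (by fun_prop) fun z => ?_
    rw [norm_pow, Real.norm_of_nonneg (hD0 z)]
    gcongr
    exact hDK z
  have hΘi : ∀ k : ℕ, Integrable fun z => pk s z * Θ z ^ k := by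
    intro k
    refine integrable_pk_mul (K := (K + K) ^ k) hs (g := fun z => Θ z ^ k) (by fun_prop) fun z => ?_
    rw [norm_pow, Real.norm_of_nonneg (hΘ0 z)]
    gcongr
    exact hΘK z
  have hosc : ∀ k, osc s ψ k x = ∫ z, pk s z * Θ z ^ k := fun k => rfl
  have hJx : ‖J - ψ x‖ ≤ ∫ z, pk s z * Θ z := by
    have : J - ψ x = ∫ z, pk s z • (ψ (x - z) - ψ x) := by
      simp only [smul_sub]
      rw [integral_sub hψi (hci _).1, (hci _).2]
    rw [this]
    refine (norm_integral_le_integral_norm _).trans_eq ?_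
    congr 1
    funext z
    rw [norm_smul, Real.norm_of_nonneg (pk_nonneg hs z)]
  -- Oscillation about the average J is comparable to oscillation about ψ x, because Jensen bounds
  -- ‖J - ψ x‖^k by `osc`.
  have hDosc : ∀ k : ℕ, k ≠ 0 → ∫ z, pk s z * D z ^ k ≤ 2 ^ k * osc s ψ k x := by
    intro k hk
    have h1 : ‖J - ψ x‖ ^ k ≤ osc s ψ k x := by
      rw [hosc]
      refine (pow_le_pow_left₀ (norm_nonneg _) hJx k).trans ?_
      exact integral_mul_pow_le (pk_nonneg hs) (integrable_pk hs) hpk1 hΘ0 hk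
        (by simpa using hΘi 1) (hΘi k)
    have h2 : ∀ z, D z ^ k ≤ 2 ^ (k - 1) * (Θ z ^ k + ‖J - ψ x‖ ^ k) := by
      intro z
      refine le_trans ?_ (add_pow_le (hΘ0 z) (norm_nonneg _) k)
      gcongr
      rw [hD, hΘ]
      calc _ = ‖(ψ (x - z) - ψ x) - (J - ψ x)‖ := by rw [sub_sub_sub_cancel_right]
        _ ≤ _ := norm_sub_le _ _
    calc _ ≤ ∫ z, (2 ^ (k - 1) * (pk s z * Θ z ^ k) + 2 ^ (k - 1) * ‖J - ψ x‖ ^ k * pk s z) := by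
          apply integral_mono (hDi k) (((hΘi k).const_mul _).add ((integrable_pk hs).const_mul _))
          intro z
          have := mul_le_mul_of_nonneg_left (h2 z) (pk_nonneg hs z)
          simp only [Pi.add_apply]
          linarith
      _ = 2 ^ (k - 1) * (osc s ψ k x + ‖J - ψ x‖ ^ k) := by
          rw [integral_add ((hΘi k).const_mul _) ((integrable_pk hs).const_mul _),
            integral_const_mul, integral_const_mul, hpk1, hosc]
          ring
      _ ≤ 2 ^ (k - 1) * (osc s ψ k x + osc s ψ k x) := by gcongr
      _ = _ := by
          obtain ⟨m, rfl⟩ := Nat.exists_eq_succ_of_ne_zero hk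
          rw [Nat.succ_sub_one, pow_succ]
          ring
  obtain ⟨L, hL⟩ := exists_norm_nonlin_taylor_le hd J
  -- Here 112 = 14·8, with 14 from the Taylor remainder and 8 bounding the power of 2 that separates
  -- ‖J‖ from D z.
  have hpt : ∀ z, ‖nonlin d (ψ (x - z)) - nonlin d J - L (ψ (x - z) - J)‖
      ≤ 112 * (κ * D z ^ 2 + D z ^ (e + 1)) := by
    intro z
    have h1 := hL (ψ (x - z) - J)
    rw [add_sub_cancel, ← he] at h1
    refine h1.trans ?_
    change 14 * (D z ^ 2 * (‖J‖ + D z) ^ (e - 1)) ≤ _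
    have h2 : (‖J‖ + D z) ^ (e - 1) ≤ 8 * (κ + D z ^ (e - 1)) := by
      refine (add_pow_le (norm_nonneg _) (hD0 z) _).trans ?_
      have h3 : (2 : ℝ) ^ (e - 1 - 1) ≤ 8 := by
        rcases hd with rfl | rfl <;> norm_num [he]
      have := hD0 z
      gcongr
    have h4 : D z ^ (e + 1) = D z ^ 2 * D z ^ (e - 1) := by
      rw [← pow_add]
      congr 1
      rcases hd with rfl | rfl <;> norm_num [he]
    rw [h4]
    have := mul_le_mul_of_nonneg_left h2 (by positivity : 0 ≤ 14 * D z ^ 2)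
    linarith
  have hLi : Integrable (fun z => pk s z • L (ψ (x - z) - J)) ∧
      ∫ z, pk s z • L (ψ (x - z) - J) = 0 := by
    have h1 : Integrable fun z => pk s z • (ψ (x - z) - J) := by
      simp only [smul_sub]
      exact hψi.sub (hci J).1
    have h2 := L.integrable_comp h1
    have h3 := L.integral_comp_comm h1
    simp only [map_smul] at h2 h3
    refine ⟨h2, h3.trans ?_⟩
    simp only [smul_sub]
    rw [integral_sub hψi (hci J).1, (hci J).2, ← hJ, sub_self, map_zero]
  set G : Sp d → ℝ := fun z => κ * D z ^ 2 + D z ^ (e + 1) with hG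
  have hG0 : ∀ z, 0 ≤ G z := fun z => by have := hD0 z; positivity
  have hGi : Integrable fun z => pk s z * G z := by
    refine (((hDi 2).const_mul κ).add (hDi (e + 1))).congr (Eventually.of_forall fun z => ?_)
    simp only [hG, Pi.add_apply]; ring
  have hG2i : Integrable fun z => pk s z * G z ^ 2 := by
    refine ((((hDi 4).const_mul (κ ^ 2)).add ((hDi (e + 3)).const_mul (2 * κ))).add
      (hDi (2 * e + 2))).congr (Eventually.of_forall fun z => ?_)
    simp only [hG, Pi.add_apply]; ring
  have hErr : ‖(∫ z, pk s z • nonlin d (ψ (x - z))) - nonlin d J‖ ≤ 112 * ∫ z, pk s z * G z := by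
    have h1 : (∫ z, pk s z • nonlin d (ψ (x - z))) - nonlin d J
        = ∫ z, pk s z • (nonlin d (ψ (x - z)) - nonlin d J - L (ψ (x - z) - J)) := by
      simp only [smul_sub (pk s _)]
      have h2 : Integrable fun z => pk s z • nonlin d (ψ (x - z)) - pk s z • nonlin d J :=
        hfi.sub (hci _).1
      rw [integral_sub h2 hLi.1, integral_sub hfi (hci _).1, hLi.2, (hci _).2, sub_zero]
    rw [h1, ← integral_const_mul]
    refine norm_integral_le_of_norm_le (hGi.const_mul _) (Eventually.of_forall fun z => ?_)
    rw [norm_smul, Real.norm_of_nonneg (pk_nonneg hs z)]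
    have := mul_le_mul_of_nonneg_left (hpt z) (pk_nonneg hs z)
    simp only [hG]
    linarith
  have hJen := integral_mul_pow_le (pk_nonneg hs) (integrable_pk hs) hpk1 hG0 two_ne_zero hGi hG2i
  have hG2 : ∫ z, pk s z * G z ^ 2
      ≤ 2 * (κ ^ 2 * (2 ^ 4 * osc s ψ 4 x) + 2 ^ (2 * e + 2) * osc s ψ (2 * e + 2) x) := by
    calc _ ≤ ∫ z, (2 * κ ^ 2 * (pk s z * D z ^ 4) + 2 * (pk s z * D z ^ (2 * e + 2))) := by
          apply integral_mono hG2i (((hDi 4).const_mul _).add ((hDi (2 * e + 2)).const_mul _))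
          intro z
          have h1 : G z ^ 2 ≤ 2 * ((κ * D z ^ 2) ^ 2 + (D z ^ (e + 1)) ^ 2) := add_sq_le
          have h2 := mul_le_mul_of_nonneg_left h1 (pk_nonneg hs z)
          refine h2.trans_eq ?_
          simp only [Pi.add_apply]
          ring
      _ = 2 * (κ ^ 2 * (∫ z, pk s z * D z ^ 4) + ∫ z, pk s z * D z ^ (2 * e + 2)) := by
          rw [integral_add ((hDi 4).const_mul _) ((hDi (2 * e + 2)).const_mul _),
            integral_const_mul, integral_const_mul]
          ring
      _ ≤ _ := by
          gcongr
          · exact hDosc 4 (by norm_num)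
          · exact hDosc _ (by omega)
  have h0 : ∀ k, 0 ≤ osc s ψ k x := fun k =>
    integral_nonneg fun z => mul_nonneg (pk_nonneg hs z) (by positivity)
  have h10 : (2 : ℝ) ^ (2 * e + 2) ≤ 2 ^ 10 := by
    apply pow_le_pow_right₀ one_le_two
    rcases hd with rfl | rfl <;> norm_num [he]
  -- The final constant is 112² · 2 · 2^10 = 25690112.
  calc _ ≤ (112 * ∫ z, pk s z * G z) ^ 2 := by gcongr
    _ = 112 ^ 2 * (∫ z, pk s z * G z) ^ 2 := by ring
    _ ≤ 112 ^ 2 * (2 * (κ ^ 2 * (2 ^ 10 * osc s ψ 4 x) + 2 ^ 10 * osc s ψ (2 * e + 2) x)) := by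
        gcongr
        refine (hJen.trans hG2).trans ?_
        have := h0 4
        have := h0 (2 * e + 2)
        gcongr <;> norm_num
    _ = _ := by ring

/-- The factor √(j+1) is needed only for d = 2, where the exponent 4/d-1 is 1. For d = 1 the
function is bounded and the factor, being at least 1, is harmless. -/
theorem exists_norm_heat_pow_le (hd : d = 1 ∨ d = 2) :
    ∃ K : ℝ, 0 ≤ K ∧ ∀ (ψ : 𝓢(Sp d, ℂ)) (j : ℕ), ∀ᵐ x,
      ‖heat (2⁻¹ ^ j) (schL2 ψ) x‖ ^ (4 / d - 1) ≤ K * √(j + 1) * ‖ofSchwartz ψ‖ ^ (4 / d - 1) := by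
  rcases hd with rfl | rfl
  · obtain ⟨C, hC, h⟩ := exists_norm_le_one
    refine ⟨C ^ 3, by positivity, fun ψ j => ?_⟩
    have hs : (0 : ℝ) < 2⁻¹ ^ j := by positivity
    filter_upwards [heat_schwartz_ae hs ψ] with x hx
    have h1 : ‖heat (2⁻¹ ^ j) (schL2 ψ) x‖ ≤ C * ‖ofSchwartz ψ‖ := by
      rw [hx, integral_pk_sub_eq]
      calc _ ≤ ∫ z : Sp 1, pk (2⁻¹ ^ j) z * (C * ‖ofSchwartz ψ‖) := by
            refine norm_integral_le_of_norm_le ((integrable_pk hs).mul_const _)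
              (Eventually.of_forall fun z => ?_)
            rw [norm_smul, Real.norm_of_nonneg (pk_nonneg hs z)]
            exact mul_le_mul_of_nonneg_left (h ψ _) (pk_nonneg hs z)
        _ = _ := by rw [integral_mul_const, integral_pk hs, one_mul]
    have h2 : (1 : ℝ) ≤ √(j + 1) := Real.one_le_sqrt.2 (by linarith [Nat.cast_nonneg (α := ℝ) j])
    calc _ ≤ (C * ‖ofSchwartz ψ‖) ^ (4 / 1 - 1) := by gcongr
      _ = C ^ 3 * 1 * ‖ofSchwartz ψ‖ ^ (4 / 1 - 1) := by norm_num [mul_pow]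
      _ ≤ _ := by gcongr
  · obtain ⟨C, hC, h⟩ := exists_norm_heat_le_two
    refine ⟨C, hC, fun ψ j => ?_⟩
    filter_upwards [h ψ j] with x hx
    simpa using hx

/-- The commutator of the heat semigroup at time `2⁻ʲ` with the nonlinearity. -/
theorem exists_norm_commutator_le (hd : d = 1 ∨ d = 2) :
    ∃ C : ℝ, 0 ≤ C ∧ ∀ (u : H1 d) (j : ℕ) (hs : (0 : ℝ) < 2⁻¹ ^ j),
      ‖heat (2⁻¹ ^ j) (nl hd u) - nl hd (heatH1 hs (toL2 u))‖ ^ 2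
        ≤ C * (j + 1) * 2⁻¹ ^ j * ‖u‖ ^ (2 * (4 / d) + 2) := by
  obtain ⟨K, hK, hKle⟩ := exists_norm_heat_pow_le hd
  obtain ⟨C1, hC1, h1⟩ := exists_integral_osc_le hd 1
  obtain ⟨C2, hC2, h2⟩ := exists_integral_osc_le hd (4 / d)
  set e := 4 / d with he
  have he2 : 2 * (e - 1) + 4 = 2 * e + 2 := by
    rcases hd with rfl | rfl <;> norm_num [he]
  refine ⟨25690112 * (K ^ 2 * C1 + C2), by positivity, ?_⟩
  have hsch : ∀ (ψ : 𝓢(Sp d, ℂ)) (j : ℕ) (hs : (0 : ℝ) < 2⁻¹ ^ j),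
      ‖heat (2⁻¹ ^ j) (nl hd (ofSchwartz ψ)) - nl hd (heatH1 hs (toL2 (ofSchwartz ψ)))‖ ^ 2
        ≤ 25690112 * (K ^ 2 * C1 + C2) * (j + 1) * 2⁻¹ ^ j * ‖ofSchwartz ψ‖ ^ (2 * e + 2) := by
    intro ψ j hs
    set s : ℝ := 2⁻¹ ^ j with hsd
    set M := ‖ofSchwartz ψ‖ with hM
    set κ := K * √(j + 1) * M ^ (e - 1) with hκ
    obtain ⟨hi1, hle1⟩ := h1 hs ψ
    obtain ⟨hi2, hle2⟩ := h2 hs ψ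
    rw [norm_sq_eq_integral]
    calc _ ≤ ∫ x, 25690112 * (κ ^ 2 * osc s ψ 4 x + osc s ψ (2 * e + 2) x) := by
          apply integral_mono_ae (integrable_norm_sq _) (((hi1.const_mul _).add hi2).const_mul _)
          filter_upwards [heat_ae hs (nl hd (ofSchwartz ψ)), heat_schwartz_ae hs ψ, hKle ψ j,
            nl_ae hd (heatH1 hs (toL2 (ofSchwartz ψ))),
            Lp.coeFn_sub (heat s (nl hd (ofSchwartz ψ))) (nl hd (heatH1 hs (toL2 (ofSchwartz ψ))))]
            with x e1 e2 e3 e4 e5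
          rw [e5, Pi.sub_apply, e1, e4, toL2_heatH1, toL2_ofSchwartz, e2]
          rw [e2] at e3
          have e6 : ∫ y, (pk s (x - y) : ℂ) * nl hd (ofSchwartz ψ) y
              = ∫ y, (pk s (x - y) : ℂ) * nonlin d (ψ y) := by
            apply integral_congr_ae
            filter_upwards [nl_ae hd (ofSchwartz ψ), schL2_ae ψ] with y hy1 hy2
            rw [hy1, toL2_ofSchwartz, hy2]
          rw [e6]
          exact sq_norm_commutator_le hd hs ψ x e3
      _ = 25690112 * (κ ^ 2 * (∫ x, osc s ψ 4 x) + ∫ x, osc s ψ (2 * e + 2) x) := by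
          rw [integral_const_mul, integral_add (hi1.const_mul _) hi2, integral_const_mul]
      _ ≤ 25690112 * (κ ^ 2 * (C1 * s * M ^ 4) + C2 * s * M ^ (2 * e + 2)) := by
          gcongr
      _ = 25690112 * (K ^ 2 * C1 * (j + 1) + C2 * 1) * s * M ^ (2 * e + 2) := by
          rw [hκ, mul_pow, mul_pow, Real.sq_sqrt (by positivity), ← he2]
          ring
      _ ≤ 25690112 * (K ^ 2 * C1 * (j + 1) + C2 * (j + 1)) * s * M ^ (2 * e + 2) := by
          have : (0 : ℝ) ≤ j := Nat.cast_nonneg j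
          gcongr
          linarith
      _ = _ := by ring
  intro u j hs
  obtain ⟨ψ, hψ, -⟩ := exists_seq_schwartz u
  obtain ⟨M, hM⟩ := (Metric.isBounded_range_of_tendsto _ hψ).exists_norm_le
  have t1 : Tendsto (fun n => heat (2⁻¹ ^ j) (nl hd (ofSchwartz (ψ n)))) atTop
      (𝓝 (heat (2⁻¹ ^ j) (nl hd u))) :=
    ((heat (2⁻¹ ^ j)).continuous.tendsto _).comp (((continuous_nl hd).tendsto u).comp hψ)
  -- Here L² convergence and an H¹ bound suffice; the smoothed functions need not be shown to
  -- converge in H¹.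
  have t2 : Tendsto (fun n => nl hd (heatH1 hs (toL2 (ofSchwartz (ψ n))))) atTop
      (𝓝 (nl hd (heatH1 hs (toL2 u)))) := by
    apply tendsto_nl hd (M := M)
    · intro n
      exact (norm_heatH1_le hs _).trans (hM _ ⟨n, rfl⟩)
    · simp only [toL2_heatH1]
      exact ((heat (2⁻¹ ^ j)).continuous.tendsto _).comp ((toL2L.continuous.tendsto u).comp hψ)
  exact le_of_tendsto_of_tendsto' ((t1.sub t2).norm.pow 2)
    ((hψ.norm.pow (2 * e + 2)).const_mul _) (fun n => hsch (ψ n) j hs)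

/-! ### Multiplication by smooth bounded functions -/

namespace IsCbInfty

variable {f g : Sp d → ℝ}

theorem pderiv (hf : IsCbInfty f) (j : Fin d) : IsCbInfty (RoughNLS.pderiv j f) := by
  have h1 : ContDiff ℝ (⊤ : ℕ∞) (fderiv ℝ f) := hf.1.fderiv_right le_rfl
  refine ⟨h1.clm_apply contDiff_const, fun m => ?_⟩
  obtain ⟨K, hK⟩ := hf.2 (m + 1)
  refine ⟨‖(ei j : Sp d)‖ * K, fun x => ?_⟩
  refine (norm_iteratedFDeriv_clm_apply_const (N := (⊤ : ℕ∞)) h1.contDiffAt (by exact_mod_cast le_top)).trans ?_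
  gcongr
  rw [norm_iteratedFDeriv_fderiv]
  exact hK x

theorem add (hf : IsCbInfty f) (hg : IsCbInfty g) : IsCbInfty (fun x => f x + g x) := by
  refine ⟨hf.1.add hg.1, fun m => ?_⟩
  obtain ⟨K, hK⟩ := hf.2 m
  obtain ⟨L, hL⟩ := hg.2 m
  refine ⟨K + L, fun x => ?_⟩
  have := iteratedFDeriv_add_apply (𝕜 := ℝ) (i := m) (x := x) (f := f) (g := g)
    (hf.1.contDiffAt.of_le (by exact_mod_cast le_top)) (hg.1.contDiffAt.of_le (by exact_mod_cast le_top))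
  rw [show (fun x => f x + g x) = f + g from rfl, this]
  exact (norm_add_le _ _).trans (add_le_add (hK x) (hL x))

theorem mul (hf : IsCbInfty f) (hg : IsCbInfty g) : IsCbInfty (fun x => f x * g x) := by
  refine ⟨hf.1.mul hg.1, fun m => ?_⟩
  choose K hK using hf.2
  choose L hL using hg.2
  refine ⟨∑ i ∈ Finset.range (m + 1), (m.choose i : ℝ) * K i * L (m - i), fun x => ?_⟩
  refine (norm_iteratedFDeriv_mul_le hf.1 hg.1 x (by exact_mod_cast le_top)).trans ?_
  gcongr with i hi
  · exact mul_nonneg (Nat.cast_nonneg _) ((norm_nonneg _).trans (hK i x))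
  · exact hK i x
  · exact hL _ x

theorem const (c : ℝ) : IsCbInfty (fun _ : Sp d => c) := by
  refine ⟨contDiff_const, fun m => ?_⟩
  rcases m with _ | m
  · exact ⟨|c|, fun x => by simp⟩
  · refine ⟨0, fun x => ?_⟩
    rw [iteratedFDeriv_const_of_ne (Nat.succ_ne_zero m)]
    simp

theorem sum {ι : Type*} (s : Finset ι) {f : ι → Sp d → ℝ} (hf : ∀ i, IsCbInfty (f i)) :
    IsCbInfty (fun x => ∑ i ∈ s, f i x) := by
  classical
  induction s using Finset.induction_on with
  | empty => simpa using const 0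
  | insert i s hi ih =>
    simp only [Finset.sum_insert hi]
    exact (hf i).add ih

theorem hasTemperateGrowth (hf : IsCbInfty f) : f.HasTemperateGrowth := by
  refine ⟨hf.1, fun n => ?_⟩
  obtain ⟨K, hK⟩ := hf.2 n
  exact ⟨0, K, fun x => by simpa using hK x⟩

theorem continuous (hf : IsCbInfty f) : Continuous f := hf.1.continuous

theorem differentiable (hf : IsCbInfty f) : Differentiable ℝ f := hf.1.differentiable (by simp)

theorem exists_bound (hf : IsCbInfty f) : ∃ K : ℝ, 0 ≤ K ∧ ∀ x, |f x| ≤ K := by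
  obtain ⟨K, hK⟩ := hf.2 0
  refine ⟨K, (norm_nonneg _).trans (hK 0), fun x => ?_⟩
  simpa using hK x

theorem exists_lipschitz (hf : IsCbInfty f) :
    ∃ K : ℝ, 0 ≤ K ∧ ∀ x y, |f x - f y| ≤ K * ‖x - y‖ := by
  obtain ⟨K, hK⟩ := hf.2 1
  refine ⟨K, (norm_nonneg _).trans (hK 0), fun x y => ?_⟩
  have := Convex.norm_image_sub_le_of_norm_fderiv_le (𝕜 := ℝ) (f := f) (s := Set.univ) (C := K)
    (x := y) (y := x) (fun z _ => hf.differentiable z) (fun z _ => by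
      have := hK z
      rwa [← norm_iteratedFDeriv_one])
    convex_univ (Set.mem_univ _) (Set.mem_univ _)
  simpa using this

end IsCbInfty

/-- A real function in `C_b^∞` as a bounded continuous complex function. -/
def bc {f : Sp d → ℝ} (hf : IsCbInfty f) : Sp d →ᵇ ℂ :=
  BoundedContinuousFunction.ofNormedAddCommGroup (fun x => (f x : ℂ))
    (Complex.continuous_ofReal.comp hf.continuous) hf.exists_bound.choose (fun x => by
      rw [Complex.norm_real]
      exact hf.exists_bound.choose_spec.2 x)

theorem bc_apply {f : Sp d → ℝ} (hf : IsCbInfty f) (x : Sp d) : bc hf x = (f x : ℂ) := rfl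

/-- Multiplication by a real function in `C_b^∞` on `L²`. -/
def mulC {f : Sp d → ℝ} (hf : IsCbInfty f) : L2 d →L[ℂ] L2 d := bmul (bc hf)

theorem mulC_ae {f : Sp d → ℝ} (hf : IsCbInfty f) (v : L2 d) :
    mulC hf v =ᵐ[volume] fun x => (f x : ℂ) * v x := bmul_ae _ _

theorem inner_mulC_left {f : Sp d → ℝ} (hf : IsCbInfty f) (v w : L2 d) :
    ⟪mulC hf v, w⟫ = ⟪v, mulC hf w⟫ := by
  rw [mulC, inner_bmul_left]
  have : star (bc hf) = bc hf := by
    ext x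
    rw [BoundedContinuousFunction.star_apply, bc_apply, RCLike.star_def, Complex.conj_ofReal]
  rw [this]

theorem norm_mulC_le {f : Sp d → ℝ} (hf : IsCbInfty f) {K : ℝ} (hK : ∀ x, |f x| ≤ K) (v : L2 d) :
    ‖mulC hf v‖ ≤ K * ‖v‖ :=
  norm_bmul_le_of_bound (fun x => by rw [bc_apply, Complex.norm_real]; exact hK x) v

/-- Multiplication of a Schwartz function by a real function in `C_b^∞`. -/
def smulS (f : Sp d → ℝ) (ψ : 𝓢(Sp d, ℂ)) : 𝓢(Sp d, ℂ) := SchwartzMap.smulLeftCLM ℂ f ψ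

theorem smulS_apply {f : Sp d → ℝ} (hf : IsCbInfty f) (ψ : 𝓢(Sp d, ℂ)) (x : Sp d) :
    smulS f ψ x = (f x : ℂ) * ψ x := by
  rw [smulS, SchwartzMap.smulLeftCLM_apply_apply hf.hasTemperateGrowth, Complex.real_smul]

theorem lineDeriv_smulS {f : Sp d → ℝ} (hf : IsCbInfty f) (ψ : 𝓢(Sp d, ℂ)) (j : Fin d) :
    (∂_{ei j} (smulS f ψ) : 𝓢(Sp d, ℂ)) = smulS f (∂_{ei j} ψ) + smulS (pderiv j f) ψ := by
  ext x
  rw [SchwartzMap.lineDerivOp_apply_eq_fderiv, add_apply, smulS_apply hf,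
    smulS_apply (hf.pderiv j), SchwartzMap.lineDerivOp_apply_eq_fderiv]
  have h1 : (smulS f ψ : Sp d → ℂ) = fun x => f x • ψ x := by
    funext y
    rw [smulS_apply hf, Complex.real_smul]
  rw [h1, fderiv_fun_smul (hf.differentiable x) ((ψ.smooth 1).differentiable one_ne_zero x)]
  simp [pderiv]

/-- Multiplication by a real function in `C_b^∞` on `H¹`. -/
def mulH1 {f : Sp d → ℝ} (hf : IsCbInfty f) (u : H1 d) : H1 d :=
  ⟨(mulC hf (toL2 u), fun j => mulC hf (grad u j) + mulC (hf.pderiv j) (toL2 u)), by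
    intro j
    ext χ
    have hu : (∂_{ei j} ((toL2 u : L2 d) : 𝓢'(Sp d, ℂ))) (smulS f χ)
      = ((grad u j : L2 d) : 𝓢'(Sp d, ℂ)) (smulS f χ) :=
      congrArg (fun T : 𝓢'(Sp d, ℂ) => T (smulS f χ)) (u.2 j)
    rw [TemperedDistribution.lineDerivOp_apply_apply, lineDeriv_smulS hf,
      Lp.toTemperedDistribution_apply, Lp.toTemperedDistribution_apply] at hu
    rw [TemperedDistribution.lineDerivOp_apply_apply, Lp.toTemperedDistribution_apply,
      Lp.toTemperedDistribution_apply]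
    have hi : ∀ (θ : 𝓢(Sp d, ℂ)) (v : L2 d), Integrable fun x => θ x * v x := fun θ v =>
      (θ.memLp 2 volume).integrable_mul (Lp.memLp v)
    have e1 : ∫ x, (-∂_{ei j} χ : 𝓢(Sp d, ℂ)) x • (mulC hf (toL2 u)) x
        = (∫ x, (-(smulS f (∂_{ei j} χ) + smulS (RoughNLS.pderiv j f) χ) : 𝓢(Sp d, ℂ)) x • toL2 u x)
          + ∫ x, smulS (RoughNLS.pderiv j f) χ x * toL2 u x := by
      simp only [smul_eq_mul]
      rw [← integral_add (hi _ _) (hi _ _)]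
      apply integral_congr_ae
      filter_upwards [mulC_ae hf (toL2 u)] with x hx
      rw [hx, neg_apply, neg_apply, add_apply, smulS_apply hf, smulS_apply (hf.pderiv j)]
      ring
    have e2 : ∫ x, χ x • (mulC hf (grad u j) + mulC (hf.pderiv j) (toL2 u)) x
        = (∫ x, smulS f χ x • grad u j x) + ∫ x, smulS (RoughNLS.pderiv j f) χ x * toL2 u x := by
      simp only [smul_eq_mul]
      rw [← integral_add (hi _ _) (hi _ _)]
      apply integral_congr_ae
      filter_upwards [mulC_ae hf (grad u j), mulC_ae (hf.pderiv j) (toL2 u),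
        Lp.coeFn_add (mulC hf (grad u j)) (mulC (hf.pderiv j) (toL2 u))] with x h1 h2 h3
      rw [h3, Pi.add_apply, h1, h2, smulS_apply hf, smulS_apply (hf.pderiv j)]
      ring
    exact (e1.trans (by rw [hu])).trans e2.symm⟩

theorem toL2_mulH1 {f : Sp d → ℝ} (hf : IsCbInfty f) (u : H1 d) :
    toL2 (mulH1 hf u) = mulC hf (toL2 u) := rfl

theorem grad_mulH1 {f : Sp d → ℝ} (hf : IsCbInfty f) (u : H1 d) (j : Fin d) :
    grad (mulH1 hf u) j = mulC hf (grad u j) + mulC (hf.pderiv j) (toL2 u) := rfl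

/-- Integration by parts in `H¹`. -/
theorem inner_grad_left (u v : H1 d) (j : Fin d) : ⟪grad u j, toL2 v⟫ = -⟪toL2 u, grad v j⟫ := by
  rw [← Lp.inner_fourier_eq, ← Lp.inner_fourier_eq (toL2 u), inner_eq_integral, inner_eq_integral,
    ← integral_neg]
  apply integral_congr_ae
  filter_upwards [fourier_grad u j, fourier_grad v j] with ξ h1 h2
  rw [h1, h2]
  simp only [map_mul, Complex.conj_ofReal, Complex.conj_I, map_ofNat]
  ring

/-- The operator `u ↦ 2 ∇φ · ∇u + (Δφ) u`. -/
def transport {f : Sp d → ℝ} (hf : IsCbInfty f) : H1 d →L[ℂ] L2 d :=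
  (∑ j, (2 : ℂ) • (mulC (hf.pderiv j) ∘L gradL j))
    + mulC (IsCbInfty.sum Finset.univ fun j => (hf.pderiv j).pderiv j) ∘L toL2L

theorem transport_apply {f : Sp d → ℝ} (hf : IsCbInfty f) (u : H1 d) :
    transport hf u = (∑ j, (2 : ℂ) • mulC (hf.pderiv j) (grad u j))
      + mulC (IsCbInfty.sum Finset.univ fun j => (hf.pderiv j).pderiv j) (toL2 u) := by
  simp [transport]

theorem mulC_sum {ι : Type*} (s : Finset ι) {f : ι → Sp d → ℝ} (hf : ∀ i, IsCbInfty (f i)) (v : L2 d) :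
    mulC (IsCbInfty.sum s hf) v = ∑ i ∈ s, mulC (hf i) v := by
  apply Lp.ext
  have h : ∀ᵐ x, ∀ i ∈ s, mulC (hf i) v x = (f i x : ℂ) * v x := by
    exact (Filter.eventually_all_finset s).2 fun i _ => mulC_ae (hf i) v
  filter_upwards [mulC_ae (IsCbInfty.sum s hf) v, h, Lp.coeFn_finsetSum s fun i => mulC (hf i) v]
    with x h1 h2 h3
  rw [h1, h3, Finset.sum_apply, Finset.sum_congr rfl h2, ← Finset.sum_mul]
  push_cast
  rfl

/-- The operator `u ↦ 2 ∇φ · ∇u + (Δφ) u` is skew-adjoint. -/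
theorem re_inner_transport_self {f : Sp d → ℝ} (hf : IsCbInfty f) (u : H1 d) :
    (⟪toL2 u, transport hf u⟫ : ℂ).re = 0 := by
  rw [transport_apply, mulC_sum Finset.univ fun j => (hf.pderiv j).pderiv j,
    ← Finset.sum_add_distrib, inner_sum, Complex.re_sum]
  apply Finset.sum_eq_zero
  intro j _
  -- Integrating (∂_j f)u against ∂_j u by parts gives 2 Re⟨u, ∂_j f ∂_j u⟩ = -⟨u, ∂_j² f u⟩, which
  -- is the cancellation wanted for each j.
  have h1 := inner_grad_left (mulH1 (hf.pderiv j) u) u j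
  rw [toL2_mulH1, grad_mulH1, inner_add_left, inner_mulC_left (hf.pderiv j),
    inner_mulC_left ((hf.pderiv j).pderiv j), inner_mulC_left (hf.pderiv j)] at h1
  have h2 : (⟪grad u j, mulC (hf.pderiv j) (toL2 u)⟫ : ℂ).re
      = (⟪toL2 u, mulC (hf.pderiv j) (grad u j)⟫ : ℂ).re := by
    rw [← inner_mulC_left (hf.pderiv j), ← inner_conj_symm, Complex.conj_re]
  have h3 := congrArg Complex.re h1
  rw [Complex.add_re, Complex.neg_re, h2] at h3
  rw [inner_add_right, inner_smul_right, Complex.add_re]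
  simp only [Complex.mul_re, Complex.re_ofNat, Complex.im_ofNat, zero_mul, sub_zero]
  linarith

/-! ### Commutators of the heat semigroup with first order operators -/

theorem hasFDerivAt_pk (s : ℝ) (z : Sp d) :
    HasFDerivAt (fun z => pk s z) ((-(2 * Real.pi ^ 2 / s) * pk s z) • innerSL ℝ z) z := by
  have h1 : HasFDerivAt (fun z : Sp d => -(Real.pi ^ 2 / s) * ‖z‖ ^ 2)
      ((-(Real.pi ^ 2 / s)) • ((2 : ℕ) • innerSL ℝ z)) z :=
    (hasStrictFDerivAt_norm_sq z).hasFDerivAt.const_mul _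
  refine (h1.exp.const_mul ((Real.pi / s) ^ ((d : ℝ) / 2))).congr_fderiv ?_
  ext v
  simp [pk]
  ring

theorem pk_le_two_mul {s : ℝ} (hs : 0 < s) (z : Sp d) :
    pk s z ≤ 2 ^ ((d : ℝ) / 2) * pk (2 * s) z := by
  rw [pk_eq_two_mul hs]
  have := pk_nonneg (by positivity : 0 < 2 * s) z
  apply mul_le_of_le_one_right (by positivity)
  rw [Real.exp_le_one_iff]
  have : 0 ≤ Real.pi ^ 2 * ‖z‖ ^ 2 / (2 * s) := by positivity
  linarith

/-- Friedrichs' commutator estimate. -/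
theorem exists_norm_heat_mulC_lineDeriv_le {a : Sp d → ℝ} (ha : IsCbInfty a) :
    ∃ C : ℝ, 0 ≤ C ∧ ∀ {s : ℝ}, 0 < s → ∀ (ψ : 𝓢(Sp d, ℂ)) (j : Fin d),
      ‖heat s (mulC ha (schL2 (∂_{ei j} ψ))) - mulC ha (heat s (schL2 (∂_{ei j} ψ)))‖
        ≤ C * ‖schL2 ψ‖ := by
  obtain ⟨L, hL0, hL⟩ := ha.exists_lipschitz
  set C : ℝ := 2 ^ ((d : ℝ) / 2) * (L + 2 * Real.pi ^ 2 * L) with hC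
  have hC0 : 0 ≤ C := by positivity
  refine ⟨C, hC0, fun {s} hs ψ j => ?_⟩
  set χ : 𝓢(Sp d, ℂ) := ∂_{ei j} ψ with hχ
  have hψc := ψ.continuous
  -- The commutator will be dominated pointwise by C times the heat flow at time 2s of |ψ|, and that
  -- flow is a contraction of L².
  have hN : MemLp (fun y => ((‖ψ y‖ : ℝ) : ℂ)) 2 := (ψ.memLp 2 volume).norm.ofReal
  set nψ : L2 d := hN.toLp with hnψ
  have hnae : nψ =ᵐ[volume] fun y => ((‖ψ y‖ : ℝ) : ℂ) := hN.coeFn_toLp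
  have hNn : ‖nψ‖ = ‖schL2 ψ‖ := by
    rw [← sq_eq_sq₀ (norm_nonneg _) (norm_nonneg _), norm_sq_eq_integral, norm_sq_schL2]
    apply integral_congr_ae
    filter_upwards [hnae] with y hy
    rw [hy, Complex.norm_real, norm_norm]
  rw [← hNn]
  have h2s : 0 < 2 * s := by positivity
  refine le_trans ?_ (mul_le_mul_of_nonneg_left (norm_heat_le (2 * s) nψ) hC0)
  apply Lp.norm_le_mul_norm_of_ae_le_mul
  filter_upwards [Lp.coeFn_sub (heat s (mulC ha (schL2 χ))) (mulC ha (heat s (schL2 χ))),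
    heat_ae hs (mulC ha (schL2 χ)), mulC_ae ha (heat s (schL2 χ)), heat_schwartz_ae hs χ,
    heat_ae h2s nψ] with x h1 h2 h3 h4 h5
  have hae : (fun y => (pk s (x - y) : ℂ) * mulC ha (schL2 χ) y)
      =ᵐ[volume] fun y => (pk s (x - y) : ℂ) * ((a y : ℂ) * χ y) := by
    filter_upwards [mulC_ae ha (schL2 χ), schL2_ae χ] with y hy1 hy2
    rw [hy1, hy2]
  have hN5 : ∫ y, (pk (2 * s) (x - y) : ℂ) * nψ y = ((∫ y, pk (2 * s) (x - y) * ‖ψ y‖ : ℝ) : ℂ) := by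
    rw [← integral_complex_ofReal]
    apply integral_congr_ae
    filter_upwards [hnae] with y hy
    rw [hy]
    push_cast
    rfl
  have hpb : ∀ y, pk s (x - y) ≤ (Real.pi / s) ^ ((d : ℝ) / 2) := fun y => pk_le hs _
  have hpb2 : ∀ y, pk (2 * s) (x - y) ≤ (Real.pi / (2 * s)) ^ ((d : ℝ) / 2) := fun y => pk_le h2s _
  have hp0 : ∀ y, 0 ≤ pk s (x - y) := fun y => pk_nonneg hs _
  have hp20 : ∀ y, 0 ≤ pk (2 * s) (x - y) := fun y => pk_nonneg h2s _
  obtain ⟨K, hK0, hK⟩ := ha.exists_bound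
  have hac := ha.continuous
  have hχc := χ.continuous
  rw [h1, Pi.sub_apply, h2, h3, h4, integral_congr_ae hae, h5, hN5]
  -- This is the kernel of the commutator, onto which the derivative of ψ is moved by parts.
  -- Differentiating the Gaussian costs |x-y|/s and a(y)-a(x) gains |x-y|; as |x-y|² times the
  -- kernel is at most s times the kernel at 2s, up to a constant, the factor 1/s cancels.
  set F : Sp d → ℝ := fun y => pk s (x - y) * (a y - a x) with hF
  set F' : Sp d → (Sp d →L[ℝ] ℝ) := fun y => pk s (x - y) • fderiv ℝ a y
    + ((a y - a x) * (2 * Real.pi ^ 2 / s * pk s (x - y))) • innerSL ℝ (x - y) with hF'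
  have hFd : ∀ y, HasFDerivAt F (F' y) y := by
    intro y
    have e1 : HasFDerivAt (fun y => pk s (x - y)) _ y :=
      (hasFDerivAt_pk s (x - y)).comp y ((hasFDerivAt_id y).const_sub x)
    have e2 : HasFDerivAt (fun y => a y - a x) (fderiv ℝ a y) y :=
      (ha.differentiable y).hasFDerivAt.sub_const _
    refine (e1.mul e2).congr_fderiv ?_
    ext v
    simp [hF']
    ring
  have hmulint : ∀ (θ : 𝓢(Sp d, ℂ)) (g : Sp d → ℝ) (M : ℝ), Continuous g → (∀ y, |g y| ≤ M) →
      Integrable fun y => g y • θ y := by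
    intro θ g M hg hM
    refine (θ.integrable (μ := volume)).norm.const_mul M |>.mono' ?_ ?_
    · have := θ.continuous
      exact Continuous.aestronglyMeasurable (by fun_prop)
    · filter_upwards with y
      rw [norm_smul]
      gcongr
      exact hM y
  have hFle : ∀ y, |F y| ≤ (Real.pi / s) ^ ((d : ℝ) / 2) * (K + K) := by
    intro y
    rw [hF, abs_mul, abs_of_nonneg (hp0 y)]
    gcongr
    · exact hpb y
    · exact (abs_sub _ _).trans (add_le_add (hK y) (hK x))
  have hF'le : ∀ y, |F' y (ei j)| ≤ C * pk (2 * s) (x - y) := by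
    intro y
    have e1 : F' y (ei j) = pk s (x - y) * fderiv ℝ a y (ei j)
        + (a y - a x) * (2 * Real.pi ^ 2 / s * pk s (x - y)) * inner ℝ (x - y) (ei j) := by
      simp only [hF', add_apply, smul_apply, innerSL_apply_apply, smul_eq_mul]
    have e2 : |fderiv ℝ a y (ei j)| ≤ L := by
      have h7 : ‖fderiv ℝ a y‖ ≤ L := by
        apply norm_fderiv_le_of_lip' ℝ hL0
        filter_upwards with z
        exact hL z y
      refine ((fderiv ℝ a y).le_opNorm (ei j)).trans ?_
      simpa using h7
    have e3 : |inner ℝ (x - y) (ei j)| ≤ ‖x - y‖ := by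
      refine (abs_real_inner_le_norm _ _).trans ?_
      simp
    have e4 : |a y - a x| ≤ L * ‖x - y‖ := by
      rw [norm_sub_rev]
      exact hL y x
    rw [e1]
    calc _ ≤ pk s (x - y) * L + L * ‖x - y‖ * (2 * Real.pi ^ 2 / s * pk s (x - y)) * ‖x - y‖ := by
          refine (abs_add_le _ _).trans ?_
          have h8 : 0 ≤ 2 * Real.pi ^ 2 / s * pk s (x - y) := mul_nonneg (by positivity) (hp0 y)
          rw [abs_mul, abs_mul, abs_mul (a y - a x), abs_of_nonneg (hp0 y), abs_of_nonneg h8]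
          exact add_le_add (mul_le_mul_of_nonneg_left e2 (hp0 y))
            (mul_le_mul (mul_le_mul_of_nonneg_right e4 h8) e3 (abs_nonneg _) (by positivity))
      _ = pk s (x - y) * L + L * (2 * Real.pi ^ 2 / s) * (‖x - y‖ ^ 2 * pk s (x - y)) := by ring
      _ ≤ (2 ^ ((d : ℝ) / 2) * pk (2 * s) (x - y)) * L + L * (2 * Real.pi ^ 2 / s)
            * (2 ^ ((d : ℝ) / 2) * s * pk (2 * s) (x - y)) := by
          exact add_le_add (mul_le_mul_of_nonneg_right (pk_le_two_mul hs _) hL0)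
            (mul_le_mul_of_nonneg_left (sq_norm_mul_pk_le hs _) (by positivity))
      _ = _ := by rw [hC]; field_simp
  have hFc : Continuous F := by fun_prop
  have hF'c : Continuous fun y => F' y (ei j) := by
    have := ha.1.continuous_fderiv (by simp)
    simp only [hF', add_apply, smul_apply, innerSL_apply_apply]
    fun_prop
  have hpar := integral_bilinear_hasFDerivAt_right_eq_neg_left_of_integrable (μ := volume)
    (f := F) (f' := F') (g := ψ) (g' := fun y => fderiv ℝ ψ y) (v := ei j)
    (B := ContinuousLinearMap.lsmul ℝ ℝ)
    (hmulint ψ _ (C * (Real.pi / (2 * s)) ^ ((d : ℝ) / 2)) hF'c fun y => (hF'le y).trans (by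
      gcongr; exact hpb2 y))
    (hmulint χ F _ hFc hFle) (hmulint ψ F _ hFc hFle) (fun y _ => hFd y)
    (fun y _ => ((ψ.smooth 1).differentiable one_ne_zero y).hasFDerivAt)
  simp only [ContinuousLinearMap.lsmul_apply] at hpar
  have hlhs : (∫ y, (pk s (x - y) : ℂ) * ((a y : ℂ) * χ y)) - (a x : ℂ) * ∫ y, (pk s (x - y) : ℂ) * χ y
      = ∫ y, F y • fderiv ℝ ψ y (ei j) := by
    rw [← integral_const_mul, ← integral_sub]
    · congr 1
      funext y
      rw [hχ, SchwartzMap.lineDerivOp_apply_eq_fderiv, hF, Complex.real_smul]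
      push_cast
      ring
    · refine (hmulint χ (fun y => pk s (x - y) * a y) ((Real.pi / s) ^ ((d : ℝ) / 2) * K)
        (by fun_prop) fun y => ?_).congr (Eventually.of_forall fun y => ?_)
      · rw [abs_mul, abs_of_nonneg (hp0 y)]
        gcongr
        · exact hpb y
        · exact hK y
      · simp only [Complex.real_smul]
        push_cast; ring
    · refine ((hmulint χ (fun y => pk s (x - y)) ((Real.pi / s) ^ ((d : ℝ) / 2))
        (by fun_prop) fun y => ?_).const_mul (a x : ℂ)).congr (Eventually.of_forall fun y => ?_)
      · rw [abs_of_nonneg (hp0 y)]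
        exact hpb y
      · simp only [Complex.real_smul]
  rw [hlhs, hpar, norm_neg, Complex.norm_real, Real.norm_of_nonneg (integral_nonneg fun y =>
    mul_nonneg (hp20 y) (norm_nonneg _)), ← integral_const_mul]
  refine norm_integral_le_of_norm_le ?_ (Eventually.of_forall fun y => ?_)
  · refine ((hmulint ψ (fun y => pk (2 * s) (x - y)) ((Real.pi / (2 * s)) ^ ((d : ℝ) / 2))
      (by fun_prop) fun y => ?_).norm.const_mul C).congr (Eventually.of_forall fun y => ?_)
    · rw [abs_of_nonneg (hp20 y)]
      exact hpb2 y
    · simp only [norm_smul, Real.norm_of_nonneg (hp20 y)]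
  · rw [norm_smul, ← mul_assoc]
    gcongr
    exact hF'le y

/-- Only the first-order part needs the Friedrichs cancellation. The multiplication by Δf is bounded
on L² and its two occurrences are estimated separately. -/
theorem exists_norm_heat_transport_le {f : Sp d → ℝ} (hf : IsCbInfty f) :
    ∃ C : ℝ, 0 ≤ C ∧ ∀ {s : ℝ} (hs : 0 < s) (ψ : 𝓢(Sp d, ℂ)),
      ‖heat s (transport hf (ofSchwartz ψ)) - transport hf (heatH1 hs (schL2 ψ))‖
        ≤ C * ‖schL2 ψ‖ := by
  choose C hC0 hC using fun j => exists_norm_heat_mulC_lineDeriv_le (hf.pderiv j)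
  have hΔ := IsCbInfty.sum Finset.univ fun j => (hf.pderiv j).pderiv j
  obtain ⟨K, hK0, hK⟩ := hΔ.exists_bound
  refine ⟨(∑ j, 2 * C j) + (K + K), add_nonneg (Finset.sum_nonneg fun j _ => mul_nonneg two_pos.le (hC0 j))
    (add_nonneg hK0 hK0), fun {s} hs ψ => ?_⟩
  have e1 : heat s (transport hf (ofSchwartz ψ)) - transport hf (heatH1 hs (schL2 ψ))
      = (∑ j, (2 : ℂ) • (heat s (mulC (hf.pderiv j) (schL2 (∂_{ei j} ψ)))
          - mulC (hf.pderiv j) (heat s (schL2 (∂_{ei j} ψ)))))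
        + (heat s (mulC hΔ (schL2 ψ)) - mulC hΔ (heat s (schL2 ψ))) := by
    have hg : ∀ j, grad (heatH1 hs (schL2 ψ)) j = heat s (schL2 (∂_{ei j} ψ)) := fun j =>
      grad_heatH1 hs (ofSchwartz ψ) j
    rw [transport_apply, transport_apply]
    simp only [hg, toL2_heatH1, toL2_ofSchwartz, grad_ofSchwartz, map_add, map_sum, map_smul,
      smul_sub, Finset.sum_sub_distrib]
    abel
  rw [e1]
  refine (norm_add_le _ _).trans ?_
  rw [add_mul]
  gcongr
  · refine (norm_sum_le _ _).trans ?_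
    rw [Finset.sum_mul]
    gcongr with j
    rw [norm_smul, Complex.norm_ofNat, mul_assoc]
    gcongr
    exact hC j hs ψ j
  · refine (norm_sub_le _ _).trans ?_
    rw [add_mul]
    gcongr
    · exact (norm_heat_le _ _).trans (norm_mulC_le hΔ hK _)
    · refine (norm_mulC_le hΔ hK _).trans ?_
      gcongr
      exact norm_heat_le _ _

/-! ### Quadratic forms of first order operators -/

theorem lineDeriv_lineDeriv_comm (ψ : 𝓢(Sp d, ℂ)) (j k : Fin d) :
    (∂_{ei k} (∂_{ei j} ψ) : 𝓢(Sp d, ℂ)) = ∂_{ei j} (∂_{ei k} ψ) := by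
  ext x
  have hψ : ContDiff ℝ 2 ψ := ψ.smooth 2
  have hd1 : Differentiable ℝ (fderiv ℝ ψ) :=
    (hψ.fderiv_right (m := 1) (by norm_num)).differentiable one_ne_zero
  have h1 : ∀ j : Fin d, ((∂_{ei j} ψ : 𝓢(Sp d, ℂ)) : Sp d → ℂ) = fun y => fderiv ℝ ψ y (ei j) := by
    intro j
    funext y
    rw [SchwartzMap.lineDerivOp_apply_eq_fderiv]
  have h2 : ∀ j k : Fin d, fderiv ℝ (fun y => fderiv ℝ ψ y (ei j)) x (ei k)
      = fderiv ℝ (fderiv ℝ ψ) x (ei k) (ei j) := by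
    intro j k
    rw [fderiv_clm_apply (hd1 x) (differentiableAt_const _)]
    simp
  rw [SchwartzMap.lineDerivOp_apply_eq_fderiv, SchwartzMap.lineDerivOp_apply_eq_fderiv, h1, h1, h2, h2]
  exact (hψ.contDiffAt.isSymmSndFDerivAt (by simp)) _ _

/-- The commutator of `∂_k` with `2 ∇f·∇ + Δf`. -/
def transportComm {f : Sp d → ℝ} (hf : IsCbInfty f) (k : Fin d) : H1 d →L[ℂ] L2 d :=
  (∑ j, (2 : ℂ) • (mulC ((hf.pderiv j).pderiv k) ∘L gradL j))
    + mulC ((IsCbInfty.sum Finset.univ fun j => (hf.pderiv j).pderiv j).pderiv k) ∘L toL2L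

theorem transportComm_apply {f : Sp d → ℝ} (hf : IsCbInfty f) (k : Fin d) (u : H1 d) :
    transportComm hf k u = (∑ j, (2 : ℂ) • mulC ((hf.pderiv j).pderiv k) (grad u j))
      + mulC ((IsCbInfty.sum Finset.univ fun j => (hf.pderiv j).pderiv j).pderiv k) (toL2 u) := by
  simp [transportComm]

/-- For Schwartz ψ the transported function is again in H¹, so the Laplacian paired with it can be
split into two gradients. This is where `transportComm` appears. -/
theorem exists_H1_transport {f : Sp d → ℝ} (hf : IsCbInfty f) (ψ : 𝓢(Sp d, ℂ)) :
    ∃ w : H1 d, toL2 w = transport hf (ofSchwartz ψ) ∧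
      ∀ k, grad w k = transport hf (ofSchwartz (∂_{ei k} ψ)) + transportComm hf k (ofSchwartz ψ) := by
  set hΔ := IsCbInfty.sum Finset.univ fun j => (hf.pderiv j).pderiv j with hΔdef
  refine ⟨(∑ j, (2 : ℂ) • mulH1 (hf.pderiv j) (ofSchwartz (∂_{ei j} ψ))) + mulH1 hΔ (ofSchwartz ψ), ?_, ?_⟩
  · rw [← toL2L_apply, map_add, map_sum, transport_apply]
    simp only [map_smul, toL2L_apply, toL2_mulH1, toL2_ofSchwartz, grad_ofSchwartz]
  · intro k
    rw [← gradL_apply, map_add, map_sum, transport_apply, transportComm_apply]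
    simp only [map_smul, gradL_apply, grad_mulH1, toL2_ofSchwartz, grad_ofSchwartz, smul_add,
      Finset.sum_add_distrib, lineDeriv_lineDeriv_comm ψ _ k]
    abel

/-- With total time s + s, half of the smoothing falls on each factor. This symmetry is what allows
skewness to be used on the smoothed functions. -/
theorem inner_lap_add {s : ℝ} (hs : 0 < s) (w u : H1 d) :
    ⟪toL2 w, lap (s + s) (toL2 u)⟫ = ∑ k, ⟪heat s (grad w k), heat s (grad u k)⟫ := by
  have h := sum_inner_grad_heatH1 hs (toL2 w) (heatH1 hs (toL2 u))
  rw [toL2_heatH1, lap_heat hs hs] at h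
  rw [← h]
  simp only [grad_heatH1]

theorem abs_re_inner_le (v w : L2 d) : |(⟪v, w⟫ : ℂ).re| ≤ ‖v‖ * ‖w‖ :=
  (Complex.abs_re_le_norm _).trans (norm_inner_le_norm _ _)

theorem re_inner_transport_eq {f : Sp d → ℝ} (hf : IsCbInfty f) {s : ℝ} (hs : 0 < s)
    (ψ : 𝓢(Sp d, ℂ)) :
    (⟪transport hf (ofSchwartz ψ), lap (s + s) (toL2 (ofSchwartz ψ))⟫ : ℂ).re
      = ∑ k, ((⟪heat s (transport hf (ofSchwartz (∂_{ei k} ψ))), heat s (schL2 (∂_{ei k} ψ))⟫ : ℂ).re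
        + (⟪heat s (transportComm hf k (ofSchwartz ψ)), heat s (grad (ofSchwartz ψ) k)⟫ : ℂ).re) := by
  obtain ⟨w, hw, hwk⟩ := exists_H1_transport hf ψ
  rw [← hw, inner_lap_add hs, Complex.re_sum]
  refine Finset.sum_congr rfl fun k _ => ?_
  rw [hwk, map_add, inner_add_left, Complex.add_re, grad_ofSchwartz]

/-- The dangerous term contains `transport` applied to ∂_kψ, hence second derivatives. Skewness
makes the form of `transport` vanish on the smoothed ∂_kψ, so only the commutator with the heat
semigroup is left, and it is bounded by ‖∂_kψ‖² uniformly in s. -/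
theorem exists_re_inner_transport_schwartz_le {f : Sp d → ℝ} (hf : IsCbInfty f) :
    ∃ C : ℝ, 0 ≤ C ∧ ∀ {s : ℝ} (_ : 0 < s) (ψ : 𝓢(Sp d, ℂ)),
      |(⟪transport hf (ofSchwartz ψ), lap (s + s) (toL2 (ofSchwartz ψ))⟫ : ℂ).re|
        ≤ C * ‖ofSchwartz ψ‖ ^ 2 := by
  obtain ⟨C, hC0, hC⟩ := exists_norm_heat_transport_le hf
  refine ⟨∑ k, (C + ‖transportComm hf k‖), Finset.sum_nonneg fun k _ => by positivity, fun {s} hs ψ => ?_⟩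
  rw [re_inner_transport_eq hf hs, Finset.sum_mul]
  refine (Finset.abs_sum_le_sum_abs _ _).trans (Finset.sum_le_sum fun k _ => ?_)
  set u := ofSchwartz ψ
  have hgk : ‖schL2 (∂_{ei k} ψ : 𝓢(Sp d, ℂ))‖ ≤ ‖u‖ := by
    rw [← grad_ofSchwartz]; exact norm_grad_le _ _
  have h1 := re_inner_transport_self hf (heatH1 hs (schL2 (∂_{ei k} ψ)))
  rw [toL2_heatH1, ← inner_conj_symm, Complex.conj_re] at h1
  have h2 : (⟪heat s (transport hf (ofSchwartz (∂_{ei k} ψ))), heat s (schL2 (∂_{ei k} ψ))⟫ : ℂ).re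
      = (⟪heat s (transport hf (ofSchwartz (∂_{ei k} ψ)))
          - transport hf (heatH1 hs (schL2 (∂_{ei k} ψ))), heat s (schL2 (∂_{ei k} ψ))⟫ : ℂ).re := by
    rw [inner_sub_left, Complex.sub_re, h1, sub_zero]
  rw [h2]
  refine (abs_add_le _ _).trans ?_
  rw [add_mul]
  refine add_le_add ((abs_re_inner_le _ _).trans ?_) ((abs_re_inner_le _ _).trans ?_)
  · calc _ ≤ (C * ‖schL2 (∂_{ei k} ψ : 𝓢(Sp d, ℂ))‖) * ‖schL2 (∂_{ei k} ψ : 𝓢(Sp d, ℂ))‖ :=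
          mul_le_mul (hC hs _) (norm_heat_le _ _) (norm_nonneg _) (by positivity)
      _ ≤ (C * ‖u‖) * ‖u‖ := by gcongr
      _ = _ := by ring
  · calc _ ≤ (‖transportComm hf k‖ * ‖u‖) * ‖u‖ :=
          mul_le_mul ((norm_heat_le _ _).trans (ContinuousLinearMap.le_opNorm _ _))
            ((norm_heat_le _ _).trans (norm_grad_le _ _)) (norm_nonneg _) (by positivity)
      _ = _ := by ring

theorem exists_re_inner_transport_le {f : Sp d → ℝ} (hf : IsCbInfty f) :
    ∃ C : ℝ, 0 ≤ C ∧ ∀ {s : ℝ} (_ : 0 < s) (u : H1 d),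
      |(⟪transport hf u, lap (s + s) (toL2 u)⟫ : ℂ).re| ≤ C * ‖u‖ ^ 2 := by
  obtain ⟨C, hC0, hC⟩ := exists_re_inner_transport_schwartz_le hf
  refine ⟨C, hC0, fun {s} hs u => ?_⟩
  refine denseRange_ofSchwartz.induction_on u ?_ fun ψ => hC hs ψ
  refine isClosed_le ?_ (by fun_prop)
  simp only [← toL2L_apply]
  fun_prop

/-! ### Limits of the quadratic forms along dyadic times. -/

theorem tendsto_nhdsWithin_dyadic : Tendsto (fun j : ℕ => (2 : ℝ)⁻¹ ^ j) atTop (𝓝[>] 0) := by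
  refine tendsto_nhdsWithin_iff.2 ⟨tendsto_pow_atTop_nhds_zero_of_lt_one (by norm_num) (by norm_num), ?_⟩
  exact Eventually.of_forall fun j => by simp only [Set.mem_Ioi]; positivity

theorem dyadic_pos (j : ℕ) : (0 : ℝ) < 2⁻¹ ^ j := by positivity

theorem tendsto_heat_dyadic (v : L2 d) : Tendsto (fun j : ℕ => heat ((2 : ℝ)⁻¹ ^ j) v) atTop (𝓝 v) :=
  (tendsto_heat v).comp tendsto_nhdsWithin_dyadic

theorem tendsto_re_inner_heat (v w : L2 d) :
    Tendsto (fun j : ℕ => (⟪heat ((2 : ℝ)⁻¹ ^ j) v, heat ((2 : ℝ)⁻¹ ^ j) w⟫ : ℂ).re) atTop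
      (𝓝 (⟪v, w⟫ : ℂ).re) :=
  (Complex.continuous_re.tendsto _).comp ((tendsto_heat_dyadic v).inner (tendsto_heat_dyadic w))

/-- For Schwartz ψ all factors lie in L² and the smoothing can be removed directly. The term with
`transport` of ∂_kψ then vanishes by skewness. -/
theorem tendsto_re_inner_transport_schwartz {f : Sp d → ℝ} (hf : IsCbInfty f) (ψ : 𝓢(Sp d, ℂ)) :
    Tendsto (fun j : ℕ => (⟪transport hf (ofSchwartz ψ),
      lap ((2 : ℝ)⁻¹ ^ j + (2 : ℝ)⁻¹ ^ j) (toL2 (ofSchwartz ψ))⟫ : ℂ).re) atTop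
      (𝓝 (∑ k, (⟪transportComm hf k (ofSchwartz ψ), grad (ofSchwartz ψ) k⟫ : ℂ).re)) := by
  simp only [re_inner_transport_eq hf (dyadic_pos _)]
  refine tendsto_finsetSum _ fun k _ => ?_
  have h1 := re_inner_transport_self hf (ofSchwartz (∂_{ei k} ψ))
  rw [← inner_conj_symm, Complex.conj_re, toL2_ofSchwartz] at h1
  have := (tendsto_re_inner_heat (transport hf (ofSchwartz (∂_{ei k} ψ))) (schL2 (∂_{ei k} ψ))).add
    (tendsto_re_inner_heat (transportComm hf k (ofSchwartz ψ)) (grad (ofSchwartz ψ) k))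
  rwa [h1, zero_add] at this

/-- A bounded quadratic form is locally Lipschitz. -/
theorem abs_re_inner_sub_le {E F : Type*} [NormedAddCommGroup E] [NormedSpace ℂ E]
    [NormedAddCommGroup F] [InnerProductSpace ℂ F] (L M : E →ₗ[ℂ] F) {C : ℝ}
    (h : ∀ u, |(⟪L u, M u⟫ : ℂ).re| ≤ C * ‖u‖ ^ 2) (u v : E) {r : ℝ} (hr : 0 < r) :
    |(⟪L u, M u⟫ : ℂ).re - (⟪L v, M v⟫ : ℂ).re| ≤ C * (r ^ 2 * ‖u - v‖ ^ 2 + r⁻¹ ^ 2 * ‖u + v‖ ^ 2) := by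
  have hC : 0 ≤ C * (r ^ 2 * ‖u - v‖ ^ 2 + r⁻¹ ^ 2 * ‖u + v‖ ^ 2) := by
    have h1 := (abs_nonneg _).trans (h (u - v))
    have h2 := (abs_nonneg _).trans (h (u + v))
    have : C * (r ^ 2 * ‖u - v‖ ^ 2 + r⁻¹ ^ 2 * ‖u + v‖ ^ 2)
      = r ^ 2 * (C * ‖u - v‖ ^ 2) + r⁻¹ ^ 2 * (C * ‖u + v‖ ^ 2) := by ring
    rw [this]
    positivity
  -- Polarisation with a weight: 4(q(u)-q(v)) = q(x+y)-q(x-y). The scale r makes the contribution of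
  -- u+v small when r is large, at the price of r² on u-v.
  set x := (r : ℂ) • (u - v)
  set y := ((r⁻¹ : ℝ) : ℂ) • (u + v)
  have hx : ‖x‖ = r * ‖u - v‖ := by
    rw [norm_smul, Complex.norm_real, Real.norm_of_nonneg hr.le]
  have hy : ‖y‖ = r⁻¹ * ‖u + v‖ := by
    rw [norm_smul, Complex.norm_real, Real.norm_of_nonneg (by positivity)]
  have e : 4 * ((⟪L u, M u⟫ : ℂ).re - (⟪L v, M v⟫ : ℂ).re)
      = (⟪L (x + y), M (x + y)⟫ : ℂ).re - (⟪L (x - y), M (x - y)⟫ : ℂ).re := by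
    have e1 : (⟪L (x + y), M (x + y)⟫ : ℂ) - ⟪L (x - y), M (x - y)⟫
        = 2 * (⟪L x, M y⟫ + ⟪L y, M x⟫) := by
      simp only [map_add, map_sub, inner_add_left, inner_add_right, inner_sub_left, inner_sub_right]
      ring
    have hr' : (r : ℂ) ≠ 0 := by exact_mod_cast hr.ne'
    have e2 : (⟪L x, M y⟫ : ℂ) = ⟪L (u - v), M (u + v)⟫ := by
      simp only [x, y, map_smul, inner_smul_left, inner_smul_right, Complex.conj_ofReal]
      push_cast; field_simp
    have e3 : (⟪L y, M x⟫ : ℂ) = ⟪L (u + v), M (u - v)⟫ := by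
      simp only [x, y, map_smul, inner_smul_left, inner_smul_right, Complex.conj_ofReal]
      push_cast; field_simp
    have e4 : (2 : ℂ) * (⟪L (u - v), M (u + v)⟫ + ⟪L (u + v), M (u - v)⟫)
        = (4 : ℝ) * (⟪L u, M u⟫ - ⟪L v, M v⟫) := by
      simp only [map_add, map_sub, inner_add_left, inner_add_right, inner_sub_left, inner_sub_right]
      push_cast; ring
    rw [← Complex.sub_re, ← Complex.sub_re, e1, e2, e3, e4, Complex.re_ofReal_mul]
  have hpm : ‖x + y‖ ^ 2 ≤ 2 * (‖x‖ ^ 2 + ‖y‖ ^ 2) := by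
    have := norm_add_le x y
    nlinarith [sq_nonneg (‖x‖ - ‖y‖), norm_nonneg (x + y), norm_nonneg x, norm_nonneg y]
  have hpm' : ‖x - y‖ ^ 2 ≤ 2 * (‖x‖ ^ 2 + ‖y‖ ^ 2) := by
    have := norm_sub_le x y
    nlinarith [sq_nonneg (‖x‖ - ‖y‖), norm_nonneg (x - y), norm_nonneg x, norm_nonneg y]
  -- No sign of `C` is assumed. It is nonnegative as soon as x or y has nonzero norm, and otherwise
  -- both forms vanish.
  by_cases hz : ‖x‖ ^ 2 + ‖y‖ ^ 2 = 0
  · have h1 := h (x + y)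
    have h2 := h (x - y)
    have z1 : ‖x + y‖ ^ 2 = 0 := le_antisymm (by linarith) (sq_nonneg _)
    have z2 : ‖x - y‖ ^ 2 = 0 := le_antisymm (by linarith) (sq_nonneg _)
    rw [z1, mul_zero] at h1
    rw [z2, mul_zero] at h2
    have h3 := abs_nonpos_iff.1 h1
    have h4 := abs_nonpos_iff.1 h2
    rw [h3, h4] at e
    have : (⟪L u, M u⟫ : ℂ).re - (⟪L v, M v⟫ : ℂ).re = 0 := by linarith
    rw [this, abs_zero]
    exact hC
  · have hpos : 0 < ‖x‖ ^ 2 + ‖y‖ ^ 2 := lt_of_le_of_ne (by positivity) (Ne.symm hz)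
    have hxy : r ^ 2 * ‖u - v‖ ^ 2 + r⁻¹ ^ 2 * ‖u + v‖ ^ 2 = ‖x‖ ^ 2 + ‖y‖ ^ 2 := by
      rw [hx, hy]; ring
    rw [hxy] at hC ⊢
    have hC0 : 0 ≤ C := nonneg_of_mul_nonneg_left hC hpos
    have h1 := (h (x + y)).trans (mul_le_mul_of_nonneg_left hpm hC0)
    have h2 := (h (x - y)).trans (mul_le_mul_of_nonneg_left hpm' hC0)
    rw [abs_le] at h1 h2 ⊢
    constructor <;> linarith [h1.1, h1.2, h2.1, h2.2]

/-- Uniformly bounded quadratic forms that converge on a dense set converge everywhere, as uniform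
boundedness makes them equicontinuous. -/
theorem tendsto_quadratic_of_denseRange {E F ι α : Type*} [NormedAddCommGroup E] [NormedSpace ℂ E]
    [NormedAddCommGroup F] [InnerProductSpace ℂ F] {l : Filter ι} (L : E →ₗ[ℂ] F)
    (M : ι → E →ₗ[ℂ] F) {D : E → ℝ} (hD : Continuous D) {C : ℝ}
    (h : ∀ i u, |(⟪L u, M i u⟫ : ℂ).re| ≤ C * ‖u‖ ^ 2) {g : α → E} (hg : DenseRange g)
    (hlim : ∀ a, Tendsto (fun i => (⟪L (g a), M i (g a)⟫ : ℂ).re) l (𝓝 (D (g a)))) (u : E) :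
    Tendsto (fun i => (⟪L u, M i u⟫ : ℂ).re) l (𝓝 (D u)) := by
  rw [Metric.tendsto_nhds]
  intro ε hε
  set K := |C| * (2 * ‖u‖ + 1) ^ 2 with hK
  -- The order of choices matters: r is taken large first, and the approximant is then taken close
  -- to u depending on r.
  obtain ⟨r, hr, hrK⟩ : ∃ r : ℝ, 0 < r ∧ r⁻¹ ^ 2 * K < ε / 4 := by
    have h1 : Tendsto (fun r : ℝ => r⁻¹ ^ 2 * K) atTop (𝓝 (0 ^ 2 * K)) :=
      (tendsto_inv_atTop_zero.pow 2).mul_const K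
    rw [zero_pow two_ne_zero, zero_mul] at h1
    exact ((eventually_gt_atTop 0).and (h1.eventually (gt_mem_nhds (by positivity)))).exists
  have hev : ∀ᶠ v in 𝓝 u, |C| * (r ^ 2 * ‖u - v‖ ^ 2) < ε / 4 ∧ ‖u - v‖ < 1 ∧ |D v - D u| < ε / 4 := by
    have h1 : Tendsto (fun v => |C| * (r ^ 2 * ‖u - v‖ ^ 2)) (𝓝 u) (𝓝 (|C| * (r ^ 2 * ‖u - u‖ ^ 2))) :=
      Continuous.tendsto (by fun_prop) u
    have h2 : Tendsto (fun v => ‖u - v‖) (𝓝 u) (𝓝 ‖u - u‖) := Continuous.tendsto (by fun_prop) u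
    have h3 : Tendsto (fun v => |D v - D u|) (𝓝 u) (𝓝 |D u - D u|) :=
      Continuous.tendsto (by fun_prop) u
    simp only [sub_self, norm_zero, abs_zero, ne_eq, OfNat.ofNat_ne_zero, not_false_eq_true, zero_pow,
      mul_zero] at h1 h2 h3
    exact (h1.eventually (gt_mem_nhds (by positivity))).and
      ((h2.eventually (gt_mem_nhds one_pos)).and (h3.eventually (gt_mem_nhds (by positivity))))
  obtain ⟨a, ha1, ha2, ha3⟩ := hg.exists_mem_open isOpen_interior
    ⟨u, mem_interior_iff_mem_nhds.2 hev⟩ |>.imp fun a ha => interior_subset ha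
  filter_upwards [(Metric.tendsto_nhds.1 (hlim a)) (ε / 4) (by positivity)] with i hi
  rw [Real.dist_eq] at hi ⊢
  have h1 := abs_re_inner_sub_le L (M i) (h i) u (g a) hr
  have h2 : ‖u + g a‖ ≤ 2 * ‖u‖ + 1 := by
    have : u + g a = (2 : ℝ) • u - (u - g a) := by rw [two_smul]; abel
    rw [this]
    refine (norm_sub_le _ _).trans ?_
    rw [norm_smul]
    simp only [Real.norm_ofNat]
    linarith
  have h3 : C * (r ^ 2 * ‖u - g a‖ ^ 2 + r⁻¹ ^ 2 * ‖u + g a‖ ^ 2) < ε / 2 := by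
    calc _ ≤ |C| * (r ^ 2 * ‖u - g a‖ ^ 2 + r⁻¹ ^ 2 * (2 * ‖u‖ + 1) ^ 2) := by
          refine (mul_le_mul_of_nonneg_right (le_abs_self C) (by positivity)).trans ?_
          gcongr
      _ = |C| * (r ^ 2 * ‖u - g a‖ ^ 2) + r⁻¹ ^ 2 * K := by rw [hK]; ring
      _ < _ := by linarith
  rw [abs_lt] at *
  rw [abs_le] at h1
  constructor <;> linarith [h1.1, h1.2, hi.1, hi.2, ha3.1, ha3.2]

theorem tendsto_re_inner_transport {f : Sp d → ℝ} (hf : IsCbInfty f) (u : H1 d) :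
    Tendsto (fun j : ℕ => (⟪transport hf u,
      lap ((2 : ℝ)⁻¹ ^ j + (2 : ℝ)⁻¹ ^ j) (toL2 u)⟫ : ℂ).re) atTop
      (𝓝 (∑ k, (⟪transportComm hf k u, grad u k⟫ : ℂ).re)) := by
  obtain ⟨C, -, hC⟩ := exists_re_inner_transport_le hf
  have hD : Continuous fun u : H1 d => ∑ k, (⟪transportComm hf k u, grad u k⟫ : ℂ).re := by
    simp only [← gradL_apply]
    fun_prop
  exact tendsto_quadratic_of_denseRange (transport hf).toLinearMap
    (fun j : ℕ => (lap ((2 : ℝ)⁻¹ ^ j + (2 : ℝ)⁻¹ ^ j) ∘L toL2L).toLinearMap) hD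
    (fun j u => by simpa using hC (dyadic_pos j) u) denseRange_ofSchwartz
    (fun ψ => by simpa using tendsto_re_inner_transport_schwartz hf ψ) u

/-! ### The potential part of the noise. -/

/-- Multiplication by `i g`, as an operator from `H¹` to `L²`. -/
def potential {g : Sp d → ℝ} (hg : IsCbInfty g) : H1 d →L[ℂ] L2 d :=
  Complex.I • (mulC hg ∘L toL2L)

theorem potential_apply {g : Sp d → ℝ} (hg : IsCbInfty g) (u : H1 d) :
    potential hg u = Complex.I • mulC hg (toL2 u) := by
  simp [potential]

/-- The derivative `∂_k` of `i g u`. -/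
def potentialDeriv {g : Sp d → ℝ} (hg : IsCbInfty g) (k : Fin d) : H1 d →L[ℂ] L2 d :=
  Complex.I • (mulC hg ∘L gradL k + mulC (hg.pderiv k) ∘L toL2L)

theorem potentialDeriv_apply {g : Sp d → ℝ} (hg : IsCbInfty g) (k : Fin d) (u : H1 d) :
    potentialDeriv hg k u = Complex.I • (mulC hg (grad u k) + mulC (hg.pderiv k) (toL2 u)) := by
  simp [potentialDeriv]

theorem re_inner_potential_eq {g : Sp d → ℝ} (hg : IsCbInfty g) {s : ℝ} (hs : 0 < s) (u : H1 d) :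
    (⟪potential hg u, lap (s + s) (toL2 u)⟫ : ℂ).re
      = ∑ k, (⟪heat s (potentialDeriv hg k u), heat s (grad u k)⟫ : ℂ).re := by
  have h1 : potential hg u = toL2 (Complex.I • mulH1 hg u) := by
    rw [← toL2L_apply, map_smul, toL2L_apply, toL2_mulH1, potential_apply]
  rw [h1, inner_lap_add hs, Complex.re_sum]
  refine Finset.sum_congr rfl fun k _ => ?_
  rw [← gradL_apply k (Complex.I • _), map_smul, gradL_apply, grad_mulH1, potentialDeriv_apply]

theorem exists_re_inner_potential_le {g : Sp d → ℝ} (hg : IsCbInfty g) :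
    ∃ C : ℝ, 0 ≤ C ∧ ∀ {s : ℝ} (_ : 0 < s) (u : H1 d),
      |(⟪potential hg u, lap (s + s) (toL2 u)⟫ : ℂ).re| ≤ C * ‖u‖ ^ 2 := by
  refine ⟨∑ k, ‖potentialDeriv hg k‖, Finset.sum_nonneg fun k _ => by positivity, fun {s} hs u => ?_⟩
  rw [re_inner_potential_eq hg hs, Finset.sum_mul]
  refine (Finset.abs_sum_le_sum_abs _ _).trans (Finset.sum_le_sum fun k _ => ?_)
  refine (abs_re_inner_le _ _).trans ?_
  calc _ ≤ (‖potentialDeriv hg k‖ * ‖u‖) * ‖u‖ :=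
          mul_le_mul ((norm_heat_le _ _).trans (ContinuousLinearMap.le_opNorm _ _))
            ((norm_heat_le _ _).trans (norm_grad_le _ _)) (norm_nonneg _) (by positivity)
      _ = _ := by ring

theorem tendsto_re_inner_potential {g : Sp d → ℝ} (hg : IsCbInfty g) (u : H1 d) :
    Tendsto (fun j : ℕ => (⟪potential hg u,
      lap ((2 : ℝ)⁻¹ ^ j + (2 : ℝ)⁻¹ ^ j) (toL2 u)⟫ : ℂ).re) atTop
      (𝓝 (∑ k, (⟪potentialDeriv hg k u, grad u k⟫ : ℂ).re)) := by
  simp only [re_inner_potential_eq hg (dyadic_pos _)]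
  exact tendsto_finsetSum _ fun k _ => tendsto_re_inner_heat _ _

/-- As g is real, i g ∂_k u paired with ∂_k u is purely imaginary. Only the term in which g is
differentiated contributes. -/
theorem re_inner_potentialDeriv {g : Sp d → ℝ} (hg : IsCbInfty g) (k : Fin d) (u : H1 d) :
    (⟪potentialDeriv hg k u, grad u k⟫ : ℂ).re
      = (⟪Complex.I • mulC (hg.pderiv k) (toL2 u), grad u k⟫ : ℂ).re := by
  rw [potentialDeriv_apply, smul_add, inner_add_left, Complex.add_re]
  have h2 : (⟪mulC hg (grad u k), grad u k⟫ : ℂ).im = 0 := by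
    rw [← Complex.conj_eq_iff_im, inner_conj_symm, inner_mulC_left hg]
  have h3 : (⟪Complex.I • mulC hg (grad u k), grad u k⟫ : ℂ).re = 0 := by
    rw [inner_smul_left, Complex.conj_I, neg_mul, Complex.neg_re, Complex.I_mul_re, h2, neg_zero, neg_zero]
  rw [h3, zero_add]

/-! ### The regularised evolution -/

/-- Complex conjugation of a Schwartz function. -/
def conjS (χ : 𝓢(Sp d, ℂ)) : 𝓢(Sp d, ℂ) :=
  SchwartzMap.postcompCLM (𝕜 := ℝ) (Complex.conjCLE : ℂ →L[ℝ] ℂ) χ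

theorem conjS_apply (χ : 𝓢(Sp d, ℂ)) (x : Sp d) : conjS χ x = starRingEnd ℂ (χ x) := rfl

theorem pderiv_conjS (χ : 𝓢(Sp d, ℂ)) (j : Fin d) (x : Sp d) :
    pderiv j (conjS χ) x = starRingEnd ℂ ((∂_{ei j} χ : 𝓢(Sp d, ℂ)) x) := by
  have h1 : (conjS χ : Sp d → ℂ) = fun y => (Complex.conjCLE : ℂ →L[ℝ] ℂ) (χ y) := rfl
  have h2 : HasFDerivAt χ (fderiv ℝ χ x) x := ((χ.smooth 1).differentiable one_ne_zero x).hasFDerivAt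
  have h3 : HasFDerivAt (fun y => (Complex.conjCLE : ℂ →L[ℝ] ℂ) (χ y)) _ x :=
    (Complex.conjCLE : ℂ →L[ℝ] ℂ).hasFDerivAt.comp x h2
  rw [pderiv, h1, h3.fderiv, SchwartzMap.lineDerivOp_apply_eq_fderiv]
  rfl

theorem inner_schL2 (χ : 𝓢(Sp d, ℂ)) (v : L2 d) :
    ⟪schL2 χ, v⟫ = ∫ x, v x * starRingEnd ℂ (χ x) := by
  rw [inner_eq_integral]
  apply integral_congr_ae
  filter_upwards [schL2_ae χ] with x hx
  rw [hx]

/-- `i ∂_t u + Δu + h = 0` on `[a,b]`, integrated in time and tested with Schwartz functions. -/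
def IsWeakSolution (a b : ℝ) (u : ℝ → H1 d) (h : ℝ → L2 d) : Prop :=
  ∀ t ∈ Set.Icc a b, ∀ ψ : 𝓢(Sp d, ℂ),
    ∫ x, toL2 (u t) x * ψ x = (∫ x, toL2 (u b) x * ψ x)
      + ∫ s in b..t, Complex.I * (-(∑ j, ∫ x, grad (u s) j x * pderiv j ψ x) + ∫ x, h s x * ψ x)

variable {a b : ℝ} {u : ℝ → H1 d} {h : ℝ → L2 d}

theorem _root_.Continuous.toL2 {X : Type*} [TopologicalSpace X] {u : X → H1 d} (hu : Continuous u) :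
    Continuous fun t => RoughNLS.toL2 (u t) := by
  simp only [← toL2L_apply]; fun_prop

theorem _root_.Continuous.grad {X : Type*} [TopologicalSpace X] {u : X → H1 d} (hu : Continuous u)
    (j : Fin d) : Continuous fun t => RoughNLS.grad (u t) j := by
  simp only [← gradL_apply]; fun_prop

theorem inner_intervalIntegral {f : ℝ → L2 d} (hf : Continuous f) (v : L2 d) (b t : ℝ) :
    ⟪v, ∫ s in b..t, f s⟫ = ∫ s in b..t, (⟪v, f s⟫ : ℂ) :=
  ((innerSL ℂ v).intervalIntegral_comp_comm (hf.intervalIntegrable b t)).symm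

/-- Density enlarges the test functions from Schwartz functions to all of H¹, so that smoothed L²
functions become admissible. -/
theorem IsWeakSolution.inner_eq_zero (hw : IsWeakSolution a b u h) (hu : Continuous u)
    (hh : Continuous h) {t : ℝ} (ht : t ∈ Set.Icc a b) (w : H1 d) :
    ⟪toL2 w, toL2 (u t) - toL2 (u b) - ∫ s in b..t, Complex.I • h s⟫
      + ∑ j, ⟪grad w j, ∫ s in b..t, Complex.I • grad (u s) j⟫ = 0 := by
  refine denseRange_ofSchwartz.induction_on w ?_ fun χ => ?_
  · refine isClosed_eq ?_ continuous_const
    have h1 : Continuous fun w : H1 d => toL2 w := continuous_id.toL2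
    have h2 : ∀ j, Continuous fun w : H1 d => grad w j := fun j => continuous_id.grad j
    fun_prop
  · have h0 := hw t ht (conjS χ)
    simp only [conjS_apply, pderiv_conjS] at h0
    rw [toL2_ofSchwartz, inner_sub_right, inner_sub_right, inner_schL2, inner_schL2, h0]
    simp only [grad_ofSchwartz]
    have hg : ∀ j, Continuous fun s => Complex.I • grad (u s) j := fun j => (hu.grad j).const_smul Complex.I
    have h1 : Continuous fun s => Complex.I • h s := hh.const_smul Complex.I
    simp only [inner_intervalIntegral h1, inner_intervalIntegral (hg _)]
    rw [← intervalIntegral.integral_finsetSum fun j _ =>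
      Continuous.intervalIntegrable (by have := hg j; fun_prop) _ _]
    have e1 : ∀ x y : ℂ, x + y - x - (∫ s in b..t, ⟪schL2 χ, Complex.I • h s⟫)
        + (∫ s in b..t, ∑ j, ⟪schL2 (∂_{ei j} χ), Complex.I • grad (u s) j⟫)
        = y - ((∫ s in b..t, ⟪schL2 χ, Complex.I • h s⟫)
        - (∫ s in b..t, ∑ j, ⟪schL2 (∂_{ei j} χ), Complex.I • grad (u s) j⟫)) := by
      intros; ring
    rw [e1, ← intervalIntegral.integral_sub (Continuous.intervalIntegrable (by fun_prop) _ _)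
      (Continuous.intervalIntegrable (by fun_prop) _ _), sub_eq_zero]
    congr 1
    funext s
    simp only [inner_smul_right, inner_schL2, ← Finset.mul_sum]
    ring

/-- Testing with `heatH1 hs v` for arbitrary v in L² and moving the smoothing to the other side
gives an integral equation in L². The smoothed solution is therefore differentiable in time with
values in L². -/
theorem IsWeakSolution.heat_eq (hw : IsWeakSolution a b u h) (hu : Continuous u)
    (hh : Continuous h) {s : ℝ} (hs : 0 < s) {t : ℝ} (ht : t ∈ Set.Icc a b) :
    heat s (toL2 (u t)) = heat s (toL2 (u b))
      + ∫ r in b..t, Complex.I • (heat s (h r) - lap s (toL2 (u r))) := by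
  apply ext_inner_left ℂ
  intro v
  have h0 := hw.inner_eq_zero hu hh ht (heatH1 hs v)
  have hg : ∀ j, Continuous fun s => Complex.I • grad (u s) j := fun j => (hu.grad j).const_smul Complex.I
  have h1 : Continuous fun s => Complex.I • h s := hh.const_smul Complex.I
  have h2 := hu.toL2
  rw [toL2_heatH1, inner_sub_right, inner_sub_right, inner_heat_left, inner_heat_left,
    inner_intervalIntegral h1] at h0
  simp only [inner_intervalIntegral (hg _), inner_smul_right, inner_heat_left] at h0
  rw [← intervalIntegral.integral_finsetSum fun j _ =>
      Continuous.intervalIntegrable (by have := hu.grad j; fun_prop) _ _] at h0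
  simp only [← Finset.mul_sum, sum_inner_grad_heatH1] at h0
  rw [inner_add_right, inner_intervalIntegral (by fun_prop)]
  simp only [inner_smul_right, inner_sub_right, mul_sub]
  rw [intervalIntegral.integral_sub (Continuous.intervalIntegrable (by fun_prop) _ _)
      (Continuous.intervalIntegrable (by fun_prop) _ _)]
  linear_combination h0

theorem IsWeakSolution.hasDerivAt_heat (hw : IsWeakSolution a b u h) (hu : Continuous u)
    (hh : Continuous h) {s : ℝ} (hs : 0 < s) {t : ℝ} (ht : t ∈ Set.Ioo a b) :
    HasDerivAt (fun t => heat s (toL2 (u t))) (Complex.I • (heat s (h t) - lap s (toL2 (u t)))) t := by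
  have h2 := hu.toL2
  have hc : Continuous fun r => Complex.I • (heat s (h r) - lap s (toL2 (u r))) := by fun_prop
  have h1 := (intervalIntegral.integral_hasDerivAt_right (hc.intervalIntegrable b t)
    (hc.stronglyMeasurableAtFilter _ _) hc.continuousAt).const_add (heat s (toL2 (u b)))
  refine h1.congr_of_eventuallyEq ?_
  filter_upwards [Icc_mem_nhds ht.1 ht.2] with r hr
  exact hw.heat_eq hu hh hs hr

/-! ### The potential energy -/

/-- `∫ |u|^{2+4/d}`. -/
def potentialEnergy (hd : d = 1 ∨ d = 2) (u : H1 d) : ℝ := (⟪nl hd u, toL2 u⟫ : ℂ).re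

theorem re_inner_eq_integral (v w : L2 d) :
    (⟪v, w⟫ : ℂ).re = ∫ x, (starRingEnd ℂ (v x) * w x).re := by
  rw [inner_eq_integral]
  have hi : Integrable fun x => w x * starRingEnd ℂ (v x) := L2.integrable_inner v w
  rw [← RCLike.re_eq_complex_re, ← integral_re hi]
  congr 1
  funext x
  rw [mul_comm]

theorem integrable_re_inner (v w : L2 d) : Integrable fun x => (starRingEnd ℂ (v x) * w x).re := by
  have hi : Integrable fun x => w x * starRingEnd ℂ (v x) := L2.integrable_inner v w
  refine hi.re.congr (Eventually.of_forall fun x => ?_)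
  simp only [RCLike.re_eq_complex_re, mul_comm]

theorem conj_nonlin_mul_self_re (hd : d = 1 ∨ d = 2) (z : ℂ) :
    (starRingEnd ℂ (nonlin d z) * z).re = ‖z‖ ^ (4 / d + 2) := by
  rw [nonlin_eq hd, map_mul, Complex.conj_ofReal, mul_assoc, Complex.re_ofReal_mul,
    ← Complex.normSq_eq_conj_mul_self, Complex.ofReal_re, Complex.normSq_eq_norm_sq]
  ring

theorem potentialEnergy_eq (hd : d = 1 ∨ d = 2) (u : H1 d) :
    potentialEnergy hd u = ∫ x, ‖toL2 u x‖ ^ (4 / d + 2) := by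
  rw [potentialEnergy, re_inner_eq_integral]
  apply integral_congr_ae
  filter_upwards [nl_ae hd u] with x hx
  rw [hx, conj_nonlin_mul_self_re hd]

theorem integrable_norm_pow_four (hd : d = 1 ∨ d = 2) (u : H1 d) :
    Integrable fun x => ‖toL2 u x‖ ^ (4 / d + 2) := by
  refine (integrable_re_inner (nl hd u) (toL2 u)).congr ?_
  filter_upwards [nl_ae hd u] with x hx
  rw [hx, conj_nonlin_mul_self_re hd]

theorem energy_eq (hd : d = 1 ∨ d = 2) (u : H1 d) :
    energy u = 1 / 2 * (∑ j, ‖grad u j‖ ^ 2) - (d : ℝ) / (2 * d + 4) * potentialEnergy hd u := by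
  rw [energy, potentialEnergy_eq hd]
  simp only [norm_sq_eq_integral]
  congr 3
  funext x
  rcases hd with rfl | rfl
  · rw [← Real.rpow_natCast]; norm_num
  · rw [← Real.rpow_natCast]; norm_num

/-- The common L^∞ bound converts the pointwise Taylor remainder into a squared L² distance. The
factor 3M comes from |u| + |v-u| ≤ 3M. -/
theorem abs_potentialEnergy_sub_le (hd : d = 1 ∨ d = 2) {u v : H1 d} {M : ℝ}
    (hu : ∀ᵐ x, ‖toL2 u x‖ ≤ M) (hv : ∀ᵐ x, ‖toL2 v x‖ ≤ M) :
    |potentialEnergy hd v - potentialEnergy hd u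
      - ((4 / d : ℕ) + 2) * (⟪nl hd u, toL2 v - toL2 u⟫ : ℂ).re|
      ≤ 23 * (3 * M) ^ (4 / d) * ‖toL2 v - toL2 u‖ ^ 2 := by
  have hvu : Integrable fun x => ‖toL2 v x‖ ^ (4 / d + 2) - ‖toL2 u x‖ ^ (4 / d + 2) :=
    (integrable_norm_pow_four hd v).sub (integrable_norm_pow_four hd u)
  rw [potentialEnergy_eq, potentialEnergy_eq, re_inner_eq_integral, ← integral_const_mul,
    ← integral_sub (integrable_norm_pow_four hd v) (integrable_norm_pow_four hd u),
    ← integral_sub hvu ((integrable_re_inner _ _).const_mul _), norm_sq_eq_integral,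
    ← integral_const_mul]
  refine (abs_integral_le_integral_abs).trans (integral_mono_ae ?_ ?_ ?_)
  · exact (((integrable_norm_pow_four hd v).sub (integrable_norm_pow_four hd u)).sub
      ((integrable_re_inner _ _).const_mul _)).abs
  · exact (integrable_norm_sq _).const_mul _
  · filter_upwards [hu, hv, nl_ae hd u, Lp.coeFn_sub (toL2 v) (toL2 u)] with x h1 h2 h3 h4
    simp only [h3, h4, Pi.sub_apply]
    refine (abs_potential_taylor_le hd (toL2 u x) (toL2 v x)).trans ?_
    rw [mul_assoc, mul_comm (‖_‖ ^ 2)]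
    gcongr
    have := norm_sub_le (toL2 v x) (toL2 u x)
    linarith

theorem continuous_potentialEnergy (hd : d = 1 ∨ d = 2) : Continuous (potentialEnergy (d := d) hd) := by
  have h1 := continuous_nl (d := d) hd
  have h2 : Continuous fun u : H1 d => toL2 u := continuous_id.toL2
  unfold potentialEnergy
  fun_prop

/-- Differentiability in L² alone would not control the superquadratic potential. The uniform bound,
which heat smoothing supplies, makes the remainder O(|r-t|²). -/
theorem hasDerivAt_potentialEnergy (hd : d = 1 ∨ d = 2) {v : ℝ → H1 d} {v' : L2 d} {t M : ℝ}
    (hv : HasDerivAt (fun r => toL2 (v r)) v' t) (hM : ∀ᶠ r in 𝓝 t, ∀ᵐ x, ‖toL2 (v r) x‖ ≤ M) :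
    HasDerivAt (fun r => potentialEnergy hd (v r))
      (((4 / d : ℕ) + 2) * (⟪nl hd (v t), v'⟫ : ℂ).re) t := by
  have h1 : HasDerivAt (fun r => ((4 / d : ℕ) + 2) * (⟪nl hd (v t), toL2 (v r) - toL2 (v t)⟫ : ℂ).re)
      (((4 / d : ℕ) + 2) * (⟪nl hd (v t), v'⟫ : ℂ).re) t := by
    have h2 : HasDerivAt (fun r => (⟪nl hd (v t), toL2 (v r) - toL2 (v t)⟫ : ℂ))
        (⟪nl hd (v t), v'⟫ : ℂ) t := by
      have := (hasDerivAt_const t (nl hd (v t))).inner ℂ (hv.sub_const (toL2 (v t)))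
      simpa using this
    have h3 := (Complex.reCLM.hasFDerivAt.comp_hasDerivAt t h2).const_mul (((4 / d : ℕ) + 2 : ℝ))
    exact h3
  have h2 : HasDerivAt (fun r => potentialEnergy hd (v r)
      - ((4 / d : ℕ) + 2) * (⟪nl hd (v t), toL2 (v r) - toL2 (v t)⟫ : ℂ).re) 0 t := by
    rw [hasDerivAt_iff_isLittleO]
    have hO : (fun r => toL2 (v r) - toL2 (v t)) =O[𝓝 t] fun r => r - t := hv.isBigO_sub
    have hO2 : (fun r => ‖toL2 (v r) - toL2 (v t)‖ ^ 2) =O[𝓝 t] fun r => (r - t) ^ 2 := hO.norm_left.pow 2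
    have hlo : (fun r => (r - t) ^ 2) =o[𝓝 t] fun r => r - t := by
      simpa [pow_two] using Asymptotics.isLittleO_pow_sub_sub t (m := 2) (by norm_num)
    refine (Asymptotics.IsBigO.of_bound (23 * (3 * M) ^ (4 / d)) ?_).trans_isLittleO (hO2.trans_isLittleO hlo)
    have hMt := hM.self_of_nhds
    filter_upwards [hM] with r hr
    have := abs_potentialEnergy_sub_le hd hMt hr
    simp only [sub_self, inner_zero_right, Complex.zero_re, mul_zero, smul_zero, sub_zero,
      Real.norm_eq_abs, abs_pow, abs_norm]
    convert this using 2
    ring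
  have h3 := h2.add h1
  rw [zero_add] at h3
  refine h3.congr_of_eventuallyEq (Eventually.of_forall fun r => ?_)
  simp only [Pi.add_apply]
  ring

/-! ### The energy identity -/

/-- Otherwise A_j ≥ ε/(j+1) for all large j, and the partial sums would grow like the harmonic
series. This is exactly what a logarithmic loss j+1 can afford. -/
theorem frequently_mul_lt_of_sum_le {A : ℕ → ℝ} {S : ℝ} (hS : ∀ n, ∑ j ∈ Finset.range n, A j ≤ S)
    {ε : ℝ} (hε : 0 < ε) : ∃ᶠ j : ℕ in atTop, ((j : ℝ) + 1) * A j < ε := by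
  intro hev
  simp only [not_lt] at hev
  obtain ⟨m, hm⟩ := eventually_atTop.1 hev
  have h1 : ∀ n, m ≤ n → ∑ j ∈ Finset.range n, ε * (1 / ((j : ℝ) + 1))
      ≤ S + ∑ j ∈ Finset.range m, (ε * (1 / ((j : ℝ) + 1)) - A j) := by
    intro n hn
    have h2 : ∑ j ∈ Finset.range n, (ε * (1 / ((j : ℝ) + 1)) - A j)
        ≤ ∑ j ∈ Finset.range m, (ε * (1 / ((j : ℝ) + 1)) - A j) := by
      induction n, hn using Nat.le_induction with
      | base => exact le_rfl
      | succ n hn ih =>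
        rw [Finset.sum_range_succ]
        have h3 : ε * (1 / ((n : ℝ) + 1)) ≤ A n := by
          rw [mul_one_div, div_le_iff₀ (by positivity), mul_comm]
          exact hm n hn
        linarith
    rw [Finset.sum_sub_distrib] at h2
    linarith [hS n]
  have h4 := (Real.tendsto_sum_range_one_div_nat_succ_atTop.const_mul_atTop hε)
  obtain ⟨n, hn1, hn2⟩ := ((eventually_ge_atTop m).and (h4.eventually_gt_atTop
    (S + ∑ j ∈ Finset.range m, (ε * (1 / ((j : ℝ) + 1)) - A j)))).exists
  have := h1 n hn1
  rw [← Finset.mul_sum] at this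
  linarith

theorem im_inner_heat_self (s : ℝ) (v : L2 d) : (⟪v, heat s v⟫ : ℂ).im = 0 := by
  rw [← Complex.conj_eq_iff_im, inner_conj_symm, inner_heat_left]

theorem re_inner_I_smul_right (v w : L2 d) :
    (⟪v, Complex.I • w⟫ : ℂ).re = -(⟪Complex.I • v, w⟫ : ℂ).re := by
  rw [inner_smul_right, inner_smul_left, Complex.conj_I, neg_mul, Complex.neg_re, neg_neg]

variable {a b : ℝ} {u : ℝ → H1 d} {h : ℝ → L2 d}

/-- The smoothing at time 2s is split as s/2 + s + s/2, so only the differentiable curve heat(s/2)u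
is differentiated. The dispersive term drops out because its pairing with the Laplacian is i times a
real number. -/
theorem IsWeakSolution.hasDerivAt_kinetic (hw : IsWeakSolution a b u h) (hu : Continuous u)
    (hh : Continuous h) {s : ℝ} (hs : 0 < s) {t : ℝ} (ht : t ∈ Set.Ioo a b) :
    HasDerivAt (fun t => 1 / 2 * (⟪toL2 (u t), lap (s + s) (toL2 (u t))⟫ : ℂ).re)
      (⟪Complex.I • h t, lap (s + s) (toL2 (u t))⟫ : ℂ).re t := by
  have hs2 : 0 < s / 2 := by positivity
  have e0 : ∀ v : L2 d, heat (s / 2) (lap s (heat (s / 2) v)) = lap (s + s) v := by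
    intro v
    rw [lap_heat hs hs2, heat_lap hs2 (by positivity)]
    congr 2
    ring
  have hd1 := hw.hasDerivAt_heat hu hh hs2 ht
  set w' := Complex.I • (heat (s / 2) (h t) - lap (s / 2) (toL2 (u t))) with hw'
  have hd2 : HasDerivAt (fun t => lap s (heat (s / 2) (toL2 (u t)))) (lap s w') t := by
    have := ((lap s : L2 d →L[ℂ] L2 d).restrictScalars ℝ).hasFDerivAt.comp_hasDerivAt t hd1
    exact this
  have hd3 := (Complex.reCLM.hasFDerivAt.comp_hasDerivAt t (hd1.inner ℂ hd2)).const_mul (1 / 2 : ℝ)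
  refine (hd3.congr_of_eventuallyEq (Eventually.of_forall fun r => ?_)).congr_deriv ?_
  · simp only [Function.comp_apply, Complex.reCLM_apply]
    rw [inner_heat_left, e0]
  · rw [Complex.reCLM_apply, Complex.add_re]
    have e1 : (⟪heat (s / 2) (toL2 (u t)), lap s w'⟫ : ℂ).re
        = (⟪w', lap s (heat (s / 2) (toL2 (u t)))⟫ : ℂ).re := by
      rw [← inner_lap_left, ← inner_conj_symm, Complex.conj_re]
    have e2 : (⟪lap (s / 2) (toL2 (u t)), lap s (heat (s / 2) (toL2 (u t)))⟫ : ℂ).im = 0 := by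
      rw [lap_heat hs hs2, ← heat_lap hs hs2]
      exact im_inner_heat_self _ _
    rw [e1, hw', inner_smul_left, inner_sub_left, inner_heat_left, e0, inner_smul_left,
      Complex.conj_I, neg_mul, neg_mul, Complex.neg_re, Complex.neg_re, Complex.I_mul_re,
      Complex.I_mul_re, Complex.sub_im, e2]
    ring

variable {X : ℝ → L2 d}

/-- The regularised energy. -/
def heatEnergy (hd : d = 1 ∨ d = 2) {s : ℝ} (hs : 0 < s) (u : H1 d) : ℝ :=
  1 / 2 * (⟪toL2 u, lap (s + s) (toL2 u)⟫ : ℂ).re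
    - (d : ℝ) / (2 * d + 4) * potentialEnergy hd (heatH1 hs (toL2 u))

/-- The part of the derivative of the regularised energy that involves the commutator of the heat
semigroup and the nonlinearity. -/
def commutatorTerm (hd : d = 1 ∨ d = 2) {s : ℝ} (hs : 0 < s) (u : H1 d) : ℝ :=
  (⟪Complex.I • (heat s (nl hd u) - nl hd (heatH1 hs (toL2 u))), lap s (toL2 u)⟫ : ℂ).re

/-- The remaining part of the derivative of the regularised energy. -/
def forcingTerm (hd : d = 1 ∨ d = 2) {s : ℝ} (hs : 0 < s) (u : H1 d) (f : L2 d) : ℝ :=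
  (⟪f, lap (s + s) (toL2 u)⟫ : ℂ).re
    - (⟪nl hd (heatH1 hs (toL2 u)), Complex.I • heat s (nl hd u) + heat s f⟫ : ℂ).re

theorem mul_four_div_add_two (hd : d = 1 ∨ d = 2) :
    (d : ℝ) / (2 * d + 4) * (((4 / d : ℕ) : ℝ) + 2) = 1 := by
  rcases hd with rfl | rfl <;> norm_num

/-- The kinetic part produces i heat(f(u)) against the smoothed Laplacian, the potential part f(heat
u) against i times the same function. They would cancel if smoothing commuted with the nonlinearity
f, so what remains is the commutator together with terms containing no uncontrolled derivative. -/
theorem IsWeakSolution.hasDerivAt_heatEnergy (hd : d = 1 ∨ d = 2)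
    (hw : IsWeakSolution a b u (fun t => nl hd (u t) - Complex.I • X t)) (hu : Continuous u)
    (hX : Continuous X) {M : ℝ} (hM : ∀ t, ‖u t‖ ≤ M) {s : ℝ} (hs : 0 < s) {t : ℝ}
    (ht : t ∈ Set.Ioo a b) :
    HasDerivAt (fun t => heatEnergy hd hs (u t))
      (commutatorTerm hd hs (u t) + forcingTerm hd hs (u t) (X t)) t := by
  have hh : Continuous fun t => nl hd (u t) - Complex.I • X t :=
    ((continuous_nl hd).comp hu).sub (hX.const_smul Complex.I)
  have h1 := hw.hasDerivAt_kinetic hu hh hs ht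
  obtain ⟨K, hK0, hK⟩ := exists_norm_heat_le (d := d) hs
  have h2 : HasDerivAt (fun t => potentialEnergy hd (heatH1 hs (toL2 (u t)))) _ t :=
    hasDerivAt_potentialEnergy hd (v := fun t => heatH1 hs (toL2 (u t))) (M := K * M)
    (by simpa only [toL2_heatH1] using hw.hasDerivAt_heat hu hh hs ht)
    (Eventually.of_forall fun r => by
      filter_upwards [hK (toL2 (u r))] with x hx
      rw [toL2_heatH1]
      refine hx.trans ?_
      gcongr
      exact (norm_toL2_le _).trans (hM r))
  have h3 := h1.sub (h2.const_mul ((d : ℝ) / (2 * d + 4)))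
  refine h3.congr_deriv ?_
  rw [← mul_assoc, mul_four_div_add_two hd, one_mul, commutatorTerm, forcingTerm]
  set f := nl hd (u t)
  set v := nl hd (heatH1 hs (toL2 (u t)))
  set L := lap s (toL2 (u t)) with hL
  have e1 : Complex.I • (f - Complex.I • X t) = Complex.I • f + X t := by
    rw [smul_sub, smul_smul, Complex.I_mul_I, neg_one_smul, sub_neg_eq_add]
  have e2 : Complex.I • (heat s (f - Complex.I • X t) - L)
      = (Complex.I • heat s f + heat s (X t)) - Complex.I • L := by
    rw [map_sub, map_smul, smul_sub, smul_sub, smul_smul, Complex.I_mul_I, neg_one_smul, sub_neg_eq_add]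
  have e3 : (⟪Complex.I • f, lap (s + s) (toL2 (u t))⟫ : ℂ) = ⟪Complex.I • heat s f, L⟫ := by
    rw [← heat_lap hs hs, ← inner_heat_left, map_smul]
  rw [e1, e2, inner_add_left, e3, inner_sub_right, smul_sub, inner_sub_left, Complex.add_re,
    Complex.sub_re, Complex.sub_re, re_inner_I_smul_right v L]
  ring

theorem continuous_heatH1 {s : ℝ} (hs : 0 < s) (hu : Continuous u) :
    Continuous fun t => heatH1 hs (toL2 (u t)) := by
  refine Continuous.subtype_mk (f := fun t => ((heatH1 hs (toL2 (u t)) : H1 d) : L2 d × (Fin d → L2 d))) ?_ _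
  have e : (fun t => ((heatH1 hs (toL2 (u t)) : H1 d) : L2 d × (Fin d → L2 d)))
      = fun t => (heat s (toL2 (u t)), fun j => heat s (grad (u t) j)) := by
    funext t
    refine Prod.ext (toL2_heatH1 hs _) (funext fun j => grad_heatH1 hs (u t) j)
  rw [e]
  have h1 := hu.toL2
  have h2 := fun j => hu.grad j
  fun_prop

theorem continuous_commutatorTerm (hd : d = 1 ∨ d = 2) {s : ℝ} (hs : 0 < s) (hu : Continuous u) :
    Continuous fun t => commutatorTerm hd hs (u t) := by
  have h1 := hu.toL2
  have h2 := (continuous_nl hd).comp hu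
  have h3 := (continuous_nl hd).comp (continuous_heatH1 hs hu)
  simp only [Function.comp_def] at h2 h3
  unfold commutatorTerm
  fun_prop

theorem continuous_forcingTerm (hd : d = 1 ∨ d = 2) {s : ℝ} (hs : 0 < s) (hu : Continuous u)
    (hX : Continuous X) : Continuous fun t => forcingTerm hd hs (u t) (X t) := by
  have h1 := hu.toL2
  have h2 := (continuous_nl hd).comp hu
  have h3 := (continuous_nl hd).comp (continuous_heatH1 hs hu)
  simp only [Function.comp_def] at h2 h3
  unfold forcingTerm
  fun_prop

theorem continuous_heatEnergy (hd : d = 1 ∨ d = 2) {s : ℝ} (hs : 0 < s) (hu : Continuous u) :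
    Continuous fun t => heatEnergy hd hs (u t) := by
  have h1 := hu.toL2
  have h3 := (continuous_potentialEnergy hd).comp (continuous_heatH1 hs hu)
  simp only [Function.comp_def] at h3
  unfold heatEnergy
  fun_prop

theorem tendsto_heatEnergy (hd : d = 1 ∨ d = 2) (u : H1 d) :
    Tendsto (fun j : ℕ => heatEnergy hd (dyadic_pos j) u) atTop (𝓝 (energy u)) := by
  rw [energy_eq hd]
  have h1 : Tendsto (fun j : ℕ => toL2 (heatH1 (dyadic_pos j) (toL2 u))) atTop (𝓝 (toL2 u)) := by
    simpa only [toL2_heatH1] using tendsto_heat_dyadic (toL2 u)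
  refine Tendsto.sub (Tendsto.const_mul _ ?_) (Tendsto.const_mul _ ?_)
  · simp only [inner_lap_add (dyadic_pos _), Complex.re_sum]
    refine tendsto_finsetSum _ fun k _ => ?_
    have h2 := tendsto_re_inner_heat (grad u k) (grad u k)
    have h3 : (⟪grad u k, grad u k⟫ : ℂ).re = ‖grad u k‖ ^ 2 := by
      rw [inner_self_eq_norm_sq_to_K]; norm_cast
    rwa [h3] at h2
  · have h2 := tendsto_nl hd (fun j => norm_heatH1_le (dyadic_pos j) u) h1
    exact (Complex.continuous_re.tendsto _).comp (h2.inner h1)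

theorem re_inner_I_smul_self (v : L2 d) : (⟪v, Complex.I • v⟫ : ℂ).re = 0 := by
  rw [inner_smul_right, inner_self_eq_norm_sq_to_K, Complex.I_mul_re]
  exact neg_eq_zero.2 (by norm_cast)

/-- In the limit the nonlinearity meets i times itself, whose real inner product vanishes, and only
the forcing survives. -/
theorem tendsto_forcingTerm (hd : d = 1 ∨ d = 2) (u : H1 d) (f : L2 d) {D : ℝ}
    (hD : Tendsto (fun j : ℕ => (⟪f, lap ((2 : ℝ)⁻¹ ^ j + (2 : ℝ)⁻¹ ^ j) (toL2 u)⟫ : ℂ).re) atTop (𝓝 D)) :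
    Tendsto (fun j : ℕ => forcingTerm hd (dyadic_pos j) u f) atTop
      (𝓝 (D - (⟪nl hd u, f⟫ : ℂ).re)) := by
  have h1 : Tendsto (fun j : ℕ => toL2 (heatH1 (dyadic_pos j) (toL2 u))) atTop (𝓝 (toL2 u)) := by
    simpa only [toL2_heatH1] using tendsto_heat_dyadic (toL2 u)
  have h2 := tendsto_nl hd (fun j => norm_heatH1_le (dyadic_pos j) u) h1
  have h3 := Filter.Tendsto.inner (𝕜 := ℂ) h2
    (((tendsto_heat_dyadic (nl hd u)).const_smul Complex.I).add (tendsto_heat_dyadic f))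
  have h4 := hD.sub ((Complex.continuous_re.tendsto _).comp h3)
  rw [inner_add_right, Complex.add_re, re_inner_I_smul_self, zero_add] at h4
  exact h4

/-- The identity for the regularised energy is integrated and j tends to infinity. Dominated
convergence handles everything except the commutator, so the defect Z is the limit of the integrated
commutators. Young's inequality with a parameter η bounds those by a multiple of η plus η⁻¹(j+1)A_j,
where the A_j have bounded partial sums. Choosing j with (j+1)A_j < η² gives |Z| = O(η). -/
theorem energy_sub_energy_eq (hd : d = 1 ∨ d = 2)
    (hw : IsWeakSolution a b u (fun t => nl hd (u t) - Complex.I • X t)) (hu : Continuous u)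
    (hX : Continuous X) {M : ℝ} (hM : ∀ t, ‖u t‖ ≤ M) {K : ℝ} (hXK : ∀ t, ‖X t‖ ≤ K) {D : ℝ → ℝ}
    {K' : ℝ} (hK' : ∀ (j : ℕ) t,
      |(⟪X t, lap ((2 : ℝ)⁻¹ ^ j + (2 : ℝ)⁻¹ ^ j) (toL2 (u t))⟫ : ℂ).re| ≤ K')
    (hD : ∀ t, Tendsto (fun j : ℕ => (⟪X t, lap ((2 : ℝ)⁻¹ ^ j + (2 : ℝ)⁻¹ ^ j) (toL2 (u t))⟫ : ℂ).re)
      atTop (𝓝 (D t))) {t : ℝ} (ht : t ∈ Set.Icc a b) :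
    energy (u b) - energy (u t) = ∫ r in t..b, (D r - (⟪nl hd (u r), X r⟫ : ℂ).re) := by
  have htb : t ≤ b := ht.2
  have hM0 : 0 ≤ M := (norm_nonneg _).trans (hM 0)
  have hK0 : 0 ≤ K := (norm_nonneg _).trans (hXK 0)
  obtain ⟨C, hC0, hC⟩ := exists_norm_nl_le hd
  obtain ⟨C', hC'0, hC'⟩ := exists_norm_commutator_le hd
  have hident : ∀ j : ℕ, heatEnergy hd (dyadic_pos j) (u b) - heatEnergy hd (dyadic_pos j) (u t)
      - (∫ r in t..b, forcingTerm hd (dyadic_pos j) (u r) (X r))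
      = ∫ r in t..b, commutatorTerm hd (dyadic_pos j) (u r) := by
    intro j
    have h1 := continuous_commutatorTerm hd (dyadic_pos j) hu
    have h2 := continuous_forcingTerm hd (dyadic_pos j) hu hX
    rw [← intervalIntegral.integral_eq_sub_of_hasDerivAt_of_le htb
      (continuous_heatEnergy hd (dyadic_pos j) hu).continuousOn
      (fun r hr => hw.hasDerivAt_heatEnergy hd hu hX hM (dyadic_pos j) ⟨ht.1.trans_lt hr.1, hr.2⟩)
      ((h1.add h2).intervalIntegrable _ _),
      intervalIntegral.integral_add (h1.intervalIntegrable _ _) (h2.intervalIntegrable _ _),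
      add_sub_cancel_right]
  have hlim : Tendsto (fun j : ℕ => heatEnergy hd (dyadic_pos j) (u b)
      - heatEnergy hd (dyadic_pos j) (u t)
      - (∫ r in t..b, forcingTerm hd (dyadic_pos j) (u r) (X r))) atTop
      (𝓝 (energy (u b) - energy (u t) - ∫ r in t..b, (D r - (⟪nl hd (u r), X r⟫ : ℂ).re))) := by
    refine ((tendsto_heatEnergy hd _).sub (tendsto_heatEnergy hd _)).sub ?_
    refine intervalIntegral.tendsto_integral_filter_of_dominated_convergence
      (fun _ => K' + C * M ^ (4 / d + 1) * (C * M ^ (4 / d + 1) + K)) ?_ ?_ (by simp) ?_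
    · exact Eventually.of_forall fun j =>
        (continuous_forcingTerm hd (dyadic_pos j) hu hX).aestronglyMeasurable
    · refine Eventually.of_forall fun j => Eventually.of_forall fun r _ => ?_
      have hn : ∀ v : H1 d, ‖v‖ ≤ M → ‖nl hd v‖ ≤ C * M ^ (4 / d + 1) := fun v hv =>
        (hC v).trans (by gcongr)
      rw [forcingTerm, Real.norm_eq_abs]
      refine (abs_sub _ _).trans (add_le_add (hK' j r) ((abs_re_inner_le _ _).trans ?_))
      gcongr
      · exact hn _ ((norm_heatH1_le _ _).trans (hM r))
      · refine (norm_add_le _ _).trans (add_le_add ?_ ((norm_heat_le _ _).trans (hXK r)))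
        rw [norm_smul, Complex.norm_I, one_mul]
        exact (norm_heat_le _ _).trans (hn _ (hM r))
    · exact Eventually.of_forall fun r _ => tendsto_forcingTerm hd (u r) (X r) (hD r)
  set Z := energy (u b) - energy (u t) - ∫ r in t..b, (D r - (⟪nl hd (u r), X r⟫ : ℂ).re) with hZ
  set A : ℕ → ℝ := fun j => ∫ r in t..b, (2 : ℝ)⁻¹ ^ j * ‖lap ((2 : ℝ)⁻¹ ^ j) (toL2 (u r))‖ ^ 2 with hA
  have hu2 := hu.toL2
  have hac : ∀ j : ℕ, Continuous fun r => (2 : ℝ)⁻¹ ^ j * ‖lap ((2 : ℝ)⁻¹ ^ j) (toL2 (u r))‖ ^ 2 := by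
    intro j; fun_prop
  have hAsum : ∀ n, ∑ j ∈ Finset.range n, A j ≤ (b - t) * (4 * Real.pi ^ 2 * (d * M ^ 2)) := by
    intro n
    rw [hA, ← intervalIntegral.integral_finsetSum fun j _ => (hac j).intervalIntegrable _ _]
    refine (intervalIntegral.integral_mono_on htb
      ((continuous_finsetSum _ fun j _ => hac j).intervalIntegrable _ _)
      (g := fun _ => 4 * Real.pi ^ 2 * (d * M ^ 2)) (by simp) fun r _ => ?_).trans
      (le_of_eq (by rw [intervalIntegral.integral_const, smul_eq_mul]))
    refine (sum_norm_sq_lap_le (u r) n).trans ?_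
    gcongr
    refine (Finset.sum_le_sum fun k _ => pow_le_pow_left₀ (norm_nonneg _)
      ((norm_grad_le (u r) k).trans (hM r)) 2).trans ?_
    simp
  set C1 := C' * M ^ (2 * (4 / d) + 2) with hC1
  have hC10 : 0 ≤ C1 := by positivity
  have hbound : ∀ η : ℝ, 0 < η → ∀ j : ℕ, |∫ r in t..b, commutatorTerm hd (dyadic_pos j) (u r)|
      ≤ 1 / 2 * (η * C1 * (b - t) + η⁻¹ * (((j : ℝ) + 1) * A j)) := by
    intro η hη j
    have hs := dyadic_pos j
    have hpt : ∀ r, |commutatorTerm hd (dyadic_pos j) (u r)| ≤ 1 / 2 * (η * C1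
        + η⁻¹ * (((j : ℝ) + 1) * ((2 : ℝ)⁻¹ ^ j * ‖lap ((2 : ℝ)⁻¹ ^ j) (toL2 (u r))‖ ^ 2))) := by
      intro r
      refine (abs_re_inner_le _ _).trans ?_
      rw [norm_smul, Complex.norm_I, one_mul]
      have h1 := (hC' (u r) j hs).trans (show _ ≤ C' * (↑j + 1) * 2⁻¹ ^ j * M ^ (2 * (4 / d) + 2) by
        gcongr; exact hM r)
      set x := ‖heat ((2 : ℝ)⁻¹ ^ j) (nl hd (u r)) - nl hd (heatH1 hs (toL2 (u r)))‖
      set y := ‖lap ((2 : ℝ)⁻¹ ^ j) (toL2 (u r))‖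
      set p := ((j : ℝ) + 1) * (2 : ℝ)⁻¹ ^ j with hp
      have hp0 : 0 < p := by positivity
      have h2 : x ^ 2 ≤ C1 * p := by rw [hC1, hp]; linarith
      -- Young's inequality with weight κ = η/p, where p = (j+1)2^(-j) is the size of the squared
      -- commutator.
      have h3 : x * y ≤ 1 / 2 * ((η * p⁻¹) * x ^ 2 + (η⁻¹ * p) * y ^ 2) := by
        have h4 : 0 < η * p⁻¹ := by positivity
        have h5 : η⁻¹ * p = (η * p⁻¹)⁻¹ := by rw [mul_inv, inv_inv]
        rw [h5]
        set κ := η * p⁻¹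
        have h6 : κ * x ^ 2 + κ⁻¹ * y ^ 2 - 2 * (x * y) = κ⁻¹ * (κ * x - y) ^ 2 := by
          field_simp; ring
        have h7 : 0 ≤ κ⁻¹ * (κ * x - y) ^ 2 := by positivity
        linarith
      refine h3.trans ?_
      have h8 : η * p⁻¹ * x ^ 2 ≤ η * C1 := by
        calc _ ≤ η * p⁻¹ * (C1 * p) := by gcongr
          _ = _ := by field_simp
      have h9 : η⁻¹ * p * y ^ 2 = η⁻¹ * (((j : ℝ) + 1) * ((2 : ℝ)⁻¹ ^ j * y ^ 2)) := by rw [hp]; ring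
      linarith
    have hcc := hac j
    refine (intervalIntegral.abs_integral_le_integral_abs htb).trans
      ((intervalIntegral.integral_mono_on htb
        ((continuous_commutatorTerm hd (dyadic_pos j) hu).abs.intervalIntegrable _ _)
        (Continuous.intervalIntegrable (by fun_prop) _ _) fun r _ => hpt r).trans ?_)
    rw [intervalIntegral.integral_const_mul, intervalIntegral.integral_add
      (Continuous.intervalIntegrable (by fun_prop) _ _)
      (Continuous.intervalIntegrable (by fun_prop) _ _), intervalIntegral.integral_const, smul_eq_mul]
    have hlast : ∫ r in t..b, η⁻¹ * (((j : ℝ) + 1)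
        * ((2 : ℝ)⁻¹ ^ j * ‖lap ((2 : ℝ)⁻¹ ^ j) (toL2 (u r))‖ ^ 2)) = η⁻¹ * (((j : ℝ) + 1) * A j) := by
      rw [intervalIntegral.integral_const_mul, intervalIntegral.integral_const_mul]
    rw [hlast]
    refine le_of_eq ?_
    ring
  have hZη : ∀ η : ℝ, 0 < η → |Z| ≤ η * (1 / 2 * (C1 * (b - t) + 1)) := by
    intro η hη
    -- The sequence is already known to converge to Z, so a bound for infinitely many j is enough.
    refine le_of_tendsto_of_frequently hlim.abs
      ((frequently_mul_lt_of_sum_le hAsum (pow_pos hη 2)).mono fun j hj => ?_)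
    rw [hident]
    refine (hbound η hη j).trans ?_
    have h1 : η⁻¹ * (((j : ℝ) + 1) * A j) ≤ η := by
      calc _ ≤ η⁻¹ * η ^ 2 := by gcongr
        _ = η := by field_simp
    linarith
  have hZ0 : |Z| ≤ 0 := by
    have h1 : Tendsto (fun η : ℝ => η * (1 / 2 * (C1 * (b - t) + 1))) (𝓝[>] 0)
        (𝓝 (0 * (1 / 2 * (C1 * (b - t) + 1)))) :=
      (tendsto_nhdsWithin_of_tendsto_nhds tendsto_id).mul_const _
    rw [zero_mul] at h1
    exact ge_of_tendsto h1 (eventually_mem_nhdsWithin.mono fun η hη => hZη η hη)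
  exact sub_eq_zero.1 (abs_nonpos_iff.1 hZ0)

section

variable {N : ℕ}

/-! ### The random equation as a forced equation -/

theorem laplacian_eq_sum_pderiv {F : Type*} [NormedAddCommGroup F] [NormedSpace ℝ F] {f : Sp d → F}
    (hf : ContDiff ℝ 2 f) (x : Sp d) : Δ f x = ∑ j, pderiv j (pderiv j f) x := by
  have hd1 : Differentiable ℝ (fderiv ℝ f) :=
    (hf.fderiv_right (m := 1) (by norm_num)).differentiable one_ne_zero
  rw [InnerProductSpace.laplacian_eq_iteratedFDeriv_orthonormalBasis f (EuclideanSpace.basisFun (Fin d) ℝ)]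
  refine Finset.sum_congr rfl fun j _ => ?_
  rw [iteratedFDeriv_two_apply, pderiv]
  change _ = fderiv ℝ (fun y => fderiv ℝ f y (ei j)) x (ei j)
  rw [fderiv_clm_apply (hd1 x) (differentiableAt_const _)]
  simp

theorem contDiff_noiseW {φ : Fin N → Sp d → ℝ} (hφ : ∀ k, IsCbInfty (φ k)) (h : Fin N → ℝ → ℝ)
    (t : ℝ) : ContDiff ℝ 2 (noiseW φ h t) := by
  refine ContDiff.sum fun k _ => (contDiff_const.mul (Complex.ofRealCLM.contDiff.comp ?_)).mul contDiff_const
  exact contDiff_infty.1 (hφ k).1 2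

theorem pderiv_noiseW {φ : Fin N → Sp d → ℝ} (hφ : ∀ k, IsCbInfty (φ k)) (h : Fin N → ℝ → ℝ)
    (t : ℝ) (j : Fin d) : pderiv j (noiseW φ h t) = noiseW (fun k => pderiv j (φ k)) h t := by
  funext x
  have h1 : HasFDerivAt (noiseW φ h t)
      (∑ k, (Complex.I * (h k t : ℂ)) • (Complex.ofRealCLM ∘L fderiv ℝ (φ k) x)) x := by
    have h2 : ∀ k ∈ Finset.univ, HasFDerivAt (fun y => (Complex.I * (h k t : ℂ)) • ((φ k y : ℝ) : ℂ))
        ((Complex.I * (h k t : ℂ)) • (Complex.ofRealCLM ∘L fderiv ℝ (φ k) x)) x := by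
      intro k _
      have h3 : HasFDerivAt (fun y => ((φ k y : ℝ) : ℂ)) (Complex.ofRealCLM ∘L fderiv ℝ (φ k) x) x :=
        Complex.ofRealCLM.hasFDerivAt.comp x ((hφ k).differentiable x).hasFDerivAt
      exact h3.const_smul (Complex.I * (h k t : ℂ))
    refine (HasFDerivAt.fun_sum h2).congr_of_eventuallyEq (Eventually.of_forall fun y => ?_)
    simp only [noiseW, smul_eq_mul]
    refine Finset.sum_congr rfl fun k _ => ?_
    ring
  rw [pderiv, h1.fderiv]
  simp only [sum_apply, smul_apply,
    ContinuousLinearMap.comp_apply, Complex.ofRealCLM_apply, noiseW, smul_eq_mul, pderiv]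
  refine Finset.sum_congr rfl fun k _ => ?_
  ring

theorem isCbInfty_sum_pderiv_mul {f g : Sp d → ℝ} (hf : IsCbInfty f) (hg : IsCbInfty g) :
    IsCbInfty (fun x => ∑ j, pderiv j f x * pderiv j g x) :=
  IsCbInfty.sum Finset.univ fun j => (hf.pderiv j).mul (hg.pderiv j)

/-- The forcing `i (b·∇u + c u)`. -/
def noiseForce {φ : Fin N → Sp d → ℝ} (hφ : ∀ k, IsCbInfty (φ k)) (h : Fin N → ℝ → ℝ) (t : ℝ)
    (u : H1 d) : L2 d :=
  -((∑ k, (h k t : ℂ) • transport (hφ k) u)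
    + ∑ k, ∑ l, ((h k t * h l t : ℝ) : ℂ) • potential (isCbInfty_sum_pderiv_mul (hφ k) (hφ l)) u)

theorem integral_mul_schwartz (v : L2 d) (ψ : 𝓢(Sp d, ℂ)) :
    ∫ x, v x * ψ x = ⟪schL2 (conjS ψ), v⟫ := by
  rw [inner_schL2]
  simp only [conjS_apply, Complex.conj_conj]

theorem ae_all_mulC {ι : Type*} [Finite ι] {f : ι → Sp d → ℝ} (hf : ∀ i, IsCbInfty (f i)) (v : L2 d) :
    ∀ᵐ x, ∀ i, mulC (hf i) v x = (f i x : ℂ) * v x :=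
  ae_all_iff.2 fun i => mulC_ae (hf i) v

theorem coeffB_mul_ae {φ : Fin N → Sp d → ℝ} (hφ : ∀ k, IsCbInfty (φ k)) (h : Fin N → ℝ → ℝ) (t : ℝ)
    (j : Fin d) (v : L2 d) :
    (∑ k, (2 * Complex.I * (h k t : ℂ)) • mulC ((hφ k).pderiv j) v : L2 d)
      =ᵐ[volume] fun x => coeffB φ h j t x * v x := by
  have h1 : ∀ᵐ x, ∀ k, ((2 * Complex.I * (h k t : ℂ)) • mulC ((hφ k).pderiv j) v : L2 d) x
      = (2 * Complex.I * (h k t : ℂ)) • mulC ((hφ k).pderiv j) v x :=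
    ae_all_iff.2 fun k => Lp.coeFn_smul _ _
  filter_upwards [ae_all_mulC (fun k => (hφ k).pderiv j) v, h1, Lp.coeFn_finsetSum Finset.univ
    fun k => (2 * Complex.I * (h k t : ℂ)) • mulC ((hφ k).pderiv j) v] with x e1 e2 e3
  rw [e3, Finset.sum_apply, coeffB, pderiv_noiseW hφ, noiseW, Finset.mul_sum, Finset.sum_mul]
  refine Finset.sum_congr rfl fun k _ => ?_
  rw [e2, e1, smul_eq_mul]
  ring

/-- As W is i times a real function, ΔW is imaginary and (∂_jW)² is real. The first is grouped with
b into the skew operator `transport`, the second becomes the potential. -/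
theorem coeffC_eq {φ : Fin N → Sp d → ℝ} (hφ : ∀ k, IsCbInfty (φ k)) (h : Fin N → ℝ → ℝ) (t : ℝ)
    (x : Sp d) : coeffC φ h t x
      = (∑ k, Complex.I * (h k t : ℂ) * ((∑ j, pderiv j (pderiv j (φ k)) x : ℝ) : ℂ))
        - ∑ k, ∑ l, ((h k t * h l t : ℝ) : ℂ) * ((∑ j, pderiv j (φ k) x * pderiv j (φ l) x : ℝ) : ℂ) := by
  rw [coeffC, laplacian_eq_sum_pderiv (contDiff_noiseW hφ h t), add_comm, sub_eq_add_neg]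
  congr 1
  · have h1 : ∀ j, pderiv j (pderiv j (noiseW φ h t)) x
        = noiseW (fun k => pderiv j (pderiv j (φ k))) h t x := fun j => by
      rw [pderiv_noiseW hφ, pderiv_noiseW fun k => (hφ k).pderiv j]
    simp only [h1, noiseW]
    rw [Finset.sum_comm]
    refine Finset.sum_congr rfl fun k _ => ?_
    push_cast
    rw [Finset.mul_sum]
    refine Finset.sum_congr rfl fun j _ => ?_
    ring
  · simp only [pderiv_noiseW hφ, noiseW, sq, Finset.sum_mul_sum]
    push_cast
    simp only [Finset.mul_sum, ← Finset.sum_neg_distrib]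
    rw [Finset.sum_comm]
    refine Finset.sum_congr rfl fun k _ => ?_
    rw [Finset.sum_comm]
    refine Finset.sum_congr rfl fun l _ => Finset.sum_congr rfl fun j _ => ?_
    linear_combination (↑(pderiv j (φ k) x) * ↑(h k t) * (↑(pderiv j (φ l) x) * ↑(h l t))) * Complex.I_mul_I

theorem coeffC_mul_ae {φ : Fin N → Sp d → ℝ} (hφ : ∀ k, IsCbInfty (φ k)) (h : Fin N → ℝ → ℝ) (t : ℝ)
    (v : L2 d) :
    ((∑ k, (Complex.I * (h k t : ℂ)) •
        mulC (IsCbInfty.sum Finset.univ fun j => ((hφ k).pderiv j).pderiv j) v)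
      - ∑ k, ∑ l, ((h k t * h l t : ℝ) : ℂ) • mulC (isCbInfty_sum_pderiv_mul (hφ k) (hφ l)) v : L2 d)
      =ᵐ[volume] fun x => coeffC φ h t x * v x := by
  have hA := fun k => IsCbInfty.sum Finset.univ fun j => ((hφ k).pderiv j).pderiv j
  have hB := fun q : Fin N × Fin N => isCbInfty_sum_pderiv_mul (hφ q.1) (hφ q.2)
  have h1 : ∀ᵐ x, ∀ k, ((Complex.I * (h k t : ℂ)) • mulC (hA k) v : L2 d) x
      = (Complex.I * (h k t : ℂ)) • mulC (hA k) v x := ae_all_iff.2 fun k => Lp.coeFn_smul _ _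
  have h2 : ∀ᵐ x, ∀ q : Fin N × Fin N, (((h q.1 t * h q.2 t : ℝ) : ℂ) • mulC (hB q) v : L2 d) x
      = ((h q.1 t * h q.2 t : ℝ) : ℂ) • mulC (hB q) v x := ae_all_iff.2 fun k => Lp.coeFn_smul _ _
  rw [← Fintype.sum_prod_type' (fun k l => ((h k t * h l t : ℝ) : ℂ)
    • mulC (isCbInfty_sum_pderiv_mul (hφ k) (hφ l)) v)]
  filter_upwards [ae_all_mulC hA v, ae_all_mulC hB v, h1, h2,
    Lp.coeFn_finsetSum Finset.univ fun k => (Complex.I * (h k t : ℂ)) • mulC (hA k) v,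
    Lp.coeFn_finsetSum Finset.univ fun q => ((h q.1 t * h q.2 t : ℝ) : ℂ) • mulC (hB q) v,
    Lp.coeFn_sub (∑ k, (Complex.I * (h k t : ℂ)) • mulC (hA k) v)
      (∑ q : Fin N × Fin N, ((h q.1 t * h q.2 t : ℝ) : ℂ) • mulC (hB q) v)] with x e1 e2 e3 e4 e5 e6 e7
  rw [e7, Pi.sub_apply, e5, e6, Finset.sum_apply, Finset.sum_apply, coeffC_eq hφ, sub_mul, Finset.sum_mul, ← Fintype.sum_prod_type'
    (fun k l => ((h k t * h l t : ℝ) : ℂ) * ((∑ j, pderiv j (φ k) x * pderiv j (φ l) x : ℝ) : ℂ)),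
    Finset.sum_mul]
  congr 1
  · refine Finset.sum_congr rfl fun k _ => ?_
    rw [e3, e1, smul_eq_mul, mul_assoc _ _ (v x)]
  · refine Finset.sum_congr rfl fun k _ => ?_
    rw [e4, e2, smul_eq_mul, mul_assoc _ _ (v x)]

/-- Rewrites the random equation as the cubic or quintic equation with an L² forcing, the form to
which the abstract energy identity applies. -/
theorem rhsPairing_eq (hd : d = 1 ∨ d = 2) {φ : Fin N → Sp d → ℝ} (hφ : ∀ k, IsCbInfty (φ k))
    (h : Fin N → ℝ → ℝ) (t : ℝ) (u : H1 d) (ψ : 𝓢(Sp d, ℂ)) :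
    rhsPairing φ h t u ψ = -(∑ j, ∫ x, grad u j x * pderiv j ψ x)
      + ∫ x, (nl hd u - Complex.I • noiseForce hφ h t u) x * ψ x := by
  have e1 : ∫ x, nonlin d (toL2 u x) * ψ x = ⟪schL2 (conjS ψ), nl hd u⟫ := by
    rw [← integral_mul_schwartz]
    apply integral_congr_ae
    filter_upwards [nl_ae hd u] with x hx
    rw [hx]
  have e2 : ∀ j, ∫ x, coeffB φ h j t x * grad u j x * ψ x = ⟪schL2 (conjS ψ),
      ∑ k, (2 * Complex.I * (h k t : ℂ)) • mulC ((hφ k).pderiv j) (grad u j)⟫ := by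
    intro j
    rw [← integral_mul_schwartz]
    apply integral_congr_ae
    filter_upwards [coeffB_mul_ae hφ h t j (grad u j)] with x hx
    rw [hx]
  have e3 : ∫ x, coeffC φ h t x * toL2 u x * ψ x = ⟪schL2 (conjS ψ),
      (∑ k, (Complex.I * (h k t : ℂ)) •
        mulC (IsCbInfty.sum Finset.univ fun j => ((hφ k).pderiv j).pderiv j) (toL2 u))
      - ∑ k, ∑ l, ((h k t * h l t : ℝ) : ℂ) •
        mulC (isCbInfty_sum_pderiv_mul (hφ k) (hφ l)) (toL2 u)⟫ := by
    rw [← integral_mul_schwartz]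
    apply integral_congr_ae
    filter_upwards [coeffC_mul_ae hφ h t (toL2 u)] with x hx
    rw [hx]
  rw [rhsPairing, e1, e3, integral_mul_schwartz]
  simp only [e2]
  rw [← inner_sum, add_assoc, add_assoc, ← inner_add_right, ← inner_add_right]
  congr 2
  rw [noiseForce, smul_neg, sub_neg_eq_add]
  congr 1
  simp only [transport_apply, potential_apply, smul_add, Finset.smul_sum, smul_smul,
    Finset.sum_add_distrib]
  rw [Finset.sum_comm, add_assoc, sub_eq_add_neg, ← Finset.sum_neg_distrib]
  congr 1
  · refine Finset.sum_congr rfl fun k _ => Finset.sum_congr rfl fun j _ => ?_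
    congr 1
    ring
  · congr 1
    refine Finset.sum_congr rfl fun k _ => ?_
    rw [← Finset.sum_neg_distrib]
    refine Finset.sum_congr rfl fun l _ => ?_
    rw [← neg_smul]
    congr 1
    linear_combination (((h k t * h l t : ℝ) : ℂ)) * (-Complex.I_mul_I)

/-! ### The energy balance of the random equation. -/

/-- The quadratic form of the noise in the energy balance. -/
def noiseForm {φ : Fin N → Sp d → ℝ} (hφ : ∀ k, IsCbInfty (φ k)) (h : Fin N → ℝ → ℝ) (t : ℝ)
    (u : H1 d) : ℝ :=
  -((∑ k, h k t * ∑ i, (⟪transportComm (hφ k) i u, grad u i⟫ : ℂ).re)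
    + ∑ k, ∑ l, h k t * h l t *
      ∑ i, (⟪potentialDeriv (isCbInfty_sum_pderiv_mul (hφ k) (hφ l)) i u, grad u i⟫ : ℂ).re)

theorem re_inner_noiseForce {φ : Fin N → Sp d → ℝ} (hφ : ∀ k, IsCbInfty (φ k)) (h : Fin N → ℝ → ℝ)
    (t : ℝ) (u : H1 d) (v : L2 d) :
    (⟪noiseForce hφ h t u, v⟫ : ℂ).re
      = -((∑ k, h k t * (⟪transport (hφ k) u, v⟫ : ℂ).re)
        + ∑ k, ∑ l, h k t * h l t *
          (⟪potential (isCbInfty_sum_pderiv_mul (hφ k) (hφ l)) u, v⟫ : ℂ).re) := by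
  simp only [noiseForce, inner_neg_left, inner_add_left, sum_inner, inner_smul_left, Complex.conj_ofReal,
    Complex.neg_re, Complex.add_re, Complex.re_sum, Complex.re_ofReal_mul]

theorem tendsto_re_inner_noiseForce {φ : Fin N → Sp d → ℝ} (hφ : ∀ k, IsCbInfty (φ k))
    (h : Fin N → ℝ → ℝ) (t : ℝ) (u : H1 d) :
    Tendsto (fun j : ℕ => (⟪noiseForce hφ h t u,
      lap ((2 : ℝ)⁻¹ ^ j + (2 : ℝ)⁻¹ ^ j) (toL2 u)⟫ : ℂ).re) atTop (𝓝 (noiseForm hφ h t u)) := by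
  simp only [re_inner_noiseForce]
  refine ((tendsto_finsetSum _ fun k _ => (tendsto_re_inner_transport (hφ k) u).const_mul _).add
    (tendsto_finsetSum _ fun k _ => tendsto_finsetSum _ fun l _ =>
      (tendsto_re_inner_potential (isCbInfty_sum_pderiv_mul (hφ k) (hφ l)) u).const_mul _)).neg

theorem exists_re_inner_noiseForce_le {φ : Fin N → Sp d → ℝ} (hφ : ∀ k, IsCbInfty (φ k))
    (h : Fin N → ℝ → ℝ) (H M : ℝ) :
    ∃ K : ℝ, ∀ (j : ℕ) (t : ℝ) (u : H1 d), (∀ k, |h k t| ≤ H) → ‖u‖ ≤ M →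
      |(⟪noiseForce hφ h t u, lap ((2 : ℝ)⁻¹ ^ j + (2 : ℝ)⁻¹ ^ j) (toL2 u)⟫ : ℂ).re| ≤ K := by
  choose C1 hC10 hC1 using fun k => exists_re_inner_transport_le (hφ k)
  choose C2 hC20 hC2 using fun k l => exists_re_inner_potential_le (isCbInfty_sum_pderiv_mul (hφ k) (hφ l))
  refine ⟨(∑ k, H * (C1 k * M ^ 2)) + ∑ k, ∑ l, H * H * (C2 k l * M ^ 2), fun j t u hH hM => ?_⟩
  have hM' : ‖u‖ ^ 2 ≤ M ^ 2 := pow_le_pow_left₀ (norm_nonneg _) hM 2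
  rw [re_inner_noiseForce, abs_neg]
  refine (abs_add_le _ _).trans (add_le_add ?_ ?_)
  · refine (Finset.abs_sum_le_sum_abs _ _).trans (Finset.sum_le_sum fun k _ => ?_)
    have hH0 : 0 ≤ H := (abs_nonneg _).trans (hH k)
    rw [abs_mul]
    exact mul_le_mul (hH k) ((hC1 k (dyadic_pos j) u).trans (mul_le_mul_of_nonneg_left hM' (hC10 k)))
      (abs_nonneg _) hH0
  · refine (Finset.abs_sum_le_sum_abs _ _).trans (Finset.sum_le_sum fun k _ => ?_)
    refine (Finset.abs_sum_le_sum_abs _ _).trans (Finset.sum_le_sum fun l _ => ?_)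
    have hH0 : 0 ≤ H := (abs_nonneg _).trans (hH k)
    rw [abs_mul, abs_mul]
    exact mul_le_mul (mul_le_mul (hH k) (hH l) (abs_nonneg _) hH0)
      ((hC2 k l (dyadic_pos j) u).trans (mul_le_mul_of_nonneg_left hM' (hC20 k l)))
      (abs_nonneg _) (by positivity)

theorem IsSolutionOn.energy_sub_energy_eq (hd : d = 1 ∨ d = 2) {φ : Fin N → Sp d → ℝ}
    (hφ : ∀ k, IsCbInfty (φ k)) {h : Fin N → ℝ → ℝ} (hh : ∀ k, Continuous (h k)) {a b : ℝ}
    {u : ℝ → H1 d} (hu : IsSolutionOn φ h a b u) {t : ℝ} (ht : t ∈ Set.Icc a b) :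
    energy (u b) - energy (u t)
      = ∫ r in t..b, (noiseForm hφ h r (u r) - (⟪nl hd (u r), noiseForce hφ h r (u r)⟫ : ℂ).re) := by
  have hab : a ≤ b := ht.1.trans ht.2
  -- Time is frozen outside [a, b], so that the solution, the path and the forcing become continuous
  -- and bounded on the whole line. Inside [a, b] nothing changes.
  set p : ℝ → ℝ := fun r => Set.projIcc a b hab r with hp
  have hpc : Continuous p := continuous_subtype_val.comp continuous_projIcc
  have hpm : ∀ r, p r ∈ Set.Icc a b := fun r => (Set.projIcc a b hab r).2
  have hpe : ∀ r ∈ Set.Icc a b, p r = r := fun r hr => by rw [hp]; simp only [Set.projIcc_of_mem hab hr]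
  set v : ℝ → H1 d := fun r => u (p r) with hv
  have hvc : Continuous v := hu.continuousOn.comp_continuous hpc hpm
  set g : Fin N → ℝ → ℝ := fun k r => h k (p r) with hg
  have hgc : ∀ k, Continuous (g k) := fun k => (hh k).comp hpc
  set X : ℝ → L2 d := fun r => noiseForce hφ g r (v r) with hX
  have hXc : Continuous X := by
    simp only [hX, noiseForce]
    fun_prop
  have hve : ∀ r ∈ Set.Icc a b, v r = u r := fun r hr => by rw [hv]; simp only [hpe r hr]
  have hXe : ∀ r ∈ Set.Icc a b, X r = noiseForce hφ h r (u r) := fun r hr => by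
    simp only [hX, hg, noiseForce, hpe r hr, hve r hr]

  obtain ⟨M, hM⟩ := isCompact_Icc.exists_bound_of_continuousOn hu.continuousOn
  obtain ⟨K, hK⟩ := isCompact_Icc.exists_bound_of_continuousOn (s := Set.Icc a b) hXc.continuousOn
  obtain ⟨H, hH⟩ : ∃ H : ℝ, ∀ k, ∀ r ∈ Set.Icc a b, |h k r| ≤ H := by
    choose H hH using fun k => isCompact_Icc.exists_bound_of_continuousOn (s := Set.Icc a b)
      (hh k).continuousOn
    refine ⟨∑ k, |H k|, fun k r hr => ((hH k r hr).trans (le_abs_self _)).trans ?_⟩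
    exact Finset.single_le_sum (f := fun k => |H k|) (fun k _ => abs_nonneg _) (Finset.mem_univ k)
  have hXp : ∀ r, X r = X (p r) := fun r => by
    simp only [hX, hg, noiseForce, hv, hpe (p r) (hpm r)]
  obtain ⟨K', hK'⟩ := exists_re_inner_noiseForce_le hφ g H M
  have hw : IsWeakSolution a b v (fun r => nl hd (v r) - Complex.I • X r) := by
    intro r hr ψ
    have hb : b ∈ Set.Icc a b := ⟨hab, le_rfl⟩
    rw [hve r hr, hve b hb, hu.equation r hr ψ]
    congr 1
    refine intervalIntegral.integral_congr fun q hq => ?_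
    have hq' : q ∈ Set.Icc a b := by
      rw [Set.uIcc_of_ge hr.2] at hq
      exact ⟨hr.1.trans hq.1, hq.2⟩
    beta_reduce
    rw [hve q hq', hXe q hq', rhsPairing_eq hd hφ]
  have hmain := RoughNLS.energy_sub_energy_eq hd hw hvc hXc (M := M) (fun r => hM _ (hpm r)) (K := K)
    (fun r => by rw [hXp]; exact hK _ (hpm r)) (K' := K')
    (fun j r => hK' j r (v r) (fun k => hH k _ (hpm r)) (hM _ (hpm r)))
    (fun r => tendsto_re_inner_noiseForce hφ g r (v r)) ht
  rw [hve b ⟨hab, le_rfl⟩, hve t ht] at hmain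
  rw [hmain]
  refine intervalIntegral.integral_congr fun q hq => ?_
  have hq' : q ∈ Set.Icc a b := by
    rw [Set.uIcc_of_le ht.2] at hq
    exact ⟨ht.1.trans hq.1, hq.2⟩
  beta_reduce
  rw [hXe q hq', hve q hq']
  simp only [noiseForm, hg, hpe q hq']

end

section

variable {N : ℕ}

/-! ### Functions that are flat at the origin -/

/-- The weight `min (1, |x|^n)`. -/
def flatWt (n : ℕ) (x : Sp d) : ℝ := min 1 (‖x‖ ^ n)

theorem flatWt_nonneg (n : ℕ) (x : Sp d) : 0 ≤ flatWt n x := le_min zero_le_one (by positivity)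

theorem flatWt_le_one (n : ℕ) (x : Sp d) : flatWt n x ≤ 1 := min_le_left _ _

theorem flatWt_le_pow (n : ℕ) (x : Sp d) : flatWt n x ≤ ‖x‖ ^ n := min_le_right _ _

theorem flatWt_eq (n : ℕ) (x : Sp d) : flatWt n x = (min 1 ‖x‖) ^ n := by
  rcases le_total ‖x‖ 1 with h | h
  · rw [flatWt, min_eq_right h, min_eq_right (pow_le_one₀ (norm_nonneg _) h)]
  · rw [flatWt, min_eq_left h, min_eq_left (one_le_pow₀ h), one_pow]

theorem flatWt_anti {m n : ℕ} (h : m ≤ n) (x : Sp d) : flatWt n x ≤ flatWt m x := by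
  rw [flatWt_eq, flatWt_eq]
  exact pow_le_pow_of_le_one (le_min zero_le_one (norm_nonneg _)) (min_le_left _ _) h

theorem continuous_flatWt (n : ℕ) : Continuous (flatWt (d := d) n) := by
  unfold flatWt; fun_prop

/-- With a = min(1, |x|), this is the arithmetic–geometric inequality for a^p v and a^q w. -/
theorem flatWt_add_mul_le (p q : ℕ) (x : Sp d) (v w : ℝ) :
    flatWt (p + q) x * (v * w) ≤ 1 / 2 * (flatWt (2 * p) x * v ^ 2 + flatWt (2 * q) x * w ^ 2) := by
  rw [flatWt_eq, flatWt_eq, flatWt_eq]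
  set a := min 1 ‖x‖
  have := sq_nonneg (a ^ p * v - a ^ q * w)
  have e : (a ^ p * v - a ^ q * w) ^ 2 = a ^ (2 * p) * v ^ 2 + a ^ (2 * q) * w ^ 2
      - 2 * (a ^ (p + q) * (v * w)) := by ring
  linarith

/-- All derivatives of `f` of order `m ≤ n` are `O(min (1, |x|^(n-m)))`. -/
def FlatOfOrder (n : ℕ) (f : Sp d → ℝ) : Prop :=
  ∀ m ≤ n, ∃ K : ℝ, 0 ≤ K ∧ ∀ x, ‖iteratedFDeriv ℝ m f x‖ ≤ K * flatWt (n - m) x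

namespace FlatOfOrder

variable {f g : Sp d → ℝ} {n : ℕ}

theorem exists_bound (hf : FlatOfOrder n f) : ∃ K : ℝ, 0 ≤ K ∧ ∀ x, |f x| ≤ K * flatWt n x := by
  obtain ⟨K, hK0, hK⟩ := hf 0 (Nat.zero_le _)
  refine ⟨K, hK0, fun x => ?_⟩
  simpa using hK x

theorem mono {m : ℕ} (h : m ≤ n) (hf : FlatOfOrder n f) : FlatOfOrder m f := by
  intro k hk
  obtain ⟨K, hK0, hK⟩ := hf k (hk.trans h)
  refine ⟨K, hK0, fun x => (hK x).trans ?_⟩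
  gcongr
  exact flatWt_anti (by omega) x

theorem pderiv (hc : IsCbInfty f) (hf : FlatOfOrder (n + 1) f) (j : Fin d) :
    FlatOfOrder n (RoughNLS.pderiv j f) := by
  intro m hm
  have h1 : ContDiff ℝ (⊤ : ℕ∞) (fderiv ℝ f) := hc.1.fderiv_right le_rfl
  obtain ⟨K, hK0, hK⟩ := hf (m + 1) (by omega)
  refine ⟨‖(ei j : Sp d)‖ * K, by positivity, fun x => ?_⟩
  refine (norm_iteratedFDeriv_clm_apply_const (N := (⊤ : ℕ∞)) h1.contDiffAt (by exact_mod_cast le_top)).trans ?_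
  rw [norm_iteratedFDeriv_fderiv, mul_assoc]
  gcongr
  simpa using hK x

theorem sum {ι : Type*} (s : Finset ι) {f : ι → Sp d → ℝ} (hc : ∀ i, IsCbInfty (f i))
    (hf : ∀ i, FlatOfOrder n (f i)) : FlatOfOrder n (fun x => ∑ i ∈ s, f i x) := by
  intro m hm
  choose K hK0 hK using fun i => hf i m hm
  refine ⟨∑ i ∈ s, K i, Finset.sum_nonneg fun i _ => hK0 i, fun x => ?_⟩
  rw [iteratedFDeriv_fun_sum_apply fun i _ => (hc i).1.contDiffAt.of_le (by exact_mod_cast le_top),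
    Finset.sum_mul]
  exact (norm_sum_le _ _).trans (Finset.sum_le_sum fun i _ => hK i x)

theorem mul (hcf : IsCbInfty f) (hf : FlatOfOrder n f) (hg : IsCbInfty g) :
    FlatOfOrder n (fun x => f x * g x) := by
  intro m hm
  choose! K hK0 hK using hf
  choose L hL using hg.2
  refine ⟨∑ i ∈ Finset.range (m + 1), (m.choose i : ℝ) * K i * |L (m - i)|,
    Finset.sum_nonneg fun i hi => ?_, fun x => ?_⟩
  · have := hK0 i (by have := Finset.mem_range.1 hi; omega)
    positivity
  · refine (norm_iteratedFDeriv_mul_le hcf.1 hg.1 x (by exact_mod_cast le_top)).trans ?_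
    rw [Finset.sum_mul]
    refine Finset.sum_le_sum fun i hi => ?_
    have hi' : i ≤ m := by have := Finset.mem_range.1 hi; omega
    have h1 := hK i (hi'.trans hm) x
    have h2 := (hL (m - i) x).trans (le_abs_self _)
    have h3 := hK0 i (hi'.trans hm)
    have h4 : flatWt (n - i) x ≤ flatWt (n - m) x := flatWt_anti (by omega) x
    calc _ ≤ (m.choose i : ℝ) * (K i * flatWt (n - m) x) * |L (m - i)| := by
          exact mul_le_mul (mul_le_mul_of_nonneg_left (h1.trans (mul_le_mul_of_nonneg_left h4 h3))
            (Nat.cast_nonneg _)) h2 (norm_nonneg _)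
            (mul_nonneg (Nat.cast_nonneg _) (mul_nonneg h3 (flatWt_nonneg _ _)))
      _ = _ := by ring

end FlatOfOrder

/-- The sixth derivative is bounded and each lower one vanishes at 0. Descending from order 6, the
mean value inequality on the ball of radius |x| gains one power of |x| per step; boundedness of the
derivatives supplies the minimum with 1. -/
theorem FlatAtOrigin.flatOfOrder {f : Sp d → ℝ} (hc : IsCbInfty f) (hf : FlatAtOrigin f) :
    FlatOfOrder 6 f := by
  have key : ∀ k ≤ 6, ∃ K : ℝ, 0 ≤ K ∧ ∀ x, ‖iteratedFDeriv ℝ (6 - k) f x‖ ≤ K * ‖x‖ ^ k := by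
    intro k
    induction k with
    | zero =>
      intro _
      obtain ⟨K, hK⟩ := hc.2 6
      exact ⟨K, (norm_nonneg _).trans (hK 0), fun x => by simpa using hK x⟩
    | succ k ih =>
      intro hk
      obtain ⟨K, hK0, hK⟩ := ih (by omega)
      refine ⟨K, hK0, fun x => ?_⟩
      have e : 6 - k = 6 - (k + 1) + 1 := by omega
      have h0 : iteratedFDeriv ℝ (6 - (k + 1)) f 0 = 0 := hf _ (by omega)
      have hdiff : Differentiable ℝ (iteratedFDeriv ℝ (6 - (k + 1)) f) :=
        (contDiff_infty.1 hc.1 (6 - (k + 1) + 1)).differentiable_iteratedFDeriv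
          (by exact_mod_cast Nat.lt_succ_self _)
      have h1 := Convex.norm_image_sub_le_of_norm_fderiv_le (𝕜 := ℝ)
        (f := iteratedFDeriv ℝ (6 - (k + 1)) f) (s := Metric.closedBall 0 ‖x‖) (C := K * ‖x‖ ^ k)
        (x := 0) (y := x) (fun z _ => hdiff z) (fun z hz => by
          rw [norm_fderiv_iteratedFDeriv, ← e]
          refine (hK z).trans ?_
          gcongr
          simpa using hz) (convex_closedBall _ _) (by simp) (by simp)
      rw [h0, sub_zero, sub_zero] at h1
      rw [pow_succ, ← mul_assoc]
      exact h1
  intro m hm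
  obtain ⟨K, hK0, hK⟩ := key (6 - m) (by omega)
  obtain ⟨L, hL⟩ := hc.2 m
  have hL0 : 0 ≤ L := (norm_nonneg _).trans (hL 0)
  refine ⟨K + L, by positivity, fun x => ?_⟩
  have e : 6 - (6 - m) = m := by omega
  have h1 := hK x
  rw [e] at h1
  rw [flatWt, mul_min_of_nonneg _ _ (by positivity : 0 ≤ K + L)]
  refine le_min (by linarith [hL x]) (h1.trans ?_)
  gcongr
  linarith

/-! ### Weighted integrals and the bounds for the noise terms. -/

/-- `∫ min (1, |x|^n) |v|²`. -/
def wint (n : ℕ) (v : L2 d) : ℝ := ∫ x, flatWt n x * ‖v x‖ ^ 2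

theorem integrable_wint (n : ℕ) (v : L2 d) : Integrable fun x => flatWt n x * ‖v x‖ ^ 2 := by
  refine (integrable_norm_sq v).mono' ?_ (Eventually.of_forall fun x => ?_)
  · exact (continuous_flatWt n).aestronglyMeasurable.mul ((Lp.aestronglyMeasurable v).norm.pow 2)
  · rw [Real.norm_of_nonneg (mul_nonneg (flatWt_nonneg _ _) (by positivity))]
    exact mul_le_of_le_one_left (by positivity) (flatWt_le_one _ _)

theorem wint_nonneg (n : ℕ) (v : L2 d) : 0 ≤ wint n v :=
  integral_nonneg fun x => mul_nonneg (flatWt_nonneg _ _) (by positivity)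

theorem wint_le (n : ℕ) (v : L2 d) : wint n v ≤ ‖v‖ ^ 2 := by
  rw [norm_sq_eq_integral]
  exact integral_mono (integrable_wint n v) (integrable_norm_sq v) fun x =>
    mul_le_of_le_one_left (by positivity) (flatWt_le_one _ _)

/-- A coefficient vanishing to order p + q is shared between the two factors. The choice of p and q
in the lemmas below matches each term with the exponents 4, 2, 6 in `noiseWeight`. -/
theorem norm_inner_mulC_le {f : Sp d → ℝ} (hc : IsCbInfty f) (p q : ℕ) {K : ℝ} (hK0 : 0 ≤ K)
    (hK : ∀ x, |f x| ≤ K * flatWt (p + q) x) (v w : L2 d) :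
    ‖(⟪mulC hc v, w⟫ : ℂ)‖ ≤ K * (wint (2 * p) v + wint (2 * q) w) := by
  rw [inner_eq_integral]
  refine (norm_integral_le_integral_norm _).trans ?_
  have hi := ((integrable_wint (2 * p) v).add (integrable_wint (2 * q) w)).const_mul (K * (1 / 2))
  have h1 : ∫ x, ‖w x * starRingEnd ℂ (mulC hc v x)‖
      ≤ ∫ x, K * (1 / 2) * (flatWt (2 * p) x * ‖v x‖ ^ 2 + flatWt (2 * q) x * ‖w x‖ ^ 2) := by
    refine integral_mono_ae (L2.integrable_inner (mulC hc v) w).norm hi ?_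
    filter_upwards [mulC_ae hc v] with x hx
    simp only [hx, norm_mul, RCLike.norm_conj, Complex.norm_real, Real.norm_eq_abs]
    calc ‖w x‖ * (|f x| * ‖v x‖) = |f x| * (‖v x‖ * ‖w x‖) := by ring
      _ ≤ K * flatWt (p + q) x * (‖v x‖ * ‖w x‖) := by gcongr; exact hK x
      _ = K * (flatWt (p + q) x * (‖v x‖ * ‖w x‖)) := by ring
      _ ≤ K * (1 / 2 * (flatWt (2 * p) x * ‖v x‖ ^ 2 + flatWt (2 * q) x * ‖w x‖ ^ 2)) := by
        exact mul_le_mul_of_nonneg_left (flatWt_add_mul_le p q x _ _) hK0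
      _ = _ := by ring
  refine h1.trans ?_
  rw [integral_const_mul, integral_add (integrable_wint _ v) (integrable_wint _ w)]
  have h2 := wint_nonneg (2 * p) v
  have h3 := wint_nonneg (2 * q) w
  change K * (1 / 2) * (wint (2 * p) v + wint (2 * q) w) ≤ _
  nlinarith [mul_nonneg hK0 h2, mul_nonneg hK0 h3]

/-- The weighted norm that controls the contribution of the noise to the energy. -/
def noiseWeight (hd : d = 1 ∨ d = 2) (u : H1 d) : ℝ :=
  (∑ j, wint 4 (grad u j)) + wint 2 (toL2 u) + wint 6 (nl hd u)

theorem wint_grad_le_noiseWeight (hd : d = 1 ∨ d = 2) (u : H1 d) (j : Fin d) :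
    wint 4 (grad u j) + wint 2 (toL2 u) + wint 6 (nl hd u) ≤ noiseWeight hd u := by
  have := Finset.single_le_sum (f := fun j => wint 4 (grad u j)) (fun j _ => wint_nonneg 4 (grad u j))
    (Finset.mem_univ j)
  simp only [noiseWeight] at this ⊢
  linarith

theorem wint_add_le_noiseWeight (hd : d = 1 ∨ d = 2) (u : H1 d) :
    wint 2 (toL2 u) + wint 6 (nl hd u) ≤ noiseWeight hd u := by
  have := Finset.sum_nonneg fun (j : Fin d) (_ : j ∈ Finset.univ) => wint_nonneg 4 (grad u j)
  simp only [noiseWeight]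
  linarith

theorem noiseWeight_nonneg (hd : d = 1 ∨ d = 2) (u : H1 d) : 0 ≤ noiseWeight hd u :=
  (add_nonneg (wint_nonneg _ _) (wint_nonneg _ _)).trans (wint_add_le_noiseWeight hd u)

theorem abs_re_le_of_norm_le {z : ℂ} {K : ℝ} (h : ‖z‖ ≤ K) : |z.re| ≤ K := (Complex.abs_re_le_norm z).trans h

/-- Second derivatives of f vanish to order 4 = 2 + 2, shared by two gradients. Third derivatives
vanish to order 3 = 1 + 2, shared by u and a gradient. -/
theorem exists_transportComm_le (hd : d = 1 ∨ d = 2) {f : Sp d → ℝ} (hc : IsCbInfty f)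
    (hf : FlatOfOrder 6 f) (i : Fin d) :
    ∃ K : ℝ, 0 ≤ K ∧ ∀ u : H1 d, ‖(⟪transportComm hc i u, grad u i⟫ : ℂ)‖ ≤ K * noiseWeight hd u := by
  have hf1 := fun j => FlatOfOrder.pderiv hc hf j
  have hf2 := fun j k => FlatOfOrder.pderiv (hc.pderiv j) (hf1 j) k
  have hf3 := FlatOfOrder.pderiv (n := 3) (IsCbInfty.sum Finset.univ fun j => (hc.pderiv j).pderiv j)
    (FlatOfOrder.sum Finset.univ (fun j => (hc.pderiv j).pderiv j) fun j => hf2 j j) i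
  choose K hK0 hK using fun j => (hf2 j i).exists_bound
  obtain ⟨L, hL0, hL⟩ := hf3.exists_bound
  refine ⟨(∑ j, 2 * (K j * 2)) + L, add_nonneg (Finset.sum_nonneg fun j _ => by
    have := hK0 j; positivity) hL0, fun u => ?_⟩
  rw [transportComm_apply, inner_add_left, sum_inner, add_mul, Finset.sum_mul]
  have hn := wint_nonneg 6 (nl hd u)
  have hn2 := wint_nonneg 2 (toL2 u)
  refine (norm_add_le _ _).trans (add_le_add ((norm_sum_le _ _).trans (Finset.sum_le_sum fun j _ => ?_)) ?_)
  · rw [inner_smul_left, norm_mul, RCLike.norm_conj, Complex.norm_ofNat, mul_assoc 2, mul_assoc (K j)]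
    have h1 := norm_inner_mulC_le ((hc.pderiv j).pderiv i) 2 2 (hK0 j) (hK j) (grad u j) (grad u i)
    have h2 := wint_grad_le_noiseWeight hd u j
    have h3 := wint_grad_le_noiseWeight hd u i
    have := hK0 j
    refine mul_le_mul_of_nonneg_left (h1.trans (mul_le_mul_of_nonneg_left ?_ (hK0 j))) two_pos.le
    norm_num
    linarith
  · have h1 := norm_inner_mulC_le ((IsCbInfty.sum Finset.univ fun j => (hc.pderiv j).pderiv j).pderiv i)
      1 2 hL0 hL (toL2 u) (grad u i)
    refine h1.trans (mul_le_mul_of_nonneg_left ?_ hL0)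
    have h3 := wint_grad_le_noiseWeight hd u i
    norm_num
    linarith

/-- First derivatives of f vanish to order 5 = 2 + 3, shared by the gradient and the nonlinearity.
Second derivatives vanish to order 4 = 1 + 3, shared by u and the nonlinearity. -/
theorem exists_inner_nl_transport_le (hd : d = 1 ∨ d = 2) {f : Sp d → ℝ} (hc : IsCbInfty f)
    (hf : FlatOfOrder 6 f) :
    ∃ K : ℝ, 0 ≤ K ∧ ∀ u : H1 d, ‖(⟪transport hc u, nl hd u⟫ : ℂ)‖ ≤ K * noiseWeight hd u := by
  have hf1 := fun j => FlatOfOrder.pderiv hc hf j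
  have hf2 := fun j k => FlatOfOrder.pderiv (hc.pderiv j) (hf1 j) k
  have hf3 := FlatOfOrder.sum Finset.univ (fun j => (hc.pderiv j).pderiv j) fun j => hf2 j j
  choose K hK0 hK using fun j => (hf1 j).exists_bound
  obtain ⟨L, hL0, hL⟩ := hf3.exists_bound
  refine ⟨(∑ j, 2 * K j) + L, add_nonneg (Finset.sum_nonneg fun j _ => by
    have := hK0 j; positivity) hL0, fun u => ?_⟩
  rw [transport_apply, inner_add_left, sum_inner, add_mul, Finset.sum_mul]
  have hn2 := wint_nonneg 2 (toL2 u)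
  refine (norm_add_le _ _).trans (add_le_add ((norm_sum_le _ _).trans (Finset.sum_le_sum fun j _ => ?_)) ?_)
  · rw [inner_smul_left, norm_mul, RCLike.norm_conj, Complex.norm_ofNat, mul_assoc 2]
    have h1 := norm_inner_mulC_le (hc.pderiv j) 2 3 (hK0 j) (hK j) (grad u j) (nl hd u)
    have h2 := wint_grad_le_noiseWeight hd u j
    refine mul_le_mul_of_nonneg_left (h1.trans (mul_le_mul_of_nonneg_left ?_ (hK0 j))) two_pos.le
    norm_num
    linarith
  · have h1 := norm_inner_mulC_le (IsCbInfty.sum Finset.univ fun j => (hc.pderiv j).pderiv j)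
      1 3 hL0 hL (toL2 u) (nl hd u)
    refine h1.trans (mul_le_mul_of_nonneg_left ?_ hL0)
    have h3 := wint_add_le_noiseWeight hd u
    norm_num
    linarith

/-- The derivative of g vanishes to order 4, of which 3 = 1 + 2 is used for u and a gradient. -/
theorem exists_potentialDeriv_le (hd : d = 1 ∨ d = 2) {g : Sp d → ℝ} (hc : IsCbInfty g)
    (hg : FlatOfOrder 5 g) (i : Fin d) :
    ∃ K : ℝ, 0 ≤ K ∧ ∀ u : H1 d, |(⟪potentialDeriv hc i u, grad u i⟫ : ℂ).re| ≤ K * noiseWeight hd u := by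
  obtain ⟨L, hL0, hL⟩ := (FlatOfOrder.mono (by norm_num : 3 ≤ 4) (FlatOfOrder.pderiv hc hg i)).exists_bound
  refine ⟨L, hL0, fun u => ?_⟩
  rw [re_inner_potentialDeriv, inner_smul_left]
  refine abs_re_le_of_norm_le ?_
  rw [norm_mul, RCLike.norm_conj, Complex.norm_I, one_mul]
  refine (norm_inner_mulC_le (hc.pderiv i) 1 2 hL0 hL (toL2 u) (grad u i)).trans
    (mul_le_mul_of_nonneg_left ?_ hL0)
  have hn := wint_nonneg 6 (nl hd u)
  have h3 := wint_grad_le_noiseWeight hd u i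
  norm_num
  linarith

theorem exists_inner_nl_potential_le (hd : d = 1 ∨ d = 2) {g : Sp d → ℝ} (hc : IsCbInfty g)
    (hg : FlatOfOrder 5 g) :
    ∃ K : ℝ, 0 ≤ K ∧ ∀ u : H1 d, ‖(⟪potential hc u, nl hd u⟫ : ℂ)‖ ≤ K * noiseWeight hd u := by
  obtain ⟨L, hL0, hL⟩ := (FlatOfOrder.mono (by norm_num : 4 ≤ 5) hg).exists_bound
  refine ⟨L, hL0, fun u => ?_⟩
  rw [potential_apply, inner_smul_left, norm_mul, RCLike.norm_conj, Complex.norm_I, one_mul]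
  refine (norm_inner_mulC_le hc 1 3 hL0 hL (toL2 u) (nl hd u)).trans (mul_le_mul_of_nonneg_left ?_ hL0)
  have h3 := wint_add_le_noiseWeight hd u
  norm_num
  linarith

theorem exists_noise_le (hd : d = 1 ∨ d = 2) {φ : Fin N → Sp d → ℝ} (hφ : ∀ k, IsCbInfty (φ k))
    (hflat : ∀ k, FlatAtOrigin (φ k)) (h : Fin N → ℝ → ℝ) (H : ℝ) :
    ∃ K : ℝ, 0 ≤ K ∧ ∀ (t : ℝ) (u : H1 d), (∀ k, |h k t| ≤ H) →
      |noiseForm hφ h t u - (⟪nl hd u, noiseForce hφ h t u⟫ : ℂ).re| ≤ K * noiseWeight hd u := by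
  have h6 := fun k => FlatAtOrigin.flatOfOrder (hφ k) (hflat k)
  -- The products vanish to order 10 at the origin, but order 5 from one factor suffices.
  have h5 : ∀ k l, FlatOfOrder 5 (fun x => ∑ j, pderiv j (φ k) x * pderiv j (φ l) x) := fun k l =>
    FlatOfOrder.sum Finset.univ (fun j => ((hφ k).pderiv j).mul ((hφ l).pderiv j)) fun j =>
      FlatOfOrder.mul ((hφ k).pderiv j) (FlatOfOrder.pderiv (hφ k) (h6 k) j) ((hφ l).pderiv j)
  choose K1 hK10 hK1 using fun k => exists_transportComm_le hd (hφ k) (h6 k)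
  choose K2 hK20 hK2 using fun k => exists_inner_nl_transport_le hd (hφ k) (h6 k)
  choose K3 hK30 hK3 using fun k l => exists_potentialDeriv_le hd
    (isCbInfty_sum_pderiv_mul (hφ k) (hφ l)) (h5 k l)
  choose K4 hK40 hK4 using fun k l => exists_inner_nl_potential_le hd
    (isCbInfty_sum_pderiv_mul (hφ k) (hφ l)) (h5 k l)
  refine ⟨((∑ k, |H| * ∑ i, K1 k i) + ∑ k, ∑ l, |H| * |H| * ∑ i, K3 k l i)
    + ((∑ k, |H| * K2 k) + ∑ k, ∑ l, |H| * |H| * K4 k l), ?_, fun t u hH => ?_⟩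
  · refine add_nonneg (add_nonneg ?_ ?_) (add_nonneg ?_ ?_)
    · exact Finset.sum_nonneg fun k _ => mul_nonneg (abs_nonneg _) (Finset.sum_nonneg fun i _ => hK10 k i)
    · exact Finset.sum_nonneg fun k _ => Finset.sum_nonneg fun l _ => mul_nonneg (by positivity)
        (Finset.sum_nonneg fun i _ => hK30 k l i)
    · exact Finset.sum_nonneg fun k _ => mul_nonneg (abs_nonneg _) (hK20 k)
    · exact Finset.sum_nonneg fun k _ => Finset.sum_nonneg fun l _ => mul_nonneg (by positivity) (hK40 k l)
  have hH' : ∀ k, |h k t| ≤ |H| := fun k => (hH k).trans (le_abs_self _)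
  have hW := noiseWeight_nonneg hd u
  rw [← inner_conj_symm, Complex.conj_re, re_inner_noiseForce, noiseForm, add_mul]
  refine (abs_sub _ _).trans (add_le_add ?_ ?_)
  · rw [abs_neg, add_mul, Finset.sum_mul, Finset.sum_mul]
    refine (abs_add_le _ _).trans (add_le_add ?_ ?_)
    · refine (Finset.abs_sum_le_sum_abs _ _).trans (Finset.sum_le_sum fun k _ => ?_)
      rw [abs_mul, mul_assoc]
      refine mul_le_mul (hH' k) ?_ (abs_nonneg _) (abs_nonneg _)
      rw [Finset.sum_mul]
      exact (Finset.abs_sum_le_sum_abs _ _).trans (Finset.sum_le_sum fun i _ =>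
        abs_re_le_of_norm_le (hK1 k i u))
    · refine (Finset.abs_sum_le_sum_abs _ _).trans (Finset.sum_le_sum fun k _ => ?_)
      rw [Finset.sum_mul]
      refine (Finset.abs_sum_le_sum_abs _ _).trans (Finset.sum_le_sum fun l _ => ?_)
      rw [abs_mul, abs_mul, mul_assoc (|H| * |H|)]
      refine mul_le_mul (mul_le_mul (hH' k) (hH' l) (abs_nonneg _) (abs_nonneg _)) ?_
        (abs_nonneg _) (by positivity)
      rw [Finset.sum_mul]
      exact (Finset.abs_sum_le_sum_abs _ _).trans (Finset.sum_le_sum fun i _ => hK3 k l i u)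
  · rw [abs_neg, add_mul, Finset.sum_mul, Finset.sum_mul]
    refine (abs_add_le _ _).trans (add_le_add ?_ ?_)
    · refine (Finset.abs_sum_le_sum_abs _ _).trans (Finset.sum_le_sum fun k _ => ?_)
      rw [abs_mul, mul_assoc]
      exact mul_le_mul (hH' k) (abs_re_le_of_norm_le (hK2 k u)) (abs_nonneg _) (abs_nonneg _)
    · refine (Finset.abs_sum_le_sum_abs _ _).trans (Finset.sum_le_sum fun k _ => ?_)
      rw [Finset.sum_mul]
      refine (Finset.abs_sum_le_sum_abs _ _).trans (Finset.sum_le_sum fun l _ => ?_)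
      rw [abs_mul, abs_mul, mul_assoc (|H| * |H|)]
      exact mul_le_mul (mul_le_mul (hH' k) (hH' l) (abs_nonneg _) (abs_nonneg _))
        (abs_re_le_of_norm_le (hK4 k l u)) (abs_nonneg _) (by positivity)

end

/-! ### Weak and classical gradients -/

theorem denseRange_schL2 : DenseRange (schL2 : 𝓢(Sp d, ℂ) → L2 d) :=
  SchwartzMap.denseRange_toLpCLM (F := ℂ) (E := Sp d) (μ := volume) (p := 2) (by simp)

theorem memLp_schwartz (ψ : 𝓢(Sp d, ℂ)) : MemLp ψ 2 (volume : Measure (Sp d)) := ψ.memLp 2 volume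

/-- The weak gradient of a `C¹` function is the classical one. -/
theorem grad_ae_eq_pderiv {v : H1 d} {W : Sp d → ℂ} (hW : ContDiff ℝ 1 W) (h : toL2 v =ᵐ[volume] W)
    {j : Fin d} (hm : MemLp (pderiv j W) 2) : grad v j =ᵐ[volume] pderiv j W := by
  set G : L2 d := hm.toLp with hG
  have hGae : G =ᵐ[volume] pderiv j W := hm.coeFn_toLp
  have hWm : MemLp W 2 := (memLp_congr_ae h).1 (Lp.memLp (toL2 v))
  suffices hs : grad v j = G by rw [hs]; exact hGae
  refine ext_inner_left ℂ fun w => ?_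
  refine denseRange_schL2.induction_on w (isClosed_eq (by fun_prop) (by fun_prop)) fun χ => ?_
  have h1 := inner_grad_left (ofSchwartz χ) v j
  rw [grad_ofSchwartz, toL2_ofSchwartz] at h1
  rw [← neg_eq_iff_eq_neg.2 h1, inner_schL2, inner_schL2]
  have e1 : ∫ x, toL2 v x * starRingEnd ℂ ((∂_{ei j} χ : 𝓢(Sp d, ℂ)) x)
      = ∫ x, W x * fderiv ℝ (conjS χ) x (ei j) := by
    apply integral_congr_ae
    filter_upwards [h] with x hx
    rw [hx, ← pderiv_conjS]
    rfl
  have e2 : ∫ x, G x * starRingEnd ℂ (χ x) = ∫ x, fderiv ℝ W x (ei j) * conjS χ x := by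
    apply integral_congr_ae
    filter_upwards [hGae] with x hx
    rw [hx]
    rfl
  have hconj : (fun x => fderiv ℝ (conjS χ) x (ei j)) = (∂_{ei j} (conjS χ) : 𝓢(Sp d, ℂ)) := by
    funext x
    rw [SchwartzMap.lineDerivOp_apply_eq_fderiv]
  rw [e1, e2, integral_mul_fderiv_eq_neg_fderiv_mul_of_integrable (f := W) (g := conjS χ), neg_neg]
  · exact hm.integrable_mul (memLp_schwartz (conjS χ))
  · have := hWm.integrable_mul (memLp_schwartz (∂_{ei j} (conjS χ)))
    rw [← hconj] at this
    exact this
  · exact hWm.integrable_mul (memLp_schwartz (conjS χ))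
  · exact fun x _ => hW.differentiable one_ne_zero x
  · exact fun x _ => ((conjS χ).smooth 1).differentiable one_ne_zero x

/-! ### The modulated profile -/

theorem integrable_comp_affine {g : Sp d → ℝ} (hg : Integrable g) {l : ℝ} (hl : 0 < l) (α : Sp d) :
    Integrable fun x => g (l⁻¹ • (x - α)) := by
  have h1 : Integrable fun x => g (l⁻¹ • x) :=
    (integrable_comp_smul_iff volume g (inv_ne_zero hl.ne')).2 hg
  exact h1.comp_sub_right α

theorem integral_comp_affine (g : Sp d → ℝ) {l : ℝ} (hl : 0 < l) (α : Sp d) :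
    ∫ x, g (l⁻¹ • (x - α)) = l ^ d * ∫ x, g x := by
  rw [integral_sub_right_eq_self (fun x => g (l⁻¹ • x)) α,
    Measure.integral_comp_inv_smul_of_nonneg volume g hl.le]
  simp

/-- The phase `β·y - γ|y|²/4` of a modulated profile. -/
def modPhase (p : Modulation d) (y : Sp d) : ℝ := inner ℝ p.β y - p.γ / 4 * ‖y‖ ^ 2

theorem hasFDerivAt_modPhase (p : Modulation d) (y : Sp d) :
    HasFDerivAt (modPhase p) (innerSL ℝ p.β - (p.γ / 4) • ((2 : ℕ) • innerSL ℝ y)) y :=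
  ((innerSL ℝ p.β).hasFDerivAt).sub ((hasStrictFDerivAt_norm_sq y).hasFDerivAt.const_mul (p.γ / 4))

theorem norm_fderiv_modPhase_le (p : Modulation d) (y : Sp d) :
    ‖innerSL ℝ p.β - (p.γ / 4) • ((2 : ℕ) • innerSL ℝ y)‖ ≤ ‖p.β‖ + |p.γ| * ‖y‖ := by
  refine (norm_sub_le _ _).trans ?_
  rw [innerSL_apply_norm, norm_smul, Real.norm_eq_abs]
  refine add_le_add le_rfl ?_
  rw [← Nat.cast_smul_eq_nsmul ℝ, norm_smul, innerSL_apply_norm, abs_div]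
  have h1 := abs_nonneg p.γ
  have h2 := norm_nonneg y
  norm_num
  nlinarith [mul_nonneg h1 h2]

/-- The profile before translation and dilation. -/
def modProfile (Q : Sp d → ℝ) (p : Modulation d) (y : Sp d) : ℂ :=
  (Q y : ℂ) * Complex.exp (Complex.I * (modPhase p y : ℂ))

theorem norm_exp_I_mul (r : ℝ) : ‖Complex.exp (Complex.I * (r : ℂ))‖ = 1 := by
  rw [mul_comm, Complex.norm_exp_ofReal_mul_I]

theorem contDiff_modProfile {Q : Sp d → ℝ} (hQ : ContDiff ℝ 1 Q) (p : Modulation d) :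
    ContDiff ℝ 1 (modProfile Q p) := by
  have h1 : ContDiff ℝ 1 (modPhase p) := by
    unfold modPhase
    exact ((innerSL ℝ p.β).contDiff).sub (contDiff_const.mul (contDiff_norm_sq ℝ))
  exact (Complex.ofRealCLM.contDiff.comp hQ).mul
    ((contDiff_const.mul (Complex.ofRealCLM.contDiff.comp h1)).cexp)

theorem norm_fderiv_modProfile_le {Q : Sp d → ℝ} (hQ : ContDiff ℝ 1 Q) (p : Modulation d) (y : Sp d) :
    ‖fderiv ℝ (modProfile Q p) y‖ ≤ ‖fderiv ℝ Q y‖ + |Q y| * (‖p.β‖ + |p.γ| * ‖y‖) := by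
  have h1 : HasFDerivAt (fun y => ((modPhase p y : ℝ) : ℂ))
      (Complex.ofRealCLM ∘L (innerSL ℝ p.β - (p.γ / 4) • ((2 : ℕ) • innerSL ℝ y))) y :=
    Complex.ofRealCLM.hasFDerivAt.comp y (hasFDerivAt_modPhase p y)
  have h2 : HasFDerivAt (fun y => ((Q y : ℝ) : ℂ)) (Complex.ofRealCLM ∘L fderiv ℝ Q y) y :=
    Complex.ofRealCLM.hasFDerivAt.comp y (hQ.differentiable one_ne_zero y).hasFDerivAt
  have h3 : HasFDerivAt (modProfile Q p) _ y := h2.mul ((h1.const_mul Complex.I).cexp)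
  rw [h3.fderiv]
  have hexp := norm_exp_I_mul (modPhase p y)
  refine (norm_add_le _ _).trans ?_
  rw [norm_smul, norm_smul, norm_smul, norm_smul, hexp, Complex.norm_I, Complex.norm_real,
    one_mul, one_mul, one_mul, Real.norm_eq_abs, add_comm]
  have hn : ∀ L : Sp d →L[ℝ] ℝ, ‖Complex.ofRealCLM ∘L L‖ ≤ ‖L‖ := fun L => by
    refine (ContinuousLinearMap.opNorm_comp_le _ _).trans ?_
    rw [Complex.ofRealCLM_norm, one_mul]
  exact add_le_add (hn _) (mul_le_mul_of_nonneg_left ((hn _).trans (norm_fderiv_modPhase_le p y))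
    (abs_nonneg _))

theorem modulated_eq (Q : Sp d → ℝ) (p : Modulation d) : modulated Q p = fun x =>
    (((p.lam ^ (-(d : ℝ) / 2) : ℝ) : ℂ) * Complex.exp (Complex.I * (p.θ : ℂ)))
      * modProfile Q p (p.lam⁻¹ • (x - p.α)) := by
  funext x
  simp only [modulated, modProfile, modPhase]
  push_cast
  ring

theorem norm_modulated_coeff (p : Modulation d) (hp : 0 < p.lam) :
    ‖((p.lam ^ (-(d : ℝ) / 2) : ℝ) : ℂ) * Complex.exp (Complex.I * (p.θ : ℂ))‖ ^ 2 = (p.lam ^ d)⁻¹ := by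
  rw [norm_mul, norm_exp_I_mul, mul_one, Complex.norm_real, Real.norm_of_nonneg (by positivity),
    ← Real.rpow_natCast, ← Real.rpow_mul hp.le]
  have : -(d : ℝ) / 2 * ((2 : ℕ) : ℝ) = -(d : ℝ) := by push_cast; ring
  rw [this, Real.rpow_neg hp.le, Real.rpow_natCast]

theorem norm_sq_modulated (Q : Sp d → ℝ) (p : Modulation d) (hp : 0 < p.lam) (x : Sp d) :
    ‖modulated Q p x‖ ^ 2 = (p.lam ^ d)⁻¹ * Q (p.lam⁻¹ • (x - p.α)) ^ 2 := by
  rw [modulated_eq, norm_mul, mul_pow, norm_modulated_coeff p hp, modProfile, norm_mul, norm_exp_I_mul,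
    mul_one, Complex.norm_real, Real.norm_eq_abs, sq_abs]

theorem contDiff_modulated {Q : Sp d → ℝ} (hQ : ContDiff ℝ 1 Q) (p : Modulation d) :
    ContDiff ℝ 1 (modulated Q p) := by
  rw [modulated_eq]
  exact contDiff_const.mul ((contDiff_modProfile hQ p).comp
    ((contDiff_id.sub contDiff_const).const_smul p.lam⁻¹))

theorem norm_sq_pderiv_modulated_le {Q : Sp d → ℝ} (hQ : ContDiff ℝ 1 Q) (p : Modulation d)
    (hp : 0 < p.lam) (j : Fin d) (x : Sp d) :
    ‖pderiv j (modulated Q p) x‖ ^ 2 ≤ (p.lam ^ d)⁻¹ * (p.lam⁻¹ ^ 2 *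
      (‖fderiv ℝ Q (p.lam⁻¹ • (x - p.α))‖ + |Q (p.lam⁻¹ • (x - p.α))|
        * (‖p.β‖ + |p.γ| * ‖p.lam⁻¹ • (x - p.α)‖)) ^ 2) := by
  set y := p.lam⁻¹ • (x - p.α) with hy
  set k := ((p.lam ^ (-(d : ℝ) / 2) : ℝ) : ℂ) * Complex.exp (Complex.I * (p.θ : ℂ)) with hk
  have h1 : HasFDerivAt (fun x => p.lam⁻¹ • (x - p.α)) (p.lam⁻¹ • ContinuousLinearMap.id ℝ (Sp d)) x :=
    ((hasFDerivAt_id x).sub_const p.α).const_smul p.lam⁻¹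
  have h2 : HasFDerivAt (modProfile Q p) (fderiv ℝ (modProfile Q p) y) y :=
    ((contDiff_modProfile hQ p).differentiable one_ne_zero y).hasFDerivAt
  have h3 : HasFDerivAt (modulated Q p) (k • (fderiv ℝ (modProfile Q p) y ∘L
      (p.lam⁻¹ • ContinuousLinearMap.id ℝ (Sp d)))) x := by
    rw [modulated_eq]
    exact (h2.comp x h1).const_mul k
  rw [pderiv, h3.fderiv, smul_apply, norm_smul, mul_pow, hk, norm_modulated_coeff p hp]
  gcongr
  rw [← mul_pow]
  gcongr
  rw [ContinuousLinearMap.comp_apply, smul_apply, ContinuousLinearMap.id_apply, map_smul, norm_smul,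
    Real.norm_of_nonneg (by positivity)]
  gcongr
  refine (ContinuousLinearMap.le_opNorm _ _).trans ?_
  rw [PiLp.norm_single, norm_one, mul_one]
  exact norm_fderiv_modProfile_le hQ p y

/-- The integrability properties of the profile that are used: weighted square integrability of the
profile and of its gradient. -/
structure IsLocalizedProfile (Q : Sp d → ℝ) : Prop where
  contDiff : ContDiff ℝ 1 Q
  integrable_sq : Integrable fun y => (1 + ‖y‖) ^ 6 * Q y ^ 2
  integrable_fderiv : Integrable fun y => (1 + ‖y‖) ^ 4 * ‖fderiv ℝ Q y‖ ^ 2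
  integrable_pow : Integrable fun y => (1 + ‖y‖) ^ 6 * (Q y ^ 2) ^ (4 / d + 1)

/-- From x = λy + α with λ ≤ 2s and |α| ≤ s one gets |x| ≤ 2s(1+|y|). A weight of order n is thus
worth s^n at the cost of moments of the profile. -/
theorem flatWt_le_of_param {p : Modulation d} {s : ℝ} (hp : 0 < p.lam) (hl : p.lam ≤ 2 * s)
    (hα : ‖p.α‖ ≤ s) (n : ℕ) (x : Sp d) :
    flatWt n x ≤ (2 * s) ^ n * (1 + ‖p.lam⁻¹ • (x - p.α)‖) ^ n := by
  refine (flatWt_le_pow n x).trans ?_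
  rw [← mul_pow]
  gcongr
  have h1 : x = p.lam • (p.lam⁻¹ • (x - p.α)) + p.α := by
    rw [smul_smul, mul_inv_cancel₀ hp.ne', one_smul, sub_add_cancel]
  have h2 := norm_add_le (p.lam • (p.lam⁻¹ • (x - p.α))) p.α
  rw [← h1, norm_smul, Real.norm_of_nonneg hp.le] at h2
  have h3 := norm_nonneg (p.lam⁻¹ • (x - p.α))
  have h4 := norm_nonneg p.α
  nlinarith

theorem memLp_pderiv_modulated {Q : Sp d → ℝ} (hQ : IsLocalizedProfile Q) (p : Modulation d)
    (hp : 0 < p.lam) (j : Fin d) : MemLp (pderiv j (modulated Q p)) 2 := by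
  have hc : Continuous (pderiv j (modulated Q p)) :=
    ((contDiff_modulated hQ.contDiff p).continuous_fderiv one_ne_zero).clm_apply continuous_const
  rw [memLp_two_iff_integrable_sq_norm hc.aestronglyMeasurable]
  have hi : Integrable fun y => (1 + ‖y‖) ^ 4 * ‖fderiv ℝ Q y‖ ^ 2
      + (‖p.β‖ + |p.γ|) ^ 2 * ((1 + ‖y‖) ^ 6 * Q y ^ 2) :=
    hQ.integrable_fderiv.add (hQ.integrable_sq.const_mul _)
  refine ((integrable_comp_affine hi hp p.α).const_mul ((p.lam ^ d)⁻¹ * (p.lam⁻¹ ^ 2 * 2))).mono'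
    (hc.norm.pow 2).aestronglyMeasurable (Eventually.of_forall fun x => ?_)
  rw [Real.norm_of_nonneg (by positivity)]
  refine (norm_sq_pderiv_modulated_le hQ.contDiff p hp j x).trans ?_
  set y := p.lam⁻¹ • (x - p.α)
  rw [mul_assoc, mul_assoc]
  gcongr
  have hy := norm_nonneg y
  have h1 : ‖p.β‖ + |p.γ| * ‖y‖ ≤ (‖p.β‖ + |p.γ|) * (1 + ‖y‖) := by
    have := norm_nonneg p.β
    have := abs_nonneg p.γ
    nlinarith [mul_nonneg (norm_nonneg p.β) hy]
  have h2 : (1 : ℝ) ≤ (1 + ‖y‖) ^ 4 := one_le_pow₀ (by linarith)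
  calc (‖fderiv ℝ Q y‖ + |Q y| * (‖p.β‖ + |p.γ| * ‖y‖)) ^ 2
      ≤ (‖fderiv ℝ Q y‖ + |Q y| * ((‖p.β‖ + |p.γ|) * (1 + ‖y‖))) ^ 2 := by gcongr
    _ ≤ 2 * (‖fderiv ℝ Q y‖ ^ 2 + (|Q y| * ((‖p.β‖ + |p.γ|) * (1 + ‖y‖))) ^ 2) := by
      exact add_sq_le
    _ = 2 * (1 * ‖fderiv ℝ Q y‖ ^ 2 + (‖p.β‖ + |p.γ|) ^ 2 * ((1 * (1 + ‖y‖) ^ 2) * Q y ^ 2)) := by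
      rw [mul_pow, sq_abs]; ring
    _ ≤ 2 * ((1 + ‖y‖) ^ 4 * ‖fderiv ℝ Q y‖ ^ 2
        + (‖p.β‖ + |p.γ|) ^ 2 * (((1 + ‖y‖) ^ 4 * (1 + ‖y‖) ^ 2) * Q y ^ 2)) := by gcongr
    _ = _ := by ring

/-- In the variable y the L² normalisation cancels the Jacobian. The squared gradient costs λ^(-2)
against s^4, the function costs nothing against s^2, and the squared nonlinearity costs λ^(-4)
against s^6 since d·(4/d) = 4. All three are of size s². -/
theorem exists_noiseWeight_modulated_le (hd : d = 1 ∨ d = 2) {Q : Sp d → ℝ} (hQ : IsLocalizedProfile Q) :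
    ∃ C : ℝ, 0 ≤ C ∧ ∀ (v : H1 d) (p : Modulation d) (s : ℝ), 0 < s → s / 2 ≤ p.lam → p.lam ≤ 2 * s →
      ‖p.α‖ ≤ s → ‖p.β‖ ≤ 1 → |p.γ| ≤ 1 → toL2 v =ᵐ[volume] modulated Q p →
      noiseWeight hd v ≤ C * s ^ 2 := by
  set J0 := ∫ y, (1 + ‖y‖) ^ 6 * Q y ^ 2 with hJ0
  set J1 := ∫ y, (1 + ‖y‖) ^ 4 * ‖fderiv ℝ Q y‖ ^ 2 with hJ1
  set J2 := ∫ y, (1 + ‖y‖) ^ 6 * (Q y ^ 2) ^ (4 / d + 1) with hJ2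
  have hJ00 : 0 ≤ J0 := integral_nonneg fun y => by positivity
  have hJ10 : 0 ≤ J1 := integral_nonneg fun y => by positivity
  have hJ20 : 0 ≤ J2 := integral_nonneg fun y => by positivity
  -- From |x| ≤ 2s(1+|y|) and 1/λ ≤ 2/s: 128 = 2^4·2^2·2, with the last 2 from the square of a sum,
  -- then 4 = 2^2 and 1024 = 2^6·2^4.
  refine ⟨(∑ _j : Fin d, 128 * (J1 + J0)) + 4 * J0 + 1024 * J2, by positivity,
    fun v p s hs hl1 hl2 hα hβ hγ hv => ?_⟩
  have hp : 0 < p.lam := lt_of_lt_of_le (by positivity) hl1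
  have hpd : 0 < p.lam ^ d := by positivity
  have hinv : p.lam⁻¹ ≤ 2 * s⁻¹ := by
    calc p.lam⁻¹ ≤ (s / 2)⁻¹ := inv_anti₀ (by positivity) hl1
      _ = 2 * s⁻¹ := by rw [inv_div, div_eq_mul_inv]
  have hinv0 : 0 ≤ p.lam⁻¹ := by positivity
  have key : ∀ (f : Sp d → ℝ) (g : Sp d → ℝ) (A : ℝ), Integrable g → (∀ x, 0 ≤ f x) →
      (∀ x, f x ≤ A * ((p.lam ^ d)⁻¹ * g (p.lam⁻¹ • (x - p.α)))) → ∫ x, f x ≤ A * ∫ y, g y := by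
    intro f g A hg hf hfg
    refine (integral_mono_of_nonneg (Eventually.of_forall hf)
      (((integrable_comp_affine hg hp p.α).const_mul _).const_mul A)
      (Eventually.of_forall hfg)).trans (le_of_eq ?_)
    rw [integral_const_mul, integral_const_mul, integral_comp_affine g hp, inv_mul_cancel_left₀ hpd.ne']
  have hflat := flatWt_le_of_param hp hl2 hα
  rw [noiseWeight, add_mul, add_mul, Finset.sum_mul]
  refine add_le_add (add_le_add (Finset.sum_le_sum fun j _ => ?_) ?_) ?_
  · have hae := grad_ae_eq_pderiv (contDiff_modulated hQ.contDiff p) hv (memLp_pderiv_modulated hQ p hp j)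
    have e1 : wint 4 (grad v j) = ∫ x, flatWt 4 x * ‖pderiv j (modulated Q p) x‖ ^ 2 := by
      apply integral_congr_ae
      filter_upwards [hae] with x hx
      rw [hx]
    have hi : Integrable fun y => (1 + ‖y‖) ^ 4 * ‖fderiv ℝ Q y‖ ^ 2 + (1 + ‖y‖) ^ 6 * Q y ^ 2 :=
      hQ.integrable_fderiv.add hQ.integrable_sq
    rw [e1]
    refine (key _ _ ((2 * s) ^ 4 * (p.lam⁻¹ ^ 2 * 2)) hi (fun x => mul_nonneg (flatWt_nonneg _ _)
      (by positivity)) fun x => ?_).trans ?_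
    · have h1 := norm_sq_pderiv_modulated_le hQ.contDiff p hp j x
      have h2 := hflat 4 x
      set y := p.lam⁻¹ • (x - p.α)
      have hy := norm_nonneg y
      have h3 : ‖p.β‖ + |p.γ| * ‖y‖ ≤ 1 + ‖y‖ := by
        have := mul_le_of_le_one_left hy hγ
        linarith
      calc _ ≤ ((2 * s) ^ 4 * (1 + ‖y‖) ^ 4) * ((p.lam ^ d)⁻¹ * (p.lam⁻¹ ^ 2 *
            (‖fderiv ℝ Q y‖ + |Q y| * (1 + ‖y‖)) ^ 2)) := by
            refine mul_le_mul h2 (h1.trans ?_) (by positivity) (by positivity)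
            gcongr
        _ ≤ ((2 * s) ^ 4 * (1 + ‖y‖) ^ 4) * ((p.lam ^ d)⁻¹ * (p.lam⁻¹ ^ 2 *
            (2 * (‖fderiv ℝ Q y‖ ^ 2 + (|Q y| * (1 + ‖y‖)) ^ 2)))) := by
            gcongr
            exact add_sq_le
        _ = _ := by rw [mul_pow |Q y|, sq_abs]; ring
    · rw [integral_add hQ.integrable_fderiv hQ.integrable_sq]
      have h4 : p.lam⁻¹ ^ 2 ≤ (2 * s⁻¹) ^ 2 := by gcongr
      calc _ ≤ (2 * s) ^ 4 * ((2 * s⁻¹) ^ 2 * 2) * (J1 + J0) := by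
            exact mul_le_mul_of_nonneg_right (by gcongr) (by positivity)
        _ = _ := by field_simp; ring
  · have e1 : wint 2 (toL2 v) = ∫ x, flatWt 2 x * ‖modulated Q p x‖ ^ 2 := by
      apply integral_congr_ae
      filter_upwards [hv] with x hx
      rw [hx]
    rw [e1]
    refine (key _ _ ((2 * s) ^ 2) hQ.integrable_sq (fun x => mul_nonneg (flatWt_nonneg _ _)
      (by positivity)) fun x => ?_).trans (le_of_eq (by ring))
    have h2 := hflat 2 x
    rw [norm_sq_modulated Q p hp]
    set y := p.lam⁻¹ • (x - p.α)
    have hy := norm_nonneg y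
    have h3 : (1 + ‖y‖) ^ 2 ≤ (1 + ‖y‖) ^ 6 := pow_le_pow_right₀ (by linarith) (by norm_num)
    calc _ ≤ ((2 * s) ^ 2 * (1 + ‖y‖) ^ 6) * ((p.lam ^ d)⁻¹ * Q y ^ 2) := by
          refine mul_le_mul_of_nonneg_right (h2.trans ?_) (by positivity)
          gcongr
      _ = _ := by ring
  · have hq : d * (4 / d) = 4 := by rcases hd with rfl | rfl <;> norm_num
    have e1 : wint 6 (nl hd v) = ∫ x, flatWt 6 x * (‖modulated Q p x‖ ^ 2) ^ (4 / d + 1) := by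
      apply integral_congr_ae
      filter_upwards [hv, nl_ae hd v] with x hx hx2
      rw [hx2, norm_nonlin hd, hx, ← pow_mul, ← pow_mul, mul_comm 2]
    rw [e1]
    refine (key _ _ ((2 * s) ^ 6 * p.lam⁻¹ ^ 4) hQ.integrable_pow (fun x => mul_nonneg (flatWt_nonneg _ _)
      (by positivity)) fun x => ?_).trans ?_
    · have h2 := hflat 6 x
      rw [norm_sq_modulated Q p hp, mul_pow, pow_succ (p.lam ^ d)⁻¹, inv_pow, ← pow_mul, hq]
      refine (mul_le_mul_of_nonneg_right h2 (by positivity)).trans (le_of_eq ?_)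
      ring
    · calc _ ≤ (2 * s) ^ 6 * (2 * s⁻¹) ^ 4 * J2 := by gcongr
        _ = _ := by field_simp; ring

/-! ### The weighted norm of a sum and of a small remainder. -/

theorem wint_add_le (n : ℕ) (v w : L2 d) : wint n (v + w) ≤ 2 * (wint n v + wint n w) := by
  have hi := ((integrable_wint n v).add (integrable_wint n w)).const_mul 2
  have h1 : wint n (v + w) ≤ ∫ x, 2 * (flatWt n x * ‖v x‖ ^ 2 + flatWt n x * ‖w x‖ ^ 2) := by
    refine integral_mono_ae (integrable_wint n _) hi ?_
    filter_upwards [Lp.coeFn_add v w] with x hx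
    rw [hx, Pi.add_apply, ← mul_add, mul_left_comm]
    refine mul_le_mul_of_nonneg_left ?_ (flatWt_nonneg _ _)
    exact (pow_le_pow_left₀ (norm_nonneg _) (norm_add_le _ _) 2).trans add_sq_le
  rwa [integral_const_mul, integral_add (integrable_wint n v) (integrable_wint n w)] at h1

theorem wint_nl_add_le (hd : d = 1 ∨ d = 2) (n : ℕ) (v w : H1 d) :
    wint n (nl hd (v + w)) ≤ 2 ^ (2 * (4 / d) + 1) * (wint n (nl hd v) + wint n (nl hd w)) := by
  have hi := ((integrable_wint n (nl hd v)).add (integrable_wint n (nl hd w))).const_mul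
    (2 ^ (2 * (4 / d) + 1))
  have h1 : wint n (nl hd (v + w)) ≤ ∫ x, 2 ^ (2 * (4 / d) + 1)
      * (flatWt n x * ‖nl hd v x‖ ^ 2 + flatWt n x * ‖nl hd w x‖ ^ 2) := by
    refine integral_mono_ae (integrable_wint n _) hi ?_
    have hadd : toL2 (v + w) = toL2 v + toL2 w := rfl
    filter_upwards [nl_ae hd (v + w), nl_ae hd v, nl_ae hd w, Lp.coeFn_add (toL2 v) (toL2 w)]
      with x h1 h2 h3 h4
    rw [h1, h2, h3, norm_nonlin hd, norm_nonlin hd, norm_nonlin hd, hadd, h4, Pi.add_apply, ← mul_add,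
      mul_left_comm]
    refine mul_le_mul_of_nonneg_left ?_ (flatWt_nonneg _ _)
    have e : (4 / d + 1) * 2 = 2 * (4 / d) + 1 + 1 := by ring
    rw [← pow_mul, ← pow_mul, ← pow_mul, e]
    refine (pow_le_pow_left₀ (norm_nonneg _) (norm_add_le _ _) _).trans ?_
    exact add_pow_le (norm_nonneg _) (norm_nonneg _) _
  rwa [integral_const_mul, integral_add (integrable_wint n _) (integrable_wint n _)] at h1

theorem noiseWeight_add_le (hd : d = 1 ∨ d = 2) (v w : H1 d) :
    noiseWeight hd (v + w) ≤ 2 ^ (2 * (4 / d) + 1) * (noiseWeight hd v + noiseWeight hd w) := by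
  have h2 : (2 : ℝ) ≤ 2 ^ (2 * (4 / d) + 1) := by
    calc (2 : ℝ) = 2 ^ 1 := (pow_one _).symm
      _ ≤ _ := pow_le_pow_right₀ one_le_two (by omega)
  have h3 : ∀ (n : ℕ) (v w : L2 d), wint n (v + w) ≤ 2 ^ (2 * (4 / d) + 1) * (wint n v + wint n w) :=
    fun n v w => (wint_add_le n v w).trans (mul_le_mul_of_nonneg_right h2
      (add_nonneg (wint_nonneg _ _) (wint_nonneg _ _)))
  have e : (2 : ℝ) ^ (2 * (4 / d) + 1) * (noiseWeight hd v + noiseWeight hd w)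
      = (∑ j, 2 ^ (2 * (4 / d) + 1) * (wint 4 (grad v j) + wint 4 (grad w j)))
        + 2 ^ (2 * (4 / d) + 1) * (wint 2 (toL2 v) + wint 2 (toL2 w))
        + 2 ^ (2 * (4 / d) + 1) * (wint 6 (nl hd v) + wint 6 (nl hd w)) := by
    rw [← Finset.mul_sum, Finset.sum_add_distrib, noiseWeight, noiseWeight]
    ring
  rw [e, noiseWeight]
  exact add_le_add (add_le_add (Finset.sum_le_sum fun j _ => h3 4 (grad v j) (grad w j))
    (h3 2 (toL2 v) (toL2 w))) (wint_nl_add_le hd 6 v w)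

theorem exists_noiseWeight_le (hd : d = 1 ∨ d = 2) :
    ∃ C : ℝ, 0 ≤ C ∧ ∀ (w : H1 d), ‖w‖ ≤ 1 → noiseWeight hd w ≤ C * ‖w‖ ^ 2 := by
  obtain ⟨C, hC0, hC⟩ := exists_norm_nl_le hd
  refine ⟨d + 1 + C ^ 2, by positivity, fun w hw => ?_⟩
  have hsq : ∀ x : ℝ, 0 ≤ x → x ≤ ‖w‖ → x ^ 2 ≤ ‖w‖ ^ 2 := fun x h0 h => pow_le_pow_left₀ h0 h 2
  have h1 : ∑ j, wint 4 (grad w j) ≤ d * ‖w‖ ^ 2 := by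
    refine (Finset.sum_le_sum fun j _ => (wint_le 4 (grad w j)).trans
      (hsq _ (norm_nonneg _) (norm_grad_le w j))).trans ?_
    simp
  have h2 := (wint_le 2 (toL2 w)).trans (hsq _ (norm_nonneg _) (norm_toL2_le w))
  have h3 : wint 6 (nl hd w) ≤ C ^ 2 * ‖w‖ ^ 2 := by
    refine (wint_le _ _).trans ?_
    rw [← mul_pow]
    refine pow_le_pow_left₀ (norm_nonneg _) ((hC w).trans ?_) 2
    gcongr
    exact pow_le_of_le_one (norm_nonneg _) hw (Nat.succ_ne_zero _)
  rw [noiseWeight]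
  linarith

/-! ### Decay of the ground state -/

/-- A positive second derivative would make x a local minimum as well, so f would be locally
constant with vanishing second derivative. -/
theorem deriv_deriv_nonpos_of_isLocalMax {f : ℝ → ℝ} {x : ℝ} (hf : ContinuousAt f x)
    (h : IsLocalMax f x) : deriv (deriv f) x ≤ 0 := by
  by_contra! hpos
  have hmin := isLocalMin_of_deriv_deriv_pos hpos h.deriv_eq_zero hf
  have hconst : f =ᶠ[𝓝 x] fun _ => f x := by
    filter_upwards [h, hmin] with y h1 h2
    exact le_antisymm h1 h2
  have hd : deriv f =ᶠ[𝓝 x] fun _ => 0 := by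
    filter_upwards [hconst.eventuallyEq_nhds] with y hy
    rw [hy.deriv_eq, deriv_const]
  rw [hd.deriv_eq, deriv_const] at hpos
  exact lt_irrefl _ hpos

theorem hasDerivAt_comp_line {f : Sp d → ℝ} (hf : Differentiable ℝ f) (x : Sp d) (j : Fin d) (t : ℝ) :
    HasDerivAt (fun t : ℝ => f (x + t • ei j)) (pderiv j f (x + t • ei j)) t := by
  have h1 : HasDerivAt (fun t : ℝ => x + t • (ei j : Sp d)) (ei j) t := by
    simpa using ((hasDerivAt_id t).smul_const (ei j : Sp d)).const_add x
  exact (hf _).hasFDerivAt.comp_hasDerivAt t h1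

theorem norm_sq_add_smul_ei (x : Sp d) (j : Fin d) (t : ℝ) :
    ‖x + t • (ei j : Sp d)‖ ^ 2 = ‖x‖ ^ 2 + 2 * x j * t + t ^ 2 := by
  rw [norm_add_sq_real, inner_smul_right, inner_ei, norm_smul, PiLp.norm_single, norm_one, mul_one,
    Real.norm_eq_abs, sq_abs]
  ring

/-- The barrier `(1 + |x|²)⁻⁴`. -/
def barrier (x : Sp d) : ℝ := ((1 + ‖x‖ ^ 2) ^ 4)⁻¹

theorem barrier_pos (x : Sp d) : 0 < barrier x := by unfold barrier; positivity

theorem hasDerivAt_inv_pow {g : ℝ → ℝ} {g' t : ℝ} (hg : HasDerivAt g g' t) (h0 : g t ≠ 0) (n : ℕ) :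
    HasDerivAt (fun t => (g t ^ n)⁻¹) (-(n * (g t ^ (n + 1))⁻¹ * g')) t := by
  refine ((hg.pow n).inv (pow_ne_zero n h0)).congr_deriv ?_
  rcases n with _ | n
  · simp
  · simp only [Nat.add_sub_cancel, Pi.pow_apply]
    field_simp
    ring

/-- With g = 1+|x|², the second derivative at 0 is exactly 80 x_j² g^(-6) - 8 g^(-5), and the
negative term is dropped. -/
theorem deriv_deriv_barrier (x : Sp d) (j : Fin d) :
    (∀ t : ℝ, HasDerivAt (fun t : ℝ => barrier (x + t • ei j))
      (-(4 * ((1 + ‖x + t • ei j‖ ^ 2) ^ 5)⁻¹ * (2 * x j + 2 * t))) t) ∧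
    ∃ b : ℝ, b ≤ 80 * x j ^ 2 * ((1 + ‖x‖ ^ 2) ^ 6)⁻¹ ∧
      HasDerivAt (fun t : ℝ => -(4 * ((1 + ‖x + t • ei j‖ ^ 2) ^ 5)⁻¹ * (2 * x j + 2 * t))) b 0 := by
  have hg : ∀ t : ℝ, HasDerivAt (fun t : ℝ => 1 + ‖x + t • ei j‖ ^ 2) (2 * x j + 2 * t) t := by
    intro t
    simp only [norm_sq_add_smul_ei]
    have h1 := ((((hasDerivAt_id t).const_mul (2 * x j)).const_add (‖x‖ ^ 2)).add
      ((hasDerivAt_id t).pow 2)).const_add 1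
    refine h1.congr_deriv ?_
    simp
  have hne : ∀ t : ℝ, 1 + ‖x + t • ei j‖ ^ 2 ≠ 0 := fun t => by positivity
  refine ⟨fun t => ?_, ?_⟩
  · have := hasDerivAt_inv_pow (hg t) (hne t) 4
    exact_mod_cast this
  · have h2 : HasDerivAt (fun t : ℝ => 2 * x j + 2 * t) 2 0 := by
      simpa using ((hasDerivAt_id (0 : ℝ)).const_mul 2).const_add (2 * x j)
    have h3 := (((hasDerivAt_inv_pow (hg 0) (hne 0) 5).const_mul 4).mul h2).neg
    refine ⟨_, ?_, h3⟩
    simp only [zero_smul, add_zero, mul_zero]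
    have : 0 ≤ ((1 + ‖x‖ ^ 2) ^ 5)⁻¹ := by positivity
    push_cast
    nlinarith

theorem IsGroundState.laplacian_eq {Q : Sp d → ℝ} (hd : d = 1 ∨ d = 2) (hQ : IsGroundState Q) (x : Sp d) :
    ∑ j, pderiv j (pderiv j Q) x = Q x - Q x * Q x ^ (4 / d) := by
  have h1 := hQ.equation x
  rw [laplacian_eq_sum_pderiv hQ.contDiff] at h1
  rw [← rpow_four_div hd, ← Real.rpow_one_add' (hQ.pos x).le (by positivity)]
  linarith

theorem differentiable_pderiv {Q : Sp d → ℝ} (hQ : ContDiff ℝ 2 Q) (j : Fin d) :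
    ContDiff ℝ 1 (pderiv j Q) :=
  (hQ.fderiv_right (m := 1) (by norm_num)).clm_apply contDiff_const

/-- A maximum principle. Far out ΔQ ≥ Q/2, because Q^(4/d) ≤ 1/2 there, while the Laplacian of the
barrier is at most half the barrier. A positive maximum of Q - A'·barrier cannot lie in the compact
part, by the choice of A'. Outside it the second derivative test gives Q ≤ A'·barrier, a
contradiction. -/
theorem IsGroundState.exists_le_barrier {Q : Sp d → ℝ} (hd : d = 1 ∨ d = 2) (hQ : IsGroundState Q) :
    ∃ A : ℝ, 0 < A ∧ ∀ x, Q x ≤ A * barrier x := by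
  have hQc := hQ.contDiff.continuous
  have hbc : Continuous (barrier (d := d)) := by
    unfold barrier
    exact Continuous.inv₀ (by fun_prop) fun x => by positivity
  have hq : 4 / d ≠ 0 := by rcases hd with rfl | rfl <;> norm_num
  -- The threshold 160 ensures 160|x|² ≤ (1+|x|²)², which is what makes 80|x|²(1+|x|²)^(-6) at most
  -- half the barrier.
  have hfar : ∀ᶠ x in cocompact (Sp d), Q x ^ (4 / d) ≤ 1 / 2 ∧ 160 ≤ 1 + ‖x‖ ^ 2 := by
    have h1 : Tendsto (fun x => Q x ^ (4 / d)) (cocompact (Sp d)) (𝓝 (0 ^ (4 / d))) := hQ.vanishing.pow _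
    rw [zero_pow hq] at h1
    have h2 : Tendsto (fun x : Sp d => ‖x‖) (cocompact (Sp d)) atTop := tendsto_norm_cocompact_atTop
    filter_upwards [h1.eventually (gt_mem_nhds (by norm_num : (0 : ℝ) < 1 / 2)),
      h2.eventually_ge_atTop 160] with x h3 h4
    exact ⟨h3.le, by nlinarith⟩
  obtain ⟨K, hK, hKc⟩ := mem_cocompact.1 hfar
  obtain ⟨A, hA⟩ := hK.exists_bound_of_continuousOn (f := fun x => Q x * (1 + ‖x‖ ^ 2) ^ 4)
    (by fun_prop)
  refine ⟨|A| + 1, by positivity, fun x1 => ?_⟩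
  set A' := |A| + 1
  have hA'0 : 0 < A' := by positivity
  by_contra! hx1
  set F : Sp d → ℝ := fun x => Q x - A' * barrier x with hF
  have hFc : Continuous F := by fun_prop
  have hF1 : 0 < F x1 := by simp only [hF]; linarith
  obtain ⟨x0, hx0⟩ := hFc.exists_forall_ge' x1 (by
    filter_upwards [hQ.vanishing.eventually (gt_mem_nhds hF1)] with x hx
    have := mul_pos hA'0 (barrier_pos x)
    simp only [hF] at hx ⊢
    linarith)
  have hF0 : 0 < F x0 := hF1.trans_le (hx0 x1)
  have hx0K : x0 ∉ K := by
    intro hmem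
    have h1 := (le_abs_self _).trans ((hA x0 hmem).trans ((le_abs_self A).trans (lt_add_one _).le))
    have h2 : Q x0 ≤ A' * barrier x0 := by
      rw [barrier, ← div_eq_mul_inv, le_div_iff₀ (by positivity)]
      exact h1
    simp only [hF] at hF0
    linarith
  obtain ⟨hsmall, hlarge⟩ := hKc hx0K
  have hQd : Differentiable ℝ Q := hQ.contDiff.differentiable two_ne_zero
  have hsecond : ∀ j, pderiv j (pderiv j Q) x0 ≤ A' * (80 * x0 j ^ 2 * ((1 + ‖x0‖ ^ 2) ^ 6)⁻¹) := by
    intro j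
    obtain ⟨hb1, b, hb, hb2⟩ := deriv_deriv_barrier x0 j
    have hf1 : ∀ t : ℝ, HasDerivAt (fun t : ℝ => F (x0 + t • ei j)) (pderiv j Q (x0 + t • ei j)
        - A' * (-(4 * ((1 + ‖x0 + t • ei j‖ ^ 2) ^ 5)⁻¹ * (2 * x0 j + 2 * t)))) t := fun t =>
      (hasDerivAt_comp_line hQd x0 j t).sub ((hb1 t).const_mul A')
    have hf2 := (hasDerivAt_comp_line ((differentiable_pderiv hQ.contDiff j).differentiable one_ne_zero)
      x0 j 0).sub (hb2.const_mul A')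
    have hmax : IsLocalMax (fun t : ℝ => F (x0 + t • ei j)) 0 := by
      refine Eventually.of_forall fun t => ?_
      simp only [zero_smul, add_zero]
      exact hx0 _
    have h1 := deriv_deriv_nonpos_of_isLocalMax (hf1 0).continuousAt hmax
    rw [funext fun t => (hf1 t).deriv] at h1
    have h2 := hf2.deriv
    simp only [zero_smul, add_zero] at h2
    have h3 : pderiv j (pderiv j Q) x0 - A' * b ≤ 0 := by
      rw [← h2]
      exact h1
    have h4 := mul_le_mul_of_nonneg_left hb hA'0.le
    linarith
  have hsum := Finset.sum_le_sum fun j (_ : j ∈ Finset.univ) => hsecond j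
  rw [hQ.laplacian_eq hd, ← Finset.mul_sum, ← Finset.sum_mul, ← Finset.mul_sum,
    ← EuclideanSpace.real_norm_sq_eq] at hsum
  have hQ0 := hQ.pos x0
  have h5 : Q x0 / 2 ≤ Q x0 - Q x0 * Q x0 ^ (4 / d) := by nlinarith
  have h6 : A' * (80 * ‖x0‖ ^ 2 * ((1 + ‖x0‖ ^ 2) ^ 6)⁻¹) ≤ A' * barrier x0 / 2 := by
    rw [mul_div_assoc]
    gcongr
    rw [barrier, ← div_eq_mul_inv, div_le_div_iff₀ (by positivity) two_pos,
      inv_mul_eq_div, le_div_iff₀ (by positivity)]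
    set ρ := ‖x0‖ ^ 2
    have hρ : 0 ≤ ρ := by positivity
    have : (1 + ρ) ^ 6 = (1 + ρ) ^ 4 * (1 + ρ) ^ 2 := by ring
    rw [this]
    have h7 : 160 * ρ ≤ (1 + ρ) ^ 2 := by nlinarith
    have h8 : 0 ≤ (1 + ρ) ^ 4 := by positivity
    nlinarith
  simp only [hF] at hF0
  linarith

theorem one_add_norm_sq_le (x : Sp d) : (1 + ‖x‖) ^ 2 ≤ 2 * (1 + ‖x‖ ^ 2) := by
  nlinarith [sq_nonneg (1 - ‖x‖)]

theorem IsGroundState.exists_sq_le {Q : Sp d → ℝ} (hd : d = 1 ∨ d = 2) (hQ : IsGroundState Q) :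
    ∃ A : ℝ, 0 < A ∧ ∀ x, Q x ^ 2 ≤ A * (1 + ‖x‖) ^ (-16 : ℝ) ∧ Q x ^ 2 ≤ A := by
  obtain ⟨A, hA0, hA⟩ := hQ.exists_le_barrier hd
  refine ⟨256 * A ^ 2, by positivity, fun x => ?_⟩
  have h1 : Q x ^ 2 ≤ (A * barrier x) ^ 2 := pow_le_pow_left₀ (hQ.pos x).le (hA x) 2
  have hpos : 0 < 1 + ‖x‖ := by positivity
  have hb : barrier x ^ 2 ≤ 256 * ((1 + ‖x‖) ^ 16)⁻¹ := by
    rw [barrier, inv_pow, ← pow_mul, ← div_eq_mul_inv, inv_le_comm₀ (by positivity) (by positivity), inv_div,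
      div_le_iff₀ (by norm_num)]
    calc (1 + ‖x‖) ^ 16 = ((1 + ‖x‖) ^ 2) ^ 8 := by ring
      _ ≤ (2 * (1 + ‖x‖ ^ 2)) ^ 8 := by gcongr; exact one_add_norm_sq_le x
      _ = _ := by ring
  have h2 : Q x ^ 2 ≤ 256 * A ^ 2 * ((1 + ‖x‖) ^ 16)⁻¹ := by
    refine h1.trans ?_
    rw [mul_pow]
    have : A ^ 2 * barrier x ^ 2 ≤ A ^ 2 * (256 * ((1 + ‖x‖) ^ 16)⁻¹) := by gcongr
    linarith
  refine ⟨?_, h2.trans (mul_le_of_le_one_right (by positivity) (inv_le_one_of_one_le₀ ?_))⟩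
  · rw [Real.rpow_neg hpos.le]
    exact_mod_cast h2
  · exact one_le_pow₀ (by linarith [norm_nonneg x])

theorem IsGroundState.integrable_weight_sq {Q : Sp d → ℝ} (hd : d = 1 ∨ d = 2) (hQ : IsGroundState Q) :
    Integrable fun y => (1 + ‖y‖) ^ 6 * Q y ^ 2 := by
  obtain ⟨A, hA0, hA⟩ := hQ.exists_sq_le hd
  have hQc := hQ.contDiff.continuous
  have hi : Integrable (fun y : Sp d => (1 + ‖y‖) ^ (-10 : ℝ)) := by
    refine integrable_one_add_norm ?_
    rw [finrank_euclideanSpace_fin]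
    rcases hd with rfl | rfl <;> norm_num
  refine (hi.const_mul A).mono' (by fun_prop) (Eventually.of_forall fun y => ?_)
  rw [Real.norm_of_nonneg (by positivity)]
  have hpos : 0 < 1 + ‖y‖ := by positivity
  calc _ ≤ (1 + ‖y‖) ^ 6 * (A * (1 + ‖y‖) ^ (-16 : ℝ)) := by gcongr; exact (hA y).1
    _ = A * ((1 + ‖y‖) ^ ((6 : ℕ) : ℝ) * (1 + ‖y‖) ^ (-16 : ℝ)) := by rw [Real.rpow_natCast]; ring
    _ = _ := by rw [← Real.rpow_add hpos]; norm_num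

theorem IsGroundState.integrable_weight_pow {Q : Sp d → ℝ} (hd : d = 1 ∨ d = 2) (hQ : IsGroundState Q) :
    Integrable fun y => (1 + ‖y‖) ^ 6 * (Q y ^ 2) ^ (4 / d + 1) := by
  obtain ⟨A, hA0, hA⟩ := hQ.exists_sq_le hd
  have hQc := hQ.contDiff.continuous
  refine ((hQ.integrable_weight_sq hd).const_mul (A ^ (4 / d))).mono' (by fun_prop)
    (Eventually.of_forall fun y => ?_)
  rw [Real.norm_of_nonneg (by positivity), pow_succ (Q y ^ 2)]
  have : (Q y ^ 2) ^ (4 / d) ≤ A ^ (4 / d) := pow_le_pow_left₀ (by positivity) (hA y).2 _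
  calc _ = (Q y ^ 2) ^ (4 / d) * ((1 + ‖y‖) ^ 6 * Q y ^ 2) := by ring
    _ ≤ _ := by gcongr

/-- Caccioppoli's inequality. -/
theorem IsGroundState.caccioppoli {Q : Sp d → ℝ} (hd : d = 1 ∨ d = 2) (hQ : IsGroundState Q)
    {ζ : Sp d → ℝ} (hζ : ContDiff ℝ 1 ζ) (hs : HasCompactSupport ζ) :
    ∑ j, ∫ x, ζ x ^ 2 * pderiv j Q x ^ 2
      ≤ 2 * (∫ x, Q x ^ (4 / d) * (ζ x ^ 2 * Q x ^ 2)) + 4 * ∑ j, ∫ x, Q x ^ 2 * pderiv j ζ x ^ 2 := by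
  have hQc := hQ.contDiff.continuous
  have hζc := hζ.continuous
  have hQ1 : ContDiff ℝ 1 Q := hQ.contDiff.of_le (by norm_num)
  have hd1 := fun j => differentiable_pderiv hQ.contDiff j
  have hc1 : ∀ j, Continuous (pderiv j Q) := fun j => (hd1 j).continuous
  have hc2 : ∀ j, Continuous (pderiv j (pderiv j Q)) := fun j =>
    ((hd1 j).continuous_fderiv one_ne_zero).clm_apply continuous_const
  have hcζ : ∀ j, Continuous (pderiv j ζ) := fun j =>
    (hζ.continuous_fderiv one_ne_zero).clm_apply continuous_const
  have hsζ : ∀ j, HasCompactSupport (pderiv j ζ) := fun j => hs.fderiv_apply ℝ (ei j)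
  have hi : ∀ f : Sp d → ℝ, Continuous f → Integrable fun x => ζ x * f x := fun f hf =>
    (hζc.mul hf).integrable_of_hasCompactSupport hs.mul_right
  have hi' : ∀ j, ∀ f : Sp d → ℝ, Continuous f → Integrable fun x => pderiv j ζ x * f x := fun j f hf =>
    ((hcζ j).mul hf).integrable_of_hasCompactSupport (hsζ j).mul_right
  have hg : ∀ j x, fderiv ℝ (fun x => ζ x ^ 2 * Q x) x (ei j)
      = ζ x ^ 2 * pderiv j Q x + 2 * ζ x * pderiv j ζ x * Q x := by
    intro j x
    have h1 := (hζ.differentiable one_ne_zero x).hasFDerivAt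
    have h2 := (hQ1.differentiable one_ne_zero x).hasFDerivAt
    have h3 : HasFDerivAt (fun x => ζ x ^ 2 * Q x) _ x := (h1.pow 2).mul h2
    rw [h3.fderiv]
    simp [pderiv]
    ring
  have hI1 : ∀ j, Integrable fun x => ζ x ^ 2 * pderiv j Q x ^ 2 := fun j =>
    (hi (fun x => ζ x * pderiv j Q x ^ 2) (by have := hc1 j; fun_prop)).congr
      (Eventually.of_forall fun x => by simp only; ring)
  have hI2 : ∀ j, Integrable fun x => 2 * ζ x * pderiv j ζ x * Q x * pderiv j Q x := fun j =>
    (hi (fun x => 2 * pderiv j ζ x * Q x * pderiv j Q x)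
      (by have := hc1 j; have := hcζ j; fun_prop)).congr (Eventually.of_forall fun x => by simp only; ring)
  have hI3 : ∀ j, Integrable fun x => Q x ^ 2 * pderiv j ζ x ^ 2 := fun j =>
    (hi' j (fun x => Q x ^ 2 * pderiv j ζ x) (by have := hcζ j; fun_prop)).congr
      (Eventually.of_forall fun x => by simp only; ring)
  have hI4 : ∀ j, Integrable fun x => pderiv j (pderiv j Q) x * (ζ x ^ 2 * Q x) := fun j =>
    (hi (fun x => pderiv j (pderiv j Q) x * (ζ x * Q x)) (by have := hc2 j; fun_prop)).congr
      (Eventually.of_forall fun x => by simp only; ring)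
  have hI5 : Integrable fun x => Q x ^ (4 / d) * (ζ x ^ 2 * Q x ^ 2) :=
    (hi (fun x => Q x ^ (4 / d) * (ζ x * Q x ^ 2)) (by fun_prop)).congr
      (Eventually.of_forall fun x => by simp only; ring)
  have hI6 : Integrable fun x => ζ x ^ 2 * Q x ^ 2 :=
    (hi (fun x => (ζ x * Q x ^ 2)) (by fun_prop)).congr (Eventually.of_forall fun x => by simp only; ring)
  have hibp : ∀ j, (∫ x, ζ x ^ 2 * pderiv j Q x ^ 2)
      + (∫ x, 2 * ζ x * pderiv j ζ x * Q x * pderiv j Q x)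
      = -∫ x, pderiv j (pderiv j Q) x * (ζ x ^ 2 * Q x) := by
    intro j
    have h1 := integral_mul_fderiv_eq_neg_fderiv_mul_of_integrable (μ := volume) (f := pderiv j Q)
      (g := fun x => ζ x ^ 2 * Q x) (v := ei j) (hI4 j)
      (by
        simp only [hg]
        exact ((hI1 j).add (hI2 j)).congr (Eventually.of_forall fun x => by
          simp only [Pi.add_apply]; ring))
      ((hi (fun x => ζ x * Q x * pderiv j Q x) (by have := hc1 j; fun_prop)).congr
        (Eventually.of_forall fun x => by simp only; ring))
      (fun x _ => (hd1 j).differentiable one_ne_zero x)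
      (fun x _ => ((hζ.differentiable one_ne_zero x).pow 2).mul (hQ1.differentiable one_ne_zero x))
    rw [← integral_add (hI1 j) (hI2 j)]
    refine Eq.trans ?_ h1
    congr 1
    funext x
    rw [hg]
    ring
  -- Young's inequality is weighted so that half of the gradient term can be absorbed on the left.
  -- This accounts for the factors 2 and 4 in the conclusion.
  have hcs : ∀ j, -(∫ x, 2 * ζ x * pderiv j ζ x * Q x * pderiv j Q x)
      ≤ 1 / 2 * (∫ x, ζ x ^ 2 * pderiv j Q x ^ 2) + 2 * ∫ x, Q x ^ 2 * pderiv j ζ x ^ 2 := by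
    intro j
    rw [← integral_neg, ← integral_const_mul, ← integral_const_mul,
      ← integral_add ((hI1 j).const_mul _) ((hI3 j).const_mul _)]
    refine integral_mono (hI2 j).neg (((hI1 j).const_mul _).add ((hI3 j).const_mul _)) fun x => ?_
    beta_reduce
    nlinarith [sq_nonneg (ζ x * pderiv j Q x + 2 * (Q x * pderiv j ζ x))]
  have hlap : ∑ j, ∫ x, pderiv j (pderiv j Q) x * (ζ x ^ 2 * Q x)
      = (∫ x, ζ x ^ 2 * Q x ^ 2) - ∫ x, Q x ^ (4 / d) * (ζ x ^ 2 * Q x ^ 2) := by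
    rw [← integral_finsetSum _ fun j _ => hI4 j, ← integral_sub hI6 hI5]
    congr 1
    funext x
    rw [← Finset.sum_mul, hQ.laplacian_eq hd]
    ring
  have hnn : 0 ≤ ∫ x, ζ x ^ 2 * Q x ^ 2 := integral_nonneg fun x => by positivity
  have htot := Finset.sum_le_sum fun j (_ : j ∈ Finset.univ) => hcs j
  have hib := Finset.sum_congr rfl fun j (_ : j ∈ Finset.univ) => hibp j
  rw [Finset.sum_add_distrib, Finset.sum_neg_distrib, hlap] at hib
  rw [Finset.sum_add_distrib, Finset.sum_neg_distrib, ← Finset.mul_sum, ← Finset.mul_sum] at htot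
  linarith

section

variable {N : ℕ}

/-- Compactly supported functions that agree with the weight 1+|x|² on growing balls. Both they and
their gradients are O(1+|x|²) with a constant independent of n, so Caccioppoli's inequality becomes
a weighted gradient bound uniform in n. -/
theorem exists_cutoff : ∃ L : ℝ, 0 ≤ L ∧ ∀ n : ℕ, ∃ ζ : Sp d → ℝ, ContDiff ℝ 1 ζ ∧ HasCompactSupport ζ ∧
    (∀ x, ‖x‖ ≤ n + 1 → ζ x = 1 + ‖x‖ ^ 2) ∧ (∀ x, |ζ x| ≤ 1 + ‖x‖ ^ 2) ∧
    ∀ j x, |pderiv j ζ x| ≤ L * (1 + ‖x‖ ^ 2) := by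
  set f : ContDiffBump (0 : Sp d) := ⟨1, 2, one_pos, one_lt_two⟩ with hf
  have hfc : ContDiff ℝ 1 f := f.contDiff (n := 1)
  obtain ⟨L, hL⟩ := (f.hasCompactSupport.fderiv ℝ).exists_bound_of_continuous
    (hfc.continuous_fderiv one_ne_zero)
  have hL0 : 0 ≤ L := (norm_nonneg _).trans (hL 0)
  refine ⟨L + 1, by positivity, fun n => ?_⟩
  set r : ℝ := ((n : ℝ) + 1)⁻¹ with hr
  have hr0 : 0 < r := by positivity
  have hr1 : r ≤ 1 := inv_le_one_of_one_le₀ (by linarith [Nat.cast_nonneg (α := ℝ) n])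
  have hg : ContDiff ℝ 1 fun x : Sp d => f (r • x) := hfc.comp (contDiff_id.const_smul r)
  have hq : ContDiff ℝ 1 fun x : Sp d => 1 + ‖x‖ ^ 2 := contDiff_const.add (contDiff_norm_sq ℝ)
  have hf1 : ∀ x, |f x| ≤ 1 := fun x => by rw [abs_of_nonneg f.nonneg]; exact f.le_one
  refine ⟨fun x => f (r • x) * (1 + ‖x‖ ^ 2), hg.mul hq, ?_, fun x hx => ?_, fun x => ?_, fun j x => ?_⟩
  · exact (f.hasCompactSupport.comp_smul hr0.ne').mul_right
  · beta_reduce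
    rw [f.one_of_mem_closedBall, one_mul]
    rw [mem_closedBall_zero_iff, norm_smul, Real.norm_of_nonneg hr0.le, hr, inv_mul_eq_div]
    exact (div_le_one (by positivity)).2 hx
  · rw [abs_mul, abs_of_nonneg (by positivity : 0 ≤ 1 + ‖x‖ ^ 2)]
    exact mul_le_of_le_one_left (by positivity) (hf1 _)
  · have h1 : HasFDerivAt (fun x : Sp d => f (r • x)) (fderiv ℝ f (r • x) ∘L
        (r • ContinuousLinearMap.id ℝ (Sp d))) x :=
      (hfc.differentiable one_ne_zero (r • x)).hasFDerivAt.comp x ((hasFDerivAt_id x).const_smul r)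
    have h2 : HasFDerivAt (fun x : Sp d => 1 + ‖x‖ ^ 2) ((2 : ℕ) • innerSL ℝ x) x :=
      (hasStrictFDerivAt_norm_sq x).hasFDerivAt.const_add 1
    have h3 : HasFDerivAt (fun x : Sp d => f (r • x) * (1 + ‖x‖ ^ 2)) _ x := h1.mul h2
    have h4 : |fderiv ℝ f (r • x) (ei j)| ≤ L := by
      refine ((fderiv ℝ f (r • x)).le_opNorm _).trans ?_
      rw [PiLp.norm_single, norm_one, mul_one]
      exact hL _
    have h5 : |inner ℝ x (ei j)| ≤ ‖x‖ := by
      refine (abs_real_inner_le_norm _ _).trans ?_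
      rw [PiLp.norm_single, norm_one, mul_one]
    have h6 : fderiv ℝ (fun x : Sp d => f (r • x) * (1 + ‖x‖ ^ 2)) x (ei j)
        = f (r • x) * (2 * inner ℝ x (ei j)) + (1 + ‖x‖ ^ 2) * (r * fderiv ℝ f (r • x) (ei j)) := by
      rw [h3.fderiv]
      simp
    rw [pderiv, h6]
    refine (abs_add_le _ _).trans ?_
    rw [abs_mul, abs_mul, abs_mul, abs_mul, abs_two, abs_of_pos hr0,
      abs_of_nonneg (by positivity : 0 ≤ 1 + ‖x‖ ^ 2)]
    calc _ ≤ 1 * (2 * ‖x‖) + (1 + ‖x‖ ^ 2) * (1 * L) := by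
          gcongr
          exact hf1 _
      _ ≤ _ := by nlinarith [sq_nonneg (‖x‖ - 1)]

/-- Caccioppoli's inequality with these cut-offs bounds the integrals over balls of radius n+1 by
moments of Q, independently of n. Exhaustion by balls then gives integrability. -/
theorem IsGroundState.integrable_weight_fderiv {Q : Sp d → ℝ} (hd : d = 1 ∨ d = 2)
    (hQ : IsGroundState Q) : Integrable fun y => (1 + ‖y‖) ^ 4 * ‖fderiv ℝ Q y‖ ^ 2 := by
  obtain ⟨L, hL0, hL⟩ := exists_cutoff (d := d)
  obtain ⟨A, hA0, hA⟩ := hQ.exists_sq_le hd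
  have hQ1 : ContDiff ℝ 1 Q := hQ.contDiff.of_le (by norm_num)
  have hc1 : ∀ j, Continuous (pderiv j Q) := fun j =>
    (hQ1.continuous_fderiv one_ne_zero).clm_apply continuous_const
  have hi6 := hQ.integrable_weight_sq hd
  set J := ∫ y, (1 + ‖y‖) ^ 6 * Q y ^ 2 with hJ
  set M := √A ^ (4 / d) with hM
  have hM0 : 0 ≤ M := by positivity
  have hw : ∀ y : Sp d, (1 + ‖y‖ ^ 2) ^ 2 * Q y ^ 2 ≤ (1 + ‖y‖) ^ 6 * Q y ^ 2 := by
    intro y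
    have h1 : 1 + ‖y‖ ^ 2 ≤ (1 + ‖y‖) ^ 3 := by nlinarith [norm_nonneg y, pow_nonneg (norm_nonneg y) 3]
    calc _ ≤ ((1 + ‖y‖) ^ 3) ^ 2 * Q y ^ 2 := by gcongr
      _ = _ := by ring
  have hcover : Integrable fun y => (1 + ‖y‖ ^ 2) ^ 2 * ∑ j, pderiv j Q y ^ 2 := by
    have hcont : Continuous fun y : Sp d => (1 + ‖y‖ ^ 2) ^ 2 * ∑ j, pderiv j Q y ^ 2 := by fun_prop
    refine (aecover_closedBall (x := (0 : Sp d)) (r := fun n : ℕ => (n : ℝ) + 1)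
      (tendsto_atTop_add_const_right _ _ tendsto_natCast_atTop_atTop)).integrable_of_integral_bounded_of_nonneg_ae
      (2 * (M * J) + 4 * ∑ _j : Fin d, L ^ 2 * J)
      (fun n => hcont.continuousOn.integrableOn_compact (isCompact_closedBall _ _))
      (Eventually.of_forall fun y => by positivity) (Eventually.of_forall fun n => ?_)
    obtain ⟨ζ, hζ, hs, hζ1, hζ2, hζ3⟩ := hL n
    have hζc := hζ.continuous
    have hcac := hQ.caccioppoli hd hζ hs
    have hint : ∀ j, Integrable fun x => ζ x ^ 2 * pderiv j Q x ^ 2 := fun j =>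
      ((hζc.mul (hζc.mul ((hc1 j).pow 2))).integrable_of_hasCompactSupport hs.mul_right).congr
        (Eventually.of_forall fun x => by simp only [Pi.mul_apply, Pi.pow_apply]; ring)
    have h1 : ∫ y in Metric.closedBall 0 ((n : ℝ) + 1), (1 + ‖y‖ ^ 2) ^ 2 * ∑ j, pderiv j Q y ^ 2
        ≤ ∑ j, ∫ x, ζ x ^ 2 * pderiv j Q x ^ 2 := by
      rw [← integral_finsetSum _ fun j _ => hint j]
      have e : ∫ y in Metric.closedBall 0 ((n : ℝ) + 1), (1 + ‖y‖ ^ 2) ^ 2 * ∑ j, pderiv j Q y ^ 2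
          = ∫ y in Metric.closedBall 0 ((n : ℝ) + 1), ∑ j, ζ y ^ 2 * pderiv j Q y ^ 2 := by
        refine setIntegral_congr_fun Metric.isClosed_closedBall.measurableSet fun y hy => ?_
        simp only [hζ1 y (mem_closedBall_zero_iff.1 hy), Finset.mul_sum]
      rw [e]
      exact setIntegral_le_integral (integrable_finsetSum _ fun j _ => hint j)
        (Eventually.of_forall fun y => Finset.sum_nonneg fun j _ => by positivity)
    refine h1.trans (hcac.trans (add_le_add ?_ ?_))
    · refine mul_le_mul_of_nonneg_left ?_ two_pos.le
      rw [hJ, ← integral_const_mul]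
      refine integral_mono_of_nonneg (Eventually.of_forall fun y => ?_) (hi6.const_mul M)
        (Eventually.of_forall fun y => ?_)
      · exact mul_nonneg (pow_nonneg (hQ.pos y).le _) (by positivity)
      · have h2 : Q y ^ (4 / d) ≤ M := pow_le_pow_left₀ (hQ.pos y).le (Real.le_sqrt_of_sq_le (hA y).2) _
        refine mul_le_mul h2 (le_trans ?_ (hw y)) (by positivity) hM0
        have h3 : ζ y ^ 2 ≤ (1 + ‖y‖ ^ 2) ^ 2 := by
          rw [← sq_abs]; exact pow_le_pow_left₀ (abs_nonneg _) (hζ2 y) 2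
        gcongr
    · refine mul_le_mul_of_nonneg_left (Finset.sum_le_sum fun j _ => ?_) (by norm_num)
      rw [hJ, ← integral_const_mul]
      refine integral_mono_of_nonneg (Eventually.of_forall fun y => by positivity) (hi6.const_mul _)
        (Eventually.of_forall fun y => ?_)
      have h3 : pderiv j ζ y ^ 2 ≤ (L * (1 + ‖y‖ ^ 2)) ^ 2 := by
        rw [← sq_abs]; exact pow_le_pow_left₀ (abs_nonneg _) (hζ3 j y) 2
      calc Q y ^ 2 * pderiv j ζ y ^ 2 ≤ Q y ^ 2 * (L * (1 + ‖y‖ ^ 2)) ^ 2 := by gcongr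
        _ = L ^ 2 * ((1 + ‖y‖ ^ 2) ^ 2 * Q y ^ 2) := by ring
        _ ≤ _ := mul_le_mul_of_nonneg_left (hw y) (by positivity)
  have hfc := hQ1.continuous_fderiv one_ne_zero
  refine (hcover.const_mul 4).mono' (by fun_prop) (Eventually.of_forall fun y => ?_)
  rw [Real.norm_of_nonneg (by positivity)]
  have h1 := sq_norm_le_sum_sq_apply_ei (fderiv ℝ Q y)
  simp only [Real.norm_eq_abs, sq_abs] at h1
  calc _ = ((1 + ‖y‖) ^ 2) ^ 2 * ‖fderiv ℝ Q y‖ ^ 2 := by ring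
    _ ≤ (2 * (1 + ‖y‖ ^ 2)) ^ 2 * ∑ j, pderiv j Q y ^ 2 := by
      gcongr
      · exact one_add_norm_sq_le y
      · exact h1
    _ = _ := by ring

theorem IsGroundState.isLocalizedProfile {Q : Sp d → ℝ} (hd : d = 1 ∨ d = 2) (hQ : IsGroundState Q) :
    IsLocalizedProfile Q where
  contDiff := hQ.contDiff.of_le (by norm_num)
  integrable_sq := hQ.integrable_weight_sq hd
  integrable_fderiv := hQ.integrable_weight_fderiv hd
  integrable_pow := hQ.integrable_weight_pow hd

/-! ### The energy estimate -/

/-- The noise contributes `O((T - t)²)` to the energy balance in the bootstrap regime. -/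
theorem exists_noiseWeight_bootstrap_le (hd : d = 1 ∨ d = 2) {Q : Sp d → ℝ} (hQ : IsGroundState Q) :
    ∃ C : ℝ, 0 ≤ C ∧ ∀ (δ T t : ℝ) (p : Modulation d) (u R : H1 d), 0 < δ → t < T → T - t ≤ 1 / 2 →
      0 < p.lam → (∀ᵐ x, toL2 u x = modulated Q p x + toL2 R x) → BootstrapBounds δ T t p R →
      noiseWeight hd u ≤ C * (T - t) ^ 2 := by
  obtain ⟨C1, hC10, hC1⟩ := exists_noiseWeight_modulated_le hd (hQ.isLocalizedProfile hd)
  obtain ⟨C2, hC20, hC2⟩ := exists_noiseWeight_le hd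
  refine ⟨2 ^ (2 * (4 / d) + 1) * (C1 + C2), by positivity,
    fun δ T t p u R hδ ht hT hp hdec hb => ?_⟩
  set s := T - t with hs
  have hs0 : 0 < s := sub_pos.2 ht
  have hs1 : s ≤ 1 := by linarith
  have hpow : ∀ n : ℕ, s ^ ((n : ℝ) + δ) ≤ s ^ n := fun n => by
    rw [← Real.rpow_natCast]
    exact Real.rpow_le_rpow_of_exponent_ge hs0 hs1 (by linarith)
  have hp3 : s ^ (3 + δ) ≤ s ^ 3 := by exact_mod_cast hpow 3
  have hp2 : s ^ (2 + δ) ≤ s ^ 2 := by exact_mod_cast hpow 2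
  -- For s ≤ 1/2 the bootstrap bounds become s/2 ≤ λ ≤ 2s, |α| ≤ s, |β| ≤ 1 and |γ| ≤ 1, the regime
  -- required for the profile.
  have hs2 : s ^ 2 ≤ s / 2 := by nlinarith
  have hs3 : s ^ 3 ≤ s / 4 := by nlinarith
  have h1 := hb.lam_γ
  have h2 := hb.α_β
  rw [← hs] at h1 h2
  have hl := abs_le.1 ((le_add_of_nonneg_right (abs_nonneg _)).trans h1)
  have hg := abs_le.1 ((le_add_of_nonneg_left (abs_nonneg _)).trans h1)
  have hα := norm_nonneg p.α
  have hβ := norm_nonneg p.β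
  -- The profile enters as the H¹ element u - R, so its membership in H¹ is inherited from u and R.
  set v := u - R with hv
  have hvae : toL2 v =ᵐ[volume] modulated Q p := by
    have e : toL2 v = toL2 u - toL2 R := rfl
    rw [e]
    filter_upwards [hdec, Lp.coeFn_sub (toL2 u) (toL2 R)] with x h3 h4
    rw [h4, Pi.sub_apply, h3, add_sub_cancel_right]
  have hW := hC1 v p s hs0 (by linarith [hl.1]) (by linarith [hl.2]) (by linarith) (by linarith)
    (abs_le.2 ⟨by linarith [hg.1], by linarith [hg.2]⟩) hvae
  have hRn : ‖R‖ ≤ 2 * s ^ 2 := by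
    have h3 : s ^ 3 ≤ s ^ 2 := pow_le_pow_of_le_one hs0.le hs1 (by norm_num)
    refine norm_H1_le (by positivity) (hb.remainder.trans ?_) fun j => ?_
    · rw [← hs]; linarith
    · refine le_trans ?_ hb.grad_remainder
      exact Real.le_sqrt_of_sq_le (Finset.single_le_sum (f := fun j => ‖grad R j‖ ^ 2)
        (fun j _ => by positivity) (Finset.mem_univ j))
  have hRw := hC2 R (hRn.trans (by linarith))
  have hRs : ‖R‖ ^ 2 ≤ s ^ 2 := pow_le_pow_left₀ (norm_nonneg _) (hRn.trans (by linarith)) 2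
  have hadd := noiseWeight_add_le hd v R
  rw [hv, sub_add_cancel] at hadd
  refine hadd.trans ?_
  rw [mul_assoc]
  gcongr
  rw [add_mul]
  exact add_le_add hW (hRw.trans (by gcongr))

end

end RoughNLS

end

/-! ### The theorem, for almost every Brownian path. -/

theorem theorem4p5 {d : ℕ} (hd : d = 1 ∨ d = 2)
    {N : ℕ} (φ : Fin N → RoughNLS.Sp d → ℝ)
    (hφ : ∀ k, RoughNLS.IsCbInfty (φ k))
    (hA0 : ∀ k, RoughNLS.AsymptoticallyFlat (φ k))
    (hA1 : ∀ k, RoughNLS.FlatAtOrigin (φ k))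
    {Ω : Type*} [MeasurableSpace Ω] (P : Measure Ω) [IsProbabilityMeasure P]
    (B : Fin N → ℝ≥0 → Ω → ℝ) (hB : ∀ k, IsBrownianReal (B k) P)
    (hBind : iIndepFun (fun k ω t => B k t ω) P)
    (Q : RoughNLS.Sp d → ℝ) (hQ : RoughNLS.IsGroundState Q)
    (ρ : RoughNLS.Sp d → ℝ) (hρ : RoughNLS.IsRho Q ρ)
    (δ : ℝ) (hδ : 0 < δ) (hδ' : δ < 1 / 12) :
    ∀ᵐ ω ∂P, ∃ τ : ℝ, 0 < τ ∧ ∃ C : ℝ, 0 < C ∧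
      ∀ T : ℝ, 0 < T → T ≤ τ →
      ∀ tn : ℕ → ℝ, Monotone tn → (∀ n, tn n < T) → Tendsto tn atTop (𝓝 T) →
      ∀ (u : ℕ → ℝ → RoughNLS.H1 d) (p : ℕ → ℝ → RoughNLS.Modulation d)
        (R : ℕ → ℝ → RoughNLS.H1 d) (tstar : ℕ → ℝ) (n : ℕ),
        0 ≤ tstar n → tstar n ≤ tn n →
        RoughNLS.IsSolutionOn φ (fun k s => B k s.toNNReal ω) (tstar n) (tn n) (u n) →
        (∀ᵐ x, RoughNLS.toL2 (u n (tn n)) x = RoughNLS.pseudoConformal Q T (tn n) x) →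
        RoughNLS.IsGeometricDecomposition Q ρ (tstar n) (tn n) (u n) (p n) (R n) →
        (∀ t ∈ Set.Icc (tstar n) (tn n), RoughNLS.BootstrapBounds δ T t (p n t) (R n t)) →
        ∀ t ∈ Set.Icc (tstar n) (tn n),
          |RoughNLS.energy (u n t) - RoughNLS.energy (u n (tn n))| ≤ C * (T - t) ^ 3 := by
  have hcont : ∀ᵐ ω ∂P, ∀ k, Continuous (B k · ω) := ae_all_iff.2 fun k => (hB k).cont
  filter_upwards [hcont] with ω hω
  set h : Fin N → ℝ → ℝ := fun k s => B k s.toNNReal ω with hh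
  have hhc : ∀ k, Continuous (h k) := fun k => (hω k).comp continuous_real_toNNReal
  -- The path enters the constants only through its bound on [0, 1/2], so they depend on ω but not
  -- on T, n or the solution.
  obtain ⟨H, hH⟩ : ∃ H : ℝ, ∀ k, ∀ r ∈ Set.Icc (0 : ℝ) (1 / 2), |h k r| ≤ H := by
    choose H hH using fun k => isCompact_Icc.exists_bound_of_continuousOn
      (s := Set.Icc (0 : ℝ) (1 / 2)) (hhc k).continuousOn
    refine ⟨∑ k, |H k|, fun k r hr => ((hH k r hr).trans (le_abs_self _)).trans ?_⟩
    exact Finset.single_le_sum (f := fun k => |H k|) (fun k _ => abs_nonneg _) (Finset.mem_univ k)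
  obtain ⟨K, hK0, hK⟩ := RoughNLS.exists_noise_le hd hφ hA1 h H
  obtain ⟨C, hC0, hC⟩ := RoughNLS.exists_noiseWeight_bootstrap_le hd hQ
  -- With τ = 1/2 every time considered lies in [0, 1/2] and T - t ≤ 1/2. The summand 1 only makes
  -- the constant positive.
  refine ⟨1 / 2, by norm_num, K * C + 1, by positivity, ?_⟩
  intro T hT0 hT tn _ htn _ u p R tstar n hstar0 hstar hsol _ hdec hboot t ht
  have hlt := htn n
  have hTt : 0 < T - t := by linarith [ht.2]
  have hpt : ∀ r ∈ Set.uIoc t (tn n),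
      ‖RoughNLS.noiseForm hφ h r (u n r)
        - (inner ℂ (RoughNLS.nl hd (u n r)) (RoughNLS.noiseForce hφ h r (u n r))).re‖
        ≤ K * (C * (T - t) ^ 2) := by
    intro r hr
    rw [Set.uIoc_of_le ht.2] at hr
    have hr' : r ∈ Set.Icc (tstar n) (tn n) := ⟨ht.1.trans hr.1.le, hr.2⟩
    have hrT : r < T := hr.2.trans_lt hlt
    have hr0 : 0 ≤ r := hstar0.trans hr'.1
    refine (hK r (u n r) fun k => hH k r ⟨hr0, by linarith⟩).trans (mul_le_mul_of_nonneg_left ?_ hK0)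
    refine (hC δ T r (p n r) (u n r) (R n r) hδ hrT (by linarith) (hdec.lam_pos r hr')
      (hdec.decomposition r hr') (hboot r hr')).trans ?_
    have h1 : T - r ≤ T - t := by linarith [hr.1]
    have h2 : 0 ≤ T - r := by linarith
    gcongr
  -- On [t, t_n] the integrand is O((T-t)²), its bound at time r being decreasing in r. The length
  -- t_n - t ≤ T - t supplies the third power.
  rw [abs_sub_comm, hsol.energy_sub_energy_eq hd hφ hhc ht, ← Real.norm_eq_abs]
  refine (intervalIntegral.norm_integral_le_of_norm_le_const hpt).trans ?_
  rw [abs_of_nonneg (by linarith [ht.2] : 0 ≤ tn n - t)]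
  have h3 : tn n - t ≤ T - t := by linarith
  calc K * (C * (T - t) ^ 2) * (tn n - t) ≤ K * (C * (T - t) ^ 2) * (T - t) := by gcongr
    _ = K * C * (T - t) ^ 3 := by ring
    _ ≤ (K * C + 1) * (T - t) ^ 3 := by gcongr; linarith
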